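/- Let $M$ be a smooth compact connected manifold without boundary, of dimension $n\ge 2$. Let $h:T^*M\setminus 0\to\mathbb R$ be smooth and positively homogeneous of degree $0$, and assume that $0$ is not a critical value of $h$. Let $\mathcal X_h=\frac{\partial h}{\partial p}\partial_q-\frac{\partial h}{\partial q}\partial_p$ be its Hamiltonian vector field and $\{h,k\}=\mathcal X_hk$. Put $\Sigma_0=h^{-1}(0)\subset T^*M\setminus 0$ and $Z_0=\Sigma_0/\mathbb R^+$, a smooth closed manifold of dimension $2n-2$. Let $\mathcal F$ be the oriented (possibly singular) foliation of $Z_0$ defined by the projection of $\mathcal X_h$, i.e. the conformal class of the vector fields on $Z_0$ that are projections of $f\mathcal X_h$ with $f>0$ smooth and homogeneous of degree $1$ on $\Sigma_0$. A vector field on an open subset of $Z_0$ generates $\mathcal F$ there if it is such a projection with $f$ defined on the cone over this subset. An escape function is a smooth function $k:\Sigma_0\to\mathbb R$, positively homogeneous of degree $1$, such that for some $\delta>0$ one has $\{h,k\}\ge\delta$ on $\Sigma_0$. Let $\phi_t$ be the flow on $Z_0$ of a vector field generating $\mathcal F$; the following notions do not depend on its choice. A compact invariant set $K\subset Z_0$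 is an attractor if $K=\bigcap_{t\ge 0}\phi_t(U)$ for some open neighbourhood $U$ of $K$, and a repellor if it is an attractor of the reversed flow. A simple structure of $\mathcal F$ is a pair $(K_+,K_-)$ of disjoint compact invariant subsets of $Z_0$ such that $K_+$ is an attractor, $K_-$ is a repellor, and for every $x\in Z_0\setminus(K_+\cup K_-)$, $\phi_t(x)$ converges to $K_+$ as $t\to+\infty$ and to $K_-$ as $t\to-\infty$ (that is, it eventually stays in any given neighbourhood of that set). The set $K_+$ (resp. $K_-$) is weakly hyperbolic if in some open neighbourhood of it there are a vector field $W$ generating $\mathcal F$ and a smooth positive density $d\mu$ with $\operatorname{div}_{d\mu}(W)<0$ (resp. $>0$). Then: an escape function exists if and only if $\mathcal F$ has a simple structure $(K_+,K_-)$ with $K_+$ and $K_-$ both weakly hyperbolic. Moreover, there is at most one simple structure $(K_+,K_-)$ with $K_+$ and $K_-$ both weakly hyperbolic. -/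

import Mathlib

open Set Filter Topology Manifold Bundle
open scoped ContDiff

noncomputable section

namespace DegreeZero

/-- The model space `ℝⁿ` of the base manifold. -/
abbrev Base (n : ℕ) : Type := EuclideanSpace ℝ (Fin n)

/-- The model space `ℝⁿ × (ℝⁿ)*` of the cotangent bundle. -/
abbrev Phase (n : ℕ) : Type := Base n × (Base n →L[ℝ] ℝ)

/-- The cotangent bundle `T*M`, with Mathlib's manifold structure on the total space of the bundle
of continuous linear maps from `TM` to the trivial line bundle.  Its preferred chart at a point
over `q₀` is the canonical chart `(q, p)` attached to the preferred chart of `M` at `q₀`. -/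
abbrev Cotangent (n : ℕ) (M : Type*) [TopologicalSpace M] [ChartedSpace (Base n) M]
    [IsManifold 𝓘(ℝ, Base n) ∞ M] : Type _ :=
  TotalSpace (Base n →L[ℝ] ℝ)
    (fun q : M => TangentSpace 𝓘(ℝ, Base n) q →L[ℝ] Bundle.Trivial M ℝ q)

/-- The model with corners of the cotangent bundle. -/
abbrev phaseModel (n : ℕ) :
    ModelWithCorners ℝ (Phase n) (ModelProd (Base n) (Base n →L[ℝ] ℝ)) :=
  𝓘(ℝ, Base n).prod 𝓘(ℝ, Base n →L[ℝ] ℝ)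

variable {n : ℕ} {M : Type*} [TopologicalSpace M] [ChartedSpace (Base n) M]
  [IsManifold 𝓘(ℝ, Base n) ∞ M]

/-- `T*M ∖ 0`. -/
def punctured (n : ℕ) (M : Type*) [TopologicalSpace M] [ChartedSpace (Base n) M]
    [IsManifold 𝓘(ℝ, Base n) ∞ M] : Set (Cotangent n M) :=
  {z | z.2 ≠ 0}

/-- The dilation `(q, p) ↦ (q, s p)`. -/
def dilate (s : ℝ) (z : Cotangent n M) : Cotangent n M := ⟨z.1, s • z.2⟩

theorem dilate_one (z : Cotangent n M) : dilate 1 z = z :=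
  congrArg (TotalSpace.mk z.1) (one_smul ℝ z.2)

theorem dilate_dilate (s t : ℝ) (z : Cotangent n M) :
    dilate t (dilate s z) = dilate (t * s) z :=
  congrArg (TotalSpace.mk z.1) (smul_smul t s z.2)

/-- The generator `p ∂_p` of the dilations. -/
def radial (z : Cotangent n M) : TangentSpace (phaseModel n) z :=
  mfderiv 𝓘(ℝ, ℝ) (phaseModel n) (fun s : ℝ => dilate s z) 1 (1 : ℝ)

/-- The symplectic gradient of a covector `α` on the model space: for `α = dh` it is
`∂h/∂p ∂_q - ∂h/∂q ∂_p`. -/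
def sympGrad (α : Phase n →L[ℝ] ℝ) : Phase n :=
  (∑ i : Fin n, α (0, EuclideanSpace.proj i) • EuclideanSpace.single i (1 : ℝ),
    -(α.comp (ContinuousLinearMap.inl ℝ (Base n) (Base n →L[ℝ] ℝ))))

/-- The Hamiltonian vector field `X_h`, computed in the canonical coordinates at each point. -/
def hamField (h : Cotangent n M → ℝ) (z : Cotangent n M) : TangentSpace (phaseModel n) z :=
  sympGrad (mfderiv (phaseModel n) 𝓘(ℝ, ℝ) h z : Phase n →L[ℝ] ℝ)

/-- The Poisson bracket `{h, k} = X_h k`. -/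
def poisson (h k : Cotangent n M → ℝ) (z : Cotangent n M) : ℝ :=
  (mfderiv (phaseModel n) 𝓘(ℝ, ℝ) k z : Phase n →L[ℝ] ℝ) (hamField h z)

/-- A Hamiltonian: a smooth function on `T*M ∖ 0`, positively homogeneous of degree `0`.
Its values on the zero section are irrelevant. -/
structure IsHamiltonian (h : Cotangent n M → ℝ) : Prop where
  smooth : ContMDiffOn (phaseModel n) 𝓘(ℝ, ℝ) ∞ h (punctured n M)
  homogeneous : ∀ s : ℝ, 0 < s → ∀ z ∈ punctured n M, h (dilate s z) = h z

/-- The energy shell `Σ₀ = h⁻¹(0) ⊆ T*M ∖ 0`. -/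
def shell (h : Cotangent n M → ℝ) : Set (Cotangent n M) :=
  {z | z ∈ punctured n M ∧ h z = 0}

/-- `0` is not a critical value of `h`. -/
def ZeroNotCritical (h : Cotangent n M → ℝ) : Prop :=
  ∀ z ∈ shell h, mfderiv (phaseModel n) 𝓘(ℝ, ℝ) h z ≠ 0

/-- A function is smooth on a subset `C` of `T*M` (below: `Σ₀` or a relatively open subset of it)
if it is locally the restriction to `C` of a smooth function on an open subset of `T*M`. -/
def SmoothOnSubset (C : Set (Cotangent n M)) (k : Cotangent n M → ℝ) : Prop :=
  ∀ z ∈ C, ∃ (U : Set (Cotangent n M)) (k' : Cotangent n M → ℝ), IsOpen U ∧ z ∈ U ∧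
    ContMDiffOn (phaseModel n) 𝓘(ℝ, ℝ) ∞ k' U ∧ EqOn k' k (U ∩ C)

/-- Escape functions `k : Σ₀ → ℝ` (the values of `k` off `Σ₀` are irrelevant).  As `X_h` is tangent
to `Σ₀`, the value of `{h, k}` at a point of `Σ₀` is that of `{h, k'}` for any smooth local
extension `k'` of `k`. -/
structure IsEscapeFunction (h k : Cotangent n M → ℝ) : Prop where
  smooth : SmoothOnSubset (shell h) k
  homogeneous : ∀ s : ℝ, 0 < s → ∀ z ∈ shell h, k (dilate s z) = s * k z
  escape : ∃ δ : ℝ, 0 < δ ∧ ∀ z ∈ shell h, ∀ (U : Set (Cotangent n M)) (k' : Cotangent n M → ℝ),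
    IsOpen U → z ∈ U → ContMDiffOn (phaseModel n) 𝓘(ℝ, ℝ) ∞ k' U →
    EqOn k' k (U ∩ shell h) → δ ≤ poisson h k' z

/-- Two points of `Σ₀` are equivalent if they lie on the same half-line. -/
def rayRel (h : Cotangent n M → ℝ) : Setoid (shell h) where
  r z w := ∃ s : ℝ, 0 < s ∧ (w : Cotangent n M) = dilate s (z : Cotangent n M)
  iseqv := by
    refine ⟨fun z => ⟨1, one_pos, (dilate_one _).symm⟩, ?_, ?_⟩
    · rintro z w ⟨s, hs, hw⟩
      exact ⟨s⁻¹, inv_pos.2 hs, by rw [hw, dilate_dilate, inv_mul_cancel₀ hs.ne', dilate_one]⟩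
    · rintro z w x ⟨s, hs, hw⟩ ⟨t, ht, hx⟩
      exact ⟨t * s, mul_pos ht hs, by rw [hx, hw, dilate_dilate]⟩

/-- `Z₀ = Σ₀ / ℝ⁺`, with the quotient topology. -/
abbrev Infinity (h : Cotangent n M → ℝ) : Type _ := Quotient (rayRel h)

/-- The projection `π : Σ₀ → Z₀`. -/
def proj (h : Cotangent n M → ℝ) (z : shell h) : Infinity h := Quotient.mk (rayRel h) z

/-- The cone `π⁻¹(O) ⊆ Σ₀` over a subset `O` of `Z₀`. -/
def coneOver (h : Cotangent n M → ℝ) (O : Set (Infinity h)) : Set (Cotangent n M) :=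
  {z | ∃ hz : z ∈ shell h, proj h ⟨z, hz⟩ ∈ O}

/-! ### The foliation `F`

`X_h` is homogeneous of degree `-1`.  For every smooth positive function `f`, homogeneous of
degree `1` on the cone over an open set `O` of `Z₀`, the field `f X_h` is invariant by dilations
and projects to a smooth vector field `W` on `O`; replacing `f` by another such function multiplies
`W` by a smooth positive function on `O`.  The conformal class of these `W` is the oriented
foliation `F`, and they are the vector fields that generate `F` on `O`.  The field `W` is
recorded through `f`. -/

/-- `f X_h` projects to a smooth vector field on `O` that generates `F`. -/
structure IsGenerator (h : Cotangent n M → ℝ) (O : Set (Infinity h))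
    (f : Cotangent n M → ℝ) : Prop where
  smooth : SmoothOnSubset (coneOver h O) f
  pos : ∀ z ∈ coneOver h O, 0 < f z
  homogeneous : ∀ s : ℝ, 0 < s → ∀ z ∈ coneOver h O, f (dilate s z) = s * f z

/-- `φ` is the flow on `Z₀` of the vector field `W` that is the projection of `f X_h`: its orbits
are the projections of the integral curves of `f X_h` in `Σ₀`. -/
def IsFlow (h f : Cotangent n M → ℝ) (φ : ℝ → Infinity h → Infinity h) : Prop :=
  ∀ z : shell h, ∃ γ : ℝ → shell h, γ 0 = z ∧
    IsMIntegralCurve (I := phaseModel n) (fun t => (γ t : Cotangent n M))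
      (fun w => f w • hamField h w) ∧
    ∀ t, φ t (proj h z) = proj h (γ t)

/-- `K` is an attractor of the flow `φ`: a compact invariant set with an open neighbourhood `U`
such that `K = ⋂_{t ≥ 0} φ_t(U)`. -/
structure IsAttractor {X : Type*} [TopologicalSpace X] (φ : ℝ → X → X) (K : Set X) : Prop where
  compact : IsCompact K
  invariant : ∀ t, φ t '' K = K
  attracts : ∃ U : Set X, IsOpen U ∧ K ⊆ U ∧ K = ⋂ t ∈ Ici (0 : ℝ), φ t '' U

/-- `(K₊, K₋)` is a simple structure of the foliation `F`.  Attractors, repellors and the limits of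
leaves do not depend on the vector field that generates `F`. -/
def IsSimpleStructure (h : Cotangent n M → ℝ) (Kp Km : Set (Infinity h)) : Prop :=
  ∃ (f : Cotangent n M → ℝ) (φ : ℝ → Infinity h → Infinity h),
    IsGenerator h univ f ∧ IsFlow h f φ ∧
    Disjoint Kp Km ∧
    IsAttractor φ Kp ∧
    IsAttractor (fun t => φ (-t)) Km ∧
    ∀ x, x ∉ Kp ∪ Km →
      Tendsto (fun t => φ t x) atTop (𝓝ˢ Kp) ∧ Tendsto (fun t => φ t x) atBot (𝓝ˢ Km)

/-! ### Densities and divergences on `Z₀` -/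

/-- The model space of `Z₀`, which has dimension `2n - 2`. -/
abbrev InfModel (n : ℕ) : Type := EuclideanSpace ℝ (Fin (2 * n - 2))

/-- Local coordinates on `Z₀`: an open subset `dom` of `ℝ^(2n-2)` and a smooth map
`σ : dom → Σ₀` such that `π ∘ σ` is an injective immersion, hence a diffeomorphism onto an open
subset of `Z₀` (the kernel of `dπ` is spanned by the radial field). -/
structure LocalParam (h : Cotangent n M → ℝ) where
  dom : Set (InfModel n)
  toFun : InfModel n → Cotangent n M
  isOpen_dom : IsOpen dom
  mem_shell : ∀ θ ∈ dom, toFun θ ∈ shell h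
  smooth : ContMDiffOn 𝓘(ℝ, InfModel n) (phaseModel n) ∞ toFun dom
  inj : ∀ θ ∈ dom, ∀ θ' ∈ dom, ∀ s : ℝ, 0 < s → toFun θ' = dilate s (toFun θ) → θ = θ'
  immersive : ∀ θ ∈ dom, ∀ (v : InfModel n) (c : ℝ),
    mfderiv 𝓘(ℝ, InfModel n) (phaseModel n) toFun θ v = c • radial (toFun θ) → v = 0

/-- The coordinate patch lies in `O`. -/
def LocalParam.MapsInto {h : Cotangent n M → ℝ} (σ : LocalParam h) (O : Set (Infinity h)) : Prop :=
  ∀ θ ∈ σ.dom, σ.toFun θ ∈ coneOver h O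

/-- A smooth (positive) density on the open subset `O` of `Z₀`: a coefficient `m_σ > 0` with
respect to Lebesgue measure in all local coordinates `σ` in `O`, such that
`m_σ = (m_τ ∘ ψ) |det Dψ|` for every change of coordinates `ψ`. -/
structure SmoothDensity (h : Cotangent n M → ℝ) (O : Set (Infinity h)) where
  coeff : LocalParam h → InfModel n → ℝ
  pos : ∀ σ : LocalParam h, σ.MapsInto O → ∀ θ ∈ σ.dom, 0 < coeff σ θ
  smooth : ∀ σ : LocalParam h, σ.MapsInto O → ContDiffOn ℝ ∞ (coeff σ) σ.dom
  compat : ∀ σ τ : LocalParam h, σ.MapsInto O → τ.MapsInto O →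
    ∀ (V : Set (InfModel n)) (ψ : InfModel n → InfModel n), IsOpen V → V ⊆ σ.dom →
      ContDiffOn ℝ ∞ ψ V → MapsTo ψ V τ.dom →
      (∀ θ ∈ V, ∃ s : ℝ, 0 < s ∧ τ.toFun (ψ θ) = dilate s (σ.toFun θ)) →
      ∀ θ ∈ V, coeff σ θ = coeff τ (ψ θ) * |(fderiv ℝ ψ θ).det|

/-- `w` is the expression in the local coordinates `σ` of the vector field on `Z₀` that is the
projection of `f X_h`. -/
def IsCoordExpr (h f : Cotangent n M → ℝ) (σ : LocalParam h)
    (w : InfModel n → InfModel n) : Prop :=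
  ∀ θ ∈ σ.dom, ∃ c : ℝ, mfderiv 𝓘(ℝ, InfModel n) (phaseModel n) σ.toFun θ (w θ) =
    f (σ.toFun θ) • hamField h (σ.toFun θ) + c • radial (σ.toFun θ)

/-- The divergence `m⁻¹ ∑ ∂_i (m w_i)` of the vector field `w` with respect to the density `m dθ`
on an open subset of `ℝ^d`. -/
def coordDiv {d : ℕ} (m : EuclideanSpace ℝ (Fin d) → ℝ)
    (w : EuclideanSpace ℝ (Fin d) → EuclideanSpace ℝ (Fin d))
    (θ : EuclideanSpace ℝ (Fin d)) : ℝ :=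
  (m θ)⁻¹ * ∑ i : Fin d, fderiv ℝ (fun x => m x * w x i) θ (EuclideanSpace.single i 1)

/-- The vector field `W` on `O` that is the projection of `f X_h` satisfies `P (div_μ W)` at all
points of `O`. -/
def DivergenceSatisfies (h f : Cotangent n M → ℝ) {O : Set (Infinity h)}
    (μ : SmoothDensity h O) (P : ℝ → Prop) : Prop :=
  ∀ σ : LocalParam h, σ.MapsInto O → ∃ w : InfModel n → InfModel n, IsCoordExpr h f σ w ∧
    ∀ θ ∈ σ.dom, P (coordDiv (μ.coeff σ) w θ)

/-- Weak hyperbolicity of a sink: in some open neighbourhood of `K` there are a generator of `F`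
and a smooth density for which the divergence is negative. -/
def WeaklyHyperbolicSink (h : Cotangent n M → ℝ) (K : Set (Infinity h)) : Prop :=
  ∃ (O : Set (Infinity h)) (f : Cotangent n M → ℝ) (μ : SmoothDensity h O),
    IsOpen O ∧ K ⊆ O ∧ IsGenerator h O f ∧ DivergenceSatisfies h f μ (fun d => d < 0)

/-- Weak hyperbolicity of a source: the same with positive divergence. -/
def WeaklyHyperbolicSource (h : Cotangent n M → ℝ) (K : Set (Infinity h)) : Prop :=
  ∃ (O : Set (Infinity h)) (f : Cotangent n M → ℝ) (μ : SmoothDensity h O),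
    IsOpen O ∧ K ⊆ O ∧ IsGenerator h O f ∧ DivergenceSatisfies h f μ (fun d => 0 < d)

/-- A simple structure whose sink and source are weakly hyperbolic. -/
def IsWeaklyHyperbolicSimpleStructure (h : Cotangent n M → ℝ) (Kp Km : Set (Infinity h)) : Prop :=
  IsSimpleStructure h Kp Km ∧ WeaklyHyperbolicSink h Kp ∧ WeaklyHyperbolicSource h Km

end DegreeZero

end

/-! Fix a norm N (`fibNorm`) on the fibres, smooth off the zero section, and a generator f X_h. A
function of degree 1 on Σ₀ has the form N u with u a function on Z₀, and f {h, N u} = N (y u + c u),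
where y is the projected generator and c = f {h, N} / N is the growth rate of log N
(`poisson_fibNorm_mul`). Since Z₀ is compact, an escape function is the same thing as a smooth u
with y u + c u > 0 on Z₀. Let τ(t, x) be the growth of log N along the orbit of x up to time t. Then
e^τ (u ∘ φ_t) has derivative e^τ ((y u + c u) ∘ φ_t) in t (`HasCocycleDeriv`), so the condition says
that this quantity increases along every orbit.

Divergence enters through Liouville's theorem. The Liouville measure of Σ₀ contracted with the
radial field, divided by g^n with g > 0 of degree 1, is a density on Z₀, and every smooth density
arises so. Because X_h preserves volume, the divergence of the projection of f X_h is {h, f} - n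
(f/g) {h, g} (`LocalParam.coordDiv_eq`). Hence k = f^(-1/(n-1)) g^(n/(n-1)) is positive of degree 1
and {h, k} = -k div / ((n-1) f); conversely the choice g = f gives div = -(n-1) {h, f}. So weak
hyperbolicity of a sink (source) means that some positive function of degree 1 near it has positive
(negative) bracket with h.

From an escape function N u: once u is nonnegative on an orbit it is positive ever after. The points
whose whole orbit lies in u ≥ 0 form an attractor K₊, those whose whole orbit lies in u ≤ 0 form a
repellor K₋, and all other orbits go from K₋ to K₊ (`isAttractor_of_sign`). The functions N u and -N
u serve as generators near K₊ and K₋.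

From a simple structure: take u₊ > 0 growing near K₊ and u₋ > 0 decreasing near K₋, and consider
e^(τ_T) (u₊ ∘ φ_T) - e^(τ_(-T)) (u₋ ∘ φ_(-T)). Transport along the flow commutes with y + c, so both
terms contribute positively when φ_T x is near K₊ and φ_(-T) x is near K₋. If φ_T x is not near K₊,
the orbit has spent all but a bounded part of [-T, T] near K₋, where e^τ decays exponentially, so
the second term dominates; the other case is symmetric (`exists_positive_combination`). Smoothness
of the transported functions is secured by replacing φ_T with an iterated Euler step, which is
smooth and almost intertwines the field with itself (`exists_smooth_approx_flow`).

Uniqueness: if x lay in one sink but outside another, its backward orbit would approach the other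
structure's source, along which e^τ decays in forward time, while inside the sink e^τ stays bounded
in backward time; together these force e^τ at a fixed time to vanish (`sink_subset`).

Calculus on Z₀ is done in a vector space: `emb` embeds the cosphere bundle, functions of degree 0
extend to the ambient space, and the pair (`emb`, log N) turns f X_h into a complete field that does
not depend on its last variable. -/

noncomputable section

namespace DegreeZero

open scoped NNReal

variable {n : ℕ} {M : Type*} [TopologicalSpace M] [ChartedSpace (Base n) M]
  [IsManifold 𝓘(ℝ, Base n) ∞ M]

/-! ### Shortcut instances -/

instance instTopologicalSpaceCotangent : TopologicalSpace (Cotangent n M) := by infer_instance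

instance instTopologicalSpacePhase (n : ℕ) : TopologicalSpace (Phase n) := by infer_instance

instance instTopologicalSpaceDual (n : ℕ) : TopologicalSpace (Base n →L[ℝ] ℝ) := by
  infer_instance

instance instContinuousSMulPhase (n : ℕ) : ContinuousSMul ℝ (Phase n) := by infer_instance

instance instT2SpacePhase (n : ℕ) : T2Space (Phase n) := by infer_instance

/-! ### Canonical charts of the cotangent bundle -/

/-- The canonical chart `(q, p)` of `T*M` attached to the preferred chart of `M` at `q`. -/
def ch (q : M) : PartialEquiv (Cotangent n M) (Phase n) :=
  extChartAt (phaseModel n) (⟨q, 0⟩ : Cotangent n M)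

/-- The preferred chart of the total space depends on the base point alone, so everything that is
defined pointwise in preferred charts can be compared with one fixed `ch q`. -/
theorem extChartAt_eq_ch (z : Cotangent n M) : extChartAt (phaseModel n) z = ch z.1 := by
  unfold ch
  rw [FiberBundle.extChartAt, FiberBundle.extChartAt]

theorem ch_source (q : M) : (ch (n := n) q).source = {z | z.1 ∈ (chartAt (Base n) q).source} := by
  ext z
  have h : ((trivializationAt (Base n →L[ℝ] ℝ)
      (fun q : M => TangentSpace 𝓘(ℝ, Base n) q →L[ℝ] Bundle.Trivial M ℝ q) q) z).1 = z.1 := rfl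
  rw [ch, FiberBundle.extChartAt]
  simp only [mfld_simps]
  simp [h]

theorem ch_target (q : M) :
    (ch (n := n) q).target = (extChartAt 𝓘(ℝ, Base n) q).target ×ˢ univ := by
  simp only [ch]
  rw [FiberBundle.extChartAt_target]
  ext w
  simp only [extChartAt, OpenPartialHomeomorph.extend, modelWithCornersSelf_partialEquiv,
    PartialEquiv.trans_refl, hom_trivializationAt_baseSet, TangentBundle.trivializationAt_baseSet,
    Trivial.fiberBundle_trivializationAt', Trivial.trivialization_baseSet, inter_univ, mem_prod,
    mem_inter_iff, mem_univ, and_true, and_iff_left_iff_imp]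
  exact fun h => (chartAt (Base n) q).map_target h

theorem mem_ch_source (z : Cotangent n M) : z ∈ (ch z.1).source := by
  rw [ch_source]; exact mem_chart_source _ _

theorem mem_ch_source_iff {q : M} {z : Cotangent n M} :
    z ∈ (ch q).source ↔ z.1 ∈ (extChartAt 𝓘(ℝ, Base n) q).source := by
  rw [ch_source, extChartAt_source]; rfl

theorem ch_apply (q : M) (z : Cotangent n M) : ch q z = (extChartAt 𝓘(ℝ, Base n) q z.1,
    (z.2 : Base n →L[ℝ] ℝ).comp
      (((trivializationAt (Base n) (TangentSpace 𝓘(ℝ, Base n)) q).symmL ℝ z.1 : _) :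
        Base n →L[ℝ] Base n)) := by
  rw [ch, FiberBundle.extChartAt, hom_trivializationAt]
  simp only [mfld_simps]
  refine Prod.ext rfl ?_
  ext v
  simp [Trivialization.continuousLinearMap_apply]

theorem ch_apply_coordChange {q : M} {z : Cotangent n M} (hz : z ∈ (ch q).source) :
    ch q z = (extChartAt 𝓘(ℝ, Base n) q z.1,
      (z.2 : Base n →L[ℝ] ℝ).comp (tangentCoordChange 𝓘(ℝ, Base n) q z.1 z.1)) := by
  rw [ch_apply]
  refine Prod.ext rfl ?_
  rw [mem_ch_source_iff] at hz
  have : (trivializationAt (Base n) (TangentSpace 𝓘(ℝ, Base n)) q).symmL ℝ z.1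
      = tangentCoordChange 𝓘(ℝ, Base n) q z.1 z.1 := by
    rw [TangentBundle.symmL_trivializationAt_eq_core (by simpa using hz)]
  rw [this]

/-- Covectors transform by precomposition with the inverse Jacobian. This makes the changes of chart
cotangent lifts, hence symplectic. -/
theorem ch_transition {q r : M} {z : Cotangent n M} (hq : z ∈ (ch q).source)
    (hr : z ∈ (ch r).source) :
    (ch r z).2 = (ch q z).2.comp (tangentCoordChange 𝓘(ℝ, Base n) r q z.1) := by
  rw [ch_apply_coordChange hq, ch_apply_coordChange hr]
  rw [mem_ch_source_iff] at hq hr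
  have h : tangentCoordChange 𝓘(ℝ, Base n) r z.1 z.1 =
      (tangentCoordChange 𝓘(ℝ, Base n) q z.1 z.1).comp (tangentCoordChange 𝓘(ℝ, Base n) r q z.1) :=
    ContinuousLinearMap.ext fun v =>
      (tangentCoordChange_comp ⟨⟨hr, hq⟩, mem_extChartAt_source _⟩).symm
  change ContinuousLinearMap.comp (z.2 : Base n →L[ℝ] ℝ) _ = _
  rw [h]
  rfl

theorem ch_symm_fst (q : M) {w : Phase n} (hw : w ∈ (ch q).target) :
    ((ch q).symm w).1 = (extChartAt 𝓘(ℝ, Base n) q).symm w.1 := by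
  have h1 := congrArg Prod.fst ((ch q).right_inv hw)
  have h2 := (ch q).map_target hw
  rw [mem_ch_source_iff] at h2
  rw [ch_apply] at h1
  simp only at h1
  rw [← h1]
  exact ((extChartAt 𝓘(ℝ, Base n) q).left_inv h2).symm

theorem isOpen_ch_source (q : M) : IsOpen (ch (n := n) q).source :=
  isOpen_extChartAt_source _

theorem isOpen_ch_target (q : M) : IsOpen (ch (n := n) q).target :=
  isOpen_extChartAt_target _

theorem contMDiffOn_ch (q : M) :
    ContMDiffOn (phaseModel n) 𝓘(ℝ, Phase n) ∞ (ch q) (ch (n := n) q).source := by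
  unfold ch
  rw [extChartAt_source]
  exact contMDiffOn_extChartAt

theorem contMDiffOn_ch_symm (q : M) :
    ContMDiffOn 𝓘(ℝ, Phase n) (phaseModel n) ∞ (ch (n := n) q).symm (ch (n := n) q).target :=
  contMDiffOn_extChartAt_symm _

/-! Dilations in canonical charts. -/

/-- The fibrewise dilation of the model space. -/
def dil (s : ℝ) : Phase n →L[ℝ] Phase n :=
  (ContinuousLinearMap.fst ℝ _ _).prod (s • ContinuousLinearMap.snd ℝ _ _)

@[simp] theorem dil_apply (s : ℝ) (w : Phase n) : dil s w = (w.1, s • w.2) := rfl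

theorem dilate_mem_ch_source {q : M} {z : Cotangent n M} (s : ℝ) :
    dilate s z ∈ (ch q).source ↔ z ∈ (ch q).source := by
  rw [ch_source]; rfl

theorem ch_dilate (q : M) (s : ℝ) (z : Cotangent n M) : ch q (dilate s z) = dil s (ch q z) := by
  rw [ch_apply, ch_apply]
  refine Prod.ext rfl ?_
  ext v
  rfl

theorem ch_snd_eq_zero_iff {q : M} {z : Cotangent n M} (hz : z ∈ (ch q).source) :
    (ch q z).2 = 0 ↔ z.2 = 0 := by
  constructor
  · intro h
    -- A vanishing fibre coordinate gives `z` and `dilate 0 z` the same image in the chart;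
    -- injectivity then identifies them, and no coordinate change has to be inverted.
    have h0 : dilate 0 z = z := by
      refine (ch q).injOn ((dilate_mem_ch_source 0).2 hz) hz ?_
      rw [ch_dilate]
      exact Prod.ext rfl (by simp [h])
    have h1 : (0 : ℝ) • z.2 = z.2 := by
      have := h0
      cases z
      simp only [dilate, TotalSpace.mk.injEq, heq_eq_eq, true_and] at this
      exact this
    rw [← h1, zero_smul]
  · intro h
    rw [ch_apply]
    ext v
    simp only [ContinuousLinearMap.comp_apply]
    rw [h]; rfl

theorem mem_punctured_iff {q : M} {z : Cotangent n M} (hz : z ∈ (ch q).source) :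
    z ∈ punctured n M ↔ (ch q z).2 ≠ 0 := (ch_snd_eq_zero_iff hz).not.symm

theorem isOpen_punctured : IsOpen (punctured n M) := by
  rw [isOpen_iff_mem_nhds]
  intro z hz
  have h1 := (contMDiffOn_ch z.1).continuousOn.continuousAt
    ((isOpen_ch_source (n := n) z.1).mem_nhds (mem_ch_source z))
  have h2 : ∀ᶠ w in 𝓝 z, (ch z.1 w).2 ≠ 0 :=
    h1.snd.eventually_ne ((mem_punctured_iff (mem_ch_source z)).1 hz)
  filter_upwards [h2, (isOpen_ch_source (n := n) z.1).mem_nhds (mem_ch_source z)] with w hw hw'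
  exact (mem_punctured_iff hw').2 hw

theorem dilate_mem_punctured {s : ℝ} (hs : s ≠ 0) {z : Cotangent n M} :
    dilate s z ∈ punctured n M ↔ z ∈ punctured n M := by
  rw [mem_punctured_iff ((dilate_mem_ch_source (q := z.1) s).2 (mem_ch_source z)),
    mem_punctured_iff (mem_ch_source z), ch_dilate]
  simp [hs]

theorem contMDiff_dilate :
    ContMDiff (𝓘(ℝ, ℝ).prod (phaseModel n)) (phaseModel n) ∞
      (fun a : ℝ × Cotangent n M => dilate a.1 a.2) := by
  intro a
  have h1 : (fun b : ℝ × Cotangent n M => dilate b.1 b.2) =ᶠ[𝓝 a]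
      fun b => (ch a.2.1).symm ((ch a.2.1 b.2).1, b.1 • (ch a.2.1 b.2).2) := by
    have : ∀ᶠ b in 𝓝 a, b.2 ∈ (ch (n := n) a.2.1).source :=
      continuousAt_snd.eventually ((isOpen_ch_source (n := n) a.2.1).mem_nhds (mem_ch_source a.2))
    filter_upwards [this] with b hb
    rw [← dil_apply, ← ch_dilate, (ch a.2.1).left_inv ((dilate_mem_ch_source _).2 hb)]
  refine ContMDiffAt.congr_of_eventuallyEq ?_ h1
  have h2 : ContMDiffAt (𝓘(ℝ, ℝ).prod (phaseModel n)) 𝓘(ℝ, Phase n) ∞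
      (fun b : ℝ × Cotangent n M => ch a.2.1 b.2) a :=
    ((contMDiffOn_ch a.2.1).contMDiffAt
      ((isOpen_ch_source (n := n) a.2.1).mem_nhds (mem_ch_source a.2))).comp a contMDiffAt_snd
  have h3 : ContMDiffAt (𝓘(ℝ, ℝ).prod (phaseModel n)) 𝓘(ℝ, Phase n) ∞
      (fun b : ℝ × Cotangent n M => ((ch a.2.1 b.2).1, b.1 • (ch a.2.1 b.2).2)) a := by
    have h4 : ContDiff ℝ ∞ (fun c : ℝ × Phase n => (c.2.1, c.1 • c.2.2)) := by fun_prop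
    exact h4.contDiffAt.contMDiffAt.comp a (contMDiffAt_fst.prodMk_space h2)
  refine ContMDiffAt.comp a ?_ h3
  refine (contMDiffOn_ch_symm a.2.1).contMDiffAt ((isOpen_ch_target _).mem_nhds ?_)
  rw [← dil_apply, ← ch_dilate]
  exact (ch a.2.1).map_source ((dilate_mem_ch_source _).2 (mem_ch_source a.2))

/-! ### Symplectic invariance -/

/-- Testing against covectors removes the basis from the first component. Together with
`sympGrad_snd_apply` it characterises the symplectic gradient. -/
theorem apply_sympGrad_fst (α : Phase n →L[ℝ] ℝ) (β : Base n →L[ℝ] ℝ) :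
    β (sympGrad α).1 = α (0, β) := by
  have hβ : β = ∑ i : Fin n, β (EuclideanSpace.single i 1) •
      (EuclideanSpace.proj i : Base n →L[ℝ] ℝ) := by
    ext v
    conv_lhs => rw [← (EuclideanSpace.basisFun (Fin n) ℝ).sum_repr v]
    simp [mul_comm]
  have h2 : α (0, β) = ∑ i : Fin n, β (EuclideanSpace.single i 1) *
      α (0, (EuclideanSpace.proj i : Base n →L[ℝ] ℝ)) := by
    have : (0, β) = ContinuousLinearMap.inr ℝ (Base n) (Base n →L[ℝ] ℝ) β := rfl
    rw [this, hβ, map_sum, map_sum]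
    refine Finset.sum_congr rfl fun i _ => ?_
    rw [map_smul, map_smul, ← hβ]
    rfl
  rw [h2]
  simp [sympGrad, mul_comm]

theorem sympGrad_snd_apply (α : Phase n →L[ℝ] ℝ) (v : Base n) :
    (sympGrad α).2 v = -α (v, 0) := rfl

theorem base_ext {a b : Base n} (h : ∀ β : Base n →L[ℝ] ℝ, β a = β b) : a = b := by
  ext i
  exact h (EuclideanSpace.proj i)

instance : AddCommGroup (Phase n →L[ℝ] ℝ) := ContinuousLinearMap.addCommGroup

/-- The symplectic gradient as a continuous linear map. -/
def sympGradCLM (n : ℕ) : (Phase n →L[ℝ] ℝ) →L[ℝ] Phase n :=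
  (∑ i : Fin n, (ContinuousLinearMap.apply ℝ ℝ
      ((0, EuclideanSpace.proj i) : Phase n)).smulRight (EuclideanSpace.single i (1 : ℝ))).prod
    (-((ContinuousLinearMap.compL ℝ (Base n) (Phase n) ℝ).flip
      (ContinuousLinearMap.inl ℝ (Base n) (Base n →L[ℝ] ℝ))))

@[simp] theorem sympGradCLM_apply (α : Phase n →L[ℝ] ℝ) : sympGradCLM n α = sympGrad α := by
  refine Prod.ext ?_ ?_
  · simp [sympGradCLM, sympGrad]
  · ext v; simp [sympGradCLM, sympGrad]

/-- Nondegeneracy of the symplectic form: `h1` reconstructs a covector from its gradient. -/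
theorem sympGrad_injective : Function.Injective (sympGrad (n := n)) := by
  intro α β h
  refine ContinuousLinearMap.ext fun v => ?_
  have h1 : ∀ (γ : Phase n →L[ℝ] ℝ), γ v = v.2 (sympGrad γ).1 - (sympGrad γ).2 v.1 := by
    intro γ
    rw [apply_sympGrad_fst, sympGrad_snd_apply, sub_neg_eq_add, ← map_add]
    simp
  rw [h1, h1 β, h]

theorem apply_sympGrad_self (α : Phase n →L[ℝ] ℝ) : α (sympGrad α) = 0 := by
  have h1 : α (sympGrad α) = (sympGrad α).2 (sympGrad α).1 - (sympGrad α).2 (sympGrad α).1 := by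
    conv_rhs =>
      rw [sympGrad_snd_apply]
    have h2 := apply_sympGrad_fst α (sympGrad α).2
    rw [sympGrad_snd_apply] at h2
    have h3 : α (sympGrad α) = α ((sympGrad α).1, 0) + α (0, (sympGrad α).2) := by
      rw [← map_add]; simp
    rw [h3, ← h2]
    ring
  rw [h1, sub_self]

/-- The lift to the cotangent bundle of a change of coordinates `κ` of the base with inverse `χ`. -/
theorem hasFDerivAt_lift {κ χ : Base n → Base n} {w : Phase n}
    (hκ : DifferentiableAt ℝ κ w.1) (hχ : DifferentiableAt ℝ (fderiv ℝ χ) (κ w.1)) :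
    HasFDerivAt (fun u : Phase n => ((κ u.1, u.2.comp (fderiv ℝ χ (κ u.1))) : Phase n))
      (((fderiv ℝ κ w.1).comp (ContinuousLinearMap.fst ℝ _ _)).prod
        (((ContinuousLinearMap.compL ℝ (Base n) (Base n) ℝ w.2).comp
            ((fderiv ℝ (fderiv ℝ χ) (κ w.1)).comp
              ((fderiv ℝ κ w.1).comp (ContinuousLinearMap.fst ℝ _ _)))) +
          ((ContinuousLinearMap.compL ℝ (Base n) (Base n) ℝ).flip (fderiv ℝ χ (κ w.1))).comp
            (ContinuousLinearMap.snd ℝ _ _))) w := by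
  have h1 : HasFDerivAt (fun u : Phase n => κ u.1)
      ((fderiv ℝ κ w.1).comp (ContinuousLinearMap.fst ℝ _ _)) w :=
    hκ.hasFDerivAt.comp w hasFDerivAt_fst
  have h2 : HasFDerivAt (fun u : Phase n => fderiv ℝ χ (κ u.1)) _ w :=
    hχ.hasFDerivAt.comp w h1
  exact h1.prodMk ((hasFDerivAt_snd (p := w)).clm_comp h2)

/-- Cotangent lifts are symplectic. The derivative of the lift contains the second derivative of χ
paired with p; it enters twice with opposite signs and cancels because second derivatives are
symmetric. -/
theorem sympGrad_lift {κ χ : Base n → Base n} {w : Phase n}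
    (hκ : ContDiffAt ℝ ∞ κ w.1) (hχ : ContDiffAt ℝ ∞ χ (κ w.1))
    (h1 : ∀ᶠ x in 𝓝 w.1, χ (κ x) = x) (h2 : ∀ᶠ x in 𝓝 (κ w.1), κ (χ x) = x)
    (α : Phase n →L[ℝ] ℝ) :
    fderiv ℝ (fun u : Phase n => ((κ u.1, u.2.comp (fderiv ℝ χ (κ u.1))) : Phase n)) w
      (sympGrad (α.comp
        (fderiv ℝ (fun u : Phase n => ((κ u.1, u.2.comp (fderiv ℝ χ (κ u.1))) : Phase n)) w))) =
      sympGrad α := by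
  have dκ : DifferentiableAt ℝ κ w.1 := hκ.differentiableAt (by simp)
  have dχ : DifferentiableAt ℝ χ (κ w.1) := hχ.differentiableAt (by simp)
  have dχ2 : DifferentiableAt ℝ (fderiv ℝ χ) (κ w.1) :=
    (hχ.fderiv_right (m := 1) (by norm_cast)).differentiableAt (by simp)
  have hsymm : IsSymmSndFDerivAt ℝ χ (κ w.1) := hχ.isSymmSndFDerivAt (by simp; exact WithTop.coe_le_coe.2 le_top)
  have hBK : ∀ v, fderiv ℝ χ (κ w.1) (fderiv ℝ κ w.1 v) = v := by
    intro v
    have h3 : HasFDerivAt (χ ∘ κ) ((fderiv ℝ χ (κ w.1)).comp (fderiv ℝ κ w.1)) w.1 :=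
      dχ.hasFDerivAt.comp w.1 dκ.hasFDerivAt
    have h4 : HasFDerivAt (χ ∘ κ) (ContinuousLinearMap.id ℝ _) w.1 :=
      (hasFDerivAt_id w.1).congr_of_eventuallyEq h1
    exact DFunLike.congr_fun (h3.unique h4) v
  have hχκ : χ (κ w.1) = w.1 := h1.self_of_nhds
  have hKB : ∀ v, fderiv ℝ κ w.1 (fderiv ℝ χ (κ w.1) v) = v := by
    intro v
    have h3 : HasFDerivAt (κ ∘ χ) ((fderiv ℝ κ w.1).comp (fderiv ℝ χ (κ w.1))) (κ w.1) := by
      refine HasFDerivAt.comp (κ w.1) ?_ dχ.hasFDerivAt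
      rw [hχκ]; exact dκ.hasFDerivAt
    have h4 : HasFDerivAt (κ ∘ χ) (ContinuousLinearMap.id ℝ _) (κ w.1) :=
      (hasFDerivAt_id (κ w.1)).congr_of_eventuallyEq h2
    exact DFunLike.congr_fun (h3.unique h4) v
  have hT0 := (hasFDerivAt_lift dκ dχ2).fderiv
  set K := fderiv ℝ κ w.1
  set B := fderiv ℝ χ (κ w.1)
  set D := fderiv ℝ (fderiv ℝ χ) (κ w.1)
  set T := fderiv ℝ (fun u : Phase n => ((κ u.1, u.2.comp (fderiv ℝ χ (κ u.1))) : Phase n)) w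
  have hTa : ∀ a b, T (a, b) = (K a, w.2.comp (D (K a)) + b.comp B) := fun a b => by
    rw [hT0]; rfl
  set g := (sympGrad α).1 with hg
  have e1 : (sympGrad (α.comp T)).1 = B g := by
    refine base_ext fun β => ?_
    rw [apply_sympGrad_fst, ContinuousLinearMap.comp_apply, hTa]
    have : β (B g) = (β.comp B) g := rfl
    rw [this, hg, apply_sympGrad_fst]
    simp
  have e3 : ∀ v, (sympGrad (α.comp T)).2 v = -(α (K v, 0) + w.2 (D (K v) g)) := by
    intro v
    rw [sympGrad_snd_apply, ContinuousLinearMap.comp_apply, hTa]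
    have : w.2 (D (K v) g) = (w.2.comp (D (K v))) g := rfl
    rw [this, hg, apply_sympGrad_fst, ← map_add]
    simp
  rw [← Prod.mk.eta (p := sympGrad (α.comp T)), hTa, e1]
  refine Prod.ext (hKB g) ?_
  ext v
  simp only [add_apply, ContinuousLinearMap.comp_apply]
  rw [e3, hKB, hKB, sympGrad_snd_apply, hsymm.eq g v]
  ring

/-! ### Change of canonical charts -/

/-- The differential at `z` of the change of coordinates from the canonical chart at `q` to the
preferred chart at `z`. -/
def trD (q : M) (z : Cotangent n M) : Phase n →L[ℝ] Phase n :=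
  fderiv ℝ (ch z.1 ∘ (ch (n := n) q).symm) (ch q z)

theorem ch_trans_eventuallyEq {q r : M} {z : Cotangent n M} (hq : z ∈ (ch q).source)
    (hr : z ∈ (ch r).source) :
    ∀ᶠ w in 𝓝 (ch q z), w ∈ (ch (n := n) q).target ∧ (ch q).symm w ∈ (ch (n := n) r).source := by
  have h1 : (ch (n := n) q).target ∈ 𝓝 (ch q z) :=
    (isOpen_ch_target q).mem_nhds ((ch q).map_source hq)
  have h2 : ContinuousAt (ch (n := n) q).symm (ch q z) :=
    (contMDiffOn_ch_symm q).continuousOn.continuousAt h1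
  have h3 : (ch (n := n) r).source ∈ 𝓝 ((ch q).symm (ch q z)) := by
    rw [(ch q).left_inv hq]
    exact (isOpen_ch_source r).mem_nhds hr
  filter_upwards [h1, h2 h3] with w hw hw'
  exact ⟨hw, hw'⟩

theorem contDiffAt_ch_trans {q r : M} {z : Cotangent n M} (hq : z ∈ (ch q).source)
    (hr : z ∈ (ch r).source) :
    ContDiffAt ℝ ∞ (ch r ∘ (ch (n := n) q).symm) (ch q z) := by
  rw [← contMDiffAt_iff_contDiffAt]
  refine ContMDiffAt.comp (I' := phaseModel n) (ch q z) ?_ ?_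
  · rw [(ch q).left_inv hq]
    exact (contMDiffOn_ch r).contMDiffAt ((isOpen_ch_source r).mem_nhds hr)
  · exact (contMDiffOn_ch_symm q).contMDiffAt
      ((isOpen_ch_target q).mem_nhds ((ch q).map_source hq))

theorem hasFDerivAt_trD {q : M} {z : Cotangent n M} (hq : z ∈ (ch q).source) :
    HasFDerivAt (ch z.1 ∘ (ch (n := n) q).symm) (trD q z) (ch q z) :=
  ((contDiffAt_ch_trans hq (mem_ch_source z)).differentiableAt (by simp)).hasFDerivAt

theorem trD_injective {q : M} {z : Cotangent n M} (hq : z ∈ (ch q).source) :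
    Function.Injective (trD q z) := by
  have h1 := hasFDerivAt_trD hq
  have h2 : HasFDerivAt (ch q ∘ (ch (n := n) z.1).symm)
      (fderiv ℝ (ch q ∘ (ch (n := n) z.1).symm) (ch z.1 z))
      ((ch z.1 ∘ (ch (n := n) q).symm) (ch q z)) := by
    rw [Function.comp_apply, (ch q).left_inv hq]
    exact ((contDiffAt_ch_trans (mem_ch_source z) hq).differentiableAt (by simp)).hasFDerivAt
  have h3 := h2.comp _ h1
  have h4 : HasFDerivAt ((ch q ∘ (ch (n := n) z.1).symm) ∘ (ch z.1 ∘ (ch (n := n) q).symm))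
      (ContinuousLinearMap.id ℝ _) (ch q z) := by
    refine (hasFDerivAt_id _).congr_of_eventuallyEq ?_
    filter_upwards [ch_trans_eventuallyEq hq (mem_ch_source z)] with w hw
    simp only [Function.comp_apply, id]
    rw [(ch z.1).left_inv hw.2, (ch q).right_inv hw.1]
  have h5 := h3.unique h4
  intro a b hab
  have h6 := DFunLike.congr_fun h5 a
  have h7 := DFunLike.congr_fun h5 b
  simp only [ContinuousLinearMap.comp_apply, ContinuousLinearMap.id_apply] at h6 h7
  rw [← h6, ← h7, hab]

/-- The change between canonical charts is the lift of the change κ of base coordinates, so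
`sympGrad_lift` applies. This is why `hamField`, computed at each point in a different chart, is one
well-defined field. -/
theorem trD_sympGrad {q : M} {z : Cotangent n M} (hq : z ∈ (ch q).source)
    (α : Phase n →L[ℝ] ℝ) : trD q z (sympGrad (α.comp (trD q z))) = sympGrad α := by
  set I := 𝓘(ℝ, Base n)
  set r := z.1 with hr
  set κ : Base n → Base n := extChartAt I r ∘ (extChartAt I q).symm with hκ
  set χ : Base n → Base n := extChartAt I q ∘ (extChartAt I r).symm with hχ
  have hq' := mem_ch_source_iff.1 hq
  have hr' : z.1 ∈ (extChartAt I r).source := mem_extChartAt_source _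
  have e1 : (ch q z).1 = extChartAt I q z.1 := by rw [ch_apply]
  have e2 : κ (extChartAt I q z.1) = extChartAt I r z.1 := by
    simp only [hκ, Function.comp_apply, (extChartAt I q).left_inv hq']
  have smooth : ∀ {a b : M}, z.1 ∈ (extChartAt I a).source → z.1 ∈ (extChartAt I b).source →
      ContDiffAt ℝ ∞ (extChartAt I b ∘ (extChartAt I a).symm) (extChartAt I a z.1) ∧
      ∀ᶠ x in 𝓝 (extChartAt I a z.1), (extChartAt I a)
        ((extChartAt I b).symm ((extChartAt I b) ((extChartAt I a).symm x))) = x := by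
    intro a b ha hb
    constructor
    · rw [← contMDiffAt_iff_contDiffAt]
      refine ContMDiffAt.comp (I' := I) _ ?_ ?_
      · rw [(extChartAt I a).left_inv ha]
        exact contMDiffAt_extChartAt' (by rwa [extChartAt_source] at hb)
      · exact (contMDiffOn_extChartAt_symm a).contMDiffAt (extChartAt_target_mem_nhds' ((extChartAt I a).map_source ha))
    · have h2 : ContinuousAt (extChartAt I a).symm (extChartAt I a z.1) :=
        continuousAt_extChartAt_symm' ha
      have h3 : (extChartAt I b).source ∈ 𝓝 ((extChartAt I a).symm (extChartAt I a z.1)) := by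
        rw [(extChartAt I a).left_inv ha]
        exact (isOpen_extChartAt_source b).mem_nhds hb
      filter_upwards [extChartAt_target_mem_nhds' ((extChartAt I a).map_source ha), h2 h3] with x hx hx'
      rw [(extChartAt I b).left_inv hx', (extChartAt I a).right_inv hx]
  have h1 := smooth hq' hr'
  have h2 := smooth hr' hq'
  have key : trD q z = fderiv ℝ
      (fun u : Phase n => ((κ u.1, u.2.comp (fderiv ℝ χ (κ u.1))) : Phase n)) (ch q z) := by
    refine Filter.EventuallyEq.fderiv_eq ?_
    filter_upwards [ch_trans_eventuallyEq hq (mem_ch_source z)] with w hw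
    refine Prod.ext ?_ ?_
    · simp only [Function.comp_apply]
      rw [ch_apply]
      simp only [hκ, Function.comp_apply]
      rw [ch_symm_fst q hw.1]
    · simp only [Function.comp_apply]
      rw [ch_transition ((ch q).map_target hw.1) hw.2, (ch q).right_inv hw.1]
      congr 1
      rw [tangentCoordChange_def]
      simp only [modelWithCornersSelf_coe, range_id, fderivWithin_univ]
      rw [ch_symm_fst q hw.1]
      rfl
  rw [key]
  refine sympGrad_lift ?_ ?_ ?_ ?_ α
  · rw [e1]; exact h1.1
  · rw [e1, e2]; exact h2.1
  · rw [e1]; exact h1.2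
  · rw [e1, e2]; exact h2.2

/-- Derivatives of maps into the cotangent bundle, computed in a canonical chart. -/
theorem hasMFDerivAt_of_ch {E : Type*} [NormedAddCommGroup E] [NormedSpace ℝ E] {q : M}
    {σ : E → Cotangent n M} {θ : E} {A : E →L[ℝ] Phase n} (hc : ContinuousAt σ θ)
    (hs : σ θ ∈ (ch q).source) (hA : HasFDerivAt (ch q ∘ σ) A θ) :
    HasMFDerivAt 𝓘(ℝ, E) (phaseModel n) σ θ ((trD q (σ θ)).comp A) := by
  refine ⟨hc, ?_⟩
  have h1 : HasFDerivAt (ch (σ θ).1 ∘ σ) ((trD q (σ θ)).comp A) θ := by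
    refine ((hasFDerivAt_trD hs).comp θ hA).congr_of_eventuallyEq ?_
    filter_upwards [hc ((isOpen_ch_source q).mem_nhds hs)] with x hx
    simp only [Function.comp_apply]
    rw [(ch q).left_inv hx]
  rw [writtenInExtChartAt, extChartAt_eq_ch]
  exact h1.hasFDerivWithinAt

theorem differentiableAt_ch_comp {E : Type*} [NormedAddCommGroup E] [NormedSpace ℝ E] {q : M}
    {σ : E → Cotangent n M} {θ : E} (hσ : MDifferentiableAt 𝓘(ℝ, E) (phaseModel n) σ θ)
    (hs : σ θ ∈ (ch q).source) : DifferentiableAt ℝ (ch q ∘ σ) θ := by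
  rw [← mdifferentiableAt_iff_differentiableAt]
  exact (((contMDiffOn_ch q).contMDiffAt ((isOpen_ch_source q).mem_nhds hs)).mdifferentiableAt
    (by simp)).comp θ hσ

theorem mfderiv_eq_trD_comp {E : Type*} [NormedAddCommGroup E] [NormedSpace ℝ E] {q : M}
    {σ : E → Cotangent n M} {θ : E} (hσ : MDifferentiableAt 𝓘(ℝ, E) (phaseModel n) σ θ)
    (hs : σ θ ∈ (ch q).source) (v : E) :
    mfderiv 𝓘(ℝ, E) (phaseModel n) σ θ v = trD q (σ θ) (fderiv ℝ (ch q ∘ σ) θ v) := by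
  rw [(hasMFDerivAt_of_ch hσ.continuousAt hs
    (differentiableAt_ch_comp hσ hs).hasFDerivAt).mfderiv]
  rfl

theorem radial_eq {q : M} {z : Cotangent n M} (hq : z ∈ (ch q).source) :
    radial z = trD q z (0, (ch q z).2) := by
  have h0 : ContMDiffAt 𝓘(ℝ, ℝ) (phaseModel n) ∞ (fun s : ℝ => dilate s z) 1 :=
    contMDiff_dilate.contMDiffAt.comp (1 : ℝ) (contMDiffAt_id.prodMk contMDiffAt_const)
  have h1 : MDifferentiableAt 𝓘(ℝ, ℝ) (phaseModel n) (fun s : ℝ => dilate s z) 1 :=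
    h0.mdifferentiableAt (by simp)
  have hq1 : dilate 1 z ∈ (ch q).source := (dilate_mem_ch_source 1).2 hq
  have h2 : HasDerivAt (ch q ∘ fun s : ℝ => dilate s z) (0, (ch q z).2) 1 := by
    have : (ch q ∘ fun s : ℝ => dilate s z) = fun s => ((ch q z).1, s • (ch q z).2) := by
      ext1 s; exact ch_dilate q s z
    rw [this]
    have := (hasDerivAt_const (1 : ℝ) (ch q z).1).prodMk
      ((hasDerivAt_id (1 : ℝ)).smul_const (ch q z).2)
    simpa using this
  have h3 := mfderiv_eq_trD_comp h1 hq1 (1 : ℝ)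
  rw [h2.hasFDerivAt.fderiv] at h3
  unfold radial
  rw [h3, ContinuousLinearMap.toSpanSingleton_apply, one_smul, dilate_one]

/-- The differential of a vector-valued function on the cotangent bundle. -/
def mfd {F : Type*} [NormedAddCommGroup F] [NormedSpace ℝ F] (k : Cotangent n M → F)
    (z : Cotangent n M) : Phase n →L[ℝ] F :=
  mfderiv (phaseModel n) 𝓘(ℝ, F) k z

/-- Derivatives of functions on the cotangent bundle, computed in a canonical chart. -/
theorem hasFDerivAt_comp_ch_symm {F : Type*} [NormedAddCommGroup F] [NormedSpace ℝ F] {q : M}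
    {k : Cotangent n M → F} {z : Cotangent n M}
    (hk : MDifferentiableAt (phaseModel n) 𝓘(ℝ, F) k z) (hq : z ∈ (ch q).source) :
    HasFDerivAt (k ∘ (ch q).symm)
      ((mfd k z).comp (trD q z)) (ch q z) := by
  have h1 : HasFDerivAt (k ∘ (ch (n := n) z.1).symm)
      (mfd k z) (ch z.1 z) := by
    have := hk.hasMFDerivAt.2
    rw [writtenInExtChartAt, extChartAt_eq_ch, ModelWithCorners.range_eq_univ] at this
    exact hasFDerivWithinAt_univ.1 this
  have h2 : HasFDerivAt (k ∘ (ch (n := n) z.1).symm)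
      (mfd k z)
      ((ch z.1 ∘ (ch (n := n) q).symm) (ch q z)) := by
    rw [Function.comp_apply, (ch q).left_inv hq]; exact h1
  refine (h2.comp _ (hasFDerivAt_trD hq)).congr_of_eventuallyEq ?_
  filter_upwards [ch_trans_eventuallyEq hq (mem_ch_source z)] with w hw
  simp only [Function.comp_apply]
  rw [(ch z.1).left_inv hw.2]

theorem mfderiv_trD {F : Type*} [NormedAddCommGroup F] [NormedSpace ℝ F] {q : M}
    {k : Cotangent n M → F} {z : Cotangent n M}
    (hk : MDifferentiableAt (phaseModel n) 𝓘(ℝ, F) k z) (hq : z ∈ (ch q).source) (v : Phase n) :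
    mfd k z (trD q z v) =
      fderiv ℝ (k ∘ (ch q).symm) (ch q z) v := by
  rw [(hasFDerivAt_comp_ch_symm hk hq).fderiv]; rfl

/-- The Hamiltonian vector field in canonical coordinates. -/
def hamCoord (h : Cotangent n M → ℝ) (q : M) (w : Phase n) : Phase n :=
  sympGrad (fderiv ℝ (h ∘ (ch q).symm) w)

/-- Expresses the field near a point in one fixed chart, the form in which it can be differentiated.
-/
theorem hamField_eq {q : M} {h : Cotangent n M → ℝ} {z : Cotangent n M}
    (hh : MDifferentiableAt (phaseModel n) 𝓘(ℝ, ℝ) h z) (hq : z ∈ (ch q).source) :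
    hamField h z = trD q z (hamCoord h q (ch q z)) := by
  rw [hamCoord, (hasFDerivAt_comp_ch_symm hh hq).fderiv]
  exact (trD_sympGrad hq (mfd h z)).symm

theorem poisson_eq {q : M} {h k : Cotangent n M → ℝ} {z : Cotangent n M}
    (hh : MDifferentiableAt (phaseModel n) 𝓘(ℝ, ℝ) h z)
    (hk : MDifferentiableAt (phaseModel n) 𝓘(ℝ, ℝ) k z) (hq : z ∈ (ch q).source) :
    poisson h k z = fderiv ℝ (k ∘ (ch q).symm) (ch q z) (hamCoord h q (ch q z)) := by
  rw [poisson, hamField_eq hh hq]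
  exact mfderiv_trD hk hq _

/-! ### A smooth norm on the fibres and an embedding of the cosphere bundle -/

theorem continuous_base : Continuous (fun z : Cotangent n M => z.1) :=
  FiberBundle.continuous_proj _ _

theorem contMDiffAt_ch {q : M} {z : Cotangent n M} (hz : z ∈ (ch q).source) :
    ContMDiffAt (phaseModel n) 𝓘(ℝ, Phase n) ∞ (ch q) z :=
  (contMDiffOn_ch q).contMDiffAt ((isOpen_ch_source q).mem_nhds hz)

theorem contMDiffAt_ch_symm {q : M} {w : Phase n} (hw : w ∈ (ch (n := n) q).target) :
    ContMDiffAt 𝓘(ℝ, Phase n) (phaseModel n) ∞ (ch (n := n) q).symm w :=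
  (contMDiffOn_ch_symm q).contMDiffAt ((isOpen_ch_target q).mem_nhds hw)

/-- By Riesz the operator norm on covectors is Euclidean, hence smooth away from zero. -/
theorem contDiffAt_dual_norm {p : Base n →L[ℝ] ℝ} (hp : p ≠ 0) :
    ContDiffAt ℝ ∞ (fun p : Base n →L[ℝ] ℝ => ‖p‖) p := by
  have h1 : (fun p : Base n →L[ℝ] ℝ => ‖p‖) =
      fun p => ‖(InnerProductSpace.toDual ℝ (Base n)).symm p‖ := by
    ext p; rw [LinearIsometryEquiv.norm_map]
  rw [h1]
  refine ContDiffAt.norm ℝ ?_ ?_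
  · exact ((InnerProductSpace.toDual ℝ (Base n)).symm.toContinuousLinearEquiv.contDiff).contDiffAt
  · simpa using hp

section Embedding

set_option linter.unusedSectionVars false

variable {ι : Type*} [Fintype ι] [T2Space M] (fs : SmoothBumpCovering ι 𝓘(ℝ, Base n) M)

theorem contMDiff_bump (i : ι) :
    ContMDiff (phaseModel n) 𝓘(ℝ, ℝ) ∞ (fun z : Cotangent n M => fs i z.1) :=
  (fs i).contMDiff.comp (Bundle.contMDiff_proj _)

theorem mem_ch_source_of_tsupport {i : ι} {z : Cotangent n M} (hz : z.1 ∈ tsupport (fs i)) :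
    z ∈ (ch (fs.c i)).source := by
  rw [ch_source]; exact (fs i).tsupport_subset_chartAt_source hz

theorem mem_ch_source_of_bump_ne_zero {i : ι} {z : Cotangent n M} (hz : fs i z.1 ≠ 0) :
    z ∈ (ch (fs.c i)).source :=
  mem_ch_source_of_tsupport fs (subset_tsupport _ hz)

theorem bump_eventually_eq_zero {i : ι} {z : Cotangent n M} (hz : z.1 ∉ tsupport (fs i)) :
    ∀ᶠ w : Cotangent n M in 𝓝 z, fs i w.1 = 0 := by
  have h1 : (tsupport (fs i))ᶜ ∈ 𝓝 z.1 := (isClosed_tsupport _).isOpen_compl.mem_nhds hz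
  filter_upwards [continuous_base.continuousAt h1] with w hw
  exact image_eq_zero_of_notMem_tsupport hw

/-- Off the support of the bump the product vanishes identically nearby, so `g` matters only inside
the chart domain. -/
theorem contMDiffAt_bump_smul {F : Type*} [NormedAddCommGroup F] [NormedSpace ℝ F] {i : ι}
    {g : Cotangent n M → F} {z : Cotangent n M}
    (hg : z ∈ (ch (fs.c i)).source → ContMDiffAt (phaseModel n) 𝓘(ℝ, F) ∞ g z) :
    ContMDiffAt (phaseModel n) 𝓘(ℝ, F) ∞ (fun w => fs i w.1 • g w) z := by
  by_cases hz : z.1 ∈ tsupport (fs i)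
  · exact (contMDiff_bump fs i).contMDiffAt.smul (hg (mem_ch_source_of_tsupport fs hz))
  · refine (contMDiffAt_const (c := (0 : F))).congr_of_eventuallyEq ?_
    filter_upwards [bump_eventually_eq_zero fs hz] with w hw
    rw [hw, zero_smul]

/-- A norm on the fibres of `T*M`, smooth off the zero section. -/
def fibNorm (z : Cotangent n M) : ℝ := ∑ i, fs i z.1 * ‖(ch (fs.c i) z).2‖

theorem fibNorm_nonneg (z : Cotangent n M) : 0 ≤ fibNorm fs z :=
  Finset.sum_nonneg fun i _ => mul_nonneg (fs i).nonneg (norm_nonneg _)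

theorem fibNorm_dilate {s : ℝ} (hs : 0 ≤ s) (z : Cotangent n M) :
    fibNorm fs (dilate s z) = s * fibNorm fs z := by
  unfold fibNorm
  rw [Finset.mul_sum]
  refine Finset.sum_congr rfl fun i _ => ?_
  rw [ch_dilate, dil_apply, norm_smul, Real.norm_of_nonneg hs]
  change fs i z.1 * _ = _
  ring

theorem norm_ch_le_fibNorm {i : ι} {z : Cotangent n M} (hi : fs i z.1 = 1) :
    ‖(ch (fs.c i) z).2‖ ≤ fibNorm fs z := by
  have := Finset.single_le_sum (f := fun i => fs i z.1 * ‖(ch (fs.c i) z).2‖)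
    (fun i _ => mul_nonneg (fs i).nonneg (norm_nonneg _)) (Finset.mem_univ i)
  rwa [hi, one_mul] at this

theorem fibNorm_pos {z : Cotangent n M} (hz : z ∈ punctured n M) : 0 < fibNorm fs z := by
  have hi := fs.apply_ind z.1 (mem_univ _)
  refine lt_of_lt_of_le ?_ (norm_ch_le_fibNorm fs hi)
  rw [norm_pos_iff]
  exact (mem_punctured_iff (mem_ch_source_of_bump_ne_zero fs (by rw [hi]; simp))).1 hz

theorem fibNorm_eq_zero {z : Cotangent n M} (hz : z ∉ punctured n M) : fibNorm fs z = 0 := by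
  have h : z.2 = 0 := not_not.1 hz
  refine Finset.sum_eq_zero fun i _ => ?_
  by_cases h1 : fs i z.1 = 0
  · rw [h1, zero_mul]
  · rw [(ch_snd_eq_zero_iff (mem_ch_source_of_bump_ne_zero fs h1)).2 h, norm_zero, mul_zero]

theorem continuous_fibNorm : Continuous (fibNorm (n := n) fs) := by
  refine continuous_finsetSum _ fun i _ => continuous_iff_continuousAt.2 fun z => ?_
  by_cases hz : z.1 ∈ tsupport (fs i)
  · exact (contMDiff_bump fs i).continuous.continuousAt.mul
      (contMDiffAt_ch (mem_ch_source_of_tsupport fs hz)).continuousAt.snd.norm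
  · refine (continuousAt_const (y := (0 : ℝ))).congr ?_
    filter_upwards [bump_eventually_eq_zero fs hz] with w hw
    rw [hw, zero_mul]

theorem contMDiffAt_fibNorm {z : Cotangent n M} (hz : z ∈ punctured n M) :
    ContMDiffAt (phaseModel n) 𝓘(ℝ, ℝ) ∞ (fibNorm fs) z := by
  refine ContMDiffAt.sum fun i _ => ?_
  refine contMDiffAt_bump_smul fs fun hs => ?_
  have h1 : (ch (fs.c i) z).2 ≠ 0 := (mem_punctured_iff hs).1 hz
  have h2 : ContMDiffAt (phaseModel n) 𝓘(ℝ, Base n →L[ℝ] ℝ) ∞ (fun w => (ch (fs.c i) w).2) z :=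
    (contDiff_snd.contDiffAt.contMDiffAt).comp z (contMDiffAt_ch hs)
  exact (contDiffAt_dual_norm h1).contMDiffAt.comp z h2

/-- Over a point where the i-th bump equals 1, the i-th fibre coordinate has norm at most `fibNorm`.
The unit cosphere bundle is therefore closed in a finite union of compact products. -/
theorem isCompact_fibNorm_eq_one [CompactSpace M] :
    IsCompact {z : Cotangent n M | fibNorm fs z = 1} := by
  refine (isCompact_iUnion (f := fun i : ι => (ch (n := n) (fs.c i)).symm ''
    ((extChartAt 𝓘(ℝ, Base n) (fs.c i) '' tsupport (fs i)) ×ˢ Metric.closedBall 0 1))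
    fun i => ?_).of_isClosed_subset (isClosed_eq (continuous_fibNorm fs) continuous_const) ?_
  · refine IsCompact.image_of_continuousOn ?_ ?_
    · refine IsCompact.prod ?_ (isCompact_closedBall _ _)
      refine (fs i).hasCompactSupport.isCompact.image_of_continuousOn ?_
      exact (continuousOn_extChartAt _).mono (fs i).tsupport_subset_extChartAt_source
    · refine (contMDiffOn_ch_symm (n := n) (fs.c i)).continuousOn.mono ?_
      rw [ch_target]
      refine prod_mono ?_ (subset_univ _)
      rintro _ ⟨x, hx, rfl⟩
      exact (extChartAt _ _).map_source ((fs i).tsupport_subset_extChartAt_source hx)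
  · intro z hz
    have hi := fs.apply_ind z.1 (mem_univ _)
    set i := fs.ind z.1 (mem_univ _)
    have hs : z ∈ (ch (fs.c i)).source := mem_ch_source_of_bump_ne_zero fs (by rw [hi]; simp)
    refine mem_iUnion.2 ⟨i, ch (fs.c i) z, ⟨?_, ?_⟩, (ch (fs.c i)).left_inv hs⟩
    · rw [ch_apply]
      exact mem_image_of_mem _ (subset_tsupport _ (by rw [Function.mem_support, hi]; simp))
    · rw [mem_closedBall_zero_iff, ← (show fibNorm fs z = 1 from hz)]
      exact norm_ch_le_fibNorm fs hi

/-- The point of the unit cosphere bundle on the half-line of `z`. -/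
def unit (z : Cotangent n M) : Cotangent n M := dilate (fibNorm fs z)⁻¹ z

theorem dilate_fibNorm_unit {z : Cotangent n M} (hz : z ∈ punctured n M) :
    dilate (fibNorm fs z) (unit fs z) = z := by
  rw [unit, dilate_dilate, mul_inv_cancel₀ (fibNorm_pos fs hz).ne', dilate_one]

theorem fibNorm_unit {z : Cotangent n M} (hz : z ∈ punctured n M) : fibNorm fs (unit fs z) = 1 := by
  rw [unit, fibNorm_dilate fs (inv_nonneg.2 (fibNorm_nonneg fs z)),
    inv_mul_cancel₀ (fibNorm_pos fs hz).ne']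

theorem unit_dilate {s : ℝ} (hs : 0 < s) (z : Cotangent n M) :
    unit fs (dilate s z) = unit fs z := by
  rw [unit, unit, fibNorm_dilate fs hs.le, dilate_dilate, mul_inv_rev, mul_assoc,
    inv_mul_cancel₀ hs.ne', mul_one]

theorem contMDiffAt_unit {z : Cotangent n M} (hz : z ∈ punctured n M) :
    ContMDiffAt (phaseModel n) (phaseModel n) ∞ (unit fs) z := by
  have h1 : ContMDiffAt (phaseModel n) 𝓘(ℝ, ℝ) ∞ (fun w => (fibNorm fs w)⁻¹) z :=
    (contMDiffAt_fibNorm fs hz).inv₀ (fibNorm_pos fs hz).ne'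
  exact contMDiff_dilate.contMDiffAt.comp z (h1.prodMk contMDiffAt_id)

/-- The ambient vector space of the embedded cosphere bundle. -/
abbrev Ambient (n : ℕ) (ι : Type*) : Type _ := ι → Phase n × ℝ

instance instNormedAddCommGroupAmbient (n : ℕ) (ι : Type*) [Fintype ι] :
    NormedAddCommGroup (Ambient n ι) := Pi.normedAddCommGroup

instance instNormedSpaceAmbient (n : ℕ) (ι : Type*) [Fintype ι] : NormedSpace ℝ (Ambient n ι) :=
  Pi.normedSpace

instance instNormedSpaceAmbientProd (n : ℕ) (ι : Type*) [Fintype ι] :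
    NormedSpace ℝ (Ambient n ι × ℝ) := Prod.normedSpace

/-- A map on `T*M ∖ 0`, homogeneous of degree `0`, that embeds the cosphere bundle. -/
def emb (z : Cotangent n M) : Ambient n ι :=
  fun i => (fs i z.1 • ch (fs.c i) (unit fs z), fs i z.1)

theorem emb_dilate {s : ℝ} (hs : 0 < s) (z : Cotangent n M) :
    emb fs (dilate s z) = emb fs z := by
  unfold emb
  rw [unit_dilate fs hs]
  rfl

theorem contMDiffAt_emb {z : Cotangent n M} (hz : z ∈ punctured n M) :
    ContMDiffAt (phaseModel n) 𝓘(ℝ, Ambient n ι) ∞ (emb fs) z := by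
  refine contMDiffAt_pi_space.2 fun i => ContMDiffAt.prodMk_space ?_ ?_
  · refine contMDiffAt_bump_smul fs fun hs => ?_
    refine ContMDiffAt.comp z (contMDiffAt_ch ?_) (contMDiffAt_unit fs hz)
    exact (dilate_mem_ch_source _).2 hs
  · exact (contMDiff_bump fs i).contMDiffAt

/-- A local left inverse of the embedding. -/
def embInv (i : ι) (ξ : Ambient n ι) : Cotangent n M :=
  (ch (fs.c i)).symm ((ξ i).2⁻¹ • (ξ i).1)

theorem ch_unit_mem_target {i : ι} {z : Cotangent n M} (hi : fs i z.1 ≠ 0) :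
    ch (fs.c i) (unit fs z) ∈ (ch (n := n) (fs.c i)).target :=
  (ch (fs.c i)).map_source ((dilate_mem_ch_source _).2 (mem_ch_source_of_bump_ne_zero fs hi))

theorem emb_inv_smul {i : ι} {z : Cotangent n M} (hi : fs i z.1 ≠ 0) :
    (emb fs z i).2⁻¹ • (emb fs z i).1 = ch (fs.c i) (unit fs z) := by
  simp [emb, smul_smul, inv_mul_cancel₀ hi]

theorem embInv_emb {i : ι} {z : Cotangent n M} (hi : fs i z.1 ≠ 0) :
    embInv fs i (emb fs z) = unit fs z := by
  rw [embInv, emb_inv_smul fs hi]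
  exact (ch (fs.c i)).left_inv ((dilate_mem_ch_source _).2 (mem_ch_source_of_bump_ne_zero fs hi))

theorem contMDiffAt_embInv {i : ι} {ξ : Ambient n ι} (h0 : (ξ i).2 ≠ 0)
    (h1 : (ξ i).2⁻¹ • (ξ i).1 ∈ (ch (n := n) (fs.c i)).target) :
    ContMDiffAt 𝓘(ℝ, Ambient n ι) (phaseModel n) ∞ (embInv fs i) ξ := by
  have h2 : ContDiffAt ℝ ∞ (fun ξ : Ambient n ι => (ξ i).2⁻¹ • (ξ i).1) ξ :=
    ((contDiff_snd.comp (contDiff_apply ℝ _ i)).contDiffAt.inv h0).smul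
      (contDiff_fst.comp (contDiff_apply ℝ _ i)).contDiffAt
  exact (contMDiffAt_ch_symm h1).comp ξ h2.contMDiffAt

/-- The bump values are themselves components of `emb`, so both points are seen by the same chart,
in which the remaining components determine the unit covector. -/
theorem unit_eq_of_emb_eq {z w : Cotangent n M} (h : emb fs z = emb fs w) :
    unit fs z = unit fs w := by
  have hi := fs.apply_ind z.1 (mem_univ _)
  set i := fs.ind z.1 (mem_univ _)
  have h1 : fs i w.1 = 1 := by
    rw [← hi]; exact (congrArg (fun ξ : Ambient n ι => (ξ i).2) h).symm
  rw [← embInv_emb fs (i := i) (by rw [hi]; simp), h, embInv_emb fs (by rw [h1]; simp)]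

theorem exists_dilate_of_emb_eq {z w : Cotangent n M} (hz : z ∈ punctured n M)
    (hw : w ∈ punctured n M) (h : emb fs z = emb fs w) : ∃ s : ℝ, 0 < s ∧ w = dilate s z := by
  refine ⟨fibNorm fs w * (fibNorm fs z)⁻¹,
    mul_pos (fibNorm_pos fs hw) (inv_pos.2 (fibNorm_pos fs hz)), ?_⟩
  rw [← dilate_dilate]
  change w = dilate (fibNorm fs w) (unit fs z)
  rw [unit_eq_of_emb_eq fs h, dilate_fibNorm_unit fs hw]

/-- Vector-valued version of `SmoothOnSubset`. -/
def LocSmooth {F : Type*} [NormedAddCommGroup F] [NormedSpace ℝ F] (C : Set (Cotangent n M))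
    (k : Cotangent n M → F) : Prop :=
  ∀ z ∈ C, ∃ (U : Set (Cotangent n M)) (k' : Cotangent n M → F), IsOpen U ∧ z ∈ U ∧
    ContMDiffOn (phaseModel n) 𝓘(ℝ, F) ∞ k' U ∧ EqOn k' k (U ∩ C)

/-- Functions of degree `0` on a closed cone extend to the ambient space of the embedding. -/
theorem exists_ambient_extension {F : Type*} [NormedAddCommGroup F] [NormedSpace ℝ F]
    {C : Set (Cotangent n M)} (hC : C ⊆ punctured n M)
    (hcone : ∀ s : ℝ, 0 < s → ∀ z ∈ C, dilate s z ∈ C) (hclosed : IsClosed (emb fs '' C))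
    {B : Cotangent n M → F} (hB : LocSmooth C B)
    (hhom : ∀ s : ℝ, 0 < s → ∀ z ∈ C, B (dilate s z) = B z) :
    ∃ g : Ambient n ι → F, ContDiff ℝ ∞ g ∧ ∀ z ∈ C, g (emb fs z) = B z := by
  have hunit : ∀ z ∈ C, unit fs z ∈ C := fun z hz => hcone _ (inv_pos.2 (fibNorm_pos fs (hC hz))) z hz
  have hBunit : ∀ z ∈ C, B (unit fs z) = B z :=
    fun z hz => hhom _ (inv_pos.2 (fibNorm_pos fs (hC hz))) z hz
  -- Prescribing the value on the image of C, and nothing elsewhere, is a convex condition, so local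
  -- smooth solutions are glued by a partition of unity.
  suffices h : ∃ g : C^((⊤ : ℕ∞))⟮𝓘(ℝ, Ambient n ι), Ambient n ι; 𝓘(ℝ, F), F⟯,
      ∀ ξ, g ξ ∈ {v : F | ∀ z ∈ C, emb fs z = ξ → v = B z} by
    obtain ⟨g, hg⟩ := h
    exact ⟨g, g.contMDiff.contDiff, fun z hz => hg _ z hz rfl⟩
  refine exists_contMDiffMap_forall_mem_convex_of_local _ ?_ ?_
  · intro ξ u hu v hv a b _ _ hab z hz hzξ
    rw [hu z hz hzξ, hv z hz hzξ, ← add_smul, hab, one_smul]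
  · intro ξ
    by_cases hξ : ξ ∈ emb fs '' C
    -- Near a point of the image, a local extension of `B` around the unit covector is composed with
    -- the local inverse `embInv`.
    · obtain ⟨z₀, hz₀, rfl⟩ := hξ
      obtain ⟨U, B', hU, hzU, hB', hEq⟩ := hB _ (hunit z₀ hz₀)
      have hi := fs.apply_ind z₀.1 (mem_univ _)
      set i := fs.ind z₀.1 (mem_univ _)
      have hi0 : fs i z₀.1 ≠ 0 := by rw [hi]; simp
      have h0 : (emb fs z₀ i).2 ≠ 0 := hi0
      have h1 : (emb fs z₀ i).2⁻¹ • (emb fs z₀ i).1 ∈ (ch (n := n) (fs.c i)).target := by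
        rw [emb_inv_smul fs hi0]; exact ch_unit_mem_target fs hi0
      have k2 : Continuous (fun ξ : Ambient n ι => (ξ i).2) :=
        continuous_snd.comp (continuous_apply i)
      have c1 : ContinuousAt (fun ξ : Ambient n ι => (ξ i).2⁻¹ • (ξ i).1) (emb fs z₀) :=
        (k2.continuousAt.inv₀ h0).smul (continuous_fst.comp (continuous_apply i)).continuousAt
      have c2 := (contMDiffAt_embInv fs h0 h1).continuousAt
      have e0 : ∀ᶠ ξ : Ambient n ι in 𝓝 (emb fs z₀), (ξ i).2 ≠ 0 :=
        k2.continuousAt.eventually_ne h0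
      have e1 : ∀ᶠ ξ : Ambient n ι in 𝓝 (emb fs z₀),
          (ξ i).2⁻¹ • (ξ i).1 ∈ (ch (n := n) (fs.c i)).target := c1 ((isOpen_ch_target (n := n) (fs.c i)).mem_nhds h1)
      have e2 : ∀ᶠ ξ in 𝓝 (emb fs z₀), embInv fs i ξ ∈ U :=
        c2 (hU.mem_nhds (by rw [embInv_emb fs hi0]; exact hzU))
      refine ⟨_, (e0.and (e1.and e2)), fun ξ => B' (embInv fs i ξ), ?_, ?_⟩
      · rintro ξ ⟨a0, a1, a2⟩
        refine ContMDiffAt.contMDiffWithinAt ?_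
        exact (hB'.contMDiffAt (hU.mem_nhds a2)).comp ξ (contMDiffAt_embInv fs a0 a1)
      · rintro ξ ⟨a0, a1, a2⟩ z hz rfl
        have hz0 : fs i z.1 ≠ 0 := a0
        rw [embInv_emb fs hz0] at a2
        change B' (embInv fs i (emb fs z)) = B z
        rw [embInv_emb fs hz0, ← hBunit z hz]
        exact hEq ⟨a2, hunit z hz⟩
    · refine ⟨_, hclosed.isOpen_compl.mem_nhds hξ, fun _ => 0, contMDiffOn_const, ?_⟩
      intro y hy z hz hzy
      exact absurd ⟨z, hz, hzy⟩ hy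

end Embedding

/-! ### Derivative of the determinant and the divergence of a Hamiltonian field -/

section Divergence

set_option linter.unusedSectionVars false

variable {Q P : Type*} [NormedAddCommGroup Q] [NormedSpace ℝ Q] [FiniteDimensional ℝ Q]
  [NormedAddCommGroup P] [NormedSpace ℝ P] [FiniteDimensional ℝ P]

theorem contDiff_clm_det : ContDiff ℝ ∞ (fun A : Q →L[ℝ] Q => A.det) := by
  let b := Module.finBasis ℝ Q
  have h1 : (fun A : Q →L[ℝ] Q => A.det) = fun A => ∑ σ : Equiv.Perm (Fin (Module.finrank ℝ Q)),
      ((Equiv.Perm.sign σ : ℤ) : ℝ) *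
        ∏ i, (LinearMap.toContinuousLinearMap (b.coord (σ i))) (A (b i)) := by
    ext A
    rw [ContinuousLinearMap.det, ← LinearMap.det_toMatrix b, Matrix.det_apply']
    simp [LinearMap.toMatrix_apply]
  rw [h1]
  refine ContDiff.sum fun σ _ => contDiff_const.mul (contDiff_prod fun i _ => ?_)
  exact (ContinuousLinearMap.contDiff _).comp (contDiff_id.clm_apply contDiff_const)

theorem fderiv_clm_det_id (H : Q →L[ℝ] Q) :
    fderiv ℝ (fun A : Q →L[ℝ] Q => A.det) (ContinuousLinearMap.id ℝ Q) H =
      LinearMap.trace ℝ Q H := by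
  let b := Module.finBasis ℝ Q
  let m := LinearMap.toMatrix b b (H : Q →ₗ[ℝ] Q)
  -- det(1 + tH) is a polynomial in t whose linear coefficient is the trace of H.
  let p : Polynomial ℝ := Matrix.det (1 + (Polynomial.X : Polynomial ℝ) • m.map Polynomial.C)
  have h1 : ∀ t : ℝ, (ContinuousLinearMap.id ℝ Q + t • H).det = p.eval t := by
    intro t
    rw [ContinuousLinearMap.det, ← LinearMap.det_toMatrix b, ← Polynomial.coe_evalRingHom,
      RingHom.map_det]
    congr 1
    ext i j
    simp [LinearMap.toMatrix_apply, m, Matrix.one_apply, Finsupp.single_apply, eq_comm]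
    split_ifs <;> simp [mul_comm]
  have h2 : HasDerivAt (fun t : ℝ => (ContinuousLinearMap.id ℝ Q + t • H).det)
      (LinearMap.trace ℝ Q H) 0 := by
    simp only [h1]
    have := p.hasDerivAt 0
    rwa [Matrix.derivative_det_one_add_X_smul, ← LinearMap.trace_eq_matrix_trace] at this
  have h3 : HasDerivAt (fun t : ℝ => ContinuousLinearMap.id ℝ Q + t • H) H 0 := by
    simpa using ((hasDerivAt_id (0 : ℝ)).smul_const H).const_add (ContinuousLinearMap.id ℝ Q)
  have h4 : HasFDerivAt (fun A : Q →L[ℝ] Q => A.det)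
      (fderiv ℝ (fun A : Q →L[ℝ] Q => A.det) (ContinuousLinearMap.id ℝ Q))
      (ContinuousLinearMap.id ℝ Q + (0 : ℝ) • H) := by
    rw [zero_smul, add_zero]
    exact (contDiff_clm_det.differentiable (by simp) _).hasFDerivAt
  have h5 := h4.comp_hasDerivAt 0 h3
  exact h5.unique h2

/-- Jacobi's formula. -/
theorem fderiv_clm_det (B : Q ≃L[ℝ] Q) (H : Q →L[ℝ] Q) :
    fderiv ℝ (fun A : Q →L[ℝ] Q => A.det) (B : Q →L[ℝ] Q) H =
      (B : Q →L[ℝ] Q).det * LinearMap.trace ℝ Q ((B.symm : Q →L[ℝ] Q).comp H) := by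
  have h1 : (fun A : Q →L[ℝ] Q => A.det) =
      fun A => (B : Q →L[ℝ] Q).det * ((B.symm : Q →L[ℝ] Q).comp A).det := by
    ext A
    rw [ContinuousLinearMap.det, ContinuousLinearMap.det, ContinuousLinearMap.det,
      ← LinearMap.det_comp, ← ContinuousLinearMap.toLinearMap_comp,
      ← ContinuousLinearMap.comp_assoc]
    simp
  have h2 : HasFDerivAt (fun A : Q →L[ℝ] Q => (B.symm : Q →L[ℝ] Q).comp A)
      (ContinuousLinearMap.compL ℝ Q Q Q (B.symm : Q →L[ℝ] Q)) (B : Q →L[ℝ] Q) :=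
    (ContinuousLinearMap.compL ℝ Q Q Q (B.symm : Q →L[ℝ] Q)).hasFDerivAt
  have h3 : HasFDerivAt (fun A : Q →L[ℝ] Q => A.det)
      (fderiv ℝ (fun A : Q →L[ℝ] Q => A.det) (ContinuousLinearMap.id ℝ Q))
      ((B.symm : Q →L[ℝ] Q).comp (B : Q →L[ℝ] Q)) := by
    rw [ContinuousLinearEquiv.coe_symm_comp_coe]
    exact (contDiff_clm_det.differentiable (by simp) _).hasFDerivAt
  have h4 := (h3.comp (B : Q →L[ℝ] Q) h2).const_mul (B : Q →L[ℝ] Q).det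
  conv_lhs => rw [h1]
  have h5 := h4.fderiv
  simp only [Function.comp_def] at h5
  rw [h5]
  simp [fderiv_clm_det_id]

/-- The linear map `(r, s, v) ↦ r ν + s ρ + S v`. -/
def frame {V : Type*} [NormedAddCommGroup V] [NormedSpace ℝ V] (ν ρ : P) (S : V →L[ℝ] P) :
    ℝ × ℝ × V →L[ℝ] P :=
  (ContinuousLinearMap.fst ℝ ℝ (ℝ × V)).smulRight ν +
    (((ContinuousLinearMap.fst ℝ ℝ V).comp (ContinuousLinearMap.snd ℝ ℝ (ℝ × V))).smulRight ρ +
      (S.comp (ContinuousLinearMap.snd ℝ ℝ V)).comp (ContinuousLinearMap.snd ℝ ℝ (ℝ × V)))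

@[simp] theorem frame_apply {V : Type*} [NormedAddCommGroup V] [NormedSpace ℝ V] (ν ρ : P)
    (S : V →L[ℝ] P) (x : ℝ × ℝ × V) : frame ν ρ S x = x.1 • ν + (x.2.1 • ρ + S x.2.2) := rfl

variable {V : Type*} [NormedAddCommGroup V] [NormedSpace ℝ V] [FiniteDimensional ℝ V]

/-- Trace computation behind the divergence formula. -/
theorem trace_frame_derivative (A : (ℝ × ℝ × V) ≃L[ℝ] P) {ν ρ : P} {S : V →L[ℝ] P}
    (hA : (A : ℝ × ℝ × V →L[ℝ] P) = frame ν ρ S)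
    {S2b : V →L[ℝ] P} {DX Pi : P →L[ℝ] P} {a : ℝ} {b : V} {a' : V →L[ℝ] ℝ} {b' : V →L[ℝ] V}
    {β : P →L[ℝ] ℝ} {x : P} {m : ℝ}
    (hx : S b + a • ρ = x) (hPi : Pi ρ = ρ) (hDXρ : DX ρ = -x + Pi x)
    (hderiv : ∀ v, S2b v + S (b' v) + (a' v • ρ + a • Pi (S v)) = DX (S v))
    (hβρ : β ρ = 0) (hβS : ∀ v, β (S v) = 0) (hβν : β ν ≠ 0)
    (htrX : LinearMap.trace ℝ P DX = 0) (htrP : LinearMap.trace ℝ P Pi = m) :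
    LinearMap.trace ℝ (ℝ × ℝ × V) ((A.symm : P →L[ℝ] ℝ × ℝ × V).comp (frame 0 (Pi (S b)) S2b)) =
      -(m - 1) * a - LinearMap.trace ℝ V b' - (β (DX ν) - a * β (Pi ν)) / β ν := by
  have hAa : ∀ y, A y = y.1 • ν + (y.2.1 • ρ + S y.2.2) := fun y => by
    have := DFunLike.congr_fun hA y
    simpa using this
  -- β annihilates ρ and the range of S, so it reads off the ν-coordinate up to the factor β ν.
  have hfst : ∀ p, (A.symm p).1 = β p / β ν := by
    intro p
    obtain ⟨y, rfl⟩ := A.surjective p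
    rw [A.symm_apply_apply, hAa]
    simp [hβρ, hβS, hβν]
  set N1 : ℝ × ℝ × V →L[ℝ] ℝ × ℝ × V :=
    (ContinuousLinearMap.fst ℝ ℝ (ℝ × V)).smulRight (A.symm (DX ν - a • Pi ν)) with hN1
  set N2 : ℝ × ℝ × V →L[ℝ] ℝ × ℝ × V :=
    ((ContinuousLinearMap.fst ℝ ℝ V).comp (ContinuousLinearMap.snd ℝ ℝ (ℝ × V))).smulRight
      ((0, a, b) : ℝ × ℝ × V) with hN2
  set J : V →L[ℝ] ℝ × ℝ × V := (0 : V →L[ℝ] ℝ).prod (a'.prod b') with hJ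
  set pr : ℝ × ℝ × V →L[ℝ] V :=
    (ContinuousLinearMap.snd ℝ ℝ V).comp (ContinuousLinearMap.snd ℝ ℝ (ℝ × V)) with hpr
  -- The derivative of the frame in the direction b agrees with (DX - aΠ) ∘ A up to three
  -- corrections: `N1` removes the column of ν, which is constant; `N2` repairs the column of ρ,
  -- where `hDXρ` encodes that X has degree -1; and `J.comp pr` accounts for the variation of the
  -- components a and b. The traces are -am, the ν-term, a and tr b'.
  have key : (A.symm : P →L[ℝ] ℝ × ℝ × V).comp (frame 0 (Pi (S b)) S2b) =
      ((A.symm : P →L[ℝ] ℝ × ℝ × V).comp ((DX - a • Pi).comp (A : ℝ × ℝ × V →L[ℝ] P))) - N1 + N2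
        - J.comp pr := by
    refine ContinuousLinearMap.ext fun y => ?_
    apply A.injective
    have e1 : A (N1 y) = y.1 • (DX ν - a • Pi ν) := by
      simp [hN1]
    have e2 : A (N2 y) = y.2.1 • (a • ρ + S b) := by
      have : N2 y = y.2.1 • ((0, a, b) : ℝ × ℝ × V) := rfl
      rw [this, map_smul, hAa]; simp
    have e3 : A (J (pr y)) = a' y.2.2 • ρ + S (b' y.2.2) := by
      rw [hAa]; simp [hJ, hpr]
    have h1 := hderiv y.2.2
    simp only [ContinuousLinearMap.comp_apply, ContinuousLinearEquiv.coe_coe, sub_apply,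
      add_apply, map_sub, map_add, A.apply_symm_apply, e1, e2, e3, frame_apply, smul_zero, zero_add]
    rw [hAa]
    simp only [map_add, map_smul, smul_apply]
    rw [hDXρ, hPi, ← h1, ← hx]
    simp only [map_add, map_smul, hPi]
    module
  rw [key]
  have t1 : LinearMap.trace ℝ (ℝ × ℝ × V) ((A.symm : P →L[ℝ] ℝ × ℝ × V).comp
      ((DX - a • Pi).comp (A : ℝ × ℝ × V →L[ℝ] P)) : ℝ × ℝ × V →L[ℝ] ℝ × ℝ × V) = -a * m := by
    rw [ContinuousLinearMap.toLinearMap_comp, LinearMap.trace_comp_comm',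
      ← ContinuousLinearMap.toLinearMap_comp, ContinuousLinearMap.comp_assoc,
      ContinuousLinearEquiv.coe_comp_coe_symm, ContinuousLinearMap.comp_id,
      ContinuousLinearMap.toLinearMap_sub, ContinuousLinearMap.toLinearMap_smul, map_sub, map_smul,
      htrX, htrP]
    simp
  have t2 : LinearMap.trace ℝ (ℝ × ℝ × V) (N1 : ℝ × ℝ × V →ₗ[ℝ] ℝ × ℝ × V) =
      (β (DX ν) - a * β (Pi ν)) / β ν := by
    have : (N1 : ℝ × ℝ × V →ₗ[ℝ] ℝ × ℝ × V) =
        (LinearMap.fst ℝ ℝ (ℝ × V)).smulRight (A.symm (DX ν - a • Pi ν)) := rfl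
    rw [this, LinearMap.trace_smulRight, LinearMap.fst_apply, hfst]
    simp
  have t3 : LinearMap.trace ℝ (ℝ × ℝ × V) (N2 : ℝ × ℝ × V →ₗ[ℝ] ℝ × ℝ × V) = a := by
    have : (N2 : ℝ × ℝ × V →ₗ[ℝ] ℝ × ℝ × V) =
        ((LinearMap.fst ℝ ℝ V).comp (LinearMap.snd ℝ ℝ (ℝ × V))).smulRight
          ((0, a, b) : ℝ × ℝ × V) := rfl
    rw [this, LinearMap.trace_smulRight]
    simp
  have t4 : LinearMap.trace ℝ (ℝ × ℝ × V) (J.comp pr : ℝ × ℝ × V →L[ℝ] ℝ × ℝ × V) =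
      LinearMap.trace ℝ V b' := by
    rw [ContinuousLinearMap.toLinearMap_comp, LinearMap.trace_comp_comm',
      ← ContinuousLinearMap.toLinearMap_comp]
    congr 1
  rw [ContinuousLinearMap.toLinearMap_sub, ContinuousLinearMap.toLinearMap_add,
    ContinuousLinearMap.toLinearMap_sub, map_sub, map_add, map_sub, t1, t2, t3, t4]
  ring

/-- The part of `frame` that is linear in `(ρ, S)`. -/
def frameLin : P × (V →L[ℝ] P) →L[ℝ] (ℝ × ℝ × V →L[ℝ] P) :=
  LinearMap.toContinuousLinearMap
    { toFun := fun x => frame 0 x.1 x.2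
      map_add' := fun x y => by
        refine ContinuousLinearMap.ext fun v => ?_
        simp only [frame_apply, add_apply, Prod.fst_add, Prod.snd_add]
        module
      map_smul' := fun c x => by
        refine ContinuousLinearMap.ext fun v => ?_
        simp only [frame_apply, smul_apply, Prod.smul_fst, Prod.smul_snd, RingHom.id_apply]
        module }

theorem frameLin_apply (x : P × (V →L[ℝ] P)) : frameLin x = frame 0 x.1 x.2 := rfl

theorem frame_eq (ν ρ : P) (S : V →L[ℝ] P) : frame ν ρ S = frame ν 0 0 + frameLin (ρ, S) := by
  refine ContinuousLinearMap.ext fun v => ?_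
  simp [frameLin_apply]

/-- The density `|det (ν, ρ, S)| / |β ν|`, the determinant being taken after `e⁻¹`. -/
def frameDensity (e : (ℝ × ℝ × V) ≃L[ℝ] P) (β : P →L[ℝ] ℝ) (ν ρ : P) (S : V →L[ℝ] P) : ℝ :=
  |((e.symm : P →L[ℝ] ℝ × ℝ × V).comp (frame ν ρ S)).det| / |β ν|

theorem frame_injective {β : P →L[ℝ] ℝ} {ν ρ : P} {S : V →L[ℝ] P} (hβρ : β ρ = 0)
    (hβS : ∀ v, β (S v) = 0) (hβν : β ν ≠ 0) (hρ : ρ ≠ 0) (hS : ∀ (v : V) (c : ℝ), S v = c • ρ → v = 0) :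
    Function.Injective (frame ν ρ S) := by
  refine (injective_iff_map_eq_zero _).2 fun x hx => ?_
  rw [frame_apply] at hx
  have h1 := congrArg β hx
  simp only [map_add, map_smul, smul_eq_mul, hβρ, hβS, mul_zero, add_zero, map_zero,
    mul_eq_zero, hβν, or_false] at h1
  rw [h1, zero_smul, zero_add] at hx
  have h2 : x.2.2 = 0 := hS _ (-x.2.1) (by rw [neg_smul]; exact eq_neg_of_add_eq_zero_right hx)
  rw [h2, map_zero, add_zero, smul_eq_zero] at hx
  exact Prod.ext h1 (Prod.ext (hx.resolve_right hρ) h2)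

/-- An injective frame, as an equivalence. -/
theorem exists_frame_equiv (e : (ℝ × ℝ × V) ≃L[ℝ] P) {A : ℝ × ℝ × V →L[ℝ] P}
    (hA : Function.Injective A) : ∃ A' : (ℝ × ℝ × V) ≃L[ℝ] P, (A' : ℝ × ℝ × V →L[ℝ] P) = A := by
  let f : ℝ × ℝ × V →ₗ[ℝ] ℝ × ℝ × V := ((e.symm : P →L[ℝ] ℝ × ℝ × V).comp A : _ →L[ℝ] _)
  have hf : Function.Injective f := e.symm.injective.comp hA
  refine ⟨(LinearEquiv.ofInjectiveEndo f hf).toContinuousLinearEquiv.trans e, ?_⟩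
  refine ContinuousLinearMap.ext fun v => ?_
  change e (e.symm (A v)) = A v
  simp

theorem frame_det_ne_zero (e : (ℝ × ℝ × V) ≃L[ℝ] P) {A : ℝ × ℝ × V →L[ℝ] P}
    (hA : Function.Injective A) : ((e.symm : P →L[ℝ] ℝ × ℝ × V).comp A).det ≠ 0 := by
  obtain ⟨A', rfl⟩ := exists_frame_equiv e hA
  exact (LinearEquiv.isUnit_det' (A'.trans e.symm).toLinearEquiv).ne_zero

/-- Divergence of a field on a section of a cone, in terms of a divergence-free field on the
ambient space. -/
theorem fderiv_frameDensity (e : (ℝ × ℝ × V) ≃L[ℝ] P) {σ : V → P} {S : V → V →L[ℝ] P}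
    {S2 : V →L[ℝ] V →L[ℝ] P} {X : P → P} {Pi DX : P →L[ℝ] P} {β : P → P →L[ℝ] ℝ}
    {β2 : P →L[ℝ] P →L[ℝ] ℝ} {a : V → ℝ} {a' : V →L[ℝ] ℝ} {b : V → V} {b' : V →L[ℝ] V} {θ : V}
    {ν : P} {m : ℝ}
    (hσ : HasFDerivAt σ (S θ) θ) (hS : HasFDerivAt S S2 θ) (hS2 : ∀ u v, S2 u v = S2 v u)
    (hX : HasFDerivAt X DX (σ θ)) (hβ : HasFDerivAt β β2 (σ θ)) (hβ2 : ∀ u v, β2 u v = β2 v u)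
    (ha : HasFDerivAt a a' θ) (hb : HasFDerivAt b b' θ)
    (hdec : ∀ᶠ η in 𝓝 θ, S η (b η) + a η • Pi (σ η) = X (σ η))
    (hβX : ∀ᶠ w in 𝓝 (σ θ), β w (X w) = 0) (hβP : ∀ᶠ w in 𝓝 (σ θ), β w (Pi w) = 0)
    (hβS : ∀ v, β (σ θ) (S θ v) = 0) (hβν : β (σ θ) ν ≠ 0) (hPi : ∀ w, Pi (Pi w) = Pi w)
    (hDX : DX (Pi (σ θ)) = -X (σ θ) + Pi (X (σ θ)))
    (htrX : LinearMap.trace ℝ P DX = 0) (htrP : LinearMap.trace ℝ P Pi = m)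
    (hinj : Function.Injective (frame ν (Pi (σ θ)) (S θ))) :
    DifferentiableAt ℝ (fun η => frameDensity e (β (σ η)) ν (Pi (σ η)) (S η)) θ ∧
      fderiv ℝ (fun η => frameDensity e (β (σ η)) ν (Pi (σ η)) (S η)) θ (b θ) =
        frameDensity e (β (σ θ)) ν (Pi (σ θ)) (S θ) *
          (-(m - 1) * a θ - LinearMap.trace ℝ V b') := by
  obtain ⟨A, hA⟩ := exists_frame_equiv e hinj
  set E' : P →L[ℝ] ℝ × ℝ × V := (e.symm : P →L[ℝ] ℝ × ℝ × V) with hE'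
  set F : V → (ℝ × ℝ × V →L[ℝ] ℝ × ℝ × V) := fun η => E'.comp (frame ν (Pi (σ η)) (S η)) with hF
  have hPσ : HasFDerivAt (fun η => Pi (σ η)) (Pi.comp (S θ)) θ := Pi.hasFDerivAt.comp θ hσ
  have hF' : HasFDerivAt F ((ContinuousLinearMap.compL ℝ (ℝ × ℝ × V) P (ℝ × ℝ × V) E').comp
      ((frameLin (P := P) (V := V)).comp ((Pi.comp (S θ)).prod S2))) θ := by
    have h1 : HasFDerivAt (fun η => frame ν (Pi (σ η)) (S η))
        ((frameLin (P := P) (V := V)).comp ((Pi.comp (S θ)).prod S2)) θ := by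
      simp only [frame_eq ν (Pi _)]
      exact ((frameLin (P := P) (V := V)).hasFDerivAt.comp θ (hPσ.prodMk hS)).const_add _
    exact (ContinuousLinearMap.compL ℝ (ℝ × ℝ × V) P (ℝ × ℝ × V) E').hasFDerivAt.comp θ h1
  have hFθ : F θ = ((A.trans e.symm : (ℝ × ℝ × V) ≃L[ℝ] (ℝ × ℝ × V)) :
      (ℝ × ℝ × V) →L[ℝ] (ℝ × ℝ × V)) := by
    simp only [hF]; rw [← hA]; rfl
  have hd0 : (F θ).det ≠ 0 := frame_det_ne_zero e hinj
  have hdet : HasFDerivAt (fun η => (F η).det) _ θ :=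
    ((contDiff_clm_det (Q := ℝ × ℝ × V)).differentiable (by simp) (F θ)).hasFDerivAt.comp θ hF'
  have hβσ : HasFDerivAt (fun η => β (σ η) ν)
      ((ContinuousLinearMap.apply ℝ ℝ ν).comp (β2.comp (S θ))) θ :=
    (ContinuousLinearMap.apply ℝ ℝ ν).hasFDerivAt.comp θ (hβ.comp θ hσ)
  -- Neither the determinant nor β ν vanishes at θ, so their signs are locally constant and the
  -- absolute values become one constant factor.
  obtain ⟨c, hc⟩ : ∃ c : ℝ, (fun η => frameDensity e (β (σ η)) ν (Pi (σ η)) (S η)) =ᶠ[𝓝 θ]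
      fun η => c * ((F η).det * (β (σ η) ν)⁻¹) := by
    refine ⟨SignType.sign (F θ).det * SignType.sign (β (σ θ) ν), ?_⟩
    have hsign : ∀ {f : V → ℝ}, ContinuousAt f θ → f θ ≠ 0 →
        ∀ᶠ η in 𝓝 θ, |f η| = SignType.sign (f θ) * f η := by
      intro f hf h0
      rcases lt_or_gt_of_ne h0 with h | h
      · filter_upwards [hf.eventually_lt continuousAt_const h] with η hη
        rw [abs_of_neg hη, sign_neg h]; simp
      · filter_upwards [continuousAt_const.eventually_lt hf h] with η hη
        rw [abs_of_pos hη, sign_pos h]; simp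
    filter_upwards [hsign hdet.continuousAt hd0, hsign hβσ.continuousAt hβν,
      hβσ.continuousAt.eventually_ne hβν] with η h1 h2 h3
    rw [frameDensity, h1, h2]
    rcases lt_or_gt_of_ne hβν with h | h
    · rw [sign_neg h]; field_simp; simp
    · rw [sign_pos h]; field_simp; simp
  have hlam := ((hdet.mul ((hasDerivAt_inv hβν).comp_hasFDerivAt θ hβσ)).const_mul c).congr_of_eventuallyEq hc
  refine ⟨hlam.differentiableAt, ?_⟩
  have hcθ : frameDensity e (β (σ θ)) ν (Pi (σ θ)) (S θ) =
      c * ((F θ).det * (β (σ θ) ν)⁻¹) := hc.self_of_nhds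
  rw [hlam.fderiv, hcθ]
  have hx := hdec.self_of_nhds
  have hβρ : β (σ θ) (Pi (σ θ)) = 0 := hβP.self_of_nhds
  -- The decomposition X = S b + a Πσ is differentiated along the section; symmetry of the second
  -- derivative moves b θ into the first slot.
  have hderiv : ∀ v, S2 (b θ) v + S θ (b' v) + (a' v • Pi (σ θ) + a θ • Pi (S θ v)) =
      DX (S θ v) := by
    intro v
    have h1 := ((hS.clm_apply hb).add (ha.smul hPσ)).congr_of_eventuallyEq
      (hdec.mono fun η h => h.symm)
    have h2 := DFunLike.congr_fun (h1.unique (hX.comp θ hσ)) v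
    simp only [add_apply, ContinuousLinearMap.comp_apply, ContinuousLinearMap.flip_apply,
      smul_apply, ContinuousLinearMap.smulRight_apply] at h2
    rw [← h2, hS2 (b θ) v]
    abel
  -- The identity β(X) = 0 holds in a full neighbourhood, so it may be differentiated in the
  -- transversal direction ν; this trades DX ν for the derivative of β.
  have hXν : β (σ θ) (DX ν) = -β2 (X (σ θ)) ν := by
    have h1 : HasFDerivAt (fun w => β w (X w)) (0 : P →L[ℝ] ℝ) (σ θ) :=
      (hasFDerivAt_const (0 : ℝ) (σ θ)).congr_of_eventuallyEq hβX
    have h2 := DFunLike.congr_fun ((hβ.clm_apply hX).unique h1) ν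
    simp only [add_apply, ContinuousLinearMap.comp_apply, ContinuousLinearMap.flip_apply,
      zero_apply] at h2
    rw [hβ2 (X (σ θ)) ν]
    linarith
  have hPν : β (σ θ) (Pi ν) = -β2 (Pi (σ θ)) ν := by
    have h1 : HasFDerivAt (fun w => β w (Pi w)) (0 : P →L[ℝ] ℝ) (σ θ) :=
      (hasFDerivAt_const (0 : ℝ) (σ θ)).congr_of_eventuallyEq hβP
    have h3 : HasFDerivAt (fun w => Pi w) Pi (σ θ) := Pi.hasFDerivAt
    have h2 := DFunLike.congr_fun ((hβ.clm_apply h3).unique h1) ν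
    simp only [add_apply, ContinuousLinearMap.comp_apply, ContinuousLinearMap.flip_apply,
      zero_apply] at h2
    rw [hβ2 (Pi (σ θ)) ν]
    linarith
  have htr := trace_frame_derivative A hA (S2b := S2 (b θ)) hx (hPi _) hDX hderiv hβρ hβS hβν
    htrX htrP
  have hjac : fderiv ℝ (fun A : ℝ × ℝ × V →L[ℝ] ℝ × ℝ × V => A.det) (F θ)
      (E'.comp (frame 0 (Pi (S θ (b θ))) (S2 (b θ)))) = (F θ).det *
        LinearMap.trace ℝ (ℝ × ℝ × V)
          ((A.symm : P →L[ℝ] ℝ × ℝ × V).comp (frame 0 (Pi (S θ (b θ))) (S2 (b θ)))) := by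
    rw [hFθ, fderiv_clm_det]
    congr 3
    refine ContinuousLinearMap.ext fun v => ?_
    simp [hE']
  -- With this the derivative of the denominator |β ν| cancels exactly the ν-term of the trace.
  have e1 : β2 (S θ (b θ)) ν = β2 (X (σ θ)) ν - a θ * β2 (Pi (σ θ)) ν := by
    rw [← hx]; simp
  simp only [add_apply, smul_apply, ContinuousLinearMap.comp_apply, smul_eq_mul,
    ContinuousLinearMap.compL_apply, frameLin_apply, ContinuousLinearMap.prod_apply,
    ContinuousLinearMap.apply_apply, Function.comp_apply]
  rw [hjac, htr, hXν, hPν, e1]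
  field_simp
  ring

end Divergence

/-! ### Transformation rules for `frameDensity` -/

section FrameDensity

set_option linter.unusedSectionVars false

variable {P V : Type*} [NormedAddCommGroup P] [NormedSpace ℝ P] [FiniteDimensional ℝ P]
  [NormedAddCommGroup V] [NormedSpace ℝ V] [FiniteDimensional ℝ V]

theorem clm_det_comp {Q : Type*} [NormedAddCommGroup Q] [NormedSpace ℝ Q] (A B : Q →L[ℝ] Q) :
    (A.comp B).det = A.det * B.det := by
  rw [ContinuousLinearMap.det, ContinuousLinearMap.toLinearMap_comp, LinearMap.det_comp]

/-- Passing from ν to ν' composes the frame with a transvection of determinant β ν' / β ν, which the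
denominator compensates: the density is the volume form divided by β. -/
theorem frameDensity_independent (e : (ℝ × ℝ × V) ≃L[ℝ] P) {β : P →L[ℝ] ℝ} {ν ν' ρ : P}
    {S : V →L[ℝ] P} (hβρ : β ρ = 0) (hβS : ∀ v, β (S v) = 0) (hν : β ν ≠ 0) (hν' : β ν' ≠ 0)
    (hinj : Function.Injective (frame ν ρ S)) :
    frameDensity e β ν' ρ S = frameDensity e β ν ρ S := by
  obtain ⟨A, hA⟩ := exists_frame_equiv e hinj
  have hAa : ∀ y, A y = y.1 • ν + (y.2.1 • ρ + S y.2.2) := fun y => by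
    have := DFunLike.congr_fun hA y
    simpa using this
  have hfst : (A.symm ν').1 = β ν' / β ν := by
    obtain ⟨y, hy⟩ := A.surjective ν'
    rw [← hy, A.symm_apply_apply, hAa]
    simp [hβρ, hβS, hν]
  let u : ℝ × ℝ × V := A.symm ν' - (1, 0, 0)
  let U : ℝ × ℝ × V →L[ℝ] ℝ × ℝ × V := ContinuousLinearMap.id ℝ _ +
    (ContinuousLinearMap.fst ℝ ℝ (ℝ × V)).smulRight u
  have hU : U.det = β ν' / β ν := by
    have : (U : ℝ × ℝ × V →ₗ[ℝ] ℝ × ℝ × V) =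
        LinearMap.transvection (LinearMap.fst ℝ ℝ (ℝ × V)) u := rfl
    rw [ContinuousLinearMap.det, this, LinearMap.transvection.det]
    simp [u, hfst]
  have hframe : frame ν' ρ S = (frame ν ρ S).comp U := by
    rw [← hA]
    refine ContinuousLinearMap.ext fun y => ?_
    have h1 : A ((1, 0, 0) : ℝ × ℝ × V) = ν := by rw [hAa]; simp
    have h2 : (U y : ℝ × ℝ × V) = y + y.1 • u := rfl
    rw [ContinuousLinearMap.comp_apply, h2, ContinuousLinearEquiv.coe_coe, map_add, map_smul,
      map_sub, A.apply_symm_apply, h1, hAa, frame_apply]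
    module
  rw [frameDensity, frameDensity, hframe, ← ContinuousLinearMap.comp_assoc, clm_det_comp, hU,
    abs_mul, abs_div]
  have := abs_pos.2 hν'
  have := abs_pos.2 hν
  field_simp

theorem frameDensity_pos (e : (ℝ × ℝ × V) ≃L[ℝ] P) {β : P →L[ℝ] ℝ} {ν ρ : P}
    {S : V →L[ℝ] P} (hν : β ν ≠ 0) (hinj : Function.Injective (frame ν ρ S)) :
    0 < frameDensity e β ν ρ S :=
  div_pos (abs_pos.2 (frame_det_ne_zero e hinj)) (abs_pos.2 hν)

theorem frameDensity_map (e : (ℝ × ℝ × V) ≃L[ℝ] P) {β : P →L[ℝ] ℝ} {ν ρ : P}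
    {S : V →L[ℝ] P} (T : P →L[ℝ] P) :
    frameDensity e β (T ν) (T ρ) (T.comp S) = |T.det| * frameDensity e (β.comp T) ν ρ S := by
  have hframe : frame (T ν) (T ρ) (T.comp S) = T.comp (frame ν ρ S) := by
    refine ContinuousLinearMap.ext fun y => ?_
    simp
  have h1 : ((e.symm : P →L[ℝ] ℝ × ℝ × V).comp (T.comp (frame ν ρ S))).det =
      T.det * ((e.symm : P →L[ℝ] ℝ × ℝ × V).comp (frame ν ρ S)).det := by
    have h2 : (e.symm : P →L[ℝ] ℝ × ℝ × V).comp (T.comp (frame ν ρ S)) =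
        ((e.symm : P →L[ℝ] ℝ × ℝ × V).comp (T.comp (e : ℝ × ℝ × V →L[ℝ] P))).comp
          ((e.symm : P →L[ℝ] ℝ × ℝ × V).comp (frame ν ρ S)) := by
      refine ContinuousLinearMap.ext fun y => ?_
      simp
    rw [h2, clm_det_comp]
    congr 1
    exact LinearMap.det_conj (T : P →ₗ[ℝ] P) e.symm.toLinearEquiv
  rw [frameDensity, frameDensity, hframe, h1, abs_mul, mul_div_assoc]
  rfl

/-- Adding multiples of ρ to S is a column operation of determinant 1. The density therefore does
not notice a displacement of the section along the rays, which lets it descend to the quotient. -/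
theorem frameDensity_reparam (e : (ℝ × ℝ × V) ≃L[ℝ] P) {β : P →L[ℝ] ℝ} {ν ρ : P}
    {S : V →L[ℝ] P} (D : V →L[ℝ] V) (l : V →L[ℝ] ℝ) :
    frameDensity e β ν ρ (S.comp D + l.smulRight ρ) = |D.det| * frameDensity e β ν ρ S := by
  let W1 : ℝ × ℝ × V →L[ℝ] ℝ × ℝ × V := ContinuousLinearMap.id ℝ _ +
    (l.comp ((ContinuousLinearMap.snd ℝ ℝ V).comp (ContinuousLinearMap.snd ℝ ℝ (ℝ × V)))).smulRight
      ((0, 1, 0) : ℝ × ℝ × V)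
  let W2 : ℝ × ℝ × V →L[ℝ] ℝ × ℝ × V :=
    (ContinuousLinearMap.id ℝ ℝ).prodMap ((ContinuousLinearMap.id ℝ ℝ).prodMap D)
  have h1 : W1.det = 1 := by
    have : (W1 : ℝ × ℝ × V →ₗ[ℝ] ℝ × ℝ × V) = LinearMap.transvection
        ((l : V →ₗ[ℝ] ℝ).comp ((LinearMap.snd ℝ ℝ V).comp (LinearMap.snd ℝ ℝ (ℝ × V))))
          ((0, 1, 0) : ℝ × ℝ × V) := rfl
    rw [ContinuousLinearMap.det, this, LinearMap.transvection.det]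
    simp
  have h2 : W2.det = D.det := by
    have : (W2 : ℝ × ℝ × V →ₗ[ℝ] ℝ × ℝ × V) = LinearMap.prodMap LinearMap.id
      (LinearMap.prodMap LinearMap.id (D : V →ₗ[ℝ] V)) := rfl
    rw [ContinuousLinearMap.det, this, LinearMap.det_prodMap, LinearMap.det_prodMap]
    simp
  have hframe : frame ν ρ (S.comp D + l.smulRight ρ) = (frame ν ρ S).comp (W2.comp W1) := by
    refine ContinuousLinearMap.ext fun y => ?_
    have : (W2.comp W1) y = (y.1, y.2.1 + l y.2.2, D y.2.2) := by
      refine Prod.ext ?_ (Prod.ext ?_ ?_) <;> simp [W1, W2]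
    rw [ContinuousLinearMap.comp_apply, this]
    simp only [frame_apply, add_apply, ContinuousLinearMap.comp_apply,
      ContinuousLinearMap.smulRight_apply]
    module
  rw [frameDensity, frameDensity, hframe, ← ContinuousLinearMap.comp_assoc, clm_det_comp,
    clm_det_comp, h1, h2, mul_one, abs_mul]
  ring

end FrameDensity

/-! ### The Hamiltonian field in a canonical chart -/

/-- `sympGrad` as a linear equivalence from the algebraic dual. -/
def sympEquiv (n : ℕ) : Module.Dual ℝ (Phase n) ≃ₗ[ℝ] Phase n :=
  LinearEquiv.ofInjectiveOfFinrankEq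
    ((sympGradCLM n : (Phase n →L[ℝ] ℝ) →ₗ[ℝ] Phase n).comp
      (LinearMap.toContinuousLinearMap (𝕜 := ℝ) (E := Phase n) (F' := ℝ)).toLinearMap)
    (by
      intro a b hab
      have : sympGrad (LinearMap.toContinuousLinearMap a) =
        sympGrad (LinearMap.toContinuousLinearMap b) := by simpa using hab
      exact (LinearMap.toContinuousLinearMap).injective (sympGrad_injective this))
    Subspace.dual_finrank_eq

theorem sympEquiv_apply (α : Phase n →L[ℝ] ℝ) :
    sympEquiv n (α : Phase n →ₗ[ℝ] ℝ) = sympGrad α := by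
  change sympGradCLM n (LinearMap.toContinuousLinearMap (α : Phase n →ₗ[ℝ] ℝ)) = _
  rw [sympGradCLM_apply]
  congr 1

/-- With J the symplectic gradient, the hypothesis reads T J Tᵗ J⁻¹ = 1, and T has the same
determinant as its transpose, so (det T)² = 1. -/
theorem abs_det_eq_one_of_symplectic {T : Phase n →L[ℝ] Phase n}
    (hT : ∀ α : Phase n →L[ℝ] ℝ, T (sympGrad (α.comp T)) = sympGrad α) : |T.det| = 1 := by
  have h1 : (T : Phase n →ₗ[ℝ] Phase n) ∘ₗ
      ((sympEquiv n : Module.Dual ℝ (Phase n) →ₗ[ℝ] Phase n) ∘ₗ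
        (T : Phase n →ₗ[ℝ] Phase n).dualMap ∘ₗ
          ((sympEquiv n).symm : Phase n →ₗ[ℝ] Module.Dual ℝ (Phase n))) = LinearMap.id := by
    refine LinearMap.ext fun v => ?_
    obtain ⟨α, rfl⟩ := (sympEquiv n).surjective v
    have h2 := hT (LinearMap.toContinuousLinearMap α)
    rw [← sympEquiv_apply, ← sympEquiv_apply] at h2
    simp only [LinearMap.comp_apply, LinearEquiv.coe_coe, LinearEquiv.symm_apply_apply,
      LinearMap.id_apply]
    exact h2
  have h3 := congrArg LinearMap.det h1
  rw [LinearMap.det_comp, LinearMap.det_id, LinearMap.det_conj, LinearMap.det_dualMap] at h3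
  have h4 : |T.det| * |T.det| = 1 := by
    rw [← abs_mul]
    exact (congrArg abs h3).trans abs_one
  nlinarith [abs_nonneg T.det]

theorem abs_det_trD {q : M} {z : Cotangent n M} (hq : z ∈ (ch q).source) : |(trD q z).det| = 1 :=
  abs_det_eq_one_of_symplectic (trD_sympGrad hq)

theorem apply_sympGrad_antisymm (α γ : Phase n →L[ℝ] ℝ) : α (sympGrad γ) = -γ (sympGrad α) := by
  have h := apply_sympGrad_self (α + γ)
  have hadd : sympGrad (α + γ) = sympGrad α + sympGrad γ := by
    simpa only [sympGradCLM_apply] using (sympGradCLM n).map_add α γ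
  rw [hadd] at h
  have h1 : α (sympGrad α) + α (sympGrad γ) + (γ (sympGrad α) + γ (sympGrad γ)) = 0 := by
    rw [← α.map_add, ← γ.map_add]
    exact h
  rw [apply_sympGrad_self, apply_sympGrad_self] at h1
  linarith

/-- J is antisymmetric and B symmetric, so the transpose of J ∘ B is -B ∘ J. Transposition and
cyclic permutation preserve the trace, which thus equals its own negative. -/
theorem trace_sympGrad_comp {B : Phase n →L[ℝ] Phase n →L[ℝ] ℝ} (hB : ∀ u v, B u v = B v u) :
    LinearMap.trace ℝ (Phase n) ((sympGradCLM n).comp B : Phase n →L[ℝ] Phase n) = 0 := by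
  set B' : Phase n →ₗ[ℝ] Module.Dual ℝ (Phase n) :=
    (LinearMap.toContinuousLinearMap (𝕜 := ℝ) (E := Phase n) (F' := ℝ)).symm.toLinearMap ∘ₗ
      (B : Phase n →ₗ[ℝ] (Phase n →L[ℝ] ℝ)) with hB'
  have h1 : (((sympGradCLM n).comp B : Phase n →L[ℝ] Phase n) : Phase n →ₗ[ℝ] Phase n) =
      (sympEquiv n : Module.Dual ℝ (Phase n) →ₗ[ℝ] Phase n) ∘ₗ B' := by
    refine LinearMap.ext fun v => ?_
    exact (sympGradCLM_apply (B v)).trans (sympEquiv_apply (B v)).symm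
  have h2 : ((sympEquiv n : Module.Dual ℝ (Phase n) →ₗ[ℝ] Phase n) ∘ₗ B').dualMap =
      -(B' ∘ₗ (sympEquiv n : Module.Dual ℝ (Phase n) →ₗ[ℝ] Phase n)) := by
    refine LinearMap.ext fun α => LinearMap.ext fun v => ?_
    have h3 := apply_sympGrad_antisymm (LinearMap.toContinuousLinearMap α) (B v)
    rw [hB] at h3
    have h4 := sympEquiv_apply (LinearMap.toContinuousLinearMap α)
    rw [← h4, ← sympEquiv_apply] at h3
    exact h3
  have h5 := LinearMap.trace_transpose' (R := ℝ)
    ((sympEquiv n : Module.Dual ℝ (Phase n) →ₗ[ℝ] Phase n) ∘ₗ B')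
  rw [h1]
  have h6 : LinearMap.trace ℝ (Module.Dual ℝ (Phase n))
      ((sympEquiv n : Module.Dual ℝ (Phase n) →ₗ[ℝ] Phase n) ∘ₗ B').dualMap =
      LinearMap.trace ℝ _ ((sympEquiv n : Module.Dual ℝ (Phase n) →ₗ[ℝ] Phase n) ∘ₗ B') := h5
  have h7 := LinearMap.map_neg (LinearMap.trace ℝ (Module.Dual ℝ (Phase n)))
    (B' ∘ₗ (sympEquiv n : Module.Dual ℝ (Phase n) →ₗ[ℝ] Phase n))
  rw [h2, h7, LinearMap.trace_comp_comm'] at h6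
  linarith

/-- The projection `(q, p) ↦ (0, p)`. -/
def fibProj (n : ℕ) : Phase n →L[ℝ] Phase n :=
  (0 : Phase n →L[ℝ] Base n).prod (ContinuousLinearMap.snd ℝ _ _)

@[simp] theorem fibProj_apply (w : Phase n) : fibProj n w = (0, w.2) := rfl

theorem finrank_base_dual : Module.finrank ℝ (Base n →L[ℝ] ℝ) = n := by
  rw [← (LinearMap.toContinuousLinearMap (𝕜 := ℝ) (E := Base n) (F' := ℝ)).finrank_eq]
  exact Subspace.dual_finrank_eq.trans finrank_euclideanSpace_fin

theorem trace_fibProj : LinearMap.trace ℝ (Phase n) (fibProj n : Phase n →L[ℝ] Phase n) = n := by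
  have : ((fibProj n : Phase n →L[ℝ] Phase n) : Phase n →ₗ[ℝ] Phase n) =
      LinearMap.prodMap (0 : Base n →ₗ[ℝ] Base n) LinearMap.id := rfl
  rw [this, LinearMap.trace_prodMap', map_zero, zero_add, LinearMap.trace_id, finrank_base_dual]

theorem det_dil (s : ℝ) : (dil (n := n) s).det = s ^ n := by
  have : ((dil (n := n) s : Phase n →L[ℝ] Phase n) : Phase n →ₗ[ℝ] Phase n) =
      LinearMap.prodMap (LinearMap.id : Base n →ₗ[ℝ] Base n) (s • LinearMap.id) := rfl
  rw [ContinuousLinearMap.det, this, LinearMap.det_prodMap, LinearMap.det_id, LinearMap.det_smul,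
    LinearMap.det_id, finrank_base_dual]
  simp

/-! ### A Hamiltonian in a canonical chart -/

instance : NormedAddCommGroup (Phase n →L[ℝ] ℝ) := ContinuousLinearMap.toNormedAddCommGroup

instance : NormedSpace ℝ (Phase n →L[ℝ] ℝ) := ContinuousLinearMap.toNormedSpace

section HamChart

variable {h : Cotangent n M → ℝ}

theorem IsHamiltonian.contMDiffAt (hh : IsHamiltonian h) {z : Cotangent n M}
    (hz : z ∈ punctured n M) : ContMDiffAt (phaseModel n) 𝓘(ℝ, ℝ) ∞ h z :=
  hh.smooth.contMDiffAt (isOpen_punctured.mem_nhds hz)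

theorem IsHamiltonian.mdifferentiableAt (hh : IsHamiltonian h) {z : Cotangent n M}
    (hz : z ∈ punctured n M) : MDifferentiableAt (phaseModel n) 𝓘(ℝ, ℝ) h z :=
  (hh.contMDiffAt hz).mdifferentiableAt (by simp)

theorem ch_symm_mem_punctured {q : M} {w : Phase n} (hw : w ∈ (ch (n := n) q).target)
    (h0 : w.2 ≠ 0) : (ch q).symm w ∈ punctured n M := by
  rw [mem_punctured_iff ((ch q).map_target hw), (ch q).right_inv hw]
  exact h0

theorem ch_snd_ne_zero {q : M} {z : Cotangent n M} (hz : z ∈ punctured n M)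
    (hq : z ∈ (ch q).source) : (ch q z).2 ≠ 0 := (mem_punctured_iff hq).1 hz

theorem dil_mem_ch_target {q : M} {w : Phase n} (s : ℝ) (hw : w ∈ (ch (n := n) q).target) :
    dil s w ∈ (ch (n := n) q).target := by
  rw [ch_target] at hw ⊢
  exact ⟨hw.1, mem_univ _⟩

theorem ch_symm_dil {q : M} {w : Phase n} (s : ℝ) (hw : w ∈ (ch (n := n) q).target) :
    (ch q).symm (dil s w) = dilate s ((ch q).symm w) := by
  have h1 : (ch q).symm w ∈ (ch (n := n) q).source := (ch q).map_target hw
  have h2 := ch_dilate q s ((ch q).symm w)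
  rw [(ch q).right_inv hw] at h2
  rw [← h2, (ch q).left_inv ((dilate_mem_ch_source s).2 h1)]

theorem eventually_ch_target {q : M} {w : Phase n} (hw : w ∈ (ch (n := n) q).target)
    (h0 : w.2 ≠ 0) : ∀ᶠ u in 𝓝 w, u ∈ (ch (n := n) q).target ∧ u.2 ≠ 0 :=
  ((isOpen_ch_target q).eventually_mem hw).and (continuous_snd.continuousAt.eventually_ne h0)

theorem contDiffAt_comp_ch_symm {F : Type*} [NormedAddCommGroup F] [NormedSpace ℝ F]
    {k : Cotangent n M → F} {q : M} {w : Phase n} (hw : w ∈ (ch (n := n) q).target)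
    (hk : ContMDiffAt (phaseModel n) 𝓘(ℝ, F) ∞ k ((ch q).symm w)) :
    ContDiffAt ℝ ∞ (k ∘ (ch q).symm) w := by
  have := hk.comp w (contMDiffAt_ch_symm hw)
  exact this.contDiffAt

theorem IsHamiltonian.contDiffAt (hh : IsHamiltonian h) {q : M} {w : Phase n}
    (hw : w ∈ (ch (n := n) q).target) (h0 : w.2 ≠ 0) :
    ContDiffAt ℝ ∞ (h ∘ (ch q).symm) w :=
  contDiffAt_comp_ch_symm hw (hh.contMDiffAt (ch_symm_mem_punctured hw h0))

theorem contDiffAt_fderiv_infty {E F : Type*} [NormedAddCommGroup E] [NormedSpace ℝ E]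
    [NormedAddCommGroup F] [NormedSpace ℝ F] {f : E → F} {x : E} (hf : ContDiffAt ℝ ∞ f x) :
    ContDiffAt ℝ ∞ (fderiv ℝ f) x :=
  hf.fderiv_right (by norm_cast)

theorem contDiffAt_hamCoord (hh : IsHamiltonian h) {q : M} {w : Phase n}
    (hw : w ∈ (ch (n := n) q).target) (h0 : w.2 ≠ 0) : ContDiffAt ℝ ∞ (hamCoord h q) w := by
  have h1 := (sympGradCLM n).contDiff.contDiffAt.comp w
    (contDiffAt_fderiv_infty (hh.contDiffAt hw h0))
  refine h1.congr_of_eventuallyEq (Eventually.of_forall fun u => ?_)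
  exact (sympGradCLM_apply _).symm

theorem IsHamiltonian.comp_dil (hh : IsHamiltonian h) {q : M} {w : Phase n}
    (hw : w ∈ (ch (n := n) q).target) (h0 : w.2 ≠ 0) {s : ℝ} (hs : 0 < s) :
    (h ∘ (ch q).symm) (dil s w) = (h ∘ (ch q).symm) w := by
  simp only [Function.comp_apply]
  rw [ch_symm_dil s hw, hh.homogeneous s hs _ (ch_symm_mem_punctured hw h0)]

theorem dil_snd_ne_zero {w : Phase n} (h0 : w.2 ≠ 0) {s : ℝ} (hs : s ≠ 0) : (dil s w).2 ≠ 0 := by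
  rw [dil_apply]
  exact smul_ne_zero hs h0

theorem hasDerivAt_dil (w : Phase n) (s : ℝ) :
    HasDerivAt (fun t : ℝ => dil t w) (fibProj n w) s := by
  have h1 : HasDerivAt (fun t : ℝ => ((w.1, t • w.2) : Phase n)) ((0 : Base n), (1 : ℝ) • w.2) s :=
    (hasDerivAt_const s w.1).prodMk ((hasDerivAt_id s).smul_const w.2)
  rw [one_smul] at h1
  exact h1

theorem dil_one' (w : Phase n) : dil 1 w = w := by
  rw [dil_apply, one_smul]

theorem fderiv_fibProj_of_homogeneous {F : Type*} [NormedAddCommGroup F] [NormedSpace ℝ F]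
    {k : Phase n → F} {w : Phase n} {c : ℝ → F} {c' : F} (hk : DifferentiableAt ℝ k w)
    (hc : HasDerivAt c c' 1) (hkc : ∀ s : ℝ, 0 < s → k (dil s w) = c s) :
    fderiv ℝ k w (fibProj n w) = c' := by
  have h1 : HasFDerivAt k (fderiv ℝ k w) (dil 1 w) := by
    rw [dil_one']; exact hk.hasFDerivAt
  have h2 := h1.comp_hasDerivAt 1 (hasDerivAt_dil w 1)
  refine h2.unique (hc.congr_of_eventuallyEq ?_)
  filter_upwards [lt_mem_nhds (zero_lt_one' ℝ)] with s hs
  exact hkc s hs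

theorem IsHamiltonian.fderiv_fibProj (hh : IsHamiltonian h) {q : M} {w : Phase n}
    (hw : w ∈ (ch (n := n) q).target) (h0 : w.2 ≠ 0) :
    fderiv ℝ (h ∘ (ch q).symm) w (fibProj n w) = 0 :=
  fderiv_fibProj_of_homogeneous ((hh.contDiffAt hw h0).differentiableAt (by simp))
    (hasDerivAt_const _ _) fun _ hs => hh.comp_dil hw h0 hs

/-- Degree -1 of X_h: dh is invariant under dilations while the symplectic form is multiplied by s.
-/
theorem hamCoord_dil (hh : IsHamiltonian h) {q : M} {w : Phase n}
    (hw : w ∈ (ch (n := n) q).target) (h0 : w.2 ≠ 0) {s : ℝ} (hs : 0 < s) :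
    hamCoord h q (dil s w) = s⁻¹ • dil s (hamCoord h q w) := by
  have h1 : (fderiv ℝ (h ∘ (ch q).symm) (dil s w)).comp (dil s) =
      fderiv ℝ (h ∘ (ch q).symm) w := by
    have h2 : HasFDerivAt (h ∘ (ch q).symm) _ (dil s w) :=
      ((hh.contDiffAt (dil_mem_ch_target s hw) (dil_snd_ne_zero h0 hs.ne')).differentiableAt
        (by simp)).hasFDerivAt
    have h3 := h2.comp w (dil (n := n) s).hasFDerivAt
    refine (h3.congr_of_eventuallyEq ?_).fderiv.symm
    filter_upwards [eventually_ch_target hw h0] with u hu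
    exact (hh.comp_dil hu.1 hu.2 hs).symm
  have h4 : ∀ v, fderiv ℝ (h ∘ (ch q).symm) (dil s w) (dil s v) =
      fderiv ℝ (h ∘ (ch q).symm) w v := fun v => DFunLike.congr_fun h1 v
  refine Prod.ext (base_ext fun β => ?_) (ContinuousLinearMap.ext fun v => ?_)
  · have h5 := h4 (0, β)
    rw [dil_apply s ((0, β) : Phase n)] at h5
    rw [hamCoord, apply_sympGrad_fst, Prod.smul_fst, dil_apply s (hamCoord h q w), map_smul,
      hamCoord, apply_sympGrad_fst, ← h5, smul_eq_mul]
    have : ((0, β) : Phase n) = s⁻¹ • ((0, s • β) : Phase n) := by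
      rw [Prod.smul_mk, smul_zero, smul_smul, inv_mul_cancel₀ hs.ne', one_smul]
    rw [this, map_smul, smul_eq_mul]
    simp [smul_smul, hs.ne']
  · have h5 := h4 (v, 0)
    rw [dil_apply s ((v, 0) : Phase n), smul_zero] at h5
    rw [hamCoord, sympGrad_snd_apply, Prod.smul_snd, dil_apply s (hamCoord h q w), smul_smul,
      inv_mul_cancel₀ hs.ne', one_smul, hamCoord, sympGrad_snd_apply, h5]

/-- Euler's relation for `hamCoord_dil`, by differentiation at s = 1. It is the input `hDX` of
`fderiv_frameDensity`. -/
theorem fderiv_hamCoord_fibProj (hh : IsHamiltonian h) {q : M} {w : Phase n}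
    (hw : w ∈ (ch (n := n) q).target) (h0 : w.2 ≠ 0) :
    fderiv ℝ (hamCoord h q) w (fibProj n w) = -hamCoord h q w + fibProj n (hamCoord h q w) := by
  refine fderiv_fibProj_of_homogeneous ((contDiffAt_hamCoord hh hw h0).differentiableAt (by simp))
    (c := fun s => s⁻¹ • dil s (hamCoord h q w)) ?_ fun _ hs => hamCoord_dil hh hw h0 hs
  have h1 := (hasDerivAt_inv (one_ne_zero (α := ℝ))).smul (hasDerivAt_dil (hamCoord h q w) 1)
  refine h1.congr_deriv ?_
  rw [dil_one']
  simp only [one_pow, inv_one, one_smul, neg_smul]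
  rw [add_comm]

theorem fderiv_symmetric {E F : Type*} [NormedAddCommGroup E] [NormedSpace ℝ E]
    [NormedAddCommGroup F] [NormedSpace ℝ F] {f : E → F} {x : E} (hf : ContDiffAt ℝ ∞ f x)
    (u v : E) : fderiv ℝ (fderiv ℝ f) x u v = fderiv ℝ (fderiv ℝ f) x v u :=
  (hf.isSymmSndFDerivAt (by simp; exact WithTop.coe_le_coe.2 le_top)).eq u v

/-- Liouville's theorem in infinitesimal form: the Jacobian of the field is the symplectic gradient
composed with the symmetric Hessian of h. -/
theorem trace_fderiv_hamCoord (hh : IsHamiltonian h) {q : M} {w : Phase n}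
    (hw : w ∈ (ch (n := n) q).target) (h0 : w.2 ≠ 0) :
    LinearMap.trace ℝ (Phase n) (fderiv ℝ (hamCoord h q) w) = 0 := by
  have hc := hh.contDiffAt hw h0
  have h1 : HasFDerivAt (hamCoord h q)
      ((sympGradCLM n).comp (fderiv ℝ (fderiv ℝ (h ∘ (ch q).symm)) w)) w := by
    have h2 := (sympGradCLM n).hasFDerivAt.comp w
      ((contDiffAt_fderiv_infty hc).differentiableAt (by simp)).hasFDerivAt
    refine h2.congr_of_eventuallyEq (Eventually.of_forall fun u => ?_)
    exact (sympGradCLM_apply _).symm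
  rw [h1.fderiv]
  exact trace_sympGrad_comp (fderiv_symmetric hc)

theorem fderiv_hamCoord_self (h : Cotangent n M → ℝ) (q : M) (w : Phase n) :
    fderiv ℝ (h ∘ (ch q).symm) w (hamCoord h q w) = 0 :=
  apply_sympGrad_self _

end HamChart

/-! ### Local coordinates on `Z₀` and the Liouville density -/

section LocalCoordinates

theorem contDiffAt_frameDensity {E P V : Type*} [NormedAddCommGroup E] [NormedSpace ℝ E]
    [NormedAddCommGroup P] [NormedSpace ℝ P]
    [FiniteDimensional ℝ P] [NormedAddCommGroup V] [NormedSpace ℝ V] [FiniteDimensional ℝ V]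
    (e : (ℝ × ℝ × V) ≃L[ℝ] P) {β : E → P →L[ℝ] ℝ} {ν : P} {ρ : E → P} {S : E → V →L[ℝ] P} {x : E}
    (hβ : ContDiffAt ℝ ∞ β x) (hρ : ContDiffAt ℝ ∞ ρ x) (hS : ContDiffAt ℝ ∞ S x)
    (hν : β x ν ≠ 0) (hinj : Function.Injective (frame ν (ρ x) (S x))) :
    ContDiffAt ℝ ∞ (fun η => frameDensity e (β η) ν (ρ η) (S η)) x := by
  have h1 : ContDiffAt ℝ ∞ (fun η => frame ν (ρ η) (S η)) x := by
    simp only [frame_eq ν (ρ _)]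
    exact contDiffAt_const.add
      (((frameLin (P := P) (V := V)).contDiff.contDiffAt (x := (ρ x, S x))).comp x (hρ.prodMk hS))
  have h2 : ContDiffAt ℝ ∞ (fun η => (e.symm : P →L[ℝ] ℝ × ℝ × V).comp (frame ν (ρ η) (S η))) x :=
    contDiffAt_const.clm_comp h1
  have h3 := (contDiff_clm_det (Q := ℝ × ℝ × V)).contDiffAt.comp x h2
  exact (h3.abs (frame_det_ne_zero e hinj)).div
    ((hβ.clm_apply contDiffAt_const).abs hν) (abs_ne_zero.2 hν)

/-- Inversion of linear maps is smooth near an invertible one, so the components of a smooth field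
in a smoothly moving frame are smooth. -/
theorem contDiffAt_frame_inverse {E P V : Type*} [NormedAddCommGroup E] [NormedSpace ℝ E]
    [NormedAddCommGroup P] [NormedSpace ℝ P]
    [FiniteDimensional ℝ P] [NormedAddCommGroup V] [NormedSpace ℝ V] [FiniteDimensional ℝ V]
    (e : (ℝ × ℝ × V) ≃L[ℝ] P) {ν : P} {ρ X : E → P} {S : E → V →L[ℝ] P} {x : E}
    (hρ : ContDiffAt ℝ ∞ ρ x) (hS : ContDiffAt ℝ ∞ S x) (hX : ContDiffAt ℝ ∞ X x)
    (hinj : Function.Injective (frame ν (ρ x) (S x))) :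
    ∃ y : E → ℝ × ℝ × V, ContDiffAt ℝ ∞ y x ∧ ∀ η, Function.Injective (frame ν (ρ η) (S η)) →
      frame ν (ρ η) (S η) (y η) = X η := by
  have h1 : ContDiffAt ℝ ∞ (fun η => frame ν (ρ η) (S η)) x := by
    simp only [frame_eq ν (ρ _)]
    exact contDiffAt_const.add
      (((frameLin (P := P) (V := V)).contDiff.contDiffAt (x := (ρ x, S x))).comp x (hρ.prodMk hS))
  obtain ⟨A, hA⟩ := exists_frame_equiv e hinj
  have : CompleteSpace (ℝ × ℝ × V) := FiniteDimensional.complete ℝ _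
  refine ⟨fun η => (frame ν (ρ η) (S η)).inverse (X η), ?_, fun η hη => ?_⟩
  · have h2 : ContDiffAt ℝ ∞ ContinuousLinearMap.inverse (frame ν (ρ x) (S x)) := by
      rw [← hA]
      exact contDiffAt_map_inverse A
    exact (h2.comp x h1).clm_apply hX
  · obtain ⟨B, hB⟩ := exists_frame_equiv e hη
    simp only [← hB, ContinuousLinearMap.inverse_equiv]
    simp

/-- The derivative of a map into `T*M`, in the preferred chart at the image. -/
def mfdInto {E : Type*} [NormedAddCommGroup E] [NormedSpace ℝ E] (σ : E → Cotangent n M) (θ : E) :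
    E →L[ℝ] Phase n := mfderiv 𝓘(ℝ, E) (phaseModel n) σ θ

theorem SmoothOnSubset.contDiffAt_comp {E : Type*} [NormedAddCommGroup E] [NormedSpace ℝ E]
    {C : Set (Cotangent n M)} {k : Cotangent n M → ℝ} (hk : SmoothOnSubset C k)
    {σ : E → Cotangent n M} {θ : E} (hσ : ContMDiffAt 𝓘(ℝ, E) (phaseModel n) ∞ σ θ)
    (hC : ∀ᶠ η in 𝓝 θ, σ η ∈ C) : ContDiffAt ℝ ∞ (fun η => k (σ η)) θ := by
  obtain ⟨U, k', hU, hz, hk', heq⟩ := hk _ hC.self_of_nhds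
  have h1 : ContMDiffAt (phaseModel n) 𝓘(ℝ, ℝ) ∞ k' (σ θ) := hk'.contMDiffAt (hU.mem_nhds hz)
  have h2 : ContDiffAt ℝ ∞ (k' ∘ σ) θ := (h1.comp θ hσ).contDiffAt
  refine h2.congr_of_eventuallyEq ?_
  filter_upwards [hC, hσ.continuousAt.eventually_mem (hU.mem_nhds hz)] with η h3 h4
  exact (heq ⟨h4, h3⟩).symm

variable {h : Cotangent n M → ℝ} (σ : LocalParam h) {θ : InfModel n} {q : M}

theorem LocalParam.contMDiffAt (hθ : θ ∈ σ.dom) :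
    ContMDiffAt 𝓘(ℝ, InfModel n) (phaseModel n) ∞ σ.toFun θ :=
  σ.smooth.contMDiffAt (σ.isOpen_dom.mem_nhds hθ)

theorem LocalParam.mem_punctured (hθ : θ ∈ σ.dom) : σ.toFun θ ∈ punctured n M :=
  (σ.mem_shell θ hθ).1

theorem LocalParam.eventually_dom (hθ : θ ∈ σ.dom) : ∀ᶠ η in 𝓝 θ, η ∈ σ.dom :=
  σ.isOpen_dom.mem_nhds hθ

theorem LocalParam.eventually_source (hθ : θ ∈ σ.dom) (hq : σ.toFun θ ∈ (ch q).source) :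
    ∀ᶠ η in 𝓝 θ, η ∈ σ.dom ∧ σ.toFun η ∈ (ch (n := n) q).source :=
  (σ.eventually_dom hθ).and
    ((σ.contMDiffAt hθ).continuousAt.eventually_mem ((isOpen_ch_source q).mem_nhds hq))

theorem LocalParam.contDiffAt_ch (hθ : θ ∈ σ.dom) (hq : σ.toFun θ ∈ (ch q).source) :
    ContDiffAt ℝ ∞ (ch q ∘ σ.toFun) θ := by
  have := (contMDiffAt_ch hq).comp θ (σ.contMDiffAt hθ)
  exact this.contDiffAt

theorem LocalParam.mfdInto_eq (hθ : θ ∈ σ.dom) (hq : σ.toFun θ ∈ (ch q).source) :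
    mfdInto σ.toFun θ = (trD q (σ.toFun θ)).comp (fderiv ℝ (ch q ∘ σ.toFun) θ) :=
  ContinuousLinearMap.ext fun v =>
    mfderiv_eq_trD_comp ((σ.contMDiffAt hθ).mdifferentiableAt (by simp)) hq v

theorem LocalParam.immersive_ch (hθ : θ ∈ σ.dom) (hq : σ.toFun θ ∈ (ch q).source)
    (v : InfModel n) (c : ℝ)
    (hv : fderiv ℝ (ch q ∘ σ.toFun) θ v = c • fibProj n (ch q (σ.toFun θ))) : v = 0 := by
  refine σ.immersive θ hθ v c ?_
  rw [radial_eq hq]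
  have h1 := mfderiv_eq_trD_comp ((σ.contMDiffAt hθ).mdifferentiableAt (by simp)) hq v
  rw [hv, map_smul] at h1
  exact h1

theorem LocalParam.fderiv_ham_ch (hh : IsHamiltonian h) (hθ : θ ∈ σ.dom)
    (hq : σ.toFun θ ∈ (ch q).source) (v : InfModel n) :
    fderiv ℝ (h ∘ (ch q).symm) (ch q (σ.toFun θ)) (fderiv ℝ (ch q ∘ σ.toFun) θ v) = 0 := by
  have h0 := ch_snd_ne_zero (σ.mem_punctured hθ) hq
  have h1 : HasFDerivAt (h ∘ (ch q).symm) _ ((ch q ∘ σ.toFun) θ) :=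
    ((hh.contDiffAt ((ch q).map_source hq) h0).differentiableAt (by simp)).hasFDerivAt
  have h2 := h1.comp θ ((σ.contDiffAt_ch hθ hq).differentiableAt (by simp)).hasFDerivAt
  have h3 : HasFDerivAt (fun _ : InfModel n => (0 : ℝ)) _ θ := h2.congr_of_eventuallyEq (by
    filter_upwards [σ.eventually_source hθ hq] with η hη
    simp only [Function.comp_apply]
    rw [(ch q).left_inv hη.2, (σ.mem_shell η hη.1).2])
  exact DFunLike.congr_fun (h3.unique (hasFDerivAt_const (0 : ℝ) θ)) v

theorem LocalParam.frame_injective_ch (hh : IsHamiltonian h) (hθ : θ ∈ σ.dom)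
    (hq : σ.toFun θ ∈ (ch q).source) {ν : Phase n}
    (hν : fderiv ℝ (h ∘ (ch q).symm) (ch q (σ.toFun θ)) ν ≠ 0) :
    Function.Injective (frame ν (fibProj n (ch q (σ.toFun θ)))
      (fderiv ℝ (ch q ∘ σ.toFun) θ)) := by
  have h0 := ch_snd_ne_zero (σ.mem_punctured hθ) hq
  exact frame_injective (hh.fderiv_fibProj ((ch q).map_source hq) h0)
    (σ.fderiv_ham_ch hh hθ hq) hν (fun h1 => h0 (congrArg Prod.snd h1))
    (σ.immersive_ch hθ hq)

theorem exists_fderiv_ham_ne_zero (hh : IsHamiltonian h) (hcrit : ZeroNotCritical h)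
    {z : Cotangent n M} (hz : z ∈ shell h) (hq : z ∈ (ch q).source) :
    ∃ ν, fderiv ℝ (h ∘ (ch q).symm) (ch q z) ν ≠ 0 := by
  by_contra! hcon
  have h1 : mfd h z ≠ 0 := hcrit z hz
  obtain ⟨v, hv⟩ : ∃ v, mfd h z v ≠ 0 := by
    by_contra! h2
    exact h1 (ContinuousLinearMap.ext h2)
  obtain ⟨u, rfl⟩ : ∃ u, trD q z u = v :=
    ((trD q z : Phase n →ₗ[ℝ] Phase n).injective_iff_surjective.1 (trD_injective hq)) v
  rw [mfderiv_trD (hh.mdifferentiableAt hz.1) hq] at hv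
  exact hv (hcon u)

/-- The coefficient in the coordinates `σ` of the contraction of the Liouville measure of `Σ₀` with
the radial field. -/
def liouville (h : Cotangent n M → ℝ) (e : (ℝ × ℝ × InfModel n) ≃L[ℝ] Phase n)
    (σ : InfModel n → Cotangent n M) (θ : InfModel n) : ℝ :=
  frameDensity e (mfd h (σ θ)) (Classical.epsilon fun ν => mfd h (σ θ) ν ≠ 0)
    (radial (σ θ) : Phase n) (mfdInto σ θ)

variable (e : (ℝ × ℝ × InfModel n) ≃L[ℝ] Phase n)

/-- The definition uses a chart and a transversal vector that vary with the point. Both may be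
fixed, since chart changes have determinant ±1 and the choice of ν is immaterial; smoothness and
derivatives are read off in this form. -/
theorem LocalParam.liouville_eq (hh : IsHamiltonian h) (hθ : θ ∈ σ.dom)
    (hq : σ.toFun θ ∈ (ch q).source) {ν : Phase n}
    (hν : fderiv ℝ (h ∘ (ch q).symm) (ch q (σ.toFun θ)) ν ≠ 0) :
    liouville h e σ.toFun θ = frameDensity e (fderiv ℝ (h ∘ (ch q).symm) (ch q (σ.toFun θ))) ν
      (fibProj n (ch q (σ.toFun θ))) (fderiv ℝ (ch q ∘ σ.toFun) θ) := by
  set T := trD q (σ.toFun θ) with hT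
  have hβ : (mfd h (σ.toFun θ)).comp T = fderiv ℝ (h ∘ (ch q).symm) (ch q (σ.toFun θ)) :=
    ContinuousLinearMap.ext fun v =>
      mfderiv_trD (hh.mdifferentiableAt (σ.mem_punctured hθ)) hq v
  have hβ' : ∀ v, mfd h (σ.toFun θ) (T v) = fderiv ℝ (h ∘ (ch q).symm) (ch q (σ.toFun θ)) v :=
    fun v => DFunLike.congr_fun hβ v
  have hρ : (radial (σ.toFun θ) : Phase n) = T (fibProj n (ch q (σ.toFun θ))) := radial_eq hq
  have hinj := σ.frame_injective_ch hh hθ hq hν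
  have hframe : frame (T ν) (T (fibProj n (ch q (σ.toFun θ))))
      (T.comp (fderiv ℝ (ch q ∘ σ.toFun) θ)) =
        T.comp (frame ν (fibProj n (ch q (σ.toFun θ))) (fderiv ℝ (ch q ∘ σ.toFun) θ)) := by
    refine ContinuousLinearMap.ext fun y => ?_
    simp only [frame_apply, ContinuousLinearMap.comp_apply, map_add, map_smul]
  have hTν : mfd h (σ.toFun θ) (T ν) ≠ 0 := by rwa [hβ']
  rw [liouville, σ.mfdInto_eq hθ hq, hρ, frameDensity_independent e (ν := T ν)]
  · rw [frameDensity_map, abs_det_trD hq, one_mul, hβ]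
  · rw [hβ']
    exact hh.fderiv_fibProj ((ch q).map_source hq) (ch_snd_ne_zero (σ.mem_punctured hθ) hq)
  · intro v
    rw [ContinuousLinearMap.comp_apply, hβ']
    exact σ.fderiv_ham_ch hh hθ hq v
  · exact hTν
  · exact Classical.epsilon_spec (p := fun ν => mfd h (σ.toFun θ) ν ≠ 0) ⟨_, hTν⟩
  · rw [hframe]
    exact (trD_injective hq).comp hinj

theorem LocalParam.liouville_eventuallyEq (hh : IsHamiltonian h) (hθ : θ ∈ σ.dom)
    (hq : σ.toFun θ ∈ (ch q).source) {ν : Phase n}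
    (hν : fderiv ℝ (h ∘ (ch q).symm) (ch q (σ.toFun θ)) ν ≠ 0) :
    ∀ᶠ η in 𝓝 θ, η ∈ σ.dom ∧ σ.toFun η ∈ (ch (n := n) q).source ∧
      fderiv ℝ (h ∘ (ch q).symm) (ch q (σ.toFun η)) ν ≠ 0 ∧
      liouville h e σ.toFun η = frameDensity e (fderiv ℝ (h ∘ (ch q).symm) (ch q (σ.toFun η))) ν
        (fibProj n (ch q (σ.toFun η))) (fderiv ℝ (ch q ∘ σ.toFun) η) := by
  have h1 : ContinuousAt (fun η => fderiv ℝ (h ∘ (ch q).symm) (ch q (σ.toFun η)) ν) θ := by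
    have h2 : ContDiffAt ℝ ∞ (fderiv ℝ (h ∘ (ch q).symm)) ((ch q ∘ σ.toFun) θ) :=
      contDiffAt_fderiv_infty (hh.contDiffAt ((ch q).map_source hq)
        (ch_snd_ne_zero (σ.mem_punctured hθ) hq))
    exact ((h2.comp θ (σ.contDiffAt_ch hθ hq)).clm_apply contDiffAt_const).continuousAt
  filter_upwards [σ.eventually_source hθ hq, h1.eventually_ne hν] with η h3 h4
  exact ⟨h3.1, h3.2, h4, σ.liouville_eq e hh h3.1 h3.2 h4⟩

theorem LocalParam.contDiffAt_liouville (hh : IsHamiltonian h) (hcrit : ZeroNotCritical h)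
    (hθ : θ ∈ σ.dom) : ContDiffAt ℝ ∞ (liouville h e σ.toFun) θ := by
  have hq := mem_ch_source (σ.toFun θ)
  obtain ⟨ν, hν⟩ := exists_fderiv_ham_ne_zero hh hcrit (σ.mem_shell θ hθ) hq
  have h2 : ContDiffAt ℝ ∞ (fderiv ℝ (h ∘ (ch (σ.toFun θ).1).symm))
      ((ch (σ.toFun θ).1 ∘ σ.toFun) θ) :=
    contDiffAt_fderiv_infty (hh.contDiffAt ((ch _).map_source hq)
      (ch_snd_ne_zero (σ.mem_punctured hθ) hq))
  have hσ := σ.contDiffAt_ch hθ hq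
  have h1 := contDiffAt_frameDensity e (x := θ) (ν := ν) (h2.comp θ hσ)
    ((fibProj n).contDiff.contDiffAt.comp θ hσ)
    (contDiffAt_fderiv_infty hσ) hν (σ.frame_injective_ch hh hθ hq hν)
  refine h1.congr_of_eventuallyEq ?_
  filter_upwards [σ.liouville_eventuallyEq e hh hθ hq hν] with η hη
  exact hη.2.2.2

theorem LocalParam.liouville_pos (hh : IsHamiltonian h) (hcrit : ZeroNotCritical h)
    (hθ : θ ∈ σ.dom) : 0 < liouville h e σ.toFun θ := by
  have hq := mem_ch_source (σ.toFun θ)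
  obtain ⟨ν, hν⟩ := exists_fderiv_ham_ne_zero hh hcrit (σ.mem_shell θ hθ) hq
  rw [σ.liouville_eq e hh hθ hq hν]
  exact frameDensity_pos e hν (σ.frame_injective_ch hh hθ hq hν)

/-- Change of variables for the Liouville density. -/
theorem LocalParam.liouville_compat (hh : IsHamiltonian h) (hcrit : ZeroNotCritical h)
    (τ : LocalParam h) {ψ : InfModel n → InfModel n} {s : InfModel n → ℝ} (hθ : θ ∈ σ.dom)
    (hψθ : ψ θ ∈ τ.dom) (hψ : DifferentiableAt ℝ ψ θ) (hs : DifferentiableAt ℝ s θ)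
    (hs0 : 0 < s θ) (heq : ∀ᶠ η in 𝓝 θ, τ.toFun (ψ η) = dilate (s η) (σ.toFun η)) :
    liouville h e τ.toFun (ψ θ) * |(fderiv ℝ ψ θ).det| =
      s θ ^ n * liouville h e σ.toFun θ := by
  obtain ⟨q, hq⟩ : ∃ q, σ.toFun θ ∈ (ch (n := n) q).source := ⟨_, mem_ch_source _⟩
  obtain ⟨ν, hν⟩ := exists_fderiv_ham_ne_zero hh hcrit (σ.mem_shell θ hθ) hq
  have hθeq : τ.toFun (ψ θ) = dilate (s θ) (σ.toFun θ) := heq.self_of_nhds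
  have hqτ : τ.toFun (ψ θ) ∈ (ch (n := n) q).source := by
    rw [hθeq]
    exact (dilate_mem_ch_source _).2 hq
  set w := ch q (σ.toFun θ) with hw
  have hwt : w ∈ (ch (n := n) q).target := (ch q).map_source hq
  have hw0 : w.2 ≠ 0 := ch_snd_ne_zero (σ.mem_punctured hθ) hq
  have hτw : ch q (τ.toFun (ψ θ)) = dil (s θ) w := by rw [hθeq, ch_dilate]
  set D := fderiv ℝ ψ θ
  set Sσ := fderiv ℝ (ch q ∘ σ.toFun) θ
  set Sτ := fderiv ℝ (ch q ∘ τ.toFun) (ψ θ) with hSτ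
  have hβ : (fderiv ℝ (h ∘ (ch q).symm) (dil (s θ) w)).comp (dil (s θ)) =
      fderiv ℝ (h ∘ (ch q).symm) w := by
    have h2 : HasFDerivAt (h ∘ (ch q).symm) _ (dil (s θ) w) :=
      ((hh.contDiffAt (dil_mem_ch_target (s θ) hwt) (dil_snd_ne_zero hw0 hs0.ne')).differentiableAt
        (by simp)).hasFDerivAt
    refine ((h2.comp w (dil (n := n) (s θ)).hasFDerivAt).congr_of_eventuallyEq ?_).fderiv.symm
    filter_upwards [eventually_ch_target hwt hw0] with u hu
    exact (hh.comp_dil hu.1 hu.2 hs0).symm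
  have hντ : fderiv ℝ (h ∘ (ch q).symm) (dil (s θ) w) (dil (s θ) ν) ≠ 0 := by
    have := DFunLike.congr_fun hβ ν
    rw [ContinuousLinearMap.comp_apply] at this
    rwa [this]
  -- The relation τ ∘ ψ = s·σ is differentiated. Apart from the derivative of s, which only
  -- contributes in the radial direction and is absorbed by `frameDensity_reparam`, the two tangent
  -- maps differ by `dil`, whose determinant produces the factor s^n.
  have hS : Sτ.comp D + (0 : InfModel n →L[ℝ] ℝ).smulRight (dil (s θ) (fibProj n w)) =
      (dil (s θ)).comp (Sσ.comp (ContinuousLinearMap.id ℝ _) +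
        ((s θ)⁻¹ • fderiv ℝ s θ).smulRight (fibProj n w)) := by
    have h1 : HasFDerivAt (ch q ∘ τ.toFun) Sτ (ψ θ) :=
      ((τ.contDiffAt_ch hψθ hqτ).differentiableAt (by simp)).hasFDerivAt
    have h2 := h1.comp θ hψ.hasFDerivAt
    have hσ : HasFDerivAt (ch q ∘ σ.toFun) Sσ θ :=
      ((σ.contDiffAt_ch hθ hq).differentiableAt (by simp)).hasFDerivAt
    have h3 : HasFDerivAt (fun η => ((((ch q ∘ σ.toFun) η).1,
        s η • ((ch q ∘ σ.toFun) η).2) : Phase n)) _ θ :=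
      hσ.fst.prodMk (hs.hasFDerivAt.smul hσ.snd)
    have h4 := h3.congr_of_eventuallyEq (f₁ := (ch q ∘ τ.toFun) ∘ ψ) (by
      filter_upwards [heq] with η hη
      simp only [Function.comp_apply]
      rw [hη, ch_dilate, dil_apply])
    have h5 := h2.unique h4
    refine ContinuousLinearMap.ext fun v => ?_
    have h6 := DFunLike.congr_fun h5 v
    rw [add_apply, h6]
    simp only [dil_apply, ContinuousLinearMap.comp_apply, add_apply,
      ContinuousLinearMap.smulRight_apply, smul_apply, fibProj_apply, zero_apply, zero_smul,
      add_zero, ContinuousLinearMap.id_apply]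
    refine Prod.ext ?_ ?_
    · simp
    · simp [smul_smul, hs0.ne']
      rfl
  rw [τ.liouville_eq e hh hψθ hqτ (ν := dil (s θ) ν) (by rw [hτw]; exact hντ),
    σ.liouville_eq e hh hθ hq hν, hτw]
  have hρ : fibProj n (dil (s θ) w) = dil (s θ) (fibProj n w) := by
    simp only [dil_apply, fibProj_apply]
  rw [hρ, mul_comm, ← frameDensity_reparam e D 0, hS, frameDensity_map, hβ, frameDensity_reparam,
    det_dil, abs_of_pos (pow_pos hs0 n)]
  have : (ContinuousLinearMap.id ℝ (InfModel n)).det = 1 := by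
    rw [ContinuousLinearMap.det]
    exact LinearMap.det_id
  rw [this, abs_one, one_mul]

end LocalCoordinates

/-! ### The divergence of a generator -/

section DivergenceFormula

theorem coordDiv_eq_add_trace {d : ℕ} {m : EuclideanSpace ℝ (Fin d) → ℝ}
    {w : EuclideanSpace ℝ (Fin d) → EuclideanSpace ℝ (Fin d)} {θ : EuclideanSpace ℝ (Fin d)}
    (hm : DifferentiableAt ℝ m θ) (hw : DifferentiableAt ℝ w θ) :
    coordDiv m w θ = (m θ)⁻¹ * (fderiv ℝ m θ (w θ) +
      m θ * LinearMap.trace ℝ (EuclideanSpace ℝ (Fin d)) (fderiv ℝ w θ)) := by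
  have h1 : ∀ i : Fin d, fderiv ℝ (fun x => m x * w x i) θ (EuclideanSpace.single i 1) =
      w θ i * fderiv ℝ m θ (EuclideanSpace.single i 1) +
        m θ * (fderiv ℝ w θ (EuclideanSpace.single i 1)) i := by
    intro i
    have h2 : HasFDerivAt (fun x => w x i)
        ((EuclideanSpace.proj i : EuclideanSpace ℝ (Fin d) →L[ℝ] ℝ).comp (fderiv ℝ w θ)) θ :=
      (EuclideanSpace.proj i : EuclideanSpace ℝ (Fin d) →L[ℝ] ℝ).hasFDerivAt.comp θ hw.hasFDerivAt
    have h3 : HasFDerivAt (fun x => m x * w x i) _ θ := hm.hasFDerivAt.mul h2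
    rw [h3.fderiv]
    simp only [add_apply, smul_apply, ContinuousLinearMap.comp_apply, smul_eq_mul]
    rw [add_comm]
    rfl
  have h3 : w θ = ∑ i, w θ i • EuclideanSpace.single i (1 : ℝ) := by
    have := (EuclideanSpace.basisFun (Fin d) ℝ).sum_repr (w θ)
    simpa using this.symm
  have h4 : LinearMap.trace ℝ (EuclideanSpace ℝ (Fin d)) (fderiv ℝ w θ) =
      ∑ i, (fderiv ℝ w θ (EuclideanSpace.single i 1)) i := by
    rw [LinearMap.trace_eq_matrix_trace ℝ (EuclideanSpace.basisFun (Fin d) ℝ).toBasis,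
      Matrix.trace]
    refine Finset.sum_congr rfl fun i _ => ?_
    simp [LinearMap.toMatrix_apply]
  rw [coordDiv, Finset.sum_congr rfl fun i _ => h1 i, Finset.sum_add_distrib, h4, Finset.mul_sum]
  congr 2
  conv_rhs => rw [h3, map_sum]
  refine Finset.sum_congr rfl fun i _ => ?_
  rw [map_smul, smul_eq_mul]

variable {h : Cotangent n M → ℝ} (σ : LocalParam h) {θ : InfModel n} {q : M}
  (e : (ℝ × ℝ × InfModel n) ≃L[ℝ] Phase n)

/-- X_h is tangent to Σ₀, so its component transversal to Σ₀ vanishes. What remains is a field b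
along the section, the projection of X_h to Z₀, and a radial part of rate a. -/
theorem LocalParam.exists_decomposition (e : (ℝ × ℝ × InfModel n) ≃L[ℝ] Phase n) (hh : IsHamiltonian h) (hcrit : ZeroNotCritical h)
    (hθ : θ ∈ σ.dom) (hq : σ.toFun θ ∈ (ch q).source) :
    ∃ (a : InfModel n → ℝ) (b : InfModel n → InfModel n), ContDiffAt ℝ ∞ a θ ∧
      ContDiffAt ℝ ∞ b θ ∧ ∀ᶠ η in 𝓝 θ, fderiv ℝ (ch q ∘ σ.toFun) η (b η) +
        a η • fibProj n (ch q (σ.toFun η)) = hamCoord h q (ch q (σ.toFun η)) := by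
  obtain ⟨ν, hν⟩ := exists_fderiv_ham_ne_zero hh hcrit (σ.mem_shell θ hθ) hq
  have hσ := σ.contDiffAt_ch hθ hq
  have hX : ContDiffAt ℝ ∞ (hamCoord h q) ((ch q ∘ σ.toFun) θ) :=
    contDiffAt_hamCoord hh ((ch q).map_source hq) (ch_snd_ne_zero (σ.mem_punctured hθ) hq)
  obtain ⟨y, hy, hyeq⟩ := contDiffAt_frame_inverse e (x := θ) (ν := ν)
    ((fibProj n).contDiff.contDiffAt.comp θ hσ) (contDiffAt_fderiv_infty hσ)
    (hX.comp θ hσ) (σ.frame_injective_ch hh hθ hq hν)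
  refine ⟨fun η => (y η).2.1, fun η => (y η).2.2, hy.snd.fst, hy.snd.snd, ?_⟩
  filter_upwards [σ.liouville_eventuallyEq e hh hθ hq hν] with η hη
  obtain ⟨hd, hs, hνη, -⟩ := hη
  have h1 := hyeq η (σ.frame_injective_ch hh hd hs hνη)
  simp only [frame_apply, Function.comp_apply] at h1
  have h2 := congrArg (fderiv ℝ (h ∘ (ch q).symm) (ch q (σ.toFun η))) h1
  rw [map_add, map_add, map_smul, map_smul, fderiv_hamCoord_self,
    hh.fderiv_fibProj ((ch q).map_source hs) (ch_snd_ne_zero (σ.mem_punctured hd) hs),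
    σ.fderiv_ham_ch hh hd hs, smul_zero, add_zero, add_zero, smul_eq_mul] at h2
  have h3 : (y η).1 = 0 := (mul_eq_zero.1 h2).resolve_right hνη
  rw [h3, zero_smul, zero_add, add_comm] at h1
  exact h1

theorem LocalParam.coordExpr_iff (hh : IsHamiltonian h) (hθ : θ ∈ σ.dom)
    (hq : σ.toFun θ ∈ (ch q).source) (v : InfModel n) (t : ℝ) :
    (∃ c : ℝ, mfderiv 𝓘(ℝ, InfModel n) (phaseModel n) σ.toFun θ v =
      t • hamField h (σ.toFun θ) + c • radial (σ.toFun θ)) ↔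
    ∃ c : ℝ, fderiv ℝ (ch q ∘ σ.toFun) θ v =
      t • hamCoord h q (ch q (σ.toFun θ)) + c • fibProj n (ch q (σ.toFun θ)) := by
  refine exists_congr fun c => ?_
  rw [mfderiv_eq_trD_comp ((σ.contMDiffAt hθ).mdifferentiableAt (by simp)) hq v,
    hamField_eq (hh.mdifferentiableAt (σ.mem_punctured hθ)) hq, radial_eq hq]
  refine Iff.trans ?_ (trD_injective hq).eq_iff
  rw [map_add, map_smul, map_smul]
  exact Iff.rfl

theorem fderiv_comp_param {k : Cotangent n M → ℝ} (hθ : θ ∈ σ.dom)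
    (hq : σ.toFun θ ∈ (ch q).source)
    (hk : ContMDiffAt (phaseModel n) 𝓘(ℝ, ℝ) ∞ k (σ.toFun θ)) (v : InfModel n) :
    fderiv ℝ (fun η => k (σ.toFun η)) θ v =
      fderiv ℝ (k ∘ (ch q).symm) (ch q (σ.toFun θ)) (fderiv ℝ (ch q ∘ σ.toFun) θ v) := by
  have h1 : HasFDerivAt (k ∘ (ch q).symm) _ ((ch q ∘ σ.toFun) θ) :=
    (hasFDerivAt_comp_ch_symm (hk.mdifferentiableAt (by simp)) hq).differentiableAt.hasFDerivAt
  have h2 := h1.comp θ ((σ.contDiffAt_ch hθ hq).differentiableAt (by simp)).hasFDerivAt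
  have h3 : HasFDerivAt (fun η => k (σ.toFun η)) _ θ := h2.congr_of_eventuallyEq (by
    filter_upwards [σ.eventually_source hθ hq] with η hη
    simp only [Function.comp_apply]
    rw [(ch q).left_inv hη.2])
  rw [h3.fderiv]
  rfl

theorem fderiv_fibProj_of_eventually {k : Cotangent n M → ℝ} {z : Cotangent n M}
    (hq : z ∈ (ch q).source) (hk : MDifferentiableAt (phaseModel n) 𝓘(ℝ, ℝ) k z)
    (hhom : ∀ᶠ s : ℝ in 𝓝 1, k (dilate s z) = s * k z) :
    fderiv ℝ (k ∘ (ch q).symm) (ch q z) (fibProj n (ch q z)) = k z := by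
  have h1 : HasFDerivAt (k ∘ (ch q).symm) (fderiv ℝ (k ∘ (ch q).symm) (ch q z))
      (dil 1 (ch q z)) := by
    rw [dil_one']
    exact (hasFDerivAt_comp_ch_symm hk hq).differentiableAt.hasFDerivAt
  have h2 := h1.comp_hasDerivAt 1 (hasDerivAt_dil (ch q z) 1)
  have h3 : HasDerivAt (fun s : ℝ => s * k z) (k z) 1 := by
    simpa using (hasDerivAt_id (1 : ℝ)).mul_const (k z)
  refine h2.unique (h3.congr_of_eventuallyEq ?_)
  filter_upwards [hhom] with s hs
  simp only [Function.comp_apply]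
  rw [← hs, ← ch_dilate, (ch q).left_inv ((dilate_mem_ch_source s).2 hq)]

/-- By Euler's identity the radial part acts on a function of degree 1 as multiplication by a. On Z₀
the bracket thus becomes a derivation plus a term of order zero. -/
theorem LocalParam.poisson_decomposition (hh : IsHamiltonian h) {k : Cotangent n M → ℝ}
    (hθ : θ ∈ σ.dom) (hq : σ.toFun θ ∈ (ch q).source)
    (hk : ContMDiffAt (phaseModel n) 𝓘(ℝ, ℝ) ∞ k (σ.toFun θ))
    (hhom : ∀ᶠ s : ℝ in 𝓝 1, k (dilate s (σ.toFun θ)) = s * k (σ.toFun θ))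
    {a : ℝ} {b : InfModel n} (hab : fderiv ℝ (ch q ∘ σ.toFun) θ b +
        a • fibProj n (ch q (σ.toFun θ)) = hamCoord h q (ch q (σ.toFun θ))) :
    poisson h k (σ.toFun θ) = fderiv ℝ (fun η => k (σ.toFun η)) θ b + a * k (σ.toFun θ) := by
  rw [poisson_eq (hh.mdifferentiableAt (σ.mem_punctured hθ)) (hk.mdifferentiableAt (by simp)) hq,
    ← hab, map_add, map_smul, fderiv_fibProj_of_eventually hq (hk.mdifferentiableAt (by simp)) hhom,
    fderiv_comp_param σ hθ hq hk, smul_eq_mul]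

/-- X_h has no divergence and `fibProj` has trace n, so `fderiv_frameDensity` applies. The result
says that b has divergence -(n-1)a with respect to the Liouville density. -/
theorem LocalParam.fderiv_liouville (hh : IsHamiltonian h) (hcrit : ZeroNotCritical h)
    (hθ : θ ∈ σ.dom) (hq : σ.toFun θ ∈ (ch q).source) {a : InfModel n → ℝ}
    {b : InfModel n → InfModel n} (ha : ContDiffAt ℝ ∞ a θ) (hb : ContDiffAt ℝ ∞ b θ)
    (hab : ∀ᶠ η in 𝓝 θ, fderiv ℝ (ch q ∘ σ.toFun) η (b η) +
        a η • fibProj n (ch q (σ.toFun η)) = hamCoord h q (ch q (σ.toFun η))) :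
    fderiv ℝ (liouville h e σ.toFun) θ (b θ) = liouville h e σ.toFun θ *
      (-(n - 1) * a θ - LinearMap.trace ℝ (InfModel n) (fderiv ℝ b θ)) := by
  obtain ⟨ν, hν⟩ := exists_fderiv_ham_ne_zero hh hcrit (σ.mem_shell θ hθ) hq
  have hσ := σ.contDiffAt_ch hθ hq
  have hw : (ch q ∘ σ.toFun) θ ∈ (ch (n := n) q).target := (ch q).map_source hq
  have hw0 : ((ch q ∘ σ.toFun) θ).2 ≠ 0 := ch_snd_ne_zero (σ.mem_punctured hθ) hq
  have hS := contDiffAt_fderiv_infty hσ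
  have hc := hh.contDiffAt hw hw0
  have key := fderiv_frameDensity e (σ := ch q ∘ σ.toFun) (S := fderiv ℝ (ch q ∘ σ.toFun))
    (X := hamCoord h q) (Pi := fibProj n) (β := fderiv ℝ (h ∘ (ch q).symm)) (a := a) (b := b)
    (θ := θ) (ν := ν) (m := n)
    (hσ.differentiableAt (by simp)).hasFDerivAt (hS.differentiableAt (by simp)).hasFDerivAt
    (fderiv_symmetric hσ)
    ((contDiffAt_hamCoord hh hw hw0).differentiableAt (by simp)).hasFDerivAt
    ((contDiffAt_fderiv_infty hc).differentiableAt (by simp)).hasFDerivAt (fderiv_symmetric hc)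
    (ha.differentiableAt (by simp)).hasFDerivAt (hb.differentiableAt (by simp)).hasFDerivAt hab
    (Eventually.of_forall (fderiv_hamCoord_self h q))
    ((eventually_ch_target hw hw0).mono fun u hu => hh.fderiv_fibProj hu.1 hu.2)
    (σ.fderiv_ham_ch hh hθ hq) hν (fun _ => rfl) (fderiv_hamCoord_fibProj hh hw hw0)
    (trace_fderiv_hamCoord hh hw hw0) trace_fibProj (σ.frame_injective_ch hh hθ hq hν)
  have h1 : liouville h e σ.toFun =ᶠ[𝓝 θ] fun η => frameDensity e
      (fderiv ℝ (h ∘ (ch q).symm) ((ch q ∘ σ.toFun) η)) ν (fibProj n ((ch q ∘ σ.toFun) η))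
        (fderiv ℝ (ch q ∘ σ.toFun) η) :=
    (σ.liouville_eventuallyEq e hh hθ hq hν).mono fun η hη => hη.2.2.2
  rw [h1.fderiv_eq, key.2, h1.self_of_nhds]

theorem LocalParam.exists_coordExpr (hh : IsHamiltonian h) (hcrit : ZeroNotCritical h)
    (e : (ℝ × ℝ × InfModel n) ≃L[ℝ] Phase n) (f : Cotangent n M → ℝ) :
    ∃ w, IsCoordExpr h f σ w := by
  have h1 : ∀ θ, ∃ v : InfModel n, θ ∈ σ.dom →
      ∃ c : ℝ, mfderiv 𝓘(ℝ, InfModel n) (phaseModel n) σ.toFun θ v =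
        f (σ.toFun θ) • hamField h (σ.toFun θ) + c • radial (σ.toFun θ) := by
    intro θ
    by_cases hθ : θ ∈ σ.dom
    · obtain ⟨a, b, -, -, hab⟩ := σ.exists_decomposition e hh hcrit hθ (mem_ch_source _)
      refine ⟨f (σ.toFun θ) • b θ, fun _ => ?_⟩
      rw [σ.coordExpr_iff hh hθ (mem_ch_source _)]
      refine ⟨-(f (σ.toFun θ) * a θ), ?_⟩
      rw [← hab.self_of_nhds, map_smul]
      module
    · exact ⟨0, fun h => absurd h hθ⟩
  choose w hw using h1
  exact ⟨w, hw⟩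

/-- The divergence of the projection of `f X_h` with respect to the density attached to `g`. -/
theorem LocalParam.coordDiv_eq (hh : IsHamiltonian h) (hcrit : ZeroNotCritical h)
    {f f' g : Cotangent n M → ℝ} {w : InfModel n → InfModel n} {m : InfModel n → ℝ}
    (hθ : θ ∈ σ.dom) (hw : IsCoordExpr h f σ w)
    (hf : ContMDiffAt (phaseModel n) 𝓘(ℝ, ℝ) ∞ f' (σ.toFun θ))
    (hg : ContMDiffAt (phaseModel n) 𝓘(ℝ, ℝ) ∞ g (σ.toFun θ))
    (hff' : ∀ᶠ η in 𝓝 θ, f (σ.toFun η) = f' (σ.toFun η)) (hg0 : 0 < g (σ.toFun θ))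
    (hm : ∀ᶠ η in 𝓝 θ, m η = (g (σ.toFun η) ^ n)⁻¹ * liouville h e σ.toFun η)
    (hhomf : ∀ᶠ s : ℝ in 𝓝 1, f' (dilate s (σ.toFun θ)) = s * f' (σ.toFun θ))
    (hhomg : ∀ᶠ s : ℝ in 𝓝 1, g (dilate s (σ.toFun θ)) = s * g (σ.toFun θ)) :
    coordDiv m w θ = poisson h f' (σ.toFun θ) -
      n * f' (σ.toFun θ) / g (σ.toFun θ) * poisson h g (σ.toFun θ) := by
  set q := (σ.toFun θ).1
  have hq : σ.toFun θ ∈ (ch q).source := mem_ch_source _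
  obtain ⟨a, b, ha, hb, hab⟩ := σ.exists_decomposition e hh hcrit hθ hq
  have hF : ContDiffAt ℝ ∞ (fun η => f' (σ.toFun η)) θ := (hf.comp θ (σ.contMDiffAt hθ)).contDiffAt
  have hG : ContDiffAt ℝ ∞ (fun η => g (σ.toFun η)) θ := (hg.comp θ (σ.contMDiffAt hθ)).contDiffAt
  -- The section is transversal to the rays, so a coordinate expression is unique and equals f b.
  -- This makes the pointwise given w smooth near θ.
  have hwb : w =ᶠ[𝓝 θ] fun η => f' (σ.toFun η) • b η := by
    filter_upwards [hab, σ.eventually_source hθ hq, hff'] with η h1 h2 h3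
    obtain ⟨c, hc⟩ := (σ.coordExpr_iff hh h2.1 h2.2 _ _).1 (hw η h2.1)
    rw [← sub_eq_zero]
    refine σ.immersive_ch h2.1 h2.2 _ (f' (σ.toFun η) * a η + c) ?_
    rw [map_sub, map_smul, hc, ← h1, h3]
    module
  have hdG := (hG.differentiableAt (by simp)).hasFDerivAt
  have hdF := (hF.differentiableAt (by simp)).hasFDerivAt
  have hdb := (hb.differentiableAt (by simp)).hasFDerivAt
  have hdL := ((σ.contDiffAt_liouville e hh hcrit hθ).differentiableAt (by simp)).hasFDerivAt
  have hdm := ((((hasDerivAt_inv (pow_ne_zero n hg0.ne')).comp_hasFDerivAt θ (hdG.pow n)).mul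
    hdL)).congr_of_eventuallyEq hm
  have hdw := (hdF.smul hdb).congr_of_eventuallyEq hwb
  have hmθ := hm.self_of_nhds
  rw [coordDiv_eq_add_trace hdm.differentiableAt hdw.differentiableAt, hdm.fderiv, hdw.fderiv,
    hwb.self_of_nhds, σ.poisson_decomposition hh hθ hq hf hhomf hab.self_of_nhds,
    σ.poisson_decomposition hh hθ hq hg hhomg hab.self_of_nhds, hmθ]
  have hlam := σ.fderiv_liouville e hh hcrit hθ hq ha hb hab
  have hlampos := σ.liouville_pos e hh hcrit hθ
  have htr : LinearMap.trace ℝ (InfModel n)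
      ((f' (σ.toFun θ) • fderiv ℝ b θ +
        (fderiv ℝ (fun η => f' (σ.toFun η)) θ).smulRight (b θ) : InfModel n →L[ℝ] InfModel n) :
          InfModel n →ₗ[ℝ] InfModel n) =
      f' (σ.toFun θ) * LinearMap.trace ℝ (InfModel n) (fderiv ℝ b θ) +
        fderiv ℝ (fun η => f' (σ.toFun η)) θ (b θ) := by
    rw [ContinuousLinearMap.toLinearMap_add, ContinuousLinearMap.toLinearMap_smul, map_add,
      map_smul, smul_eq_mul]
    congr 1
    exact LinearMap.trace_smulRight _ _
  rw [htr]
  simp only [add_apply, smul_apply, map_smul, smul_eq_mul, Function.comp_apply]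
  rw [hlam]
  set G := g (σ.toFun θ)
  set L := liouville h e σ.toFun θ
  -- The derivative of the n-th power carries the truncated exponent `n - 1`, so n = 0 is treated
  -- apart.
  obtain ⟨k, rfl⟩ | rfl : (∃ k, n = k + 1) ∨ n = 0 := by
    cases n with
    | zero => exact Or.inr rfl
    | succ k => exact Or.inl ⟨k, rfl⟩
  · simp only [Nat.add_sub_cancel, nsmul_eq_mul]
    push_cast
    field_simp
    ring
  · simp
    field_simp
    ring

end DivergenceFormula

/-! ### Cones over subsets of `Z₀` -/

section Cones

variable {h : Cotangent n M → ℝ}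

theorem dilate_mem_shell (hh : IsHamiltonian h) {z : Cotangent n M} (hz : z ∈ shell h) {s : ℝ}
    (hs : 0 < s) : dilate s z ∈ shell h :=
  ⟨(dilate_mem_punctured hs.ne').2 hz.1, (hh.homogeneous s hs z hz.1).trans hz.2⟩

theorem proj_dilate {z : Cotangent n M} (hz : z ∈ shell h) {s : ℝ} (hs : 0 < s)
    (hz' : dilate s z ∈ shell h) : proj h ⟨dilate s z, hz'⟩ = proj h ⟨z, hz⟩ :=
  (Quotient.sound (show (rayRel h).r ⟨z, hz⟩ ⟨dilate s z, hz'⟩ from ⟨s, hs, rfl⟩)).symm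

theorem coneOver_mono {O O' : Set (Infinity h)} (hO : O ⊆ O') : coneOver h O ⊆ coneOver h O' :=
  fun _ ⟨hz, hzO⟩ => ⟨hz, hO hzO⟩

theorem dilate_mem_coneOver (hh : IsHamiltonian h) {O : Set (Infinity h)} {z : Cotangent n M}
    (hz : z ∈ coneOver h O) {s : ℝ} (hs : 0 < s) : dilate s z ∈ coneOver h O := by
  obtain ⟨hz1, hz2⟩ := hz
  refine ⟨dilate_mem_shell hh hz1 hs, ?_⟩
  rw [proj_dilate hz1 hs]
  exact hz2

theorem continuous_proj : Continuous (proj h) := continuous_quotient_mk'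

theorem exists_isOpen_coneOver {O : Set (Infinity h)} (hO : IsOpen O) :
    ∃ W : Set (Cotangent n M), IsOpen W ∧ coneOver h O = W ∩ shell h := by
  obtain ⟨W, hW, hWO⟩ := isOpen_induced_iff.1 (hO.preimage continuous_proj)
  refine ⟨W, hW, Set.ext fun z => ⟨fun ⟨hz, hzO⟩ => ⟨?_, hz⟩, fun ⟨hzW, hz⟩ => ⟨hz, ?_⟩⟩⟩
  · exact (hWO.symm ▸ hzO : (⟨z, hz⟩ : shell h) ∈ Subtype.val ⁻¹' W)
  · exact (hWO ▸ hzW : (⟨z, hz⟩ : shell h) ∈ proj h ⁻¹' O)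

theorem continuous_dilate_left (z : Cotangent n M) : Continuous (fun s : ℝ => dilate s z) :=
  contMDiff_dilate.continuous.comp (Continuous.prodMk_left z)

theorem eventually_dilate_mem {U : Set (Cotangent n M)} (hU : IsOpen U) {z : Cotangent n M}
    (hz : z ∈ U) : ∀ᶠ s : ℝ in 𝓝 1, 0 < s ∧ dilate s z ∈ U := by
  refine (lt_mem_nhds one_pos).and ?_
  have h1 := (continuous_dilate_left z).continuousAt (x := (1 : ℝ))
  refine h1.eventually_mem ?_
  rw [dilate_one]
  exact hU.mem_nhds hz

/-- A local extension of a homogeneous function is homogeneous along the ray at points of `Σ₀`. -/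
theorem eventually_homogeneous (hh : IsHamiltonian h) {O : Set (Infinity h)}
    {k k' : Cotangent n M → ℝ}
    (hk : ∀ s : ℝ, 0 < s → ∀ z ∈ coneOver h O, k (dilate s z) = s * k z)
    {U : Set (Cotangent n M)} (hU : IsOpen U) (heq : EqOn k' k (U ∩ coneOver h O))
    {z : Cotangent n M} (hzU : z ∈ U) (hz : z ∈ coneOver h O) :
    ∀ᶠ s : ℝ in 𝓝 1, k' (dilate s z) = s * k' z := by
  filter_upwards [eventually_dilate_mem hU hzU] with s hs
  rw [heq ⟨hs.2, dilate_mem_coneOver hh hz hs.1⟩, heq ⟨hzU, hz⟩, hk s hs.1 z hz]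

theorem LocalParam.eventually_coneOver {O : Set (Infinity h)} (σ : LocalParam h)
    (hσ : σ.MapsInto O) {θ : InfModel n} (hθ : θ ∈ σ.dom) :
    ∀ᶠ η in 𝓝 θ, σ.toFun η ∈ coneOver h O :=
  (σ.eventually_dom hθ).mono fun η hη => hσ η hη

/-- The density attached to a positive function that is homogeneous of degree one. -/
def densityOf (hh : IsHamiltonian h) (hcrit : ZeroNotCritical h)
    (e : (ℝ × ℝ × InfModel n) ≃L[ℝ] Phase n) {O : Set (Infinity h)} {g : Cotangent n M → ℝ}
    (hg : IsGenerator h O g) : SmoothDensity h O where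
  coeff σ θ := (g (σ.toFun θ) ^ n)⁻¹ * liouville h e σ.toFun θ
  pos σ hσ θ hθ := mul_pos (inv_pos.2 (pow_pos (hg.pos _ (hσ θ hθ)) n))
    (σ.liouville_pos e hh hcrit hθ)
  smooth σ hσ θ hθ := by
    have h1 := hg.smooth.contDiffAt_comp (σ.contMDiffAt hθ) (σ.eventually_coneOver hσ hθ)
    exact (((h1.pow n).inv (pow_ne_zero n (hg.pos _ (hσ θ hθ)).ne')).mul
      (σ.contDiffAt_liouville e hh hcrit hθ)).contDiffWithinAt
  compat σ τ hσ hτ V ψ hV hVσ hψ hψτ hrel θ hθ := by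
    obtain ⟨s, hs⟩ : ∃ s : InfModel n → ℝ, ∀ θ ∈ V, 0 < s θ ∧
        τ.toFun (ψ θ) = dilate (s θ) (σ.toFun θ) := by
      choose! s hs using hrel
      exact ⟨s, hs⟩
    have hψθ : ContDiffAt ℝ ∞ ψ θ := hψ.contDiffAt (hV.mem_nhds hθ)
    have h1 := hg.smooth.contDiffAt_comp (σ.contMDiffAt (hVσ hθ))
      (σ.eventually_coneOver hσ (hVσ hθ))
    have h2 := (hg.smooth.contDiffAt_comp (τ.contMDiffAt (hψτ hθ))
      (τ.eventually_coneOver hτ (hψτ hθ))).comp θ hψθ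
    have hg0 := hg.pos _ (hσ θ (hVσ hθ))
    -- The factor s is chosen pointwise, but the homogeneity of g exhibits it as the quotient
    -- g(τψ)/g(σ), which is smooth. The s^n of the Liouville density is then cancelled by that of
    -- g^n.
    have h3 : DifferentiableAt ℝ s θ := by
      refine ((h2.div h1 hg0.ne').differentiableAt (by simp)).congr_of_eventuallyEq ?_
      filter_upwards [hV.mem_nhds hθ] with η hη
      have := (hg.pos _ (hσ η (hVσ hη))).ne'
      simp only [Pi.div_apply, Function.comp_apply]
      rw [(hs η hη).2, hg.homogeneous _ (hs η hη).1 _ (hσ η (hVσ hη)), mul_div_assoc, div_self this,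
        mul_one]
    have h4 := σ.liouville_compat e hh hcrit τ (hVσ hθ) (hψτ hθ)
      (hψθ.differentiableAt (by simp)) h3 (hs θ hθ).1
      ((hV.eventually_mem hθ).mono fun η hη => (hs η hη).2)
    have hs0 := (hs θ hθ).1
    rw [mul_assoc, h4, (hs θ hθ).2, hg.homogeneous _ hs0 _ (hσ θ (hVσ hθ)), mul_pow]
    field_simp

end Cones

/-! ### Local sections of `Σ₀ → Z₀` -/

section Sections

/-- The pair (α, β) maps onto ℝ², being triangular on ν and ρ, so its kernel has the dimension of V.
Any identification of the kernel with V, composed with a projection onto the kernel, serves as L. -/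
theorem exists_complementary_coordinates {P V : Type*} [NormedAddCommGroup P] [NormedSpace ℝ P]
    [FiniteDimensional ℝ P] [NormedAddCommGroup V] [NormedSpace ℝ V] [FiniteDimensional ℝ V]
    (e : (ℝ × ℝ × V) ≃L[ℝ] P) {α β : P →L[ℝ] ℝ} {ν ρ : P} (hαν : α ν ≠ 0) (hαρ : α ρ = 0)
    (hβρ : β ρ ≠ 0) : ∃ L : P →L[ℝ] V, ∀ v, α v = 0 → β v = 0 → L v = 0 → v = 0 := by
  let T : P →ₗ[ℝ] ℝ × ℝ := (α : P →ₗ[ℝ] ℝ).prod β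
  have hT : Function.Surjective T := by
    rintro ⟨x, y⟩
    refine ⟨(x / α ν) • ν + ((y - x / α ν * β ν) / β ρ) • ρ, ?_⟩
    have hTv : ∀ v, T v = (α v, β v) := fun _ => rfl
    rw [hTv]
    simp only [map_add, map_smul, smul_eq_mul, hαρ, mul_zero, add_zero]
    refine Prod.ext ?_ ?_
    · simp only; field_simp
    · simp only; field_simp; ring
  have h1 := T.finrank_range_add_finrank_ker
  rw [LinearMap.range_eq_top.2 hT, finrank_top, Module.finrank_prod, Module.finrank_self,
    ← e.toLinearEquiv.finrank_eq, Module.finrank_prod, Module.finrank_prod,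
    Module.finrank_self] at h1
  let ψ : LinearMap.ker T ≃ₗ[ℝ] V := LinearEquiv.ofFinrankEq _ _ (by omega)
  obtain ⟨g, hg⟩ := (LinearMap.ker T).subtype.exists_leftInverse_of_injective
    (Submodule.ker_subtype _)
  refine ⟨LinearMap.toContinuousLinearMap (ψ.toLinearMap ∘ₗ g), fun v h2 h3 h4 => ?_⟩
  have h5 : v ∈ LinearMap.ker T := by
    rw [LinearMap.mem_ker]
    exact Prod.ext h2 h3
  have h6 : ψ (g v) = 0 := h4
  have h7 : g v = ⟨v, h5⟩ := DFunLike.congr_fun hg ⟨v, h5⟩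
  rw [h7, map_eq_zero_iff _ ψ.injective] at h6
  exact congrArg Subtype.val h6

variable {h : Cotangent n M → ℝ}

/-- A local section of `Σ₀ → Z₀` through `z₀` with image over `O`, together with the coordinates on
`Z₀` that it defines, extended to a neighbourhood of the ray of `z₀` in `T*M`. -/
structure SectionAt (h : Cotangent n M → ℝ) (O : Set (Infinity h)) (z₀ : Cotangent n M) where
  param : LocalParam h
  mapsInto : param.MapsInto O
  coord : Cotangent n M → InfModel n
  nhd : Set (Cotangent n M)
  isOpen_nhd : IsOpen nhd
  mem_nhd : z₀ ∈ nhd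
  smooth : ContMDiffOn (phaseModel n) 𝓘(ℝ, InfModel n) ∞ coord nhd
  coord_mem : ∀ z ∈ nhd, coord z ∈ param.dom
  dilate_mem : ∀ s : ℝ, 0 < s → ∀ z ∈ nhd, dilate s z ∈ nhd
  coord_dilate : ∀ s : ℝ, 0 < s → ∀ z ∈ nhd, coord (dilate s z) = coord z
  exists_dilate : ∀ z ∈ nhd, z ∈ shell h → ∃ s : ℝ, 0 < s ∧ param.toFun (coord z) = dilate s z
  base : param.toFun (coord z₀) = z₀

/-- The functions h, ‖p‖ and L form local coordinates by the inverse function theorem: dh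
annihilates the radial direction, d‖p‖ does not, and L separates the common kernel. Freezing the
first two will give a section of Σ₀ → Z₀. -/
theorem exists_inverse_coordinates (e : (ℝ × ℝ × InfModel n) ≃L[ℝ] Phase n)
    (hh : IsHamiltonian h) (hcrit : ZeroNotCritical h) {z : Cotangent n M} (hz : z ∈ shell h)
    {q : M} (hq : z ∈ (ch q).source) : ∃ (L : Phase n →L[ℝ] InfModel n)
      (Ψ : OpenPartialHomeomorph (Phase n) (ℝ × ℝ × InfModel n)), ch q z ∈ Ψ.source ∧
      (∀ w, Ψ w = ((h ∘ (ch q).symm) w, ‖w.2‖, L w)) ∧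
      (∀ w ∈ Ψ.source, w ∈ (ch (n := n) q).target ∧ w.2 ≠ 0) ∧
      ∀ y ∈ Ψ.target, ContDiffAt ℝ ∞ Ψ.symm y := by
  set w₀ := ch q z
  have hw₀ : w₀ ∈ (ch (n := n) q).target := (ch q).map_source hq
  have h0 : w₀.2 ≠ 0 := ch_snd_ne_zero hz.1 hq
  have hN : ∀ w : Phase n, w.2 ≠ 0 → ContDiffAt ℝ ∞ (fun w : Phase n => ‖w.2‖) w :=
    fun w hw => (contDiffAt_dual_norm hw).comp w contDiffAt_snd
  obtain ⟨ν, hν⟩ := exists_fderiv_ham_ne_zero hh hcrit hz hq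
  have hNρ : fderiv ℝ (fun w : Phase n => ‖w.2‖) w₀ (fibProj n w₀) = ‖w₀.2‖ :=
    fderiv_fibProj_of_homogeneous ((hN _ h0).differentiableAt (by simp))
      (c := fun s => s * ‖w₀.2‖) (by simpa using (hasDerivAt_id (1 : ℝ)).mul_const ‖w₀.2‖)
      fun s hs => by rw [dil_apply, norm_smul, Real.norm_of_nonneg hs.le]
  obtain ⟨L, hL⟩ := exists_complementary_coordinates e hν (hh.fderiv_fibProj hw₀ h0)
    (by rw [hNρ]; exact norm_ne_zero_iff.2 h0)
  let B : Phase n → ℝ × ℝ × InfModel n := fun w => ((h ∘ (ch q).symm) w, ‖w.2‖, L w)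
  have hB : ∀ w ∈ (ch (n := n) q).target, w.2 ≠ 0 → ContDiffAt ℝ ∞ B w := fun w hw hw0 =>
    (hh.contDiffAt hw hw0).prodMk ((hN w hw0).prodMk L.contDiff.contDiffAt)
  have hBd : fderiv ℝ B w₀ = (fderiv ℝ (h ∘ (ch q).symm) w₀).prod
      ((fderiv ℝ (fun w : Phase n => ‖w.2‖) w₀).prod L) :=
    (((hh.contDiffAt hw₀ h0).differentiableAt (by simp)).hasFDerivAt.prodMk
      (((hN _ h0).differentiableAt (by simp)).hasFDerivAt.prodMk L.hasFDerivAt)).fderiv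
  have hinj : Function.Injective (fderiv ℝ B w₀) := by
    refine (injective_iff_map_eq_zero _).2 fun v hv => ?_
    rw [hBd] at hv
    exact hL v (congrArg Prod.fst hv) (congrArg (fun y => y.2.1) hv)
      (congrArg (fun y => y.2.2) hv)
  obtain ⟨A, hA⟩ : ∃ A : Phase n ≃L[ℝ] (ℝ × ℝ × InfModel n),
      (A : Phase n →L[ℝ] ℝ × ℝ × InfModel n) = fderiv ℝ B w₀ := by
    refine ⟨(LinearEquiv.ofInjectiveOfFinrankEq (fderiv ℝ B w₀ : Phase n →ₗ[ℝ] _) hinj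
      e.toLinearEquiv.finrank_eq.symm).toContinuousLinearEquiv, ?_⟩
    exact ContinuousLinearMap.ext fun v => rfl
  have hB₀ : HasFDerivAt B (A : Phase n →L[ℝ] ℝ × ℝ × InfModel n) w₀ := by
    rw [hA]
    exact ((hB w₀ hw₀ h0).differentiableAt (by simp)).hasFDerivAt
  let Ψ₀ := (hB w₀ hw₀ h0).toOpenPartialHomeomorph B hB₀ (by simp)
  -- The source is shrunk to the points where the differential is invertible, so that the inverse is
  -- smooth on the whole target and not only at one point.
  have hG : ∀ᶠ w in 𝓝 w₀, (w ∈ (ch (n := n) q).target ∧ w.2 ≠ 0) ∧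
      fderiv ℝ B w ∈ range ((↑) : (Phase n ≃L[ℝ] (ℝ × ℝ × InfModel n)) → _) := by
    refine (eventually_ch_target hw₀ h0).and ?_
    have h1 : ContinuousAt (fderiv ℝ B) w₀ :=
      (contDiffAt_fderiv_infty (hB w₀ hw₀ h0)).continuousAt
    refine h1.eventually_mem ?_
    rw [← hA]
    exact ContinuousLinearEquiv.nhds A
  obtain ⟨G, hG1, hG2, hG3⟩ := eventually_nhds_iff.1 hG
  have hΨ₀ : ∀ w, Ψ₀ w = B w := fun w => rfl
  refine ⟨L, Ψ₀.restrOpen G hG2, ?_, fun w => rfl, fun w hw => ?_, fun y hy => ?_⟩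
  · exact ⟨(hB w₀ hw₀ h0).mem_toOpenPartialHomeomorph_source hB₀ (by simp), hG3⟩
  · exact (hG1 w hw.2).1
  · have hw := (Ψ₀.restrOpen G hG2).map_target hy
    obtain ⟨⟨hw1, hw2⟩, A', hA'⟩ := hG1 _ hw.2
    refine (Ψ₀.restrOpen G hG2).contDiffAt_symm (f₀' := A') hy ?_ (hB _ hw1 hw2)
    rw [hA']
    exact ((hB _ hw1 hw2).differentiableAt (by simp)).hasFDerivAt

/-- The section is the slice h = 0, ‖p‖ = c in the coordinates above. A nearby point receives the
coordinates of its rescaling to ‖p‖ = c, which makes them constant on rays. -/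
theorem exists_sectionAt (e : (ℝ × ℝ × InfModel n) ≃L[ℝ] Phase n)
    (hh : IsHamiltonian h) (hcrit : ZeroNotCritical h) {O : Set (Infinity h)} (hO : IsOpen O)
    {z₀ : Cotangent n M} (hz₀ : z₀ ∈ coneOver h O) : Nonempty (SectionAt h O z₀) := by
  obtain ⟨W, hW, hWO⟩ := exists_isOpen_coneOver hO
  obtain ⟨q, hq⟩ : ∃ q, z₀ ∈ (ch (n := n) q).source := ⟨_, mem_ch_source _⟩
  have hzs : z₀ ∈ shell h := hz₀.1
  obtain ⟨L, Ψ, hΨ₀, hΨ, hsrc, hsm⟩ := exists_inverse_coordinates e hh hcrit hzs hq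
  set c := ‖(ch q z₀).2‖ with hc
  have hc0 : 0 < c := norm_pos_iff.2 (hsrc _ hΨ₀).2
  -- the open set of admissible parameters
  let j : InfModel n → ℝ × ℝ × InfModel n := fun θ => (0, c, θ)
  have hj : ContDiff ℝ ∞ j := contDiff_const.prodMk (contDiff_const.prodMk contDiff_id)
  let D : Set (InfModel n) := j ⁻¹' (Ψ.target ∩ Ψ.symm ⁻¹' (Ψ.source ∩
    ((ch (n := n) q).target ∩ (ch q).symm ⁻¹' W)))
  have hWopen : IsOpen ((ch (n := n) q).target ∩ (ch q).symm ⁻¹' W) :=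
    (contMDiffOn_ch_symm q).continuousOn.isOpen_inter_preimage (isOpen_ch_target q) hW
  have hD : IsOpen D :=
    (Ψ.isOpen_inter_preimage_symm (Ψ.open_source.inter hWopen)).preimage hj.continuous
  let σq : InfModel n → Phase n := fun θ => Ψ.symm (j θ)
  have hσq : ∀ θ ∈ D, σq θ ∈ Ψ.source ∧ σq θ ∈ (ch (n := n) q).target ∧
      (ch q).symm (σq θ) ∈ W ∧ Ψ (σq θ) = j θ := fun θ hθ =>
    ⟨hθ.2.1, hθ.2.2.1, hθ.2.2.2, Ψ.right_inv hθ.1⟩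
  have hσqs : ∀ θ ∈ D, ContDiffAt ℝ ∞ σq θ := fun θ hθ =>
    (hsm _ hθ.1).comp θ hj.contDiffAt
  have hval : ∀ θ ∈ D, (h ∘ (ch q).symm) (σq θ) = 0 ∧ ‖(σq θ).2‖ = c ∧ L (σq θ) = θ := by
    intro θ hθ
    have h1 := (hσq θ hθ).2.2.2
    rw [hΨ] at h1
    exact ⟨congrArg Prod.fst h1, congrArg (fun y => y.2.1) h1, congrArg (fun y => y.2.2) h1⟩
  have hshell : ∀ θ ∈ D, (ch q).symm (σq θ) ∈ shell h := fun θ hθ =>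
    ⟨ch_symm_mem_punctured (hσq θ hθ).2.1 (hsrc _ (hσq θ hθ).1).2, (hval θ hθ).1⟩
  have hsource : ∀ θ ∈ D, (ch q).symm (σq θ) ∈ (ch (n := n) q).source := fun θ hθ =>
    (ch q).map_target (hσq θ hθ).2.1
  have hchσ : ∀ θ ∈ D, ch q ((ch q).symm (σq θ)) = σq θ := fun θ hθ =>
    (ch q).right_inv (hσq θ hθ).2.1
  have hsmooth : ContMDiffOn 𝓘(ℝ, InfModel n) (phaseModel n) ∞ (fun θ => (ch q).symm (σq θ)) D :=
    fun θ hθ => ((contMDiffAt_ch_symm (hσq θ hθ).2.1).comp θ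
      (hσqs θ hθ).contMDiffAt).contMDiffWithinAt
  let σ : LocalParam h :=
    { dom := D
      toFun := fun θ => (ch q).symm (σq θ)
      isOpen_dom := hD
      mem_shell := hshell
      smooth := hsmooth
      inj := by
        intro θ hθ θ' hθ' s hs heq
        have h1 := congrArg (ch q) heq
        rw [ch_dilate, hchσ θ hθ, hchσ θ' hθ'] at h1
        have h2 := congrArg (fun w : Phase n => ‖w.2‖) h1
        simp only [dil_apply, norm_smul, Real.norm_of_nonneg hs.le, (hval θ hθ).2.1,
          (hval θ' hθ').2.1] at h2
        have h3 : s = 1 := by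
          field_simp at h2
          exact h2.symm
        rw [h3, dil_one'] at h1
        rw [← (hval θ hθ).2.2, ← (hval θ' hθ').2.2, h1]
      immersive := by
        intro θ hθ v t hv
        have hmd : MDifferentiableAt 𝓘(ℝ, InfModel n) (phaseModel n)
            (fun θ => (ch q).symm (σq θ)) θ :=
          (hsmooth.contMDiffAt (hD.mem_nhds hθ)).mdifferentiableAt (by simp)
        have h1 := mfderiv_eq_trD_comp hmd (hsource θ hθ) v
        rw [radial_eq (hsource θ hθ), hchσ θ hθ] at hv
        have h2 : trD q ((ch q).symm (σq θ))
            (fderiv ℝ (ch q ∘ fun θ => (ch q).symm (σq θ)) θ v - t • fibProj n (σq θ)) = 0 := by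
          rw [map_sub, map_smul, sub_eq_zero]
          exact h1.symm.trans hv
        have h3 := (map_eq_zero_iff _ (trD_injective (hsource θ hθ))).1 h2
        have h4 : fderiv ℝ (ch q ∘ fun θ => (ch q).symm (σq θ)) θ = fderiv ℝ σq θ :=
          Filter.EventuallyEq.fderiv_eq ((hD.eventually_mem hθ).mono hchσ)
        rw [h4, sub_eq_zero] at h3
        have hσd := ((hσqs θ hθ).differentiableAt (by simp)).hasFDerivAt
        -- Since ‖p‖ is constant along the section while its radial derivative is c ≠ 0, the
        -- coefficient t vanishes. Then v = 0, because L inverts the section.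
        have h5 : HasFDerivAt (fun η => ‖(σq η).2‖) _ θ :=
          (((contDiffAt_dual_norm (hsrc _ (hσq θ hθ).1).2).comp (σq θ)
            contDiffAt_snd).differentiableAt (by simp)).hasFDerivAt.comp θ hσd
        have h6 := h5.congr_of_eventuallyEq (f₁ := fun _ => c)
          ((hD.eventually_mem hθ).mono fun η hη => (hval η hη).2.1.symm)
        have h7 := DFunLike.congr_fun (h6.unique (hasFDerivAt_const c θ)) v
        have h8 : fderiv ℝ (fun w : Phase n => ‖w.2‖) (σq θ) (fibProj n (σq θ)) = c := by
          refine fderiv_fibProj_of_homogeneous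
            (((contDiffAt_dual_norm (hsrc _ (hσq θ hθ).1).2).comp (σq θ)
            contDiffAt_snd).differentiableAt (by simp))
            (c := fun s => s * c) (by simpa using (hasDerivAt_id (1 : ℝ)).mul_const c)
            fun s hs => ?_
          rw [dil_apply, norm_smul, Real.norm_of_nonneg hs.le, (hval θ hθ).2.1]
        have h9 : fderiv ℝ (fun w : Phase n => ‖w.2‖) (σq θ) (fderiv ℝ σq θ v) = 0 := h7
        rw [h3, map_smul, h8, smul_eq_mul] at h9
        have h10 : t = 0 := (mul_eq_zero.1 h9).resolve_right hc0.ne'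
        rw [h10, zero_smul] at h3
        have h11 : HasFDerivAt (fun η => L (σq η)) (L.comp (fderiv ℝ σq θ)) θ :=
          L.hasFDerivAt.comp θ hσd
        have h12 := h11.congr_of_eventuallyEq (f₁ := fun η => η)
          ((hD.eventually_mem hθ).mono fun η hη => (hval η hη).2.2.symm)
        have h13 := DFunLike.congr_fun (h12.unique (hasFDerivAt_id θ)) v
        rw [ContinuousLinearMap.comp_apply, h3, map_zero] at h13
        exact h13.symm }
  -- the coordinates
  let nrm : Phase n → Phase n := fun w => (w.1, (c / ‖w.2‖) • w.2)
  have hnrm_dil : ∀ w : Phase n, nrm w = dil (c / ‖w.2‖) w := fun w => (dil_apply _ _).symm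
  have hnrm : ∀ w : Phase n, w.2 ≠ 0 → ContDiffAt ℝ ∞ nrm w := fun w hw =>
    contDiffAt_fst.prodMk ((contDiffAt_const.div
      ((contDiffAt_dual_norm hw).comp w contDiffAt_snd) (norm_ne_zero_iff.2 hw)).smul
        contDiffAt_snd)
  let Θ : Cotangent n M → InfModel n := fun z => L (nrm (ch q z))
  let Y : Set (Phase n) := Ψ.source ∩ ((ch (n := n) q).target ∩ (ch q).symm ⁻¹' W)
  have hY : IsOpen Y := Ψ.open_source.inter hWopen
  let S : Set (Cotangent n M) := (ch (n := n) q).source ∩ punctured n M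
  have hS : IsOpen S := (isOpen_ch_source q).inter isOpen_punctured
  have hnS : ∀ z ∈ S, ContMDiffAt (phaseModel n) 𝓘(ℝ, Phase n) ∞ (fun z => nrm (ch q z)) z :=
    fun z hz => (hnrm _ (ch_snd_ne_zero hz.2 hz.1)).contMDiffAt.comp z (contMDiffAt_ch hz.1)
  have hΘS : ∀ z ∈ S, ContMDiffAt (phaseModel n) 𝓘(ℝ, InfModel n) ∞ Θ z :=
    fun z hz => L.contDiff.contDiffAt.contMDiffAt.comp z (hnS z hz)
  have hpair : ContinuousOn (fun z => (nrm (ch q z), Θ z)) S := fun z hz =>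
    ((hnS z hz).continuousAt.prodMk (hΘS z hz).continuousAt).continuousWithinAt
  have hU : IsOpen (S ∩ (fun z => (nrm (ch q z), Θ z)) ⁻¹' (Y ×ˢ D)) :=
    hpair.isOpen_inter_preimage hS (hY.prod hD)
  have hmem : ∀ z ∈ S, z ∈ shell h → nrm (ch q z) ∈ Y → Θ z ∈ D ∧
      (ch q).symm (σq (Θ z)) = dilate (c / ‖(ch q z).2‖) z := by
    intro z hzS hzs hzY
    have hn0 : 0 < ‖(ch q z).2‖ := norm_pos_iff.2 (ch_snd_ne_zero hzS.2 hzS.1)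
    have ht : (ch q z) ∈ (ch (n := n) q).target := (ch q).map_source hzS.1
    have h1 : Ψ (nrm (ch q z)) = j (Θ z) := by
      rw [hΨ]
      refine Prod.ext ?_ (Prod.ext ?_ rfl)
      · rw [hnrm_dil, hh.comp_dil ht (ch_snd_ne_zero hzS.2 hzS.1) (div_pos hc0 hn0)]
        simp only [Function.comp_apply]
        rw [(ch q).left_inv hzS.1, hzs.2]
      · simp only [nrm, norm_smul, norm_div, Real.norm_of_nonneg hc0.le, norm_norm, j]
        field_simp
    have h2 : Ψ.symm (j (Θ z)) = nrm (ch q z) := by rw [← h1, Ψ.left_inv hzY.1]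
    refine ⟨⟨?_, ?_⟩, ?_⟩
    · rw [← h1]; exact Ψ.map_source hzY.1
    · change Ψ.symm (j (Θ z)) ∈ Y
      rw [h2]
      exact hzY
    · change (ch q).symm (Ψ.symm (j (Θ z))) = _
      rw [h2, hnrm_dil, ch_symm_dil _ ht, (ch q).left_inv hzS.1]
  have hnrm0 : nrm (ch q z₀) = ch q z₀ := by
    simp only [nrm]
    rw [← hc, div_self hc0.ne', one_smul]
  have hY0 : nrm (ch q z₀) ∈ Y := by
    rw [hnrm0]
    refine ⟨hΨ₀, (ch q).map_source hq, ?_⟩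
    rw [mem_preimage, (ch q).left_inv hq]
    rw [hWO] at hz₀
    exact hz₀.1
  have hm0 := hmem z₀ ⟨hq, hzs.1⟩ hzs hY0
  have hdil : ∀ s : ℝ, 0 < s → ∀ z ∈ S, nrm (ch q (dilate s z)) = nrm (ch q z) := by
    intro s hs z hz
    have hn0 : 0 < ‖(ch q z).2‖ := norm_pos_iff.2 (ch_snd_ne_zero hz.2 hz.1)
    rw [ch_dilate]
    simp only [nrm, dil_apply, norm_smul, Real.norm_of_nonneg hs.le, smul_smul]
    congr 2
    field_simp
  refine ⟨{ param := σ, mapsInto := ?_, coord := Θ, nhd := _, isOpen_nhd := hU,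
            mem_nhd := ⟨⟨hq, hzs.1⟩, hY0, hm0.1⟩, smooth := ?_, coord_mem := ?_,
            dilate_mem := ?_, coord_dilate := ?_, exists_dilate := ?_, base := ?_ }⟩
  · intro θ hθ
    rw [hWO]
    exact ⟨(hσq θ hθ).2.2.1, hshell θ hθ⟩
  · exact fun z hz => (hΘS z hz.1).contMDiffWithinAt
  · exact fun z hz => hz.2.2
  · intro s hs z hz
    refine ⟨⟨(dilate_mem_ch_source s).2 hz.1.1, (dilate_mem_punctured hs.ne').2 hz.1.2⟩, ?_⟩
    have h1 := hdil s hs z hz.1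
    simp only [mem_preimage, Θ, h1]
    exact hz.2
  · intro s hs z hz
    simp only [Θ, hdil s hs z hz.1]
  · intro z hz hzs
    exact ⟨_, div_pos hc0 (norm_pos_iff.2 (ch_snd_ne_zero hz.1.2 hz.1.1)),
      (hmem z hz.1 hzs hz.2.1).2⟩
  · have := hm0.2
    rw [← hc, div_self hc0.ne', dilate_one] at this
    exact this

end Sections

/-! ### Local escape functions from weak hyperbolicity -/

section LocalEscape

/-! ### Operations on locally smooth functions on subsets of the cotangent bundle. -/

theorem LocSmooth.comp {F G : Type*} [NormedAddCommGroup F] [NormedSpace ℝ F]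
    [NormedAddCommGroup G] [NormedSpace ℝ G] {C : Set (Cotangent n M)} {k : Cotangent n M → F}
    (hk : LocSmooth C k) {P : Set F} (hP : IsOpen P) {Φ : F → G} (hΦ : ContDiffOn ℝ ∞ Φ P)
    (hkP : ∀ z ∈ C, k z ∈ P) : LocSmooth C (fun z => Φ (k z)) := by
  intro z hz
  obtain ⟨U, k', hU, hzU, hk', heq⟩ := hk z hz
  refine ⟨U ∩ k' ⁻¹' P, fun z => Φ (k' z), hk'.continuousOn.isOpen_inter_preimage hU hP,
    ⟨hzU, ?_⟩, fun w hw => ?_, fun w hw => ?_⟩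
  · rw [mem_preimage, heq ⟨hzU, hz⟩]
    exact hkP z hz
  · exact ((hΦ.contDiffAt (hP.mem_nhds hw.2)).contMDiffAt.comp w
      (hk'.contMDiffAt (hU.mem_nhds hw.1))).contMDiffWithinAt
  · simp only
    rw [heq ⟨hw.1.1, hw.2⟩]

theorem LocSmooth.prodMk {F G : Type*} [NormedAddCommGroup F] [NormedSpace ℝ F]
    [NormedAddCommGroup G] [NormedSpace ℝ G] {C : Set (Cotangent n M)} {k : Cotangent n M → F}
    {l : Cotangent n M → G} (hk : LocSmooth C k) (hl : LocSmooth C l) :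
    LocSmooth C (fun z => (k z, l z)) := by
  intro z hz
  obtain ⟨U, k', hU, hzU, hk', heq⟩ := hk z hz
  obtain ⟨V, l', hV, hzV, hl', heq'⟩ := hl z hz
  refine ⟨U ∩ V, fun z => (k' z, l' z), hU.inter hV, ⟨hzU, hzV⟩,
    (hk'.mono inter_subset_left).prodMk_space (hl'.mono inter_subset_right), fun w hw => ?_⟩
  simp only
  rw [heq ⟨hw.1.1, hw.2⟩, heq' ⟨hw.1.2, hw.2⟩]

theorem LocSmooth.mono {F : Type*} [NormedAddCommGroup F] [NormedSpace ℝ F]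
    {C C' : Set (Cotangent n M)} {k : Cotangent n M → F} (hk : LocSmooth C k) (hC : C' ⊆ C) :
    LocSmooth C' k := by
  intro z hz
  obtain ⟨U, k', hU, hzU, hk', heq⟩ := hk z (hC hz)
  exact ⟨U, k', hU, hzU, hk', heq.mono (inter_subset_inter_right U hC)⟩

variable {h : Cotangent n M → ℝ}

theorem coneOver_univ : coneOver h univ = shell h :=
  Set.ext fun _ => ⟨fun hz => hz.1, fun hz => ⟨hz, mem_univ _⟩⟩

/-- The Poisson bracket of an extension at the point of a local section. -/
theorem LocalParam.poisson_extension (hh : IsHamiltonian h) {O : Set (Infinity h)}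
    (σ : LocalParam h) (hσ : σ.MapsInto O) {θ : InfModel n} (hθ : θ ∈ σ.dom)
    {k k' : Cotangent n M → ℝ} (hk : ∀ s : ℝ, 0 < s → ∀ z ∈ coneOver h O, k (dilate s z) = s * k z)
    {U : Set (Cotangent n M)} (hU : IsOpen U) (hzU : σ.toFun θ ∈ U)
    (hk' : ContMDiffOn (phaseModel n) 𝓘(ℝ, ℝ) ∞ k' U) (heq : EqOn k' k (U ∩ coneOver h O))
    {a : ℝ} {b : InfModel n} (hab : fderiv ℝ (ch (σ.toFun θ).1 ∘ σ.toFun) θ b +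
        a • fibProj n (ch (σ.toFun θ).1 (σ.toFun θ)) =
          hamCoord h (σ.toFun θ).1 (ch (σ.toFun θ).1 (σ.toFun θ))) :
    poisson h k' (σ.toFun θ) = fderiv ℝ (fun η => k (σ.toFun η)) θ b + a * k (σ.toFun θ) := by
  have h1 : (fun η => k' (σ.toFun η)) =ᶠ[𝓝 θ] fun η => k (σ.toFun η) := by
    filter_upwards [σ.eventually_coneOver hσ hθ,
      (σ.contMDiffAt hθ).continuousAt.eventually_mem (hU.mem_nhds hzU)] with η h2 h3
    exact heq ⟨h3, h2⟩
  rw [σ.poisson_decomposition hh hθ (mem_ch_source _) (hk'.contMDiffAt (hU.mem_nhds hzU))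
    (eventually_homogeneous hh hk hU heq hzU (hσ θ hθ)) hab, h1.fderiv_eq]
  congr 2
  exact h1.self_of_nhds

/-- Through a section, either bracket is expressed by the values of k on the cone alone, so the
choice of local extension does not matter. -/
theorem poisson_congr (e : (ℝ × ℝ × InfModel n) ≃L[ℝ] Phase n)
    (hh : IsHamiltonian h) (hcrit : ZeroNotCritical h) {O : Set (Infinity h)} (hO : IsOpen O)
    {k k₁ k₂ : Cotangent n M → ℝ}
    (hk : ∀ s : ℝ, 0 < s → ∀ z ∈ coneOver h O, k (dilate s z) = s * k z)
    {U V : Set (Cotangent n M)} (hU : IsOpen U) (hV : IsOpen V) {z : Cotangent n M}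
    (hz : z ∈ coneOver h O) (hzU : z ∈ U) (hzV : z ∈ V)
    (hk₁ : ContMDiffOn (phaseModel n) 𝓘(ℝ, ℝ) ∞ k₁ U) (heq₁ : EqOn k₁ k (U ∩ coneOver h O))
    (hk₂ : ContMDiffOn (phaseModel n) 𝓘(ℝ, ℝ) ∞ k₂ V) (heq₂ : EqOn k₂ k (V ∩ coneOver h O)) :
    poisson h k₁ z = poisson h k₂ z := by
  obtain ⟨S⟩ := exists_sectionAt e hh hcrit hO hz
  have hθ := S.coord_mem z S.mem_nhd
  obtain ⟨a, b, -, -, hab⟩ := S.param.exists_decomposition e hh hcrit hθ (mem_ch_source _)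
  have h1 := S.param.poisson_extension hh S.mapsInto hθ hk hU (S.base.symm ▸ hzU) hk₁ heq₁
    hab.self_of_nhds
  have h2 := S.param.poisson_extension hh S.mapsInto hθ hk hV (S.base.symm ▸ hzV) hk₂ heq₂
    hab.self_of_nhds
  rw [S.base] at h1 h2
  rw [h1, h2]

/-- The quotient of two smooth densities. -/
theorem SmoothDensity.exists_ratio (e : (ℝ × ℝ × InfModel n) ≃L[ℝ] Phase n)
    (hh : IsHamiltonian h) (hcrit : ZeroNotCritical h) {O : Set (Infinity h)} (hO : IsOpen O)
    (μ ζ : SmoothDensity h O) : ∃ R : Cotangent n M → ℝ, LocSmooth (coneOver h O) R ∧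
      (∀ z ∈ coneOver h O, 0 < R z) ∧
      (∀ s : ℝ, 0 < s → ∀ z ∈ coneOver h O, R (dilate s z) = R z) ∧
      ∀ σ : LocalParam h, σ.MapsInto O → ∀ θ ∈ σ.dom,
        μ.coeff σ θ = R (σ.toFun θ) * ζ.coeff σ θ := by
  have S : ∀ z : Cotangent n M, z ∈ coneOver h O → SectionAt h O z := fun z hz =>
    (exists_sectionAt e hh hcrit hO hz).some
  classical
  let R : Cotangent n M → ℝ := fun z => if hz : z ∈ coneOver h O then
    μ.coeff (S z hz).param ((S z hz).coord z) / ζ.coeff (S z hz).param ((S z hz).coord z) else 1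
  have hR : ∀ z (hz : z ∈ coneOver h O), R z =
      μ.coeff (S z hz).param ((S z hz).coord z) / ζ.coeff (S z hz).param ((S z hz).coord z) :=
    fun z hz => dif_pos hz
  -- Under a change of coordinates both coefficients acquire the same Jacobian factor, nonzero
  -- because ζ is positive, so the quotient does not depend on the coordinates.
  have key : ∀ z₀ (hz₀ : z₀ ∈ coneOver h O) (τ : LocalParam h), τ.MapsInto O → ∀ θ ∈ τ.dom,
      τ.toFun θ ∈ (S z₀ hz₀).nhd → μ.coeff τ θ / ζ.coeff τ θ =
        μ.coeff (S z₀ hz₀).param ((S z₀ hz₀).coord (τ.toFun θ)) /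
          ζ.coeff (S z₀ hz₀).param ((S z₀ hz₀).coord (τ.toFun θ)) := by
    intro z₀ hz₀ τ hτ θ hθ hmem
    set T := S z₀ hz₀
    have hVo : IsOpen (τ.dom ∩ τ.toFun ⁻¹' T.nhd) :=
      τ.smooth.continuousOn.isOpen_inter_preimage τ.isOpen_dom T.isOpen_nhd
    have hψ : ContDiffOn ℝ ∞ (fun η => T.coord (τ.toFun η)) (τ.dom ∩ τ.toFun ⁻¹' T.nhd) := by
      intro η hη
      have := (T.smooth.contMDiffAt (T.isOpen_nhd.mem_nhds hη.2)).comp η (τ.contMDiffAt hη.1)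
      exact this.contDiffAt.contDiffWithinAt
    have hrel : ∀ η ∈ τ.dom ∩ τ.toFun ⁻¹' T.nhd, ∃ s : ℝ, 0 < s ∧
        T.param.toFun (T.coord (τ.toFun η)) = dilate s (τ.toFun η) := fun η hη =>
      T.exists_dilate _ hη.2 (τ.mem_shell η hη.1)
    have hmaps : MapsTo (fun η => T.coord (τ.toFun η)) (τ.dom ∩ τ.toFun ⁻¹' T.nhd) T.param.dom :=
      fun η hη => T.coord_mem _ hη.2
    have h1 := μ.compat τ T.param hτ T.mapsInto _ _ hVo inter_subset_left hψ hmaps hrel θ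
      ⟨hθ, hmem⟩
    have h2 := ζ.compat τ T.param hτ T.mapsInto _ _ hVo inter_subset_left hψ hmaps hrel θ
      ⟨hθ, hmem⟩
    have h3 := ζ.pos τ hτ θ hθ
    have h4 : |(fderiv ℝ (fun η => T.coord (τ.toFun η)) θ).det| ≠ 0 := by
      intro h0
      rw [h2, h0, mul_zero] at h3
      exact lt_irrefl _ h3
    rw [h1, h2, mul_div_mul_right _ _ h4]
  have hloc : ∀ z₀ (hz₀ : z₀ ∈ coneOver h O), ∀ z ∈ (S z₀ hz₀).nhd, z ∈ coneOver h O →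
      R z = μ.coeff (S z₀ hz₀).param ((S z₀ hz₀).coord z) /
        ζ.coeff (S z₀ hz₀).param ((S z₀ hz₀).coord z) := by
    intro z₀ hz₀ z hz hzO
    rw [hR z hzO]
    have h1 := key z₀ hz₀ (S z hzO).param (S z hzO).mapsInto _ ((S z hzO).coord_mem z
      (S z hzO).mem_nhd) (by rw [(S z hzO).base]; exact hz)
    rw [(S z hzO).base] at h1
    exact h1
  refine ⟨R, fun z₀ hz₀ => ?_, fun z hz => ?_, fun s hs z hz => ?_, fun τ hτ θ hθ => ?_⟩
  · refine ⟨(S z₀ hz₀).nhd, _, (S z₀ hz₀).isOpen_nhd, (S z₀ hz₀).mem_nhd, ?_,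
      fun z hz => (hloc z₀ hz₀ z hz.1 hz.2).symm⟩
    intro z hz
    set T := S z₀ hz₀
    have h1 := T.coord_mem z hz
    have h2 : ContDiffAt ℝ ∞ (fun θ => μ.coeff T.param θ / ζ.coeff T.param θ) (T.coord z) :=
      ((μ.smooth T.param T.mapsInto).contDiffAt (T.param.isOpen_dom.mem_nhds h1)).div
        ((ζ.smooth T.param T.mapsInto).contDiffAt (T.param.isOpen_dom.mem_nhds h1))
        (ζ.pos T.param T.mapsInto _ h1).ne'
    exact (h2.contMDiffAt.comp z
      (T.smooth.contMDiffAt (T.isOpen_nhd.mem_nhds hz))).contMDiffWithinAt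
  · rw [hR z hz]
    have h1 := (S z hz).coord_mem z (S z hz).mem_nhd
    exact div_pos (μ.pos _ (S z hz).mapsInto _ h1) (ζ.pos _ (S z hz).mapsInto _ h1)
  · rw [hloc z hz (dilate s z) ((S z hz).dilate_mem s hs z (S z hz).mem_nhd)
      (dilate_mem_coneOver hh hz hs), (S z hz).coord_dilate s hs z (S z hz).mem_nhd, hR z hz]
  · have hz := hτ θ hθ
    have h1 := key _ hz τ hτ θ hθ (S _ hz).mem_nhd
    rw [hR _ hz, ← h1, div_mul_cancel₀ _ (ζ.pos τ hτ θ hθ).ne']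

/-- Every density has the form `densityOf`: if R is its quotient by the density attached to `f₀`,
the equation is solved by g = f₀ R^(-1/n). -/
theorem SmoothDensity.exists_generator (hn : n ≠ 0) (e : (ℝ × ℝ × InfModel n) ≃L[ℝ] Phase n)
    (hh : IsHamiltonian h) (hcrit : ZeroNotCritical h) {O : Set (Infinity h)} (hO : IsOpen O)
    (μ : SmoothDensity h O) {f₀ : Cotangent n M → ℝ} (hf₀ : IsGenerator h O f₀) :
    ∃ g : Cotangent n M → ℝ, IsGenerator h O g ∧ ∀ σ : LocalParam h, σ.MapsInto O → ∀ θ ∈ σ.dom,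
      μ.coeff σ θ = (g (σ.toFun θ) ^ n)⁻¹ * liouville h e σ.toFun θ := by
  obtain ⟨R, hR1, hR2, hR3, hR4⟩ := μ.exists_ratio e hh hcrit hO (densityOf hh hcrit e hf₀)
  have hP : IsOpen {x : ℝ × ℝ | 0 < x.2} := isOpen_lt continuous_const continuous_snd
  refine ⟨fun z => f₀ z * R z ^ (-(n : ℝ)⁻¹), ⟨?_, fun z hz => ?_, fun s hs z hz => ?_⟩,
    fun σ hσ θ hθ => ?_⟩
  · refine LocSmooth.comp (LocSmooth.prodMk hf₀.smooth hR1) hP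
      (Φ := fun x : ℝ × ℝ => x.1 * x.2 ^ (-(n : ℝ)⁻¹)) (fun x hx => ?_) fun z hz => hR2 z hz
    exact (contDiffAt_fst.mul (contDiffAt_snd.rpow_const_of_ne (ne_of_gt hx))).contDiffWithinAt
  · exact mul_pos (hf₀.pos z hz) (Real.rpow_pos_of_pos (hR2 z hz) _)
  · rw [hf₀.homogeneous s hs z hz, hR3 s hs z hz, mul_assoc]
  · have hz := hσ θ hθ
    have h1 : (R (σ.toFun θ) ^ (-(n : ℝ)⁻¹)) ^ n = (R (σ.toFun θ))⁻¹ := by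
      rw [← Real.rpow_natCast, ← Real.rpow_mul (hR2 _ hz).le, neg_mul,
        inv_mul_cancel₀ (Nat.cast_ne_zero.2 hn), Real.rpow_neg_one]
    rw [hR4 σ hσ θ hθ, mul_pow, h1, mul_inv, inv_inv]
    change _ * ((f₀ (σ.toFun θ) ^ n)⁻¹ * _) = _
    ring

theorem rpow_combination_deriv {F G : InfModel n → ℝ} {θ b : InfModel n} {p r : ℝ}
    (hF : DifferentiableAt ℝ F θ) (hG : DifferentiableAt ℝ G θ) (hF0 : 0 < F θ) (hG0 : 0 < G θ) :
    fderiv ℝ (fun η => F η ^ p * G η ^ r) θ b = F θ ^ p * G θ ^ r *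
      (p * fderiv ℝ F θ b / F θ + r * fderiv ℝ G θ b / G θ) := by
  have h1 : HasFDerivAt (fun η => F η ^ p * G η ^ r) _ θ :=
    (hF.hasFDerivAt.rpow_const (p := p) (Or.inl hF0.ne')).mul
      (hG.hasFDerivAt.rpow_const (p := r) (Or.inl hG0.ne'))
  rw [h1.fderiv]
  simp only [add_apply, smul_apply, smul_eq_mul]
  rw [Real.rpow_sub_one hF0.ne', Real.rpow_sub_one hG0.ne']
  field_simp
  ring

/-- A generator and a density define a homogeneous function whose derivative along `X_h` is
governed by the divergence. -/
theorem exists_function_of_divergence (hn : 2 ≤ n) (e : (ℝ × ℝ × InfModel n) ≃L[ℝ] Phase n)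
    (hh : IsHamiltonian h) (hcrit : ZeroNotCritical h) {O : Set (Infinity h)} (hO : IsOpen O)
    (μ : SmoothDensity h O) {f : Cotangent n M → ℝ} (hf : IsGenerator h O f) :
    ∃ k : Cotangent n M → ℝ, IsGenerator h O k ∧ ∀ z ∈ coneOver h O,
      ∀ (U : Set (Cotangent n M)) (k' : Cotangent n M → ℝ), IsOpen U → z ∈ U →
      ContMDiffOn (phaseModel n) 𝓘(ℝ, ℝ) ∞ k' U → EqOn k' k (U ∩ coneOver h O) →
      ∃ σ : LocalParam h, σ.MapsInto O ∧ ∃ θ ∈ σ.dom, ∀ w, IsCoordExpr h f σ w →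
        poisson h k' z = -(k z / ((n - 1) * f z)) * coordDiv (μ.coeff σ) w θ := by
  obtain ⟨g, hg, hμ⟩ := μ.exists_generator (by omega) e hh hcrit hO hf
  have hP : IsOpen {x : ℝ × ℝ | 0 < x.1 ∧ 0 < x.2} :=
    (isOpen_lt continuous_const continuous_fst).inter (isOpen_lt continuous_const continuous_snd)
  have hn1 : (0 : ℝ) < n - 1 := by
    have : (2 : ℝ) ≤ n := by exact_mod_cast hn
    linarith
  -- The exponents are forced: p + r = 1 gives degree 1, and p {h,f}/f + r {h,g}/g = -div / ((n-1)
  -- f) by the divergence formula. The division by n - 1 uses 2 ≤ n.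
  set p : ℝ := -((n : ℝ) - 1)⁻¹ with hp
  set r : ℝ := n / (n - 1) with hr
  have hpr : p + r = 1 := by rw [hp, hr]; field_simp; ring
  have hk : IsGenerator h O (fun z => f z ^ p * g z ^ r) := by
    refine ⟨?_, fun z hz => ?_, fun s hs z hz => ?_⟩
    · refine LocSmooth.comp (LocSmooth.prodMk hf.smooth hg.smooth) hP
        (Φ := fun x : ℝ × ℝ => x.1 ^ p * x.2 ^ r) (fun x hx => ?_)
        fun z hz => ⟨hf.pos z hz, hg.pos z hz⟩
      exact ((contDiffAt_fst.rpow_const_of_ne hx.1.ne').mul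
        (contDiffAt_snd.rpow_const_of_ne hx.2.ne')).contDiffWithinAt
    · exact mul_pos (Real.rpow_pos_of_pos (hf.pos z hz) _) (Real.rpow_pos_of_pos (hg.pos z hz) _)
    · have h1 : s ^ p * s ^ r = s := by rw [← Real.rpow_add hs, hpr, Real.rpow_one]
      rw [hf.homogeneous s hs z hz, hg.homogeneous s hs z hz,
        Real.mul_rpow hs.le (hf.pos z hz).le, Real.mul_rpow hs.le (hg.pos z hz).le]
      linear_combination (f z ^ p * g z ^ r) * h1
  refine ⟨_, hk, fun z hz U k' hU hzU hk' heq => ?_⟩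
  obtain ⟨S⟩ := exists_sectionAt e hh hcrit hO hz
  have hθ := S.coord_mem z S.mem_nhd
  refine ⟨S.param, S.mapsInto, S.coord z, hθ, fun w hw => ?_⟩
  obtain ⟨a, b, -, -, hab⟩ := S.param.exists_decomposition e hh hcrit hθ (mem_ch_source _)
  have hab := hab.self_of_nhds
  have hz' : S.param.toFun (S.coord z) ∈ coneOver h O := S.mapsInto _ hθ
  obtain ⟨Uf, f', hUf, hzf, hf', heqf⟩ := hf.smooth _ hz'
  obtain ⟨Ug, g', hUg, hzg, hg', heqg⟩ := hg.smooth _ hz'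
  have hcone := S.param.eventually_coneOver S.mapsInto hθ
  have hcont := (S.param.contMDiffAt hθ).continuousAt
  have h1 := S.param.coordDiv_eq e hh hcrit (m := μ.coeff S.param) hθ hw
    (hf'.contMDiffAt (hUf.mem_nhds hzf)) (hg'.contMDiffAt (hUg.mem_nhds hzg))
    (by
      filter_upwards [hcone, hcont.eventually_mem (hUf.mem_nhds hzf)] with η h2 h3
      exact (heqf ⟨h3, h2⟩).symm)
    (by rw [heqg ⟨hzg, hz'⟩]; exact hg.pos _ hz')
    (by
      filter_upwards [hcone, hcont.eventually_mem (hUg.mem_nhds hzg),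
        S.param.eventually_dom hθ] with η h2 h3 h4
      rw [hμ _ S.mapsInto η h4, heqg ⟨h3, h2⟩])
    (eventually_homogeneous hh hf.homogeneous hUf heqf hzf hz')
    (eventually_homogeneous hh hg.homogeneous hUg heqg hzg hz')
  have h2 := S.param.poisson_extension hh S.mapsInto hθ hf.homogeneous hUf hzf hf' heqf hab
  have h3 := S.param.poisson_extension hh S.mapsInto hθ hg.homogeneous hUg hzg hg' heqg hab
  have h4 := S.param.poisson_extension hh S.mapsInto hθ hk.homogeneous hU
    (S.base.symm ▸ hzU) hk' heq hab
  have hF := (hf.smooth.contDiffAt_comp (S.param.contMDiffAt hθ) hcone).differentiableAt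
    (by simp)
  have hG := (hg.smooth.contDiffAt_comp (S.param.contMDiffAt hθ) hcone).differentiableAt
    (by simp)
  have hf0 := hf.pos _ hz'
  have hg0 := hg.pos _ hz'
  rw [rpow_combination_deriv hF hG hf0 hg0] at h4
  rw [heqf ⟨hzf, hz'⟩, heqg ⟨hzg, hz'⟩] at h1
  rw [h1, h2, h3]
  rw [S.base] at h4 hf0 hg0 ⊢
  rw [h4, hp, hr]
  field_simp
  ring

end LocalEscape

/-! ### Flows of bounded Lipschitz fields -/

section Flow

variable {E : Type*} [NormedAddCommGroup E] [NormedSpace ℝ E]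

/-- `Φ` is the flow of the vector field `V`. -/
structure IsODEFlow (V : E → E) (Φ : ℝ → E → E) : Prop where
  zero : ∀ x, Φ 0 x = x
  deriv : ∀ x t, HasDerivAt (fun s => Φ s x) (V (Φ t x)) t

theorem exists_isODEFlow [CompleteSpace E] {V : E → E} {K B : ℝ≥0} (hK : LipschitzWith K V)
    (hB : ∀ x, ‖V x‖ ≤ B) : ∃ Φ, IsODEFlow V Φ := by
  have h1 : ∀ (x : E) (T : ℝ), 0 < T → ∃ α : ℝ → E, α 0 = x ∧
      ∀ t ∈ Ioo (-T) T, HasDerivAt α (V (α t)) t := by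
    intro x T hT
    -- A solution moves by at most B T in time T, so the Picard ball of that radius suffices for
    -- every T and no smallness is needed.
    have hpl : IsPicardLindelof (fun _ => V) (tmin := -T) (tmax := T)
        ⟨0, by constructor <;> linarith⟩ x (B * T.toNNReal) 0 B K :=
      { lipschitzOnWith := fun t _ => hK.lipschitzOnWith
        continuousOn := fun x _ => continuousOn_const
        norm_le := fun t _ x _ => hB x
        mul_max_le := by
          simp [Real.coe_toNNReal _ hT.le] }
    obtain ⟨α, hα0, hα⟩ := hpl.exists_eq_forall_mem_Icc_hasDerivWithinAt₀
    exact ⟨α, hα0, fun t ht => (hα t (Ioo_subset_Icc_self ht)).hasDerivAt (Icc_mem_nhds ht.1 ht.2)⟩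
  choose! α hα0 hα using h1
  have heq : ∀ x S T, 0 < S → S ≤ T → EqOn (α x S) (α x T) (Ioo (-S) S) := by
    intro x S T hS hST
    refine ODE_solution_unique_of_mem_Ioo (v := fun _ => V) (s := fun _ => univ) (K := K) (t₀ := 0)
      (fun t _ => hK.lipschitzOnWith) (by constructor <;> linarith)
      (fun t ht => ⟨hα x S hS t ht, mem_univ _⟩)
      (fun t ht => ⟨hα x T (hS.trans_le hST) t ⟨by linarith [ht.1], by linarith [ht.2]⟩,
        mem_univ _⟩) ?_
    rw [hα0 x S hS, hα0 x T (hS.trans_le hST)]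
  -- At time t the solution on the window of radius |t| + 1 is used; solutions on different windows
  -- agree by uniqueness.
  refine ⟨fun t x => α x (|t| + 1) t, fun x => ?_, fun x t => ?_⟩
  · simp [hα0]
  · have ht : t ∈ Ioo (-(|t| + 1)) (|t| + 1) := abs_lt.1 (lt_add_one _)
    refine (hα x (|t| + 1) (by positivity) t ht).congr_of_eventuallyEq ?_
    filter_upwards [Ioo_mem_nhds ht.1 ht.2] with s hs
    rcases le_total |s| |t| with hst | hst
    · exact heq x _ _ (by positivity) (by linarith) (abs_lt.1 (lt_add_one _))
    · exact (heq x _ _ (by positivity) (by linarith) hs).symm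

namespace IsODEFlow

variable {V : E → E} {Φ : ℝ → E → E} {K : ℝ≥0}

theorem eq_of_hasDerivAt_Ioo (hΦ : IsODEFlow V Φ) (hK : LipschitzWith K V) {γ : ℝ → E} {a b : ℝ}
    (h0 : (0 : ℝ) ∈ Ioo a b) (hγ : ∀ t ∈ Ioo a b, HasDerivAt γ (V (γ t)) t) {t : ℝ}
    (ht : t ∈ Ioo a b) : γ t = Φ t (γ 0) :=
  ODE_solution_unique_of_mem_Ioo (v := fun _ => V) (s := fun _ => univ) (K := K)
    (fun t _ => hK.lipschitzOnWith) h0 (fun t ht => ⟨hγ t ht, mem_univ _⟩)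
    (fun t _ => ⟨hΦ.deriv _ t, mem_univ _⟩) (by simp only [hΦ.zero]) ht

theorem eq_of_hasDerivAt (hΦ : IsODEFlow V Φ) (hK : LipschitzWith K V) {γ : ℝ → E}
    (hγ : ∀ t, HasDerivAt γ (V (γ t)) t) (t : ℝ) : γ t = Φ t (γ 0) :=
  hΦ.eq_of_hasDerivAt_Ioo hK (a := -(|t| + 1)) (b := |t| + 1)
    (by constructor <;> linarith [abs_nonneg t]) (fun t _ => hγ t) (abs_lt.1 (lt_add_one _))

theorem add (hΦ : IsODEFlow V Φ) (hK : LipschitzWith K V) (s t : ℝ) (x : E) :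
    Φ (s + t) x = Φ s (Φ t x) := by
  have h1 := hΦ.eq_of_hasDerivAt hK (γ := fun s => Φ (s + t) x)
    (fun s => (hΦ.deriv x (s + t)).comp_add_const s t) s
  simpa using h1

theorem neg (hΦ : IsODEFlow V Φ) : IsODEFlow (fun x => -V x) (fun t => Φ (-t)) where
  zero x := by simp [hΦ.zero]
  deriv x t := by
    have := (hΦ.deriv x (-t)).scomp t (hasDerivAt_neg t)
    rw [neg_one_smul] at this
    exact this

theorem dist_le_of_nonneg (hΦ : IsODEFlow V Φ) (hK : LipschitzWith K V) {t : ℝ} (ht : 0 ≤ t)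
    (x y : E) : dist (Φ t x) (Φ t y) ≤ dist x y * Real.exp (K * t) := by
  have := dist_le_of_trajectories_ODE (v := fun _ => V) (K := K) (f := fun t => Φ t x)
    (g := fun t => Φ t y) (a := 0) (b := t) (δ := dist x y) (fun t => hK)
    (fun t _ => (hΦ.deriv x t).continuousAt.continuousWithinAt)
    (fun t _ => (hΦ.deriv x t).hasDerivWithinAt)
    (fun t _ => (hΦ.deriv y t).continuousAt.continuousWithinAt)
    (fun t _ => (hΦ.deriv y t).hasDerivWithinAt) (by simp [hΦ.zero]) t ⟨ht, le_rfl⟩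
  simpa using this

theorem dist_le (hΦ : IsODEFlow V Φ) (hK : LipschitzWith K V) (t : ℝ) (x y : E) :
    dist (Φ t x) (Φ t y) ≤ dist x y * Real.exp (K * |t|) := by
  rcases le_total 0 t with ht | ht
  · rw [abs_of_nonneg ht]
    exact hΦ.dist_le_of_nonneg hK ht x y
  · have := hΦ.neg.dist_le_of_nonneg (K := K) hK.neg (neg_nonneg.2 ht) x y
    simpa [abs_of_nonpos ht] using this

theorem continuous (hΦ : IsODEFlow V Φ) (hK : LipschitzWith K V) :
    Continuous (fun p : ℝ × E => Φ p.1 p.2) := by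
  refine continuous_iff_continuousAt.2 fun ⟨t, x⟩ => ?_
  have h1 : Tendsto (fun p : ℝ × E => Φ p.1 x) (𝓝 (t, x)) (𝓝 (Φ t x)) :=
    (hΦ.deriv x t).continuousAt.tendsto.comp continuous_fst.continuousAt
  have h2 : Tendsto (fun p : ℝ × E => dist p.2 x * Real.exp (K * |p.1|)) (𝓝 (t, x)) (𝓝 0) := by
    have : Continuous (fun p : ℝ × E => dist p.2 x * Real.exp (K * |p.1|)) := by fun_prop
    simpa using this.tendsto (t, x)
  have h3 : Tendsto (fun p : ℝ × E => dist (Φ p.1 p.2) (Φ p.1 x)) (𝓝 (t, x)) (𝓝 0) :=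
    squeeze_zero (fun _ => dist_nonneg) (fun p => hΦ.dist_le hK p.1 p.2 x) h2
  exact (tendsto_iff_of_dist h3).2 h1

theorem norm_sub_le (hΦ : IsODEFlow V Φ) {B : ℝ} (hB : ∀ x, ‖V x‖ ≤ B) (t : ℝ) (x : E) :
    ‖Φ t x - x‖ ≤ B * |t| := by
  have := convex_univ.norm_image_sub_le_of_norm_hasDerivWithin_le (f := fun s => Φ s x)
    (f' := fun s => V (Φ s x)) (C := B) (fun s _ => (hΦ.deriv x s).hasDerivWithinAt)
    (fun s _ => hB _) (mem_univ 0) (mem_univ t)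
  simpa [hΦ.zero] using this

end IsODEFlow

/-! ### Euler's method, with convergence of the derivative in the direction of the field -/

/-- Applied with q = O(t) and a local error r = O(t²) at fixed N t, it leaves a global error O(t).
-/
theorem discrete_gronwall_quadratic {a : ℕ → ℝ} {q r : ℝ} (hq : 0 ≤ q) (hr : 0 ≤ r) (h0 : a 0 ≤ 0)
    (ha : ∀ j, a (j + 1) ≤ (1 + q) * a j + r) (N : ℕ) : a N ≤ N * r * Real.exp (N * q) := by
  have h1 : a N ≤ N * r * (1 + q) ^ N := by
    induction N with
    | zero => simpa using h0
    | succ N ih =>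
      have h2 : (1 : ℝ) ≤ (1 + q) ^ (N + 1) := one_le_pow₀ (by linarith)
      calc a (N + 1) ≤ (1 + q) * a N + r := ha N
        _ ≤ (1 + q) * (N * r * (1 + q) ^ N) + r * (1 + q) ^ (N + 1) := by
          refine add_le_add (mul_le_mul_of_nonneg_left ih (by linarith)) ?_
          exact le_mul_of_one_le_right hr h2
        _ = ((N + 1 : ℕ) : ℝ) * r * (1 + q) ^ (N + 1) := by push_cast; ring
  refine h1.trans (mul_le_mul_of_nonneg_left ?_ (by positivity))
  rw [Real.exp_nat_mul]
  exact pow_le_pow_left₀ (by linarith) (by linarith [Real.add_one_le_exp q]) N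

/-- One step of Euler's method. -/
def eulerStep (V : E → E) (t : ℝ) (x : E) : E := x + t • V x

theorem contDiff_eulerStep_iterate {V : E → E} (hV : ContDiff ℝ ∞ V) (t : ℝ) (N : ℕ) :
    ContDiff ℝ ∞ (eulerStep V t)^[N] := by
  induction N with
  | zero => exact contDiff_id
  | succ N ih => exact ih.comp (contDiff_id.add (contDiff_const.smul hV))

/-- Translation symmetries of the field survive discretisation. In the ambient system they play the
role of the dilations. -/
theorem eulerStep_iterate_add {V : E → E} {a : E} (ha : ∀ x, V (x + a) = V x) (t : ℝ) (N : ℕ)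
    (x : E) : (eulerStep V t)^[N] (x + a) = (eulerStep V t)^[N] x + a := by
  have h1 : Function.Semiconj (fun x => x + a) (eulerStep V t) (eulerStep V t) := fun x => by
    simp only [eulerStep, ha]
    abel
  exact ((h1.iterate_right N) x).symm

theorem dist_flow_euler {V : E → E} {Φ : ℝ → E → E} (hΦ : IsODEFlow V Φ) {K B : ℝ≥0}
    (hK : LipschitzWith K V) (hB : ∀ x, ‖V x‖ ≤ B) (t : ℝ) (N : ℕ) (x : E) :
    ‖Φ (N * t) x - (eulerStep V t)^[N] x‖ ≤ N * (K * B * t ^ 2) * Real.exp (N * (|t| * K)) := by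
  have hstep : ∀ z, ‖Φ t z - eulerStep V t z‖ ≤ K * B * t ^ 2 := by
    intro z
    have h1 := (convex_uIcc (0 : ℝ) t).norm_image_sub_le_of_norm_hasDerivWithin_le
      (f := fun s => Φ s z - s • V z) (f' := fun s => V (Φ s z) - (1 : ℝ) • V z)
      (C := K * (B * |t|))
      (fun s _ => ((hΦ.deriv z s).sub ((hasDerivAt_id s).smul_const (V z))).hasDerivWithinAt)
      (fun s hs => by
        rw [one_smul]
        refine (hK.norm_sub_le _ _).trans (mul_le_mul_of_nonneg_left ?_ K.coe_nonneg)
        refine (hΦ.norm_sub_le hB s z).trans (mul_le_mul_of_nonneg_left ?_ B.coe_nonneg)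
        simpa using abs_sub_left_of_mem_uIcc hs) left_mem_uIcc right_mem_uIcc
    simp only [hΦ.zero, zero_smul, sub_zero, Real.norm_eq_abs] at h1
    have h2 : Φ t z - eulerStep V t z = Φ t z - t • V z - z := by
      rw [eulerStep]; abel
    rw [h2]
    refine h1.trans (le_of_eq ?_)
    rw [← sq_abs t]; ring
  refine discrete_gronwall_quadratic (a := fun N : ℕ => ‖Φ (N * t) x - (eulerStep V t)^[N] x‖)
    (by positivity) (by positivity) (by simp [hΦ.zero]) (fun j => ?_) N
  rw [Function.iterate_succ_apply']
  have h3 : Φ ((j + 1 : ℕ) * t) x = Φ t (Φ (j * t) x) := by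
    rw [← hΦ.add hK]; congr 1; push_cast; ring
  rw [h3]
  set z := Φ (j * t) x
  set w := (eulerStep V t)^[j] x
  have h4 : Φ t z - eulerStep V t w = (Φ t z - eulerStep V t z) + ((z - w) + t • (V z - V w)) := by
    simp only [eulerStep, smul_sub]; abel
  have h5 : ‖t • (V z - V w)‖ ≤ |t| * (K * ‖z - w‖) := by
    rw [norm_smul, Real.norm_eq_abs]
    exact mul_le_mul_of_nonneg_left (hK.norm_sub_le z w) (abs_nonneg t)
  rw [h4]
  refine (norm_add_le _ _).trans ?_
  have h6 := norm_add_le (z - w) (t • (V z - V w))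
  have h7 := hstep z
  linarith

/-- An exact flow carries the field to itself: DΦ V = V ∘ Φ. An Euler step violates this by a Taylor
remainder of second order, and the recursion for the defect accumulates to an error of first order.
Convergence of the derivative in other directions is not needed. -/
theorem norm_fderiv_euler_sub_le {V : E → E} (hV : ContDiff ℝ ∞ V) {K B L : ℝ≥0}
    (hK : ∀ x, ‖fderiv ℝ V x‖ ≤ K) (hB : ∀ x, ‖V x‖ ≤ B) (hL : LipschitzWith L (fderiv ℝ V))
    (t : ℝ) (N : ℕ) (x : E) :
    ‖fderiv ℝ (eulerStep V t)^[N] x (V x) - V ((eulerStep V t)^[N] x)‖ ≤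
      N * (L * B ^ 2 * |t| ^ 2) * Real.exp (N * (|t| * K)) := by
  have hVd : Differentiable ℝ V := hV.differentiable (by simp)
  have hstep : ∀ z, ‖V (eulerStep V t z) - V z - t • fderiv ℝ V z (V z)‖ ≤ L * B ^ 2 * |t| ^ 2 := by
    intro z
    have hr : 0 ≤ |t| * B := by positivity
    have h1 := (convex_closedBall z (|t| * B)).norm_image_sub_le_of_norm_hasFDerivWithin_le
      (f := fun w => V w - fderiv ℝ V z w) (f' := fun w => fderiv ℝ V w - fderiv ℝ V z)
      (C := L * (|t| * B))
      (fun w _ => ((hVd w).hasFDerivAt.sub (fderiv ℝ V z).hasFDerivAt).hasFDerivWithinAt)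
      (fun w hw => by
        refine (hL.norm_sub_le _ _).trans (mul_le_mul_of_nonneg_left ?_ L.coe_nonneg)
        rw [← dist_eq_norm]; exact hw) (Metric.mem_closedBall_self hr)
      (y := eulerStep V t z) (by
        rw [Metric.mem_closedBall, dist_eq_norm, eulerStep, add_sub_cancel_left, norm_smul,
          Real.norm_eq_abs]
        exact mul_le_mul_of_nonneg_left (hB z) (abs_nonneg t))
    have h2 : eulerStep V t z - z = t • V z := by rw [eulerStep, add_sub_cancel_left]
    have h3 : V (eulerStep V t z) - V z - t • fderiv ℝ V z (V z) =
        V (eulerStep V t z) - fderiv ℝ V z (eulerStep V t z) - (V z - fderiv ℝ V z z) := by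
      rw [← map_smul, ← h2, map_sub]; abel
    rw [h3]
    refine h1.trans ?_
    rw [h2, norm_smul, Real.norm_eq_abs]
    have : L * (|t| * B) * (|t| * ‖V z‖) ≤ L * (|t| * B) * (|t| * B) := by
      refine mul_le_mul_of_nonneg_left ?_ (by positivity)
      exact mul_le_mul_of_nonneg_left (hB z) (abs_nonneg t)
    refine this.trans (le_of_eq (by ring))
  refine discrete_gronwall_quadratic
    (a := fun N : ℕ => ‖fderiv ℝ (eulerStep V t)^[N] x (V x) - V ((eulerStep V t)^[N] x)‖)
    (by positivity) (by positivity) (by simp) (fun j => ?_) N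
  set z := (eulerStep V t)^[j] x with hz
  set d := fderiv ℝ (eulerStep V t)^[j] x (V x)
  have h1 : fderiv ℝ (eulerStep V t)^[j + 1] x (V x) = d + t • fderiv ℝ V z d := by
    have h2 : HasFDerivAt (eulerStep V t) (ContinuousLinearMap.id ℝ E + t • fderiv ℝ V z) z :=
      (hasFDerivAt_id z).add ((hVd z).hasFDerivAt.const_smul t)
    have h3 : HasFDerivAt (eulerStep V t)^[j] (fderiv ℝ (eulerStep V t)^[j] x) x :=
      ((contDiff_eulerStep_iterate hV t j).differentiable (by simp) x).hasFDerivAt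
    rw [Function.iterate_succ', (h2.comp x h3).fderiv]
    rfl
  rw [Function.iterate_succ_apply', ← hz, h1]
  have h4 : d + t • fderiv ℝ V z d - V (eulerStep V t z) =
      ((d - V z) + t • fderiv ℝ V z (d - V z)) -
        (V (eulerStep V t z) - V z - t • fderiv ℝ V z (V z)) := by
    rw [map_sub, smul_sub]; abel
  have h5 : ‖t • fderiv ℝ V z (d - V z)‖ ≤ |t| * (K * ‖d - V z‖) := by
    rw [norm_smul, Real.norm_eq_abs]
    refine mul_le_mul_of_nonneg_left ?_ (abs_nonneg t)
    exact ((fderiv ℝ V z).le_opNorm _).trans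
      (mul_le_mul_of_nonneg_right (hK z) (norm_nonneg _))
  rw [h4]
  refine (norm_sub_le _ _).trans ?_
  have h6 := norm_add_le (d - V z) (t • fderiv ℝ V z (d - V z))
  have h7 := hstep z
  linarith

/-- The time-`T` map of a flow is approximated uniformly by smooth maps that almost intertwine the
field with itself. -/
theorem exists_smooth_approx_flow {V : E → E} {Φ : ℝ → E → E} (hΦ : IsODEFlow V Φ)
    (hV : ContDiff ℝ ∞ V) {K B L : ℝ≥0}
    (hK : ∀ x, ‖fderiv ℝ V x‖ ≤ K) (hB : ∀ x, ‖V x‖ ≤ B) (hL : LipschitzWith L (fderiv ℝ V))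
    (T : ℝ) {ε : ℝ} (hε : 0 < ε) : ∃ P : E → E, ContDiff ℝ ∞ P ∧
      (∀ x, ‖Φ T x - P x‖ ≤ ε) ∧ (∀ x, ‖fderiv ℝ P x (V x) - V (P x)‖ ≤ ε) ∧
      ∀ a, (∀ x, V (x + a) = V x) → ∀ x, P (x + a) = P x + a := by
  have hKL : LipschitzWith K V := lipschitzWith_of_nnnorm_fderiv_le (hV.differentiable (by simp)) hK
  have h1 : ∀ C : ℝ, ∀ᶠ N : ℕ in atTop, C / N < ε := fun C =>
    (tendsto_const_div_atTop_nhds_zero_nat C).eventually_lt_const hε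
  obtain ⟨N, hN1, hN2, hN0⟩ := ((h1 (K * B * T ^ 2 * Real.exp (|T| * K))).and
    ((h1 (L * B ^ 2 * T ^ 2 * Real.exp (|T| * K))).and (eventually_gt_atTop 0))).exists
  have hN : (N : ℝ) ≠ 0 := Nat.cast_ne_zero.2 hN0.ne'
  have hNT : (N : ℝ) * (|T / N| * K) = |T| * K := by
    rw [abs_div, Nat.abs_cast]; field_simp
  refine ⟨(eulerStep V (T / N))^[N], contDiff_eulerStep_iterate hV _ _, fun x => ?_, fun x => ?_,
    fun a ha x => eulerStep_iterate_add ha _ _ x⟩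
  · have h2 := dist_flow_euler hΦ hKL hB (T / N) N x
    rw [mul_div_cancel₀ T hN, hNT] at h2
    refine h2.trans (le_trans (le_of_eq ?_) hN1.le)
    field_simp
  · have h2 := norm_fderiv_euler_sub_le hV hK hB hL (T / N) N x
    rw [hNT] at h2
    refine h2.trans (le_trans (le_of_eq ?_) hN2.le)
    rw [abs_div, Nat.abs_cast, div_pow, sq_abs]
    field_simp

end Flow

/-! ### Linear systems over a flow -/

section Cocycle

variable {E : Type*} [NormedAddCommGroup E] [NormedSpace ℝ E]

/-- The field on `E × ℝ` associated with a field `y` and a function `c` on `E`. -/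
def cocycleField (y : E → E) (c : E → ℝ) (p : E × ℝ) : E × ℝ := (y p.1, c p.1)

/-- The operator `u ↦ y u + c u`. -/
def cocycleOp (y : E → E) (c u : E → ℝ) (x : E) : ℝ := fderiv ℝ u x (y x) + c x * u x

/-- Uniform bounds for a smooth field and its first two derivatives. -/
structure IsBoundedField (V : E → E) (K B L : ℝ≥0) : Prop where
  contDiff : ContDiff ℝ ∞ V
  norm_fderiv_le : ∀ x, ‖fderiv ℝ V x‖ ≤ K
  norm_le : ∀ x, ‖V x‖ ≤ B
  lipschitz_fderiv : LipschitzWith L (fderiv ℝ V)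

theorem IsBoundedField.lipschitz {V : E → E} {K B L : ℝ≥0} (hV : IsBoundedField V K B L) :
    LipschitzWith K V :=
  lipschitzWith_of_nnnorm_fderiv_le (hV.contDiff.differentiable (by simp)) hV.norm_fderiv_le

theorem exists_isBoundedField {y : E → E} {c : E → ℝ} (hy : ContDiff ℝ ∞ y) (hc : ContDiff ℝ ∞ c)
    (hys : HasCompactSupport y) (hcs : HasCompactSupport c) :
    ∃ K B L : ℝ≥0, IsBoundedField (cocycleField y c) K B L := by
  have hW : ContDiff ℝ ∞ (fun x => (y x, c x)) := hy.prodMk hc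
  have hWs : HasCompactSupport (fun x => (y x, c x)) := by
    refine HasCompactSupport.intro (K := tsupport y ∪ tsupport c) (hys.union hcs) fun x hx => ?_
    rw [mem_union, not_or] at hx
    have h1 : y x = 0 := image_eq_zero_of_notMem_tsupport hx.1
    have h2 : c x = 0 := image_eq_zero_of_notMem_tsupport hx.2
    rw [h1, h2, Prod.mk_zero_zero]
  have hWf : ContDiff ℝ ∞ (fderiv ℝ (fun x => (y x, c x))) := hW.fderiv_right (by norm_cast)
  obtain ⟨B, hB⟩ := hWs.exists_bound_of_continuous hW.continuous
  obtain ⟨K, hK⟩ := (hWs.fderiv ℝ).exists_bound_of_continuous hWf.continuous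
  obtain ⟨L, hL⟩ := ContDiff.lipschitzWith_of_hasCompactSupport (hWs.fderiv ℝ) hWf (by simp)
  have hcont : ContDiff ℝ ∞ (cocycleField y c) := hW.comp contDiff_fst
  have hfd : ∀ p : E × ℝ, fderiv ℝ (cocycleField y c) p =
      (fderiv ℝ (fun x => (y x, c x)) p.1).comp (ContinuousLinearMap.fst ℝ E ℝ) := fun p =>
    ((hW.differentiable (by simp) p.1).hasFDerivAt.comp p
      (hasFDerivAt_fst (p := p))).fderiv
  have hfst : ∀ A : E →L[ℝ] E × ℝ, ‖A.comp (ContinuousLinearMap.fst ℝ E ℝ)‖ ≤ ‖A‖ := fun A =>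
    (A.opNorm_comp_le _).trans (mul_le_of_le_one_right (norm_nonneg _)
      (ContinuousLinearMap.norm_fst_le ℝ E ℝ))
  refine ⟨K.toNNReal, B.toNNReal, L, hcont, fun p => ?_, fun p => ?_, ?_⟩
  · rw [hfd]
    exact (hfst _).trans ((hK _).trans (Real.le_coe_toNNReal K))
  · exact (hB p.1).trans (Real.le_coe_toNNReal B)
  · refine LipschitzWith.of_dist_le_mul fun p p' => ?_
    rw [dist_eq_norm, hfd, hfd, ← ContinuousLinearMap.sub_comp]
    refine (hfst _).trans ?_
    rw [← dist_eq_norm]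
    refine (hL.dist_le_mul _ _).trans (mul_le_mul_of_nonneg_left ?_ L.coe_nonneg)
    exact le_max_left _ _

/-- With s = log N, functions of degree 1 are those of the form e^s u(x). The field on the product
acts on them through `cocycleOp`. -/
theorem fderiv_exp_mul {y : E → E} {c u : E → ℝ} (hu : Differentiable ℝ u) (p : E × ℝ) :
    fderiv ℝ (fun p : E × ℝ => Real.exp p.2 * u p.1) p (cocycleField y c p) =
      Real.exp p.2 * cocycleOp y c u p.1 := by
  have h1 : HasFDerivAt (fun p : E × ℝ => Real.exp p.2 * u p.1) _ p :=
    ((hasFDerivAt_snd (p := p)).exp).mul ((hu p.1).hasFDerivAt.comp p (hasFDerivAt_fst (p := p)))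
  rw [h1.fderiv]
  simp only [add_apply, smul_apply, ContinuousLinearMap.comp_apply, smul_eq_mul,
    ContinuousLinearMap.coe_fst', ContinuousLinearMap.coe_snd', cocycleField, cocycleOp]
  ring

/-- Transport of a smooth function by the flow of a linear system, up to a small error in the
operator. -/
theorem exists_smooth_transport [FiniteDimensional ℝ E] {y : E → E} {c : E → ℝ} {K B L : ℝ≥0}
    (hV : IsBoundedField (cocycleField y c) K B L) {Φ : ℝ → E × ℝ → E × ℝ}
    (hΦ : IsODEFlow (cocycleField y c) Φ) {X : Set E} (hX : IsCompact X) {u : E → ℝ}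
    (hu : ContDiff ℝ ∞ u) (T : ℝ) {ε : ℝ} (hε : 0 < ε) : ∃ v : E → ℝ, ContDiff ℝ ∞ v ∧
      ∀ x ∈ X, |cocycleOp y c v x -
        Real.exp (Φ T (x, 0)).2 * cocycleOp y c u (Φ T (x, 0)).1| ≤ ε := by
  let G : E × ℝ → ℝ := fun p => Real.exp p.2 * u p.1
  have hG : ContDiff ℝ ∞ G := (Real.contDiff_exp.comp contDiff_snd).mul (hu.comp contDiff_fst)
  let Q : E × ℝ → ℝ := fun p => fderiv ℝ G p (cocycleField y c p)
  have hGf : Continuous (fderiv ℝ G) := hG.continuous_fderiv (by simp)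
  have hQ : Continuous Q := hGf.clm_apply hV.contDiff.continuous
  have hS0 : IsCompact ((fun x : E => Φ T (x, 0)) '' X) := by
    refine hX.image ?_
    exact (hΦ.continuous hV.lipschitz).comp (by fun_prop : Continuous fun x : E => (T, (x, (0 : ℝ))))
  let S := Metric.cthickening 1 ((fun x : E => Φ T (x, 0)) '' X)
  have hS : IsCompact S := hS0.cthickening
  obtain ⟨C, hC⟩ := hS.exists_bound_of_continuousOn hGf.continuousOn
  obtain ⟨δ, hδ, hQδ⟩ := Metric.uniformContinuousOn_iff.1
    (hS.uniformContinuousOn_of_continuous hQ.continuousOn) (ε / 2) (half_pos hε)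
  have hC1 : 0 < |C| + 1 := by positivity
  -- The bound 1 keeps the approximate map in the compact thickening S, δ controls the displacement
  -- of the base point of Q, and the last bound controls the intertwining defect multiplied by the
  -- size of dG.
  obtain ⟨η, hη0, hη1, hη2, hη3⟩ : ∃ η : ℝ, 0 < η ∧ η ≤ 1 ∧ η < δ ∧ (|C| + 1) * η ≤ ε / 2 := by
    refine ⟨min 1 (min (δ / 2) (ε / 2 / (|C| + 1))), by positivity, min_le_left _ _, ?_, ?_⟩
    · exact ((min_le_right _ _).trans (min_le_left _ _)).trans_lt (half_lt_self hδ)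
    · rw [← le_div_iff₀' hC1]
      exact (min_le_right _ _).trans (min_le_right _ _)
  obtain ⟨P, hP, hP1, hP2, hP3⟩ := exists_smooth_approx_flow hΦ hV.contDiff hV.norm_fderiv_le
    hV.norm_le hV.lipschitz_fderiv T hη0
  have hv : ContDiff ℝ ∞ (fun x : E => G (P (x, 0))) :=
    hG.comp (hP.comp (contDiff_id.prodMk contDiff_const))
  refine ⟨fun x => G (P (x, 0)), hv, fun x hx => ?_⟩
  -- P commutes with translations of the last variable, so G ∘ P is again of the form e^s v(x), and
  -- `fderiv_exp_mul` evaluates its derivative as `cocycleOp` of v.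
  have h1 : (G ∘ P) = fun p : E × ℝ => Real.exp p.2 * G (P (p.1, 0)) := by
    funext p
    have h2 := hP3 (0, p.2) (fun q => by simp [cocycleField]) (p.1, 0)
    have h3 : ((p.1, 0) : E × ℝ) + (0, p.2) = p := by simp
    rw [h3] at h2
    simp only [Function.comp_apply, h2, G, Prod.snd_add, Prod.fst_add, add_zero, Real.exp_add]
    ring
  have h4 := fderiv_exp_mul (y := y) (c := c) (hv.differentiable (by simp)) (x, 0)
  rw [← h1, Real.exp_zero, one_mul] at h4
  have h5 : HasFDerivAt (G ∘ P) _ (x, (0 : ℝ)) :=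
    (hG.differentiable (by simp) (P (x, 0))).hasFDerivAt.comp (x, (0 : ℝ))
      (hP.differentiable (by simp) (x, 0)).hasFDerivAt
  rw [h5.fderiv, ContinuousLinearMap.comp_apply] at h4
  have hΦS : Φ T (x, 0) ∈ S := Metric.self_subset_cthickening _ ⟨x, hx, rfl⟩
  have hPS : P (x, 0) ∈ S := by
    refine Metric.mem_cthickening_of_dist_le _ _ _ _ (mem_image_of_mem _ hx) ?_
    rw [dist_comm, dist_eq_norm]
    exact (hP1 _).trans hη1
  have h6 : |Q (P (x, 0)) - Q (Φ T (x, 0))| ≤ ε / 2 := by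
    have := hQδ _ hPS _ hΦS (by
      rw [dist_comm, dist_eq_norm]; exact (hP1 _).trans_lt hη2)
    exact this.le
  have h7 : |cocycleOp y c (fun x : E => G (P (x, 0))) x - Q (P (x, 0))| ≤ ε / 2 := by
    rw [← h4, ← map_sub, ← Real.norm_eq_abs]
    refine ((fderiv ℝ G (P (x, 0))).le_opNorm _).trans (le_trans ?_ hη3)
    exact mul_le_mul ((hC _ hPS).trans ((le_abs_self C).trans (by linarith))) (hP2 _)
      (norm_nonneg _) hC1.le
  have h8 : Q (Φ T (x, 0)) = Real.exp (Φ T (x, 0)).2 * cocycleOp y c u (Φ T (x, 0)).1 :=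
    fderiv_exp_mul (hu.differentiable (by simp)) _
  rw [← h8]
  calc |_ - Q (Φ T (x, 0))| ≤ _ := abs_sub_le _ (Q (P (x, 0))) _
    _ ≤ ε / 2 + ε / 2 := add_le_add h7 h6
    _ = ε := add_halves ε

end Cocycle

/-! ### Derivatives along the Hamiltonian field -/

section DerivX

variable {F : Type*} [NormedAddCommGroup F] [NormedSpace ℝ F]
  {G : Type*} [NormedAddCommGroup G] [NormedSpace ℝ G] {h : Cotangent n M → ℝ}

/-- The derivative of a vector-valued function along `X_h`. -/
def derivX (h : Cotangent n M → ℝ) (k : Cotangent n M → F) (z : Cotangent n M) : F :=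
  mfd k z (hamField h z : Phase n)

theorem poisson_eq_derivX (h k : Cotangent n M → ℝ) (z : Cotangent n M) :
    poisson h k z = derivX h k z := rfl

theorem derivX_eq_ch (hh : IsHamiltonian h) {k : Cotangent n M → F} {q : M} {z : Cotangent n M}
    (hz : z ∈ punctured n M) (hk : MDifferentiableAt (phaseModel n) 𝓘(ℝ, F) k z)
    (hq : z ∈ (ch q).source) :
    derivX h k z = fderiv ℝ (k ∘ (ch q).symm) (ch q z) (hamCoord h q (ch q z)) := by
  have h1 : (hamField h z : Phase n) = trD q z (hamCoord h q (ch q z)) :=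
    hamField_eq (hh.mdifferentiableAt hz) hq
  rw [derivX, h1, mfderiv_trD hk hq]

theorem derivX_comp (hh : IsHamiltonian h) {k : Cotangent n M → F} {Φ : F → G}
    {z : Cotangent n M} (hz : z ∈ punctured n M)
    (hk : MDifferentiableAt (phaseModel n) 𝓘(ℝ, F) k z) (hΦ : DifferentiableAt ℝ Φ (k z)) :
    derivX h (fun w => Φ (k w)) z = fderiv ℝ Φ (k z) (derivX h k z) := by
  have hq := mem_ch_source z
  have h1 := hasFDerivAt_comp_ch_symm hk hq
  have h2 : HasFDerivAt Φ (fderiv ℝ Φ (k z)) ((k ∘ (ch z.1).symm) (ch z.1 z)) := by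
    rw [Function.comp_apply, (ch z.1).left_inv hq]
    exact hΦ.hasFDerivAt
  have h3 : MDifferentiableAt (phaseModel n) 𝓘(ℝ, G) (fun w => Φ (k w)) z :=
    (hΦ.mdifferentiableAt).comp z hk
  rw [derivX_eq_ch hh hz hk hq, derivX_eq_ch hh hz h3 hq, h1.fderiv]
  exact DFunLike.congr_fun (h2.comp _ h1).fderiv _

theorem derivX_prodMk (hh : IsHamiltonian h) {k : Cotangent n M → F} {l : Cotangent n M → G}
    {z : Cotangent n M} (hz : z ∈ punctured n M)
    (hk : MDifferentiableAt (phaseModel n) 𝓘(ℝ, F) k z)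
    (hl : MDifferentiableAt (phaseModel n) 𝓘(ℝ, G) l z) :
    derivX h (fun w => (k w, l w)) z = (derivX h k z, derivX h l z) := by
  have hq := mem_ch_source z
  have h1 := hasFDerivAt_comp_ch_symm hk hq
  have h2 := hasFDerivAt_comp_ch_symm hl hq
  rw [derivX_eq_ch hh hz hk hq, derivX_eq_ch hh hz hl hq,
    derivX_eq_ch hh hz (hk.prodMk_space hl) hq, h1.fderiv, h2.fderiv]
  exact DFunLike.congr_fun (h1.prodMk h2).fderiv _

theorem contMDiffAt_derivX (hh : IsHamiltonian h) {k : Cotangent n M → F}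
    (hk : ∀ z ∈ punctured n M, ContMDiffAt (phaseModel n) 𝓘(ℝ, F) ∞ k z)
    {z : Cotangent n M} (hz : z ∈ punctured n M) :
    ContMDiffAt (phaseModel n) 𝓘(ℝ, F) ∞ (derivX h k) z := by
  have hq := mem_ch_source z
  have ht : ch z.1 z ∈ (ch (n := n) z.1).target := (ch z.1).map_source hq
  have h0 := ch_snd_ne_zero hz hq
  have h1 : ContDiffAt ℝ ∞
      (fun w => fderiv ℝ (k ∘ (ch z.1).symm) w (hamCoord h z.1 w)) (ch z.1 z) := by
    refine ContDiffAt.clm_apply (contDiffAt_fderiv_infty ?_) (contDiffAt_hamCoord hh ht h0)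
    refine contDiffAt_comp_ch_symm ht ?_
    rw [(ch z.1).left_inv hq]
    exact hk z hz
  refine (h1.contMDiffAt.comp z (contMDiffAt_ch hq)).congr_of_eventuallyEq ?_
  filter_upwards [(isOpen_ch_source z.1).mem_nhds hq, isOpen_punctured.mem_nhds hz] with w h2 h3
  exact derivX_eq_ch hh h3 ((hk w h3).mdifferentiableAt (by simp)) h2

theorem derivX_dilate (hh : IsHamiltonian h) {k : Cotangent n M → F}
    (hk : ∀ z ∈ punctured n M, ContMDiffAt (phaseModel n) 𝓘(ℝ, F) ∞ k z) {s c : ℝ} (hs : 0 < s)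
    (hsc : ∀ z ∈ punctured n M, k (dilate s z) = c • k z) {z : Cotangent n M}
    (hz : z ∈ punctured n M) : derivX h k (dilate s z) = (s⁻¹ * c) • derivX h k z := by
  have hq := mem_ch_source z
  have ht : ch z.1 z ∈ (ch (n := n) z.1).target := (ch z.1).map_source hq
  have h0 := ch_snd_ne_zero hz hq
  have hsz : dilate s z ∈ punctured n M := (dilate_mem_punctured hs.ne').2 hz
  have hsq : dilate s z ∈ (ch (n := n) z.1).source := (dilate_mem_ch_source s).2 hq
  have h1 := hasFDerivAt_comp_ch_symm ((hk _ hsz).mdifferentiableAt (by simp)) hsq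
  have h2 := hasFDerivAt_comp_ch_symm ((hk _ hz).mdifferentiableAt (by simp)) hq
  rw [derivX_eq_ch hh hz ((hk _ hz).mdifferentiableAt (by simp)) hq,
    derivX_eq_ch hh hsz ((hk _ hsz).mdifferentiableAt (by simp)) hsq, ch_dilate,
    hamCoord_dil hh ht h0 hs, map_smul, mul_smul]
  congr 1
  rw [← ch_dilate, h1.fderiv, h2.fderiv]
  rw [ch_dilate] at h1
  have h3 := h1.comp _ (dil (n := n) s).hasFDerivAt
  have h4 := (h2.const_smul c).congr_of_eventuallyEq
    (f₁ := (k ∘ (ch (n := n) z.1).symm) ∘ dil s) (by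
      filter_upwards [eventually_ch_target ht h0] with w hw
      simp only [Function.comp_apply, Pi.smul_apply]
      rw [ch_symm_dil s hw.1, hsc _ (ch_symm_mem_punctured hw.1 hw.2)])
  exact DFunLike.congr_fun (h3.unique h4) _

/-- Derivative of a function along an integral curve of `f X_h`. -/
theorem hasDerivAt_comp_curve {f : Cotangent n M → ℝ} {k : Cotangent n M → F}
    {γ : ℝ → Cotangent n M} {t : ℝ}
    (hγ : HasMFDerivAt 𝓘(ℝ, ℝ) (phaseModel n) γ t
      ((1 : ℝ →L[ℝ] ℝ).smulRight (f (γ t) • hamField h (γ t))))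
    (hk : MDifferentiableAt (phaseModel n) 𝓘(ℝ, F) k (γ t)) :
    HasDerivAt (fun s => k (γ s)) (f (γ t) • derivX h k (γ t)) t := by
  obtain ⟨x, hx⟩ : ∃ x : Phase n, x = f (γ t) • (hamField h (γ t) : Phase n) := ⟨_, rfl⟩
  have h1 : HasFDerivAt (k ∘ γ) ((mfd k (γ t)).comp ((1 : ℝ →L[ℝ] ℝ).smulRight x)) t := by
    rw [hx]
    exact (hk.hasMFDerivAt.comp t hγ).hasFDerivAt
  refine h1.hasDerivAt.congr_deriv ?_
  rw [ContinuousLinearMap.comp_apply, ContinuousLinearMap.smulRight_apply,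
    one_apply_eq_self, one_smul, hx]
  exact (mfd k (γ t)).map_smul (f (γ t)) (hamField h (γ t) : Phase n)

/-- Local integral curves of `f X_h` in `Σ₀`. -/
theorem exists_local_curve (hh : IsHamiltonian h) {f : Cotangent n M → ℝ}
    (hf : IsGenerator h univ f) {z : Cotangent n M} (hz : z ∈ shell h) :
    ∃ ε : ℝ, 0 < ε ∧ ∃ γ : ℝ → Cotangent n M, γ 0 = z ∧ ∀ t ∈ Ioo (-ε) ε, γ t ∈ shell h ∧
      HasMFDerivAt 𝓘(ℝ, ℝ) (phaseModel n) γ t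
        ((1 : ℝ →L[ℝ] ℝ).smulRight (f (γ t) • hamField h (γ t))) := by
  have hq := mem_ch_source z
  set q := z.1
  have ht : ch q z ∈ (ch (n := n) q).target := (ch q).map_source hq
  have h0 := ch_snd_ne_zero hz.1 hq
  obtain ⟨U, f', hU, hzU, hf', heq⟩ := hf.smooth z (by rw [coneOver_univ]; exact hz)
  rw [coneOver_univ] at heq
  have hW : IsOpen ((ch (n := n) q).target ∩ (ch q).symm ⁻¹' U) :=
    (contMDiffOn_ch_symm q).continuousOn.isOpen_inter_preimage (isOpen_ch_target q) hU
  have hWz : ch q z ∈ (ch (n := n) q).target ∩ (ch q).symm ⁻¹' U := by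
    refine ⟨ht, ?_⟩
    rw [mem_preimage, (ch q).left_inv hq]
    exact hzU
  have hf'z : ContMDiffAt (phaseModel n) 𝓘(ℝ, ℝ) ∞ f' ((ch q).symm (ch q z)) := by
    rw [(ch q).left_inv hq]
    exact hf'.contMDiffAt (hU.mem_nhds hzU)
  have hsm : ContDiffAt ℝ ∞ (fun w => (f' ∘ (ch q).symm) w • hamCoord h q w) (ch q z) :=
    (contDiffAt_comp_ch_symm ht hf'z).smul (contDiffAt_hamCoord hh ht h0)
  obtain ⟨α, hα0, ε₀, hε₀, hα⟩ :=
    (hsm.of_le (m := 1) (by norm_cast)).exists_forall_mem_closedBall_exists_eq_forall_mem_Ioo_hasDerivAt₀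
      0
  have hev : ∀ᶠ t in 𝓝 (0 : ℝ), α t ∈ (ch (n := n) q).target ∩ (ch q).symm ⁻¹' U ∧
      (α t).2 ≠ 0 := by
    have hc : ContinuousAt α 0 := (hα 0 (by constructor <;> linarith)).continuousAt
    refine (hc.eventually_mem (hW.mem_nhds (hα0.symm ▸ hWz))).and ?_
    exact (continuous_snd.continuousAt.comp hc).eventually_ne (by
      rw [Function.comp_apply, hα0]; exact h0)
  obtain ⟨ε₁, hε₁, hα₁⟩ := Metric.eventually_nhds_iff.1 hev
  have hmem : ∀ t ∈ Ioo (-min ε₀ ε₁) (min ε₀ ε₁), HasDerivAt α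
      ((f' ∘ (ch q).symm) (α t) • hamCoord h q (α t)) t ∧
        (α t ∈ (ch (n := n) q).target ∩ (ch q).symm ⁻¹' U) ∧ (α t).2 ≠ 0 := by
    intro t ht
    have h1 : |t| < min ε₀ ε₁ := abs_lt.2 ht
    refine ⟨hα t ?_, hα₁ ?_⟩
    · rw [zero_sub, zero_add]
      exact abs_lt.1 (h1.trans_le (min_le_left _ _))
    · rw [Real.dist_eq, sub_zero]
      exact h1.trans_le (min_le_right _ _)
  have h00 : (0 : ℝ) ∈ Ioo (-min ε₀ ε₁) (min ε₀ ε₁) := by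
    have := lt_min hε₀ hε₁
    constructor <;> linarith
  -- h is constant along any multiple of its Hamiltonian field, so the solution curve does not leave
  -- Σ₀.
  have hconst : ∀ t ∈ Ioo (-min ε₀ ε₁) (min ε₀ ε₁), h ((ch q).symm (α t)) = 0 := by
    intro t ht
    have h1 := (convex_Ioo (-min ε₀ ε₁) (min ε₀ ε₁)).norm_image_sub_le_of_norm_hasDerivWithin_le
      (f := fun t => (h ∘ (ch q).symm) (α t)) (f' := fun _ => 0) (C := 0)
      (fun t ht => by
        obtain ⟨h2, h3, h4⟩ := hmem t ht
        have h5 := ((hh.contDiffAt h3.1 h4).differentiableAt (by simp)).hasFDerivAt.comp_hasDerivAt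
          t h2
        rw [map_smul, fderiv_hamCoord_self, smul_zero] at h5
        exact h5.hasDerivWithinAt) (fun _ _ => norm_zero.le) h00 ht
    rw [zero_mul, norm_le_zero_iff, sub_eq_zero, hα0] at h1
    simp only [Function.comp_apply] at h1
    rw [h1, (ch q).left_inv hq, hz.2]
  have hshell : ∀ t ∈ Ioo (-min ε₀ ε₁) (min ε₀ ε₁), (ch q).symm (α t) ∈ shell h := fun t ht =>
    ⟨ch_symm_mem_punctured (hmem t ht).2.1.1 (hmem t ht).2.2, hconst t ht⟩
  refine ⟨min ε₀ ε₁, lt_min hε₀ hε₁, fun t => (ch q).symm (α t), ?_, fun t ht => ⟨hshell t ht, ?_⟩⟩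
  · simp only
    rw [hα0, (ch q).left_inv hq]
  · obtain ⟨h2, h3, h4⟩ := hmem t ht
    have hsrc : (ch q).symm (α t) ∈ (ch (n := n) q).source := (ch q).map_target h3.1
    have h6 : HasFDerivAt (ch q ∘ fun t => (ch q).symm (α t)) ((1 : ℝ →L[ℝ] ℝ).smulRight
        ((f' ∘ (ch q).symm) (α t) • hamCoord h q (α t))) t := by
      refine h2.hasFDerivAt.congr_of_eventuallyEq ?_
      filter_upwards [Ioo_mem_nhds ht.1 ht.2] with s hs
      exact (ch q).right_inv (hmem s hs).2.1.1
    have h7 := hasMFDerivAt_of_ch (((contMDiffAt_ch_symm h3.1).continuousAt).comp h2.continuousAt)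
      hsrc h6
    have h8 : (hamField h ((ch q).symm (α t)) : Phase n) =
        trD q ((ch q).symm (α t)) (hamCoord h q (α t)) := by
      have := hamField_eq (hh.mdifferentiableAt (hshell t ht).1) hsrc
      rw [(ch q).right_inv h3.1] at this
      exact this
    have h9 : f ((ch q).symm (α t)) = f' ((ch q).symm (α t)) :=
      (heq ⟨h3.2, hshell t ht⟩).symm
    obtain ⟨x, hx⟩ : ∃ x : Phase n, x =
      f ((ch q).symm (α t)) • (hamField h ((ch q).symm (α t)) : Phase n) := ⟨_, rfl⟩
    have h10 : (trD q ((ch q).symm (α t))).comp ((1 : ℝ →L[ℝ] ℝ).smulRight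
        ((f' ∘ (ch q).symm) (α t) • hamCoord h q (α t))) = (1 : ℝ →L[ℝ] ℝ).smulRight x := by
      refine ContinuousLinearMap.ext fun v => ?_
      rw [hx, h8, h9]
      simp only [ContinuousLinearMap.comp_apply, ContinuousLinearMap.smulRight_apply, map_smul,
        Function.comp_apply]
      rfl
    -- The derivative is a variable here so that the identity of linear maps can be substituted
    -- although the tangent spaces are indexed by points.
    have h11 : ∀ A : ℝ →L[ℝ] Phase n, (trD q ((ch q).symm (α t))).comp
        ((1 : ℝ →L[ℝ] ℝ).smulRight ((f' ∘ (ch q).symm) (α t) • hamCoord h q (α t))) = A →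
        HasMFDerivAt 𝓘(ℝ, ℝ) (phaseModel n) (fun t => (ch q).symm (α t)) t A :=
      fun A hA => hA ▸ h7
    subst hx
    exact h11 _ h10

end DerivX

/-! ### The ambient system -/

theorem locSmooth_of_contMDiffAt {F : Type*} [NormedAddCommGroup F] [NormedSpace ℝ F]
    {C : Set (Cotangent n M)} {k : Cotangent n M → F} (hC : C ⊆ punctured n M)
    (hk : ∀ z ∈ punctured n M, ContMDiffAt (phaseModel n) 𝓘(ℝ, F) ∞ k z) : LocSmooth C k :=
  fun _ hz => ⟨punctured n M, k, isOpen_punctured, hC hz,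
    fun w hw => (hk w hw).contMDiffWithinAt, fun _ _ => rfl⟩

theorem derivX_mul_comp {F : Type*} [NormedAddCommGroup F] [NormedSpace ℝ F]
    {h : Cotangent n M → ℝ} (hh : IsHamiltonian h) {g : Cotangent n M → ℝ}
    {k : Cotangent n M → F} {u : F → ℝ} {z : Cotangent n M} (hz : z ∈ punctured n M)
    (hg : MDifferentiableAt (phaseModel n) 𝓘(ℝ, ℝ) g z)
    (hk : MDifferentiableAt (phaseModel n) 𝓘(ℝ, F) k z) (hu : DifferentiableAt ℝ u (k z)) :
    derivX h (fun w => g w * u (k w)) z =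
      g z * fderiv ℝ u (k z) (derivX h k z) + u (k z) * derivX h g z := by
  have h3 : HasFDerivAt (fun p : ℝ × F => p.1 * u p.2)
      (g z • (fderiv ℝ u (k z)).comp (ContinuousLinearMap.snd ℝ ℝ F) +
        u (k z) • ContinuousLinearMap.fst ℝ ℝ F) (g z, k z) :=
    HasFDerivAt.mul hasFDerivAt_fst
      (HasFDerivAt.comp (𝕜 := ℝ) (g z, k z) (f := Prod.snd) hu.hasFDerivAt hasFDerivAt_snd)
  have h4 := derivX_comp hh hz (hg.prodMk_space hk) h3.differentiableAt
  rw [h4, derivX_prodMk hh hz hg hk, h3.fderiv]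
  rfl

theorem cocycleOp_of_eq_smul {E : Type*} [NormedAddCommGroup E] [NormedSpace ℝ E] {y : E → E}
    {c u : E → ℝ} {x v : E} {a : ℝ} (hy : y x = a • v) :
    cocycleOp y c u x = a * fderiv ℝ u x v + c x * u x := by
  rw [cocycleOp, hy, map_smul, smul_eq_mul]

theorem shell_subset_punctured {h : Cotangent n M → ℝ} : shell h ⊆ punctured n M :=
  fun _ hz => hz.1

theorem exists_mem_shell_proj {h : Cotangent n M → ℝ} (x : Infinity h) :
    ∃ z : shell h, proj h z = x := Quotient.exists_rep x

theorem exists_bumpCovering.{u} {n : ℕ} (M : Type u) [TopologicalSpace M]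
    [ChartedSpace (Base n) M] [IsManifold 𝓘(ℝ, Base n) ∞ M] [T2Space M] [CompactSpace M] :
    ∃ (ι : Type u) (_ : Fintype ι), Nonempty (SmoothBumpCovering ι 𝓘(ℝ, Base n) M) := by
  obtain ⟨ι, fs, _⟩ := SmoothBumpCovering.exists_isSubordinate 𝓘(ℝ, Base n)
    (isClosed_univ (X := M)) (U := fun _ => univ) (fun _ _ => univ_mem)
  exact ⟨ι, fs.fintype, ⟨fs⟩⟩

section Ambient

variable {ι : Type*} [Fintype ι] [T2Space M] (fs : SmoothBumpCovering ι 𝓘(ℝ, Base n) M)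
  {h f : Cotangent n M → ℝ}

theorem isGenerator_fibNorm (O : Set (Infinity h)) : IsGenerator h O (fibNorm fs) where
  smooth := locSmooth_of_contMDiffAt (fun _ hz => hz.1.1) fun _ hz => contMDiffAt_fibNorm fs hz
  pos := fun _ hz => fibNorm_pos fs hz.1.1
  homogeneous := fun _ hs z _ => fibNorm_dilate fs hs.le z

/-- The map `Z₀ → Ambient` induced by `emb`. -/
def embQ (h : Cotangent n M → ℝ) (x : Infinity h) : Ambient n ι :=
  Quotient.lift (fun z : shell h => emb fs (z : Cotangent n M))
    (by
      rintro z w ⟨s, hs, hw⟩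
      simp only [hw, emb_dilate fs hs]) x

theorem embQ_proj (z : shell h) : embQ fs h (proj h z) = emb fs (z : Cotangent n M) := rfl

theorem continuous_embQ : Continuous (embQ fs h) :=
  continuous_quot_lift _ (continuous_iff_continuousAt.2 fun z =>
    (contMDiffAt_emb fs z.2.1).continuousAt.comp continuous_subtype_val.continuousAt)

theorem embQ_injective : Function.Injective (embQ fs h) := by
  intro x y hxy
  obtain ⟨z, rfl⟩ := exists_mem_shell_proj x
  obtain ⟨w, rfl⟩ := exists_mem_shell_proj y
  rw [embQ_proj, embQ_proj] at hxy
  obtain ⟨s, hs, hw⟩ := exists_dilate_of_emb_eq fs z.2.1 w.2.1 hxy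
  exact Quotient.sound (show (rayRel h).r z w from ⟨s, hs, hw⟩)

/-! ### Topology of Z₀ and extension of functions of degree 0. -/

theorem t2Space_infinity (fs : SmoothBumpCovering ι 𝓘(ℝ, Base n) M) : T2Space (Infinity h) :=
  T2Space.of_injective_continuous (embQ_injective fs) (continuous_embQ fs)

theorem unit_mem_shell (hh : IsHamiltonian h) {z : Cotangent n M} (hz : z ∈ shell h) :
    unit fs z ∈ shell h :=
  dilate_mem_shell hh hz (inv_pos.2 (fibNorm_pos fs hz.1))

theorem proj_unit (hh : IsHamiltonian h) (z : shell h) :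
    proj h ⟨unit fs z, unit_mem_shell fs hh z.2⟩ = proj h z :=
  proj_dilate z.2 (inv_pos.2 (fibNorm_pos fs z.2.1)) _

theorem isCompact_shell_fibNorm_eq_one [CompactSpace M] (hh : IsHamiltonian h) :
    IsCompact {z : shell h | fibNorm fs (z : Cotangent n M) = 1} := by
  rw [Subtype.isCompact_iff]
  have h1 : {z : Cotangent n M | fibNorm fs z = 1} ⊆ punctured n M := fun z hz => by
    by_contra h2
    have h3 : fibNorm fs z = 1 := hz
    rw [fibNorm_eq_zero fs h2] at h3
    exact zero_ne_one h3
  have h2 := (hh.smooth.continuousOn.mono h1).preimage_isClosed_of_isClosed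
    (isClosed_singleton.preimage (continuous_fibNorm fs)) (isClosed_singleton (x := (0 : ℝ)))
  have h3 : Subtype.val '' {z : shell h | fibNorm fs (z : Cotangent n M) = 1} =
      {z : Cotangent n M | fibNorm fs z = 1} ∩ h ⁻¹' {0} := by
    refine Set.ext fun z => ⟨?_, fun hz => ⟨⟨z, h1 hz.1, hz.2⟩, hz.1, rfl⟩⟩
    rintro ⟨w, hw, rfl⟩
    exact ⟨hw, w.2.2⟩
  rw [h3]
  exact (isCompact_fibNorm_eq_one fs).of_isClosed_subset h2 inter_subset_left

theorem compactSpace_infinity [CompactSpace M] (fs : SmoothBumpCovering ι 𝓘(ℝ, Base n) M)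
    (hh : IsHamiltonian h) :
    CompactSpace (Infinity h) := by
  refine ⟨?_⟩
  have h1 := (isCompact_shell_fibNorm_eq_one fs hh).image continuous_proj
  have h2 : proj h '' {z : shell h | fibNorm fs (z : Cotangent n M) = 1} = univ := by
    refine eq_univ_of_forall fun x => ?_
    obtain ⟨z, rfl⟩ := exists_mem_shell_proj x
    exact ⟨⟨unit fs z, unit_mem_shell fs hh z.2⟩, fibNorm_unit fs z.2.1, proj_unit fs hh z⟩
  rwa [h2] at h1

theorem emb_image_coneOver (C : Set (Infinity h)) : emb fs '' coneOver h C = embQ fs h '' C := by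
  refine Set.ext fun ξ => ⟨?_, ?_⟩
  · rintro ⟨z, ⟨hz, hzC⟩, rfl⟩
    exact ⟨_, hzC, embQ_proj fs ⟨z, hz⟩⟩
  · rintro ⟨x, hx, rfl⟩
    obtain ⟨z, rfl⟩ := exists_mem_shell_proj x
    exact ⟨z, ⟨z.2, hx⟩, rfl⟩

theorem isCompact_emb_image_coneOver [CompactSpace M] (hh : IsHamiltonian h)
    {C : Set (Infinity h)} (hC : IsClosed C) : IsCompact (emb fs '' coneOver h C) := by
  rw [emb_image_coneOver]
  have := compactSpace_infinity fs hh
  exact hC.isCompact.image (continuous_embQ fs)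

/-- A smooth extension, with compact support, of a function of degree `0`. -/
theorem exists_compactly_supported_extension [CompactSpace M] (hh : IsHamiltonian h)
    {F : Type*} [NormedAddCommGroup F] [NormedSpace ℝ F] {C : Set (Infinity h)} (hC : IsClosed C)
    {B : Cotangent n M → F} (hB : LocSmooth (coneOver h C) B)
    (hhom : ∀ s : ℝ, 0 < s → ∀ z ∈ coneOver h C, B (dilate s z) = B z) :
    ∃ g : Ambient n ι → F, ContDiff ℝ ∞ g ∧ HasCompactSupport g ∧
      ∀ z ∈ coneOver h C, g (emb fs z) = B z := by
  have hcpt := isCompact_emb_image_coneOver fs hh hC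
  obtain ⟨g, hg, hgB⟩ := exists_ambient_extension fs (fun _ hz => hz.1.1)
    (fun s hs z hz => dilate_mem_coneOver hh hz hs) hcpt.isClosed hB hhom
  obtain ⟨R, hR, hRC⟩ := hcpt.isBounded.subset_closedBall_lt 0 0
  let χ : ContDiffBump (0 : Ambient n ι) := ⟨R, R + 1, hR, lt_add_one R⟩
  refine ⟨fun ξ => χ ξ • g ξ, χ.contDiff.smul hg, χ.hasCompactSupport.smul_right, fun z hz => ?_⟩
  simp only
  rw [χ.one_of_mem_closedBall (hRC (mem_image_of_mem _ hz)), one_smul, hgB z hz]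

/-- The maps `y` and `c` express the field `f X_h` on `Σ₀` in the coordinates `emb` and
`log fibNorm`, and `Φ` is the flow of the resulting field. -/
structure IsAmbientFlow (h f : Cotangent n M → ℝ) (y : Ambient n ι → Ambient n ι)
    (c : Ambient n ι → ℝ) (Φ : ℝ → Ambient n ι × ℝ → Ambient n ι × ℝ) : Prop where
  bounded : ∃ K B L : ℝ≥0, IsBoundedField (cocycleField y c) K B L
  flow : IsODEFlow (cocycleField y c) Φ
  y_emb : ∀ z ∈ shell h, y (emb fs z) = f z • derivX h (emb fs) z
  c_emb : ∀ z ∈ shell h, c (emb fs z) = f z * derivX h (fibNorm fs) z / fibNorm fs z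

/-- f has degree 1 and X_h degree -1, so the derivatives of `emb` and of log N along f X_h have
degree 0 and extend to the ambient space. Compact support gives the bounds that make the flow
global. -/
theorem exists_isAmbientFlow [CompactSpace M] (hh : IsHamiltonian h)
    (hf : IsGenerator h univ f) : ∃ y c Φ, IsAmbientFlow fs h f y c Φ := by
  have hcu : coneOver h univ = shell h := coneOver_univ
  have hfs : LocSmooth (shell h) f := hcu ▸ hf.smooth
  have hfh : ∀ s : ℝ, 0 < s → ∀ z ∈ shell h, f (dilate s z) = s * f z := hcu ▸ hf.homogeneous
  have h1 : LocSmooth (shell h) (fun z => f z • derivX h (emb fs) z) :=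
    (hfs.prodMk (locSmooth_of_contMDiffAt shell_subset_punctured fun z hz =>
      contMDiffAt_derivX hh (fun w hw => contMDiffAt_emb fs hw) hz)).comp isOpen_univ
      (Φ := fun p => p.1 • p.2) (contDiff_fst.smul contDiff_snd).contDiffOn fun _ _ => mem_univ _
  have h2 : LocSmooth (shell h) (fun z => f z * derivX h (fibNorm fs) z / fibNorm fs z) :=
    (hfs.prodMk ((locSmooth_of_contMDiffAt shell_subset_punctured fun z hz =>
      contMDiffAt_derivX hh (fun w hw => contMDiffAt_fibNorm fs hw) hz).prodMk
        (locSmooth_of_contMDiffAt shell_subset_punctured fun w hw =>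
          contMDiffAt_fibNorm fs hw))).comp
      (P := {p : ℝ × ℝ × ℝ | p.2.2 ≠ 0}) (isOpen_ne_fun (by fun_prop) (by fun_prop))
      (Φ := fun p => p.1 * p.2.1 / p.2.2)
      (ContDiffOn.div (by fun_prop) (by fun_prop) fun _ hp => hp)
      fun z hz => (fibNorm_pos fs hz.1).ne'
  obtain ⟨y, hy, hys, hyB⟩ := exists_compactly_supported_extension fs hh isClosed_univ
    (hcu.symm ▸ h1) (fun s hs z hz => by
      rw [hf.homogeneous s hs z hz, derivX_dilate (c := 1) hh
        (fun w hw => contMDiffAt_emb fs hw) hs (fun w hw => by rw [emb_dilate fs hs, one_smul])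
        hz.1.1, smul_smul, mul_one, mul_right_comm, mul_inv_cancel₀ hs.ne', one_mul])
  obtain ⟨c, hc, hcs, hcB⟩ := exists_compactly_supported_extension fs hh isClosed_univ
    (hcu.symm ▸ h2) (fun s hs z hz => by
      rw [hf.homogeneous s hs z hz, derivX_dilate (c := s) hh
        (fun w hw => contMDiffAt_fibNorm fs hw) hs (fun w hw => fibNorm_dilate fs hs.le w)
        hz.1.1, fibNorm_dilate fs hs.le, inv_mul_cancel₀ hs.ne', one_smul, mul_assoc,
        mul_div_mul_left _ _ hs.ne'])
  rw [hcu] at hyB hcB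
  obtain ⟨K, B, L, hV⟩ := exists_isBoundedField hy hc hys hcs
  obtain ⟨Φ, hΦ⟩ := exists_isODEFlow hV.lipschitz hV.norm_le
  exact ⟨y, c, Φ, ⟨K, B, L, hV⟩, hΦ, hyB, hcB⟩

/-- The dictionary between brackets on Σ₀ and the operator u ↦ y u + c u, by the product rule. -/
theorem poisson_fibNorm_mul {y : Ambient n ι → Ambient n ι} {c : Ambient n ι → ℝ}
    {Φ : ℝ → Ambient n ι × ℝ → Ambient n ι × ℝ} (hh : IsHamiltonian h)
    (hA : IsAmbientFlow fs h f y c Φ)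
    {u : Ambient n ι → ℝ} (hu : ContDiff ℝ ∞ u) {z : Cotangent n M} (hz : z ∈ shell h) :
    f z * poisson h (fun w => fibNorm fs w * u (emb fs w)) z =
      fibNorm fs z * cocycleOp y c u (emb fs z) := by
  have h1 := (contMDiffAt_emb fs hz.1).mdifferentiableAt (by simp)
  have h2 := (contMDiffAt_fibNorm fs hz.1).mdifferentiableAt (by simp)
  have hu' : DifferentiableAt ℝ u (emb fs z) := (hu.differentiable (by simp)).differentiableAt
  have h0 := (fibNorm_pos fs hz.1).ne'
  rw [poisson_eq_derivX, derivX_mul_comp hh hz.1 h2 h1 hu',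
    cocycleOp_of_eq_smul (hA.y_emb z hz), hA.c_emb z hz]
  field_simp

end Ambient

/-! ### The flow on `Z₀` -/

/-- A scalar factor in front of the field only changes the time. This compares the flows of two
generators. -/
theorem IsODEFlow.eq_of_hasDerivAt_smul {E : Type*} [NormedAddCommGroup E] [NormedSpace ℝ E]
    {V : E → E} {Φ : ℝ → E → E} {K : ℝ≥0} (hΦ : IsODEFlow V Φ) (hK : LipschitzWith K V)
    {ρ : ℝ → ℝ} (hρ : Continuous ρ) {γ : ℝ → E} (hγ : ∀ t, HasDerivAt γ (ρ t • V (γ t)) t)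
    (t : ℝ) : γ t = Φ (∫ s in (0 : ℝ)..t, ρ s) (γ 0) := by
  have hη : ∀ t, HasDerivAt (fun t => Φ (∫ s in (0 : ℝ)..t, ρ s) (γ 0))
      (ρ t • V (Φ (∫ s in (0 : ℝ)..t, ρ s) (γ 0))) t := fun t =>
    (hΦ.deriv (γ 0) _).scomp t (hρ.integral_hasStrictDerivAt 0 t).hasDerivAt
  obtain ⟨C, hC⟩ := (isCompact_Icc (a := -(|t| + 1)) (b := |t| + 1)).exists_bound_of_continuousOn
    hρ.continuousOn
  have h0 := abs_nonneg t
  refine ODE_solution_unique_of_mem_Icc (v := fun t x => ρ t • V x) (K := C.toNNReal * K)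
    (s := fun _ => univ) (a := -(|t| + 1)) (b := |t| + 1) (t₀ := 0) (fun s hs => ?_)
    ⟨by linarith, by linarith⟩ (fun s _ => (hγ s).continuousAt.continuousWithinAt)
    (fun s _ => hγ s) (fun _ _ => mem_univ _)
    (fun s _ => (hη s).continuousAt.continuousWithinAt) (fun s _ => hη s) (fun _ _ => mem_univ _)
    ?_ ⟨by linarith [neg_abs_le t], by linarith [le_abs_self t]⟩
  · refine LipschitzWith.lipschitzOnWith (LipschitzWith.of_dist_le_mul fun x y => ?_)
    rw [dist_smul₀, NNReal.coe_mul, mul_assoc]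
    have h1 := hC s (Ioo_subset_Icc_self hs)
    exact mul_le_mul (h1.trans (Real.le_coe_toNNReal C)) (hK.dist_le_mul x y) dist_nonneg
      (NNReal.coe_nonneg _)
  · rw [intervalIntegral.integral_same, hΦ.zero]

/-- The field ignores its last variable. In terms of log N, the flow commutes with dilations. -/
theorem IsODEFlow.cocycle_translate {E : Type*} [NormedAddCommGroup E] [NormedSpace ℝ E]
    {y : E → E} {c : E → ℝ} {Φ : ℝ → E × ℝ → E × ℝ} {K : ℝ≥0}
    (hΦ : IsODEFlow (cocycleField y c) Φ) (hK : LipschitzWith K (cocycleField y c)) (t : ℝ)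
    (x : E) (a : ℝ) : Φ t (x, a) = ((Φ t (x, 0)).1, (Φ t (x, 0)).2 + a) := by
  have h1 := hΦ.eq_of_hasDerivAt hK (γ := fun t => Φ t (x, 0) + (0, a)) (fun t => by
    refine ((hΦ.deriv (x, 0) t).add_const (0, a)).congr_deriv ?_
    simp [cocycleField]) t
  rw [hΦ.zero] at h1
  simp only [Prod.mk_add_mk, add_zero, zero_add] at h1
  rw [← h1]
  ext <;> simp

section AmbientFlow

variable {ι : Type*} [Fintype ι] [T2Space M] {fs : SmoothBumpCovering ι 𝓘(ℝ, Base n) M}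
  {h f : Cotangent n M → ℝ} {y : Ambient n ι → Ambient n ι} {c : Ambient n ι → ℝ}
  {Φ : ℝ → Ambient n ι × ℝ → Ambient n ι × ℝ}

/-- The coordinates `emb` and `log fibNorm`. -/
def embLog (fs : SmoothBumpCovering ι 𝓘(ℝ, Base n) M) (z : Cotangent n M) : Ambient n ι × ℝ :=
  (emb fs z, Real.log (fibNorm fs z))

theorem embLog_injOn {z w : Cotangent n M} (hz : z ∈ punctured n M) (hw : w ∈ punctured n M)
    (hzw : embLog fs z = embLog fs w) : z = w := by
  obtain ⟨h1, h2⟩ := Prod.ext_iff.1 hzw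
  have h3 := Real.log_injOn_pos (fibNorm_pos fs hz) (fibNorm_pos fs hw) h2
  have h4 : unit fs z = unit fs w := unit_eq_of_emb_eq fs h1
  rw [← dilate_fibNorm_unit fs hz, h4, h3, dilate_fibNorm_unit fs hw]

theorem exists_embLog_eq (hh : IsHamiltonian h) {z : Cotangent n M} (hz : z ∈ shell h) (a : ℝ) :
    ∃ w ∈ shell h, embLog fs w = (emb fs z, a) := by
  have h0 := fibNorm_pos fs hz.1
  have h1 := div_pos (Real.exp_pos a) h0
  refine ⟨dilate (Real.exp a / fibNorm fs z) z, dilate_mem_shell hh hz h1, ?_⟩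
  rw [embLog, emb_dilate fs h1, fibNorm_dilate fs h1.le, div_mul_cancel₀ _ h0.ne', Real.log_exp]

theorem IsAmbientFlow.hasDerivAt_embLog (hA : IsAmbientFlow fs h f y c Φ)
    {γ : ℝ → Cotangent n M} {t : ℝ} (hz : γ t ∈ shell h)
    (hγ : HasMFDerivAt 𝓘(ℝ, ℝ) (phaseModel n) γ t
      ((1 : ℝ →L[ℝ] ℝ).smulRight (f (γ t) • hamField h (γ t)))) :
    HasDerivAt (fun s => embLog fs (γ s)) (cocycleField y c (embLog fs (γ t))) t := by
  have h1 := hasDerivAt_comp_curve hγ ((contMDiffAt_emb fs hz.1).mdifferentiableAt (by simp))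
  have h2 := hasDerivAt_comp_curve hγ ((contMDiffAt_fibNorm fs hz.1).mdifferentiableAt (by simp))
  refine (h1.prodMk (h2.log (fibNorm_pos fs hz.1).ne')).congr_deriv ?_
  rw [cocycleField, embLog, hA.y_emb _ hz, hA.c_emb _ hz, smul_eq_mul]

theorem IsAmbientFlow.embLog_curve (hA : IsAmbientFlow fs h f y c Φ) {γ : ℝ → Cotangent n M}
    {a b : ℝ} (h0 : (0 : ℝ) ∈ Ioo a b) (hγ : ∀ t ∈ Ioo a b, γ t ∈ shell h ∧
      HasMFDerivAt 𝓘(ℝ, ℝ) (phaseModel n) γ t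
        ((1 : ℝ →L[ℝ] ℝ).smulRight (f (γ t) • hamField h (γ t)))) {t : ℝ} (ht : t ∈ Ioo a b) :
    embLog fs (γ t) = Φ t (embLog fs (γ 0)) := by
  obtain ⟨K, B, L, hV⟩ := hA.bounded
  exact hA.flow.eq_of_hasDerivAt_Ioo hV.lipschitz (γ := fun t => embLog fs (γ t)) h0
    (fun s hs => hA.hasDerivAt_embLog (hγ s hs).1 (hγ s hs).2) ht

/-- Every point of `Σ₀` lies on an integral curve of `f X_h` that is defined for all times. -/
theorem IsAmbientFlow.exists_curve [CompactSpace M] (hA : IsAmbientFlow fs h f y c Φ)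
    (hh : IsHamiltonian h) (hf : IsGenerator h univ f) (z : shell h) :
    ∃ γ : ℝ → shell h, γ 0 = z ∧
      IsMIntegralCurve (I := phaseModel n) (fun t => (γ t : Cotangent n M))
        (fun w => f w • hamField h w) ∧
      ∀ t, embLog fs (γ t : Cotangent n M) = Φ t (embLog fs (z : Cotangent n M)) := by
  obtain ⟨K, B, L, hV⟩ := hA.bounded
  have hK := hV.lipschitz
  have hloc : ∀ w ∈ shell h, ∃ ε : ℝ, 0 < ε ∧ ∃ β : ℝ → Cotangent n M, β 0 = w ∧
      (∀ t ∈ Ioo (-ε) ε, β t ∈ shell h ∧ HasMFDerivAt 𝓘(ℝ, ℝ) (phaseModel n) β t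
        ((1 : ℝ →L[ℝ] ℝ).smulRight (f (β t) • hamField h (β t)))) ∧
      ∀ t ∈ Ioo (-ε) ε, embLog fs (β t) = Φ t (embLog fs w) := by
    intro w hw
    obtain ⟨ε, hε, β, h0, hβ⟩ := exists_local_curve hh hf hw
    refine ⟨ε, hε, β, h0, hβ, fun t ht => ?_⟩
    rw [hA.embLog_curve ⟨by linarith, hε⟩ hβ ht, h0]
  -- The times at which the ambient orbit lies over the image of Σ₀ form a closed set, as the image
  -- is compact, and an open set, by the local integral curves. By connectedness these are all
  -- times, so the curve can be lifted globally through the injective `embLog`.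
  have hS : {t : ℝ | (Φ t (embLog fs (z : Cotangent n M))).1 ∈ emb fs '' shell h} = univ := by
    refine IsClopen.eq_univ ⟨?_, ?_⟩ ⟨0, z, z.2, by rw [hA.flow.zero]; rfl⟩
    · have h1 : IsClosed (emb fs '' shell h) := by
        rw [← coneOver_univ]
        exact (isCompact_emb_image_coneOver fs hh isClosed_univ).isClosed
      exact h1.preimage (continuous_fst.comp (continuous_iff_continuousAt.2 fun t =>
        (hA.flow.deriv _ t).continuousAt))
    · refine isOpen_iff_mem_nhds.2 fun t ht => ?_
      obtain ⟨w, hw, hwt⟩ := ht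
      obtain ⟨v, hv, hvt⟩ := exists_embLog_eq (fs := fs) hh hw
        (Φ t (embLog fs (z : Cotangent n M))).2
      have hvt' : embLog fs v = Φ t (embLog fs (z : Cotangent n M)) := by rw [hvt, hwt]
      obtain ⟨ε, hε, β, -, hβ, hβ'⟩ := hloc v hv
      filter_upwards [Ioo_mem_nhds (sub_lt_self t hε) (lt_add_of_pos_right t hε)] with s hs
      have h1 : s - t ∈ Ioo (-ε) ε := ⟨by linarith [hs.1], by linarith [hs.2]⟩
      refine ⟨β (s - t), (hβ _ h1).1, ?_⟩
      have h2 := hβ' _ h1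
      rw [hvt', ← hA.flow.add hK, sub_add_cancel] at h2
      exact congrArg Prod.fst h2
  have hγ : ∀ t, ∃ w : shell h,
      embLog fs (w : Cotangent n M) = Φ t (embLog fs (z : Cotangent n M)) := by
    intro t
    obtain ⟨w, hw, hwt⟩ := eq_univ_iff_forall.1 hS t
    obtain ⟨v, hv, hvt⟩ := exists_embLog_eq (fs := fs) hh hw
      (Φ t (embLog fs (z : Cotangent n M))).2
    exact ⟨⟨v, hv⟩, by rw [hvt, hwt]⟩
  choose γ hγ using hγ
  refine ⟨γ, Subtype.ext (embLog_injOn (fs := fs) (γ 0).2.1 z.2.1 (by rw [hγ, hA.flow.zero])),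
    fun t => ?_, hγ⟩
  obtain ⟨ε, hε, β, hβ0, hβ, hβ'⟩ := hloc _ (γ t).2
  have h1 : IsMIntegralCurveAt (I := phaseModel n) β (fun w => f w • hamField h w) 0 :=
    (isMIntegralCurveAt_iff).2 ⟨Ioo (-ε) ε, Ioo_mem_nhds (by linarith) hε,
      fun s hs => (hβ s hs).2.hasMFDerivWithinAt⟩
  have h2 := (isMIntegralCurveAt_comp_sub (dt := t)).2 h1
  rw [zero_add] at h2
  have heq : (fun s => (γ s : Cotangent n M)) =ᶠ[𝓝 t] (β ∘ fun s => s - t) := by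
    filter_upwards [Ioo_mem_nhds (sub_lt_self t hε) (lt_add_of_pos_right t hε)] with s hs
    have h3 : s - t ∈ Ioo (-ε) ε := ⟨by linarith [hs.1], by linarith [hs.2]⟩
    refine embLog_injOn (fs := fs) (γ s).2.1 (hβ _ h3).1.1 ?_
    rw [Function.comp_apply, hβ' _ h3, hγ, hγ, ← hA.flow.add hK, sub_add_cancel]
  have h4 : ∀ w : Cotangent n M, (γ t : Cotangent n M) = w →
      HasMFDerivAt 𝓘(ℝ, ℝ) (phaseModel n) (fun s => (γ s : Cotangent n M)) t
        ((1 : ℝ →L[ℝ] ℝ).smulRight (f w • hamField h w : Phase n)) →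
      HasMFDerivAt 𝓘(ℝ, ℝ) (phaseModel n) (fun s => (γ s : Cotangent n M)) t
        ((1 : ℝ →L[ℝ] ℝ).smulRight (f (γ t) • hamField h (γ t) : Phase n)) := by
    rintro _ rfl h
    exact h
  exact h4 _ heq.self_of_nhds (h2.hasMFDerivAt.congr_of_eventuallyEq heq)

/-- A continuous flow. -/
structure IsContinuousFlow {X : Type*} [TopologicalSpace X] (φ : ℝ → X → X) : Prop where
  continuous : Continuous (fun p : ℝ × X => φ p.1 p.2)
  zero : ∀ x, φ 0 x = x
  add : ∀ s t x, φ (s + t) x = φ s (φ t x)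

/-- The projected orbit does not depend on the representative chosen on a ray: representatives
differ by a translation of log N. -/
theorem IsAmbientFlow.exists_isFlow [CompactSpace M] (hA : IsAmbientFlow fs h f y c Φ)
    (hh : IsHamiltonian h) (hf : IsGenerator h univ f) : ∃ φ, IsFlow h f φ := by
  obtain ⟨K, B, L, hV⟩ := hA.bounded
  choose γ h0 hγ hγΦ using hA.exists_curve hh hf
  refine ⟨fun t x => proj h (γ x.out t), fun z => ⟨γ z, h0 z, hγ z, fun t => ?_⟩⟩
  apply embQ_injective fs
  have h1 : embQ fs h (proj h (proj h z).out) = embQ fs h (proj h z) :=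
    congrArg _ (Quotient.out_eq _)
  have h2 := congrArg Prod.fst (hγΦ z t)
  have h3 := congrArg Prod.fst (hγΦ (proj h z).out t)
  rw [embLog, hA.flow.cocycle_translate hV.lipschitz] at h2 h3
  rw [embQ_proj, embQ_proj] at h1 ⊢
  simp only [embLog] at h2 h3
  rw [h1] at h3
  exact h3.trans h2.symm

theorem IsAmbientFlow.embLog_integralCurve (hA : IsAmbientFlow fs h f y c Φ) {γ : ℝ → shell h}
    (hγ : IsMIntegralCurve (I := phaseModel n) (fun t => (γ t : Cotangent n M))
      (fun w => f w • hamField h w)) (t : ℝ) :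
    embLog fs (γ t : Cotangent n M) = Φ t (embLog fs (γ 0 : Cotangent n M)) := by
  have h0 := abs_nonneg t
  exact hA.embLog_curve (γ := fun t => (γ t : Cotangent n M)) (a := -(|t| + 1)) (b := |t| + 1)
    ⟨by linarith, by linarith⟩ (fun s _ => ⟨(γ s).2, hγ s⟩)
    ⟨by linarith [neg_abs_le t], by linarith [le_abs_self t]⟩

theorem IsAmbientFlow.embQ_flow (hA : IsAmbientFlow fs h f y c Φ)
    {φ : ℝ → Infinity h → Infinity h} (hφ : IsFlow h f φ) (t : ℝ) (x : Infinity h) :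
    embQ fs h (φ t x) = (Φ t (embQ fs h x, 0)).1 := by
  obtain ⟨K, B, L, hV⟩ := hA.bounded
  obtain ⟨z, rfl⟩ := exists_mem_shell_proj x
  obtain ⟨γ, h0, hγ, hφγ⟩ := hφ z
  have h1 := congrArg Prod.fst (hA.embLog_integralCurve hγ t)
  rw [embLog, embLog, hA.flow.cocycle_translate hV.lipschitz, h0] at h1
  rw [hφγ, embQ_proj, embQ_proj]
  exact h1

theorem isClosedEmbedding_embQ [CompactSpace M] (fs : SmoothBumpCovering ι 𝓘(ℝ, Base n) M)
    (hh : IsHamiltonian h) : IsClosedEmbedding (embQ fs h) := by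
  have := compactSpace_infinity fs hh
  exact (continuous_embQ fs).isClosedEmbedding (embQ_injective fs)

theorem IsAmbientFlow.isContinuousFlow [CompactSpace M] (hA : IsAmbientFlow fs h f y c Φ)
    (hh : IsHamiltonian h) {φ : ℝ → Infinity h → Infinity h} (hφ : IsFlow h f φ) :
    IsContinuousFlow φ := by
  obtain ⟨K, B, L, hV⟩ := hA.bounded
  refine ⟨?_, fun x => ?_, fun s t x => ?_⟩
  · rw [(isClosedEmbedding_embQ fs hh).isEmbedding.continuous_iff]
    have h1 : Continuous (fun p : ℝ × Infinity h => (p.1, (embQ fs h p.2, (0 : ℝ)))) :=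
      continuous_fst.prodMk (((continuous_embQ fs).comp continuous_snd).prodMk continuous_const)
    refine (continuous_fst.comp ((hA.flow.continuous hV.lipschitz).comp h1)).congr fun p => ?_
    exact (hA.embQ_flow hφ p.1 p.2).symm
  · apply embQ_injective fs
    rw [hA.embQ_flow hφ, hA.flow.zero]
  · apply embQ_injective fs
    rw [hA.embQ_flow hφ, hA.embQ_flow hφ, hA.embQ_flow hφ, hA.flow.add hV.lipschitz,
      ← Prod.mk.eta (p := Φ t (embQ fs h x, 0)), hA.flow.cocycle_translate hV.lipschitz]

end AmbientFlow

theorem SmoothOnSubset.continuousOn {C : Set (Cotangent n M)} {k : Cotangent n M → ℝ}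
    (hk : SmoothOnSubset C k) : ContinuousOn k C := by
  intro z hz
  obtain ⟨U, k', hU, hzU, hk', heq⟩ := hk z hz
  have h1 := (hk'.contMDiffAt (hU.mem_nhds hzU)).continuousAt.continuousWithinAt (s := C)
  refine h1.congr_of_eventuallyEq ?_ (heq ⟨hzU, hz⟩).symm
  filter_upwards [inter_mem_nhdsWithin C (hU.mem_nhds hzU)] with w hw
  exact (heq ⟨hw.2, hw.1⟩).symm

/-- The flows of two generators have the same orbits. -/
theorem IsFlow.exists_eq_flow [CompactSpace M] [T2Space M] {h f f' : Cotangent n M → ℝ}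
    (hh : IsHamiltonian h) (hf : IsGenerator h univ f) (hf' : IsGenerator h univ f')
    {φ φ' : ℝ → Infinity h → Infinity h} (hφ : IsFlow h f φ) (hφ' : IsFlow h f' φ') (t : ℝ)
    (x : Infinity h) : ∃ s, φ' t x = φ s x := by
  obtain ⟨ι, _, ⟨fs⟩⟩ := exists_bumpCovering (n := n) M
  obtain ⟨y, c, Φ, hA⟩ := exists_isAmbientFlow fs hh hf
  obtain ⟨y', c', Φ', hA'⟩ := exists_isAmbientFlow fs hh hf'
  obtain ⟨K, B, L, hV⟩ := hA.bounded
  obtain ⟨z, rfl⟩ := exists_mem_shell_proj x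
  obtain ⟨γ, h0, hγ, hφγ⟩ := hφ' z
  have hcont : ∀ {g : Cotangent n M → ℝ}, IsGenerator h univ g →
      Continuous fun s => g (γ s : Cotangent n M) := fun hg => by
    have h1 := (hg.smooth.continuousOn)
    rw [coneOver_univ] at h1
    refine h1.comp_continuous (continuous_iff_continuousAt.2 fun s => ?_) fun s => (γ s).2
    exact (hγ s).continuousAt
  have hpos : ∀ w : shell h, 0 < f (w : Cotangent n M) := fun w =>
    hf.pos _ (by rw [coneOver_univ]; exact w.2)
  have hρ : Continuous fun s => f' (γ s : Cotangent n M) / f (γ s : Cotangent n M) :=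
    (hcont hf').div (hcont hf) fun s => (hpos _).ne'
  -- Along the orbit the second field is f'/f times the first, so the new time is the integral of
  -- that quotient.
  refine ⟨∫ s in (0 : ℝ)..t, f' (γ s : Cotangent n M) / f (γ s : Cotangent n M), ?_⟩
  have h1 := hA.flow.eq_of_hasDerivAt_smul hV.lipschitz hρ
    (γ := fun s => embLog fs (γ s : Cotangent n M)) (fun s => by
      refine (hA'.hasDerivAt_embLog (γ s).2 (hγ s)).congr_deriv ?_
      have h2 := (hpos (γ s)).ne'
      rw [cocycleField, cocycleField, embLog, hA'.y_emb _ (γ s).2, hA'.c_emb _ (γ s).2,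
        hA.y_emb _ (γ s).2, hA.c_emb _ (γ s).2, Prod.smul_mk, smul_smul, div_mul_cancel₀ _ h2,
        smul_eq_mul, ← mul_div_assoc, ← mul_assoc, div_mul_cancel₀ _ h2]) t
  apply embQ_injective fs
  rw [hφγ, hA.embQ_flow hφ, embQ_proj, embQ_proj]
  have h3 := congrArg Prod.fst h1
  rw [h0, embLog, embLog, hA.flow.cocycle_translate hV.lipschitz] at h3
  exact h3

/-! ### Attractors of continuous flows -/

section Dynamics

variable {X : Type*} [TopologicalSpace X] {φ : ℝ → X → X} {τ : ℝ → X → ℝ}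

theorem IsContinuousFlow.reverse (hφ : IsContinuousFlow φ) :
    IsContinuousFlow (fun t => φ (-t)) where
  continuous := hφ.continuous.comp (continuous_fst.neg.prodMk continuous_snd)
  zero x := by rw [neg_zero, hφ.zero]
  add s t x := by rw [neg_add, hφ.add]

theorem IsContinuousFlow.continuous_time (hφ : IsContinuousFlow φ) (x : X) :
    Continuous fun t => φ t x := hφ.continuous.comp (continuous_id.prodMk continuous_const)

theorem IsContinuousFlow.continuous_space (hφ : IsContinuousFlow φ) (t : ℝ) :
    Continuous (φ t) := hφ.continuous.comp (continuous_const.prodMk continuous_id)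

theorem IsContinuousFlow.neg_apply (hφ : IsContinuousFlow φ) (t : ℝ) (x : X) :
    φ (-t) (φ t x) = x := by rw [← hφ.add, neg_add_cancel, hφ.zero]

theorem IsContinuousFlow.apply_neg (hφ : IsContinuousFlow φ) (t : ℝ) (x : X) :
    φ t (φ (-t) x) = x := by rw [← hφ.add, add_neg_cancel, hφ.zero]

theorem IsContinuousFlow.mem_image_iff (hφ : IsContinuousFlow φ) (t : ℝ) (x : X) (U : Set X) :
    x ∈ φ t '' U ↔ φ (-t) x ∈ U := by
  refine ⟨?_, fun hx => ⟨_, hx, hφ.apply_neg t x⟩⟩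
  rintro ⟨y, hy, rfl⟩
  rwa [hφ.neg_apply]

/-- The basin criterion: a continuous function which is positive along the flow as soon as it is
nonnegative defines an attractor. -/
theorem IsContinuousFlow.isAttractor_of_sign [CompactSpace X] (hφ : IsContinuousFlow φ)
    {a : X → ℝ} (ha : Continuous a) (hpos : ∀ x t, 0 < t → 0 ≤ a x → 0 < a (φ t x)) :
    IsAttractor φ {x | ∀ t, 0 ≤ a (φ t x)} ∧
      ∀ x, ¬ (∀ t, a (φ t x) ≤ 0) →
        Tendsto (fun t => φ t x) atTop (𝓝ˢ {x | ∀ t, 0 ≤ a (φ t x)}) := by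
  have hcl : ∀ t, IsClosed {x | 0 ≤ a (φ t x)} := fun t =>
    isClosed_le continuous_const (ha.comp (hφ.continuous_space t))
  have hmono : ∀ x s t, s < t → 0 ≤ a (φ s x) → 0 < a (φ t x) := fun x s t hst hs => by
    have h1 := hpos (φ s x) (t - s) (sub_pos.2 hst) hs
    rwa [← hφ.add, sub_add_cancel] at h1
  have hK : {x | ∀ t, 0 ≤ a (φ t x)} = ⋂ t, {x | 0 ≤ a (φ t x)} := by
    ext x; simp
  have hKc : IsClosed {x | ∀ t, 0 ≤ a (φ t x)} := hK ▸ isClosed_iInter hcl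
  have hinv : ∀ x t, (∀ s, 0 ≤ a (φ s x)) → ∀ s, 0 ≤ a (φ s (φ t x)) := fun x t hx s => by
    rw [← hφ.add]; exact hx _
  refine ⟨⟨hKc.isCompact, fun t => ?_, {x | 0 < a x}, isOpen_lt continuous_const ha,
    fun x hx => ?_, ?_⟩, fun x hx => ?_⟩
  · refine Set.ext fun x => ?_
    rw [hφ.mem_image_iff]
    refine ⟨fun hx => ?_, fun hx => hinv x (-t) hx⟩
    have h1 := hinv _ t hx
    rwa [hφ.apply_neg] at h1
  · have h1 := hmono x (-1) 0 (by norm_num) (hx (-1))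
    rwa [hφ.zero] at h1
  · refine Set.ext fun x => ?_
    simp only [mem_iInter, mem_Ici, hφ.mem_image_iff]
    refine ⟨fun hx t _ => hmono x (-t - 1) (-t) (by linarith) (hx _), fun hx t => ?_⟩
    exact (hmono x (-(|t| + 1)) t (by linarith [neg_abs_le t])
      (le_of_lt (hx (|t| + 1) (by positivity)))).le
  · push Not at hx
    obtain ⟨t₀, ht₀⟩ := hx
    rw [(hasBasis_nhdsSet _).tendsto_right_iff]
    rintro V ⟨hV, hKV⟩
    -- The sets φ_m({a ≥ 0}) decrease to the attractor, so by compactness one of them lies in V; an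
    -- orbit with a > 0 at some time enters it and stays.
    obtain ⟨m, hm⟩ := exists_subset_nhds_of_compactSpace
      (V := fun m : ℕ => {x | 0 ≤ a (φ (-(m : ℝ)) x)})
      (directed_of_isDirected_le fun i j hij x hx => by
        rcases hij.eq_or_lt with rfl | hij
        · exact hx
        · exact (hmono x (-(j : ℝ)) (-(i : ℝ)) (by simpa using hij) hx).le)
      (fun m => hcl _) (U := V) (fun x hx => by
        refine hV.mem_nhds (hKV fun t => ?_)
        rw [mem_iInter] at hx
        obtain ⟨m, hm⟩ := exists_nat_gt (-t)
        exact (hmono x (-(m : ℝ)) t (by linarith) (hx m)).le)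
    filter_upwards [eventually_gt_atTop (t₀ + m)] with t ht
    refine hm ?_
    have h1 := hmono x t₀ (-(m : ℝ) + t) (by linarith) ht₀.le
    rw [hφ.add] at h1
    exact h1.le

/-- Orbits that start near an attractor stay near it. -/
theorem IsAttractor.exists_stable [T2Space X] [CompactSpace X] {K : Set X}
    (hK : IsAttractor φ K) (hφ : IsContinuousFlow φ) {N : Set X} (hN : IsOpen N) (hKN : K ⊆ N) :
    ∃ V : Set X, IsOpen V ∧ K ⊆ V ∧ ∀ x ∈ V, ∀ t, 0 ≤ t → φ t x ∈ N := by
  obtain ⟨U, hU, hKU, hKeq⟩ := hK.attracts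
  have hKcl := hK.compact.isClosed
  obtain ⟨G, hG, hKG, hGN⟩ := normal_exists_closure_subset hKcl (hN.inter hU)
    (subset_inter hKN hKU)
  -- A boundary point of G whose whole backward orbit stays in the closure of G, hence in U, would
  -- lie in ⋂ φ_t(U) = K ⊆ G. By compactness of the boundary, backward orbits of its points leave
  -- the closure within a uniform time m.
  have hex : ∃ m : ℕ, ∀ x ∈ frontier G, ¬ ∀ s ∈ Icc (0 : ℝ) m, φ (-s) x ∈ closure G := by
    have hDcl : ∀ m : ℕ, IsClosed (frontier G ∩ ⋂ s ∈ Icc (0 : ℝ) m, φ (-s) ⁻¹' closure G) :=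
      fun m => isClosed_frontier.inter (isClosed_biInter fun s _ =>
        isClosed_closure.preimage (hφ.continuous_space _))
    obtain ⟨m, hm⟩ := exists_subset_nhds_of_compactSpace
      (V := fun m : ℕ => frontier G ∩ ⋂ s ∈ Icc (0 : ℝ) m, φ (-s) ⁻¹' closure G)
      (directed_of_isDirected_le fun i j hij => inter_subset_inter_right _
        (biInter_subset_biInter_left (Icc_subset_Icc_right (Nat.cast_le.2 hij))))
      hDcl (U := ∅) (fun x hx => by
        exfalso
        rw [mem_iInter] at hx
        have h1 : x ∈ K := by
          rw [hKeq]
          simp only [mem_iInter, mem_Ici, hφ.mem_image_iff]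
          intro t ht
          obtain ⟨m, hm⟩ := exists_nat_ge t
          exact (hGN (mem_iInter₂.1 (hx m).2 t ⟨ht, hm⟩)).2
        exact (hx 0).1.2 (hG.interior_eq.symm ▸ hKG h1))
    refine ⟨m, fun x hx h1 => ?_⟩
    exact (hm ⟨hx, mem_iInter₂.2 h1⟩).elim
  obtain ⟨m, hm⟩ := hex
  have hinv : ∀ x ∈ K, ∀ t, φ t x ∈ K := fun x hx t => by
    rw [← hK.invariant t]
    exact mem_image_of_mem _ hx
  obtain ⟨V, hV, hKV, hVG⟩ : ∃ V : Set X, IsOpen V ∧ K ⊆ V ∧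
      ∀ x ∈ V, ∀ s ∈ Icc (0 : ℝ) m, φ s x ∈ G := by
    obtain ⟨A, V, -, hV, hA, hKV, hAV⟩ := generalized_tube_lemma (isCompact_Icc (a := (0 : ℝ))
      (b := m)) hK.compact (hG.preimage hφ.continuous) (fun p hp => hKG (hinv _ hp.2 _))
    exact ⟨V, hV, hKV, fun x hx s hs =>
      hAV (show (s, x) ∈ A ×ˢ V from ⟨hA hs, hx⟩)⟩
  refine ⟨V, hV, hKV, fun x hx t ht => ?_⟩
  -- At the first exit time r from G the orbit is on the boundary. Points of V stay in G up to time
  -- m, so r > m and the orbit was in the closure of G during the preceding time m, against the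
  -- choice of m.
  by_contra hcon
  set S : Set ℝ := {s | 0 ≤ s ∧ φ s x ∉ G}
  have hScl : IsClosed S := isClosed_Ici.inter
    (hG.isClosed_compl.preimage (hφ.continuous_time x))
  have htS : t ∈ S := ⟨ht, fun h1 => hcon (hGN (subset_closure h1)).1⟩
  have hbdd : BddBelow S := ⟨0, fun s hs => hs.1⟩
  have hs := hScl.csInf_mem ⟨t, htS⟩ hbdd
  set r := sInf S
  have hlt : ∀ s, 0 ≤ s → s < r → φ s x ∈ G := fun s h0 hsr => by
    by_contra h1
    exact (csInf_le hbdd ⟨h0, h1⟩).not_gt hsr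
  have hmr : (m : ℝ) < r := by
    by_contra h1
    exact hs.2 (hVG x hx r ⟨hs.1, not_lt.1 h1⟩)
  have hr0 : 0 < r := (Nat.cast_nonneg m).trans_lt hmr
  have hrcl : φ r x ∈ closure G := by
    have h1 : r ∈ closure (Ico 0 r) := by
      rw [closure_Ico hr0.ne]
      exact right_mem_Icc.2 hr0.le
    exact map_mem_closure (f := fun t => φ t x) (hφ.continuous_time x) h1
      fun s hs => hlt s hs.1 hs.2
  refine hm _ ⟨hrcl, fun h1 => hs.2 (interior_subset h1)⟩ fun s hs' => ?_
  rw [← hφ.add]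
  rcases hs'.1.eq_or_lt with rfl | h0
  · rwa [neg_zero, zero_add]
  · exact subset_closure (hlt _ (by linarith [hs'.2]) (by linarith))

/-- Each orbit enters a neighbourhood from which N is never left again; entering is an open
condition, and finitely many entrance times suffice for a compact set. -/
theorem IsAttractor.uniform_attraction [T2Space X] [CompactSpace X] {K : Set X}
    (hK : IsAttractor φ K) (hφ : IsContinuousFlow φ) {N C : Set X} (hN : IsOpen N) (hKN : K ⊆ N)
    (hC : IsCompact C)
    (hconv : ∀ x ∈ C, Tendsto (fun t => φ t x) atTop (𝓝ˢ K)) :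
    ∃ T : ℝ, 0 ≤ T ∧ ∀ x ∈ C, ∀ t, T ≤ t → φ t x ∈ N := by
  obtain ⟨V, hV, hKV, hVN⟩ := hK.exists_stable hφ hN hKN
  refine hC.induction_on (p := fun C => ∃ T : ℝ, 0 ≤ T ∧ ∀ x ∈ C, ∀ t, T ≤ t → φ t x ∈ N)
    ⟨0, le_rfl, fun x hx => hx.elim⟩ ?_ ?_ ?_
  · rintro A B hAB ⟨T, h0, hT⟩
    exact ⟨T, h0, fun x hx => hT x (hAB hx)⟩
  · rintro A B ⟨T, h0, hT⟩ ⟨T', h0', hT'⟩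
    refine ⟨max T T', h0.trans (le_max_left _ _), ?_⟩
    rintro x (hx | hx) t ht
    · exact hT x hx t ((le_max_left _ _).trans ht)
    · exact hT' x hx t ((le_max_right _ _).trans ht)
  · intro x hx
    have h1 := (hconv x hx).eventually (hV.mem_nhdsSet.2 hKV)
    obtain ⟨T, h0, hT⟩ := ((eventually_ge_atTop (0 : ℝ)).and h1).exists
    refine ⟨φ T ⁻¹' V, mem_nhdsWithin_of_mem_nhds
      ((hV.preimage (hφ.continuous_space T)).mem_nhds hT), T, h0, fun z hz t ht => ?_⟩
    have h2 := hVN _ hz (t - T) (sub_nonneg.2 ht)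
    rwa [← hφ.add, sub_add_cancel] at h2

/-! ### Cocycles -/

/-- `τ` is an additive cocycle over the flow `φ`. -/
structure IsCocycle (φ : ℝ → X → X) (τ : ℝ → X → ℝ) : Prop where
  continuous : Continuous (fun p : ℝ × X => τ p.1 p.2)
  add : ∀ s t x, τ (s + t) x = τ s (φ t x) + τ t x

/-- `g'` is the derivative of `g` along the flow twisted by the cocycle. -/
def HasCocycleDeriv (φ : ℝ → X → X) (τ : ℝ → X → ℝ) (g g' : X → ℝ) : Prop :=
  ∀ x t, HasDerivAt (fun s => Real.exp (τ s x) * g (φ s x)) (Real.exp (τ t x) * g' (φ t x)) t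

theorem IsCocycle.reverse (hτ : IsCocycle φ τ) :
    IsCocycle (fun t => φ (-t)) (fun t => τ (-t)) where
  continuous := hτ.continuous.comp (continuous_fst.neg.prodMk continuous_snd)
  add s t x := by rw [neg_add, hτ.add]

theorem HasCocycleDeriv.reverse {X : Type*} {φ : ℝ → X → X} {τ : ℝ → X → ℝ} {g g' : X → ℝ} (hg : HasCocycleDeriv φ τ g g') :
    HasCocycleDeriv (fun t => φ (-t)) (fun t => τ (-t)) g (fun x => -g' x) := by
  intro x t
  refine ((hg x (-t)).scomp t (hasDerivAt_neg t)).congr_deriv ?_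
  rw [smul_eq_mul]
  ring

/-- On N one has g' ≤ -κ g with κ = min |g'| / max g, so e^(κs) e^τ (g ∘ φ_s) does not increase.
Bounds of g from both sides then give decay of e^τ alone, with A = max g / min g. -/
theorem HasCocycleDeriv.exists_decay {g g' : X → ℝ} (hg : HasCocycleDeriv φ τ g g')
    (hφ : IsContinuousFlow φ) (hτ : IsCocycle φ τ) (hc : Continuous g) (hc' : Continuous g')
    {N : Set X} (hN : IsCompact N) (hpos : ∀ x ∈ N, 0 < g x) (hneg : ∀ x ∈ N, g' x < 0) :
    ∃ A κ : ℝ, 0 < A ∧ 0 < κ ∧ ∀ x r, 0 ≤ r → (∀ s ∈ Icc 0 r, φ s x ∈ N) →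
      Real.exp (τ r x) ≤ A * Real.exp (-(κ * r)) := by
  rcases N.eq_empty_or_nonempty with rfl | hne
  · exact ⟨1, 1, one_pos, one_pos, fun x r hr h => (h 0 ⟨le_rfl, hr⟩).elim⟩
  obtain ⟨x₁, hx₁, h1⟩ := hN.exists_isMinOn hne hc.continuousOn
  obtain ⟨x₂, hx₂, h2⟩ := hN.exists_isMaxOn hne hc.continuousOn
  obtain ⟨x₃, hx₃, h3⟩ := hN.exists_isMaxOn hne hc'.continuousOn
  have p1 := hpos _ hx₁
  have p2 := hpos _ hx₂
  have p3 := hneg _ hx₃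
  refine ⟨g x₂ / g x₁, -g' x₃ / g x₂, div_pos p2 p1, div_pos (neg_pos.2 p3) p2,
    fun x r hr hx => ?_⟩
  set κ := -g' x₃ / g x₂
  have hκ : 0 < κ := div_pos (neg_pos.2 p3) p2
  have hd : ∀ t, HasDerivAt (fun s => Real.exp (κ * s) * (Real.exp (τ s x) * g (φ s x)))
      (Real.exp (κ * t) * κ * (Real.exp (τ t x) * g (φ t x)) +
        Real.exp (κ * t) * (Real.exp (τ t x) * g' (φ t x))) t := fun t => by
    have h4 : HasDerivAt (fun s => Real.exp (κ * s)) (Real.exp (κ * t) * κ) t := by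
      simpa using ((hasDerivAt_id t).const_mul κ).exp
    exact h4.mul (hg x t)
  have hanti : AntitoneOn (fun s => Real.exp (κ * s) * (Real.exp (τ s x) * g (φ s x)))
      (Icc 0 r) := by
    refine antitoneOn_of_deriv_nonpos (convex_Icc 0 r)
      (fun s _ => (hd s).continuousAt.continuousWithinAt)
      (fun s _ => (hd s).differentiableAt.differentiableWithinAt) fun s hs => ?_
    rw [(hd s).deriv]
    have hsN := hx s (interior_subset hs)
    have h5 : κ * g (φ s x) + g' (φ s x) ≤ 0 := by
      have h6 : κ * g (φ s x) ≤ κ * g x₂ := mul_le_mul_of_nonneg_left (h2 hsN) hκ.le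
      have h7 : κ * g x₂ = -g' x₃ := div_mul_cancel₀ _ p2.ne'
      have h8 : g' (φ s x) ≤ g' x₃ := h3 hsN
      linarith
    have h6 : 0 ≤ Real.exp (κ * s) * Real.exp (τ s x) := by positivity
    nlinarith [mul_nonpos_of_nonneg_of_nonpos h6 h5]
  have h4 := hanti (left_mem_Icc.2 hr) (right_mem_Icc.2 hr) hr
  have hτ0 : τ 0 x = 0 := by
    have := hτ.add 0 0 x
    rw [add_zero, hφ.zero] at this
    linarith
  simp only [mul_zero, Real.exp_zero, one_mul, hτ0, hφ.zero] at h4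
  have h5 : g x₁ ≤ g (φ r x) := h1 (hx r ⟨hr, le_rfl⟩)
  have h6 : g x ≤ g x₂ := by
    have := h2 (hx 0 ⟨le_rfl, hr⟩)
    rwa [hφ.zero] at this
  rw [Real.exp_neg, ← div_eq_mul_inv, le_div_iff₀ (Real.exp_pos _), le_div_iff₀ p1]
  calc Real.exp (τ r x) * Real.exp (κ * r) * g x₁
      ≤ Real.exp (τ r x) * Real.exp (κ * r) * g (φ r x) :=
        mul_le_mul_of_nonneg_left h5 (by positivity)
    _ = Real.exp (κ * r) * (Real.exp (τ r x) * g (φ r x)) := by ring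
    _ ≤ g x₂ := h4.trans h6

/-- If the orbit is outside `Np` at time T, it must have been in `Nm` throughout [-T, T - T₀], since
leaving `Nm` would have brought it into `Np` by then. The decay over a time 2T - T₀ outweighs the
bounded factor of the last stretch of length T₀. -/
theorem IsCocycle.exists_domination [CompactSpace X] (hφ : IsContinuousFlow φ)
    (hτ : IsCocycle φ τ) {Nm Np : Set X} {T₀ A κ : ℝ} (hκ : 0 < κ)
    (hatt : ∀ w, w ∉ Nm → ∀ t, T₀ ≤ t → φ t w ∈ Np)
    (hdec : ∀ x r, 0 ≤ r → (∀ s ∈ Icc 0 r, φ s x ∈ Nm) →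
      Real.exp (τ r x) ≤ A * Real.exp (-(κ * r))) {η : ℝ} (hη : 0 < η) :
    ∀ᶠ T in atTop, ∀ x, φ T x ∉ Np →
      φ (-T) x ∈ Nm ∧ Real.exp (τ T x) ≤ η * Real.exp (τ (-T) x) := by
  obtain ⟨B, hB⟩ := isCompact_univ.exists_bound_of_continuousOn
    (f := fun x => Real.exp (τ T₀ x)) (Real.continuous_exp.comp
      (hτ.continuous.comp (continuous_const.prodMk continuous_id))).continuousOn
  have h1 : Tendsto (fun T : ℝ => |B| * (A * Real.exp (-(κ * (2 * T - T₀))))) atTop (𝓝 0) := by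
    have h2 : Tendsto (fun T : ℝ => κ * (2 * T - T₀)) atTop atTop :=
      (tendsto_atTop_add_const_right _ (-T₀)
        (tendsto_id.const_mul_atTop two_pos)).const_mul_atTop hκ
    have h3 := ((Real.tendsto_exp_neg_atTop_nhds_zero.comp h2).const_mul A).const_mul |B|
    simpa using h3
  filter_upwards [h1.eventually (gt_mem_nhds hη), eventually_ge_atTop |T₀|] with T hT hT₀ x hx
  have h2 : T₀ ≤ T := (le_abs_self T₀).trans hT₀
  have h3 : 0 ≤ T := (abs_nonneg T₀).trans hT₀
  have h4 : ∀ s ∈ Icc 0 (2 * T - T₀), φ s (φ (-T) x) ∈ Nm := fun s hs => by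
    by_contra h5
    have h6 := hatt _ h5 (2 * T - s) (by linarith [hs.2])
    rw [← hφ.add, ← hφ.add] at h6
    exact hx (by convert h6 using 2; ring)
  have h5 : (0 : ℝ) ≤ 2 * T - T₀ := by linarith
  refine ⟨?_, ?_⟩
  · have h6 := h4 0 ⟨le_rfl, h5⟩
    rwa [hφ.zero] at h6
  have h6 : τ T x = τ T₀ (φ (2 * T - T₀) (φ (-T) x)) + τ (2 * T - T₀) (φ (-T) x) + τ (-T) x := by
    rw [← hτ.add, ← hτ.add]
    congr 1
    ring
  rw [h6, Real.exp_add, Real.exp_add]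
  refine mul_le_mul_of_nonneg_right (le_trans ?_ hT.le) (Real.exp_pos _).le
  have h7 := hB (φ (2 * T - T₀) (φ (-T) x)) (mem_univ _)
  exact mul_le_mul (((le_abs_self _).trans h7).trans (le_abs_self B)) (hdec _ _ h5 h4)
    (Real.exp_pos _).le (abs_nonneg B)

theorem exists_pos_lower_bound {N : Set X} (hN : IsCompact N) {q : X → ℝ} (hq : Continuous q)
    (hpos : ∀ x ∈ N, 0 < q x) : ∃ q₀ : ℝ, 0 < q₀ ∧ ∀ x ∈ N, q₀ ≤ q x := by
  rcases N.eq_empty_or_nonempty with rfl | hne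
  · exact ⟨1, one_pos, fun x hx => hx.elim⟩
  · obtain ⟨x₁, hx₁, h1⟩ := hN.exists_isMinOn hne hq.continuousOn
    exact ⟨q x₁, hpos _ hx₁, fun x hx => h1 hx⟩

theorem exists_comparison [CompactSpace X] {N : Set X} (hN : IsCompact N) {p q : X → ℝ}
    (hp : Continuous p) (hq : Continuous q) (hpos : ∀ x ∈ N, 0 < q x) :
    ∃ η : ℝ, 0 < η ∧ ∀ x, ∀ z ∈ N, η * |p x| < q z := by
  obtain ⟨q₀, h0, hq₀⟩ := exists_pos_lower_bound hN hq hpos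
  obtain ⟨B, hB⟩ := isCompact_univ.exists_bound_of_continuousOn hp.continuousOn
  refine ⟨q₀ / (|B| + 1), by positivity, fun x z hz => lt_of_lt_of_le ?_ (hq₀ z hz)⟩
  have h1 : |p x| < |B| + 1 :=
    lt_of_le_of_lt ((hB x (mem_univ _)).trans (le_abs_self B)) (lt_add_one _)
  rw [div_mul_eq_mul_div, div_lt_iff₀ (by positivity)]
  exact mul_lt_mul_of_pos_left h1 h0

/-- Functions that grow near the sink and decrease near the source combine to a function that
grows everywhere. -/
theorem exists_positive_combination [T2Space X] [CompactSpace X] (hφ : IsContinuousFlow φ)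
    (hτ : IsCocycle φ τ) {Kp Km : Set X} (hKp : IsAttractor φ Kp)
    (hKm : IsAttractor (fun t => φ (-t)) Km)
    (hconv : ∀ x, x ∉ Kp ∪ Km → Tendsto (fun t => φ t x) atTop (𝓝ˢ Kp) ∧
      Tendsto (fun t => φ t x) atBot (𝓝ˢ Km))
    {gp gp' gm gm' : X → ℝ} (hgp : HasCocycleDeriv φ τ gp gp') (hgm : HasCocycleDeriv φ τ gm gm')
    (cp : Continuous gp) (cp' : Continuous gp') (cm : Continuous gm) (cm' : Continuous gm')
    {Op Om : Set X} (hOp : IsOpen Op) (hOm : IsOpen Om) (hKOp : Kp ⊆ Op) (hKOm : Km ⊆ Om)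
    (hp : ∀ x ∈ Op, 0 < gp x ∧ 0 < gp' x) (hm : ∀ x ∈ Om, 0 < gm x ∧ gm' x < 0) :
    ∃ T : ℝ, ∀ x, 0 < Real.exp (τ T x) * gp' (φ T x) - Real.exp (τ (-T) x) * gm' (φ (-T) x) := by
  obtain ⟨Gp, hGp, hKGp, hGOp⟩ := normal_exists_closure_subset hKp.compact.isClosed hOp hKOp
  obtain ⟨Gm, hGm, hKGm, hGOm⟩ := normal_exists_closure_subset hKm.compact.isClosed hOm hKOm
  have hinvp : ∀ x ∈ Kp, ∀ t, φ t x ∈ Kp := fun x hx t => by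
    rw [← hKp.invariant t]
    exact mem_image_of_mem _ hx
  have hinvm : ∀ x ∈ Km, ∀ t, φ (-t) x ∈ Km := fun x hx t => by
    rw [← hKm.invariant t]
    exact ⟨x, hx, rfl⟩
  -- The complement of a neighbourhood of the source is compact, and each of its points lies in the
  -- sink or converges to it, so the time of attraction is uniform.
  obtain ⟨Tp, -, hTp⟩ := hKp.uniform_attraction hφ hGp hKGp hGm.isClosed_compl.isCompact
    (fun x hx => by
      by_cases h1 : x ∈ Kp
      · exact (tendsto_principal.2 (Eventually.of_forall fun t => hinvp x h1 t)).mono_right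
          principal_le_nhdsSet
      · exact (hconv x fun h2 => h2.elim h1 fun h3 => hx (hKGm h3)).1)
  obtain ⟨Tm, -, hTm⟩ := hKm.uniform_attraction hφ.reverse hGm hKGm hGp.isClosed_compl.isCompact
    (fun x hx => by
      by_cases h1 : x ∈ Km
      · exact (tendsto_principal.2 (Eventually.of_forall fun t => hinvm x h1 t)).mono_right
          principal_le_nhdsSet
      · exact (hconv x fun h2 => h2.elim (fun h3 => hx (hKGp h3)) h1).2.comp
          tendsto_neg_atTop_atBot)
  obtain ⟨A, κ, hA, hκ, hdec⟩ := hgm.exists_decay hφ hτ cm cm' (isClosed_closure (s := Gm)).isCompact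
    (fun x hx => (hm x (hGOm hx)).1) (fun x hx => (hm x (hGOm hx)).2)
  obtain ⟨A', κ', hA', hκ', hdec'⟩ := hgp.reverse.exists_decay hφ.reverse hτ.reverse cp cp'.neg
    (isClosed_closure (s := Gp)).isCompact
    (fun x hx => (hp x (hGOp hx)).1) (fun x hx => neg_neg_of_pos (hp x (hGOp hx)).2)
  obtain ⟨η, hη, hη1⟩ := exists_comparison (isClosed_closure (s := Gm)).isCompact cp' cm'.neg
    (fun x hx => neg_pos.2 (hm x (hGOm hx)).2)
  obtain ⟨η', hη', hη1'⟩ := exists_comparison (isClosed_closure (s := Gp)).isCompact cm' cp'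
    (fun x hx => (hp x (hGOp hx)).2)
  have hd := hτ.exists_domination hφ hκ (Np := closure Gp)
    (fun w hw t ht => subset_closure (hTp w (fun h1 => hw (subset_closure h1)) t ht)) hdec hη
  have hd' := hτ.reverse.exists_domination hφ.reverse hκ' (Np := closure Gm)
    (fun w hw t ht => subset_closure (hTm w (fun h1 => hw (subset_closure h1)) t ht)) hdec' hη'
  obtain ⟨T, hT, hT'⟩ := (hd.and hd').exists
  simp only [neg_neg] at hT'
  refine ⟨T, fun x => ?_⟩
  have e1 := Real.exp_pos (τ T x)
  have e2 := Real.exp_pos (τ (-T) x)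
  -- If both ends of the orbit segment are in the good neighbourhoods, both terms help. If one end
  -- is not, domination puts the other end in its neighbourhood and makes that term outweigh the
  -- uncontrolled one.
  by_cases h1 : φ T x ∈ closure Gp
  · by_cases h2 : φ (-T) x ∈ closure Gm
    · have h3 := mul_pos e1 (hp _ (hGOp h1)).2
      have h4 := mul_neg_of_pos_of_neg e2 (hm _ (hGOm h2)).2
      linarith
    · obtain ⟨-, h4⟩ := hT' x h2
      have h5 := hη1' (φ (-T) x) _ h1
      have h6 : Real.exp (τ (-T) x) * gm' (φ (-T) x) ≤
          η' * Real.exp (τ T x) * |gm' (φ (-T) x)| :=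
        (mul_le_mul_of_nonneg_left (le_abs_self _) e2.le).trans
          (mul_le_mul_of_nonneg_right h4 (abs_nonneg _))
      nlinarith [mul_pos e1 (sub_pos.2 h5)]
  · obtain ⟨h3, h4⟩ := hT x h1
    have h5 : η * |gp' (φ T x)| < -gm' (φ (-T) x) := hη1 (φ T x) _ h3
    have h6 : -(Real.exp (τ T x) * gp' (φ T x)) ≤
        η * Real.exp (τ (-T) x) * |gp' (φ T x)| := by
      rw [← mul_neg]
      exact (mul_le_mul_of_nonneg_left (neg_le_abs _) e1.le).trans
        (mul_le_mul_of_nonneg_right h4 (abs_nonneg _))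
    nlinarith [mul_pos e2 (sub_pos.2 h5)]

/-- A sink is contained in every other sink. -/
theorem sink_subset [CompactSpace X] [T2Space X] (hφ : IsContinuousFlow φ)
    (hτ : IsCocycle φ τ) {K Kp Km : Set X} (hK : IsCompact K) (hinv : ∀ x ∈ K, ∀ t, φ t x ∈ K)
    (hKm : IsCompact Km) (hinvm : ∀ x ∈ Km, ∀ t, φ t x ∈ Km)
    (hconv : ∀ x, x ∉ Kp ∪ Km → Tendsto (fun t => φ t x) atBot (𝓝ˢ Km))
    {g g' gm gm' : X → ℝ} (hg : HasCocycleDeriv φ τ g g') (hgm : HasCocycleDeriv φ τ gm gm')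
    (cg : Continuous g) (cg' : Continuous g') (cm : Continuous gm) (cm' : Continuous gm')
    {Om : Set X} (hOm : IsOpen Om) (hKOm : Km ⊆ Om)
    (hp : ∀ x ∈ K, 0 < g x ∧ 0 < g' x) (hm : ∀ x ∈ Om, 0 < gm x ∧ gm' x < 0) : K ⊆ Kp := by
  intro x hx
  by_contra hxp
  obtain ⟨Gm, hGm, hKGm, hGOm⟩ := normal_exists_closure_subset hKm.isClosed hOm hKOm
  obtain ⟨A, κ, hA, hκ, hdec⟩ := hgm.exists_decay hφ hτ cm cm' (isClosed_closure (s := Gm)).isCompact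
    (fun x hx => (hm x (hGOm hx)).1) (fun x hx => (hm x (hGOm hx)).2)
  obtain ⟨A', κ', hA', hκ', hdec'⟩ := hg.reverse.exists_decay hφ.reverse hτ.reverse cg cg'.neg hK
    (fun x hx => (hp x hx).1) (fun x hx => neg_neg_of_pos (hp x hx).2)
  have hev : ∀ᶠ t in atBot, φ t x ∈ Gm := by
    by_cases hxm : x ∈ Km
    · exact Eventually.of_forall fun t => hKGm (hinvm x hxm t)
    · exact (hconv x fun h => h.elim hxp hxm).eventually (hGm.mem_nhdsSet.2 hKGm)
  obtain ⟨T, hT⟩ := eventually_atBot.1 hev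
  -- On [T - r, T] the orbit is near the other structure's source and e^τ decays. The factor e^(τ(T
  -- - r)) is bounded by A', since x lies in K, where e^τ decays in backward time.
  have hbound : ∀ r, 0 ≤ r → T - r ≤ 0 →
      Real.exp (τ T x) ≤ A * Real.exp (-(κ * r)) * A' := fun r hr hTr => by
    have h1 := hdec (φ (T - r) x) r hr fun s hs => by
      rw [← hφ.add]
      exact subset_closure (hT _ (by linarith [hs.2]))
    have h2 := hdec' x (-(T - r)) (by linarith) fun s _ => hinv x hx _
    have h3 : τ T x = τ r (φ (T - r) x) + τ (T - r) x := by
      rw [← hτ.add]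
      congr 1
      ring
    rw [neg_neg] at h2
    have h4 : Real.exp (-(κ' * -(T - r))) ≤ 1 :=
      Real.exp_le_one_iff.2 (by nlinarith)
    rw [h3, Real.exp_add]
    refine mul_le_mul h1 (h2.trans ?_) (Real.exp_pos _).le (by positivity)
    exact mul_le_of_le_one_right hA'.le h4
  have h1 : Tendsto (fun r : ℝ => A * Real.exp (-(κ * r)) * A') atTop (𝓝 0) := by
    have h3 := ((Real.tendsto_exp_neg_atTop_nhds_zero.comp
      (tendsto_id.const_mul_atTop hκ)).const_mul A).mul_const A'
    simpa using h3
  obtain ⟨r, h2, h3, h4⟩ := ((h1.eventually (gt_mem_nhds (Real.exp_pos (τ T x)))).and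
    ((eventually_ge_atTop (0 : ℝ)).and (eventually_ge_atTop T))).exists
  exact (hbound r h3 (by linarith)).not_gt h2

end Dynamics

/-! ### Growth along the flow -/

theorem nonempty_shellEquiv (hn : 2 ≤ n) :
    Nonempty ((ℝ × ℝ × InfModel n) ≃L[ℝ] Phase n) := by
  refine ⟨ContinuousLinearEquiv.ofFinrankEq ?_⟩
  rw [Module.finrank_prod, Module.finrank_prod, Module.finrank_prod, finrank_base_dual,
    finrank_euclideanSpace_fin, finrank_euclideanSpace_fin, Module.finrank_self]
  omega

theorem IsGenerator.pos_shell {h f : Cotangent n M → ℝ} (hf : IsGenerator h univ f)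
    {z : Cotangent n M} (hz : z ∈ shell h) : 0 < f z :=
  hf.pos z (by rw [coneOver_univ]; exact hz)

theorem exists_isOpen_closure_subset {X : Type*} [TopologicalSpace X] [T2Space X] [CompactSpace X]
    {K O : Set X} (hK : IsCompact K) (hO : IsOpen O) (hKO : K ⊆ O) :
    ∃ G : Set X, IsOpen G ∧ K ⊆ G ∧ closure G ⊆ O :=
  normal_exists_closure_subset hK.isClosed hO hKO

section Growth

variable {ι : Type*} [Fintype ι] [T2Space M] {fs : SmoothBumpCovering ι 𝓘(ℝ, Base n) M}
  {h f : Cotangent n M → ℝ} {y : Ambient n ι → Ambient n ι} {c : Ambient n ι → ℝ}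
  {Φ : ℝ → Ambient n ι × ℝ → Ambient n ι × ℝ} {φ : ℝ → Infinity h → Infinity h}

/-- The logarithmic growth of the fibre norm along the flow. -/
def growth (fs : SmoothBumpCovering ι 𝓘(ℝ, Base n) M) (h : Cotangent n M → ℝ)
    (Φ : ℝ → Ambient n ι × ℝ → Ambient n ι × ℝ) (t : ℝ) (x : Infinity h) : ℝ :=
  (Φ t (embQ fs h x, 0)).2

theorem IsAmbientFlow.eq_embQ_growth (hA : IsAmbientFlow fs h f y c Φ) (hφ : IsFlow h f φ)
    (t : ℝ) (x : Infinity h) : Φ t (embQ fs h x, 0) = (embQ fs h (φ t x), growth fs h Φ t x) :=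
  Prod.ext (hA.embQ_flow hφ t x).symm rfl

theorem IsAmbientFlow.isCocycle (hA : IsAmbientFlow fs h f y c Φ) (hφ : IsFlow h f φ) :
    IsCocycle φ (growth fs h Φ) := by
  obtain ⟨K, B, L, hV⟩ := hA.bounded
  refine ⟨?_, fun s t x => ?_⟩
  · have h1 : Continuous (fun p : ℝ × Infinity h => (p.1, (embQ fs h p.2, (0 : ℝ)))) :=
      continuous_fst.prodMk (((continuous_embQ fs).comp continuous_snd).prodMk continuous_const)
    exact continuous_snd.comp ((hA.flow.continuous hV.lipschitz).comp h1)
  · rw [growth, hA.flow.add hV.lipschitz, hA.eq_embQ_growth hφ t,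
      hA.flow.cocycle_translate hV.lipschitz]
    rfl

/-- The chain rule for e^s u along the ambient flow, whose last component is the growth of log N. -/
theorem IsAmbientFlow.hasCocycleDeriv (hA : IsAmbientFlow fs h f y c Φ) (hφ : IsFlow h f φ)
    {u : Ambient n ι → ℝ} (hu : ContDiff ℝ ∞ u) :
    HasCocycleDeriv φ (growth fs h Φ) (fun x => u (embQ fs h x))
      (fun x => cocycleOp y c u (embQ fs h x)) := by
  intro x t
  have hu' : Differentiable ℝ u := hu.differentiable (by simp)
  have h1 : Differentiable ℝ (fun p : Ambient n ι × ℝ => Real.exp p.2 * u p.1) :=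
    (Real.differentiable_exp.comp differentiable_snd).mul (hu'.comp differentiable_fst)
  have h2 := (h1 (Φ t (embQ fs h x, 0))).hasFDerivAt.comp_hasDerivAt t
    (hA.flow.deriv (embQ fs h x, 0) t)
  rw [fderiv_exp_mul hu'] at h2
  rw [hA.eq_embQ_growth hφ] at h2
  refine h2.congr_of_eventuallyEq (Eventually.of_forall fun s => ?_)
  simp only [Function.comp_apply, hA.eq_embQ_growth hφ]

theorem IsAmbientFlow.continuous_cocycleOp (hA : IsAmbientFlow fs h f y c Φ)
    {u : Ambient n ι → ℝ} (hu : ContDiff ℝ ∞ u) :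
    Continuous (fun x => cocycleOp y c u (embQ fs h x)) := by
  obtain ⟨K, B, L, hV⟩ := hA.bounded
  have hy : Continuous y := (continuous_fst.comp hV.contDiff.continuous).comp
    (f := fun x : Ambient n ι => (x, (0 : ℝ))) (continuous_id.prodMk continuous_const)
  have hc : Continuous c := (continuous_snd.comp hV.contDiff.continuous).comp
    (f := fun x : Ambient n ι => (x, (0 : ℝ))) (continuous_id.prodMk continuous_const)
  have h1 : Continuous (cocycleOp y c u) :=
    ((hu.continuous_fderiv (by simp)).clm_apply hy).add (hc.mul hu.continuous)
  exact h1.comp (continuous_embQ fs)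

/-- The function `fibNorm · (u ∘ emb)`, homogeneous of degree one. -/
def lift (fs : SmoothBumpCovering ι 𝓘(ℝ, Base n) M) (u : Ambient n ι → ℝ) (z : Cotangent n M) : ℝ :=
  fibNorm fs z * u (emb fs z)

theorem lift_dilate (u : Ambient n ι → ℝ) {s : ℝ} (hs : 0 < s) (z : Cotangent n M) :
    lift fs u (dilate s z) = s * lift fs u z := by
  rw [lift, lift, fibNorm_dilate fs hs.le, emb_dilate fs hs, mul_assoc]

theorem contMDiffAt_lift {u : Ambient n ι → ℝ} (hu : ContDiff ℝ ∞ u) {z : Cotangent n M}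
    (hz : z ∈ punctured n M) : ContMDiffAt (phaseModel n) 𝓘(ℝ, ℝ) ∞ (lift fs u) z :=
  (contMDiffAt_fibNorm fs hz).mul (hu.contMDiff.contMDiffAt.comp z (contMDiffAt_emb fs hz))

theorem IsAmbientFlow.mul_poisson_lift (hA : IsAmbientFlow fs h f y c Φ) (hh : IsHamiltonian h)
    {u : Ambient n ι → ℝ} (hu : ContDiff ℝ ∞ u) {z : Cotangent n M} (hz : z ∈ shell h) :
    f z * poisson h (lift fs u) z = fibNorm fs z * cocycleOp y c u (emb fs z) :=
  poisson_fibNorm_mul fs hh hA hu hz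

/-- A weakly hyperbolic set has a neighbourhood with a growing function. -/
theorem IsAmbientFlow.exists_local_function [CompactSpace M] (hA : IsAmbientFlow fs h f y c Φ)
    (hn : 2 ≤ n) (hh : IsHamiltonian h) (hcrit : ZeroNotCritical h)
    (hf : IsGenerator h univ f) {K O : Set (Infinity h)} (hK : IsCompact K) (hO : IsOpen O)
    (hKO : K ⊆ O) (μ : SmoothDensity h O) {f' : Cotangent n M → ℝ} (hf' : IsGenerator h O f') :
    ∃ u : Ambient n ι → ℝ, ContDiff ℝ ∞ u ∧ ∃ G : Set (Infinity h), IsOpen G ∧ K ⊆ G ∧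
      ∀ x ∈ G, 0 < u (embQ fs h x) ∧ ∃ σ : LocalParam h, σ.MapsInto O ∧ ∃ θ ∈ σ.dom,
        ∃ a : ℝ, 0 < a ∧ ∀ w, IsCoordExpr h f' σ w →
          cocycleOp y c u (embQ fs h x) = -a * coordDiv (μ.coeff σ) w θ := by
  obtain ⟨e⟩ := nonempty_shellEquiv hn
  have := t2Space_infinity (h := h) fs
  have := compactSpace_infinity fs hh
  obtain ⟨k, hk, hkμ⟩ := exists_function_of_divergence hn e hh hcrit hO μ hf'
  obtain ⟨G, hG, hKG, hGO⟩ := exists_isOpen_closure_subset hK hO hKO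
  -- The function k is defined over O only. Its quotient by the norm is extended from a smaller
  -- closed neighbourhood of K to the whole ambient space.
  have hsm : LocSmooth (coneOver h (closure G)) (fun z => k z / fibNorm fs z) :=
    ((LocSmooth.mono hk.smooth (coneOver_mono hGO)).prodMk
      (isGenerator_fibNorm fs (closure G)).smooth).comp (P := {p : ℝ × ℝ | p.2 ≠ 0})
      (isOpen_ne_fun (by fun_prop) (by fun_prop)) (Φ := fun p => p.1 / p.2)
      (ContDiffOn.div (by fun_prop) (by fun_prop) fun _ hp => hp)
      fun z hz => (fibNorm_pos fs hz.1.1).ne'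
  obtain ⟨u, hu, -, hku⟩ := exists_compactly_supported_extension fs hh isClosed_closure hsm
    (fun s hs z hz => by
      rw [hk.homogeneous s hs z (coneOver_mono hGO hz), fibNorm_dilate fs hs.le,
        mul_div_mul_left _ _ hs.ne'])
  obtain ⟨W, hW, hGW⟩ := exists_isOpen_coneOver hG
  refine ⟨u, hu, G, hG, hKG, fun x hx => ?_⟩
  obtain ⟨z, rfl⟩ := exists_mem_shell_proj x
  have hzG : (z : Cotangent n M) ∈ coneOver h G := ⟨z.2, hx⟩
  have hzO : (z : Cotangent n M) ∈ coneOver h O :=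
    coneOver_mono (subset_closure.trans hGO) hzG
  have hN := fibNorm_pos fs z.2.1
  have hkz := hk.pos _ hzO
  rw [embQ_proj]
  refine ⟨?_, ?_⟩
  · rw [hku _ (coneOver_mono subset_closure hzG)]
    exact div_pos hkz hN
  obtain ⟨σ, hσ, θ, hθ, hw⟩ := hkμ z hzO (punctured n M ∩ W) (lift fs u)
    (isOpen_punctured.inter hW) ⟨z.2.1, (hGW ▸ hzG : (z : Cotangent n M) ∈ W ∩ shell h).1⟩
    (fun w hw => (contMDiffAt_lift hu hw.1).contMDiffWithinAt) (fun w hw => by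
      have h1 : w ∈ coneOver h G := hGW ▸ ⟨hw.1.2, hw.2.1⟩
      rw [lift, hku w (coneOver_mono subset_closure h1),
        mul_div_cancel₀ _ (fibNorm_pos fs hw.1.1).ne'])
  have hn1 : (0 : ℝ) < n - 1 := by
    have : (2 : ℝ) ≤ n := by exact_mod_cast hn
    linarith
  have hfz := hf.pos_shell z.2
  have hfz' := hf'.pos _ hzO
  -- The factor comes from {h, k} = -k div / ((n-1) f') and from the passage f / N between brackets
  -- and `cocycleOp`.
  refine ⟨σ, hσ, θ, hθ, f z * (k z / ((n - 1) * f' z)) / fibNorm fs z, by positivity,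
    fun w hw' => ?_⟩
  have h2 := hA.mul_poisson_lift hh hu z.2
  rw [hw w hw'] at h2
  field_simp
  field_simp at h2
  linarith

theorem IsAmbientFlow.exists_growth_sink [CompactSpace M] (hA : IsAmbientFlow fs h f y c Φ)
    (hn : 2 ≤ n) (hh : IsHamiltonian h) (hcrit : ZeroNotCritical h)
    (hf : IsGenerator h univ f) {K : Set (Infinity h)} (hK : IsCompact K)
    (hyp : WeaklyHyperbolicSink h K) :
    ∃ u : Ambient n ι → ℝ, ContDiff ℝ ∞ u ∧ ∃ G : Set (Infinity h), IsOpen G ∧ K ⊆ G ∧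
      ∀ x ∈ G, 0 < u (embQ fs h x) ∧ 0 < cocycleOp y c u (embQ fs h x) := by
  obtain ⟨O, f', μ, hO, hKO, hf', hdiv⟩ := hyp
  obtain ⟨u, hu, G, hG, hKG, hx⟩ := hA.exists_local_function hn hh hcrit hf hK hO hKO μ hf'
  refine ⟨u, hu, G, hG, hKG, fun x hxG => ⟨(hx x hxG).1, ?_⟩⟩
  obtain ⟨-, σ, hσ, θ, hθ, a, ha, hw⟩ := hx x hxG
  obtain ⟨w, hw', hP⟩ := hdiv σ hσ
  rw [hw w hw']
  nlinarith [hP θ hθ]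

theorem IsAmbientFlow.exists_growth_source [CompactSpace M] (hA : IsAmbientFlow fs h f y c Φ)
    (hn : 2 ≤ n) (hh : IsHamiltonian h) (hcrit : ZeroNotCritical h)
    (hf : IsGenerator h univ f) {K : Set (Infinity h)} (hK : IsCompact K)
    (hyp : WeaklyHyperbolicSource h K) :
    ∃ u : Ambient n ι → ℝ, ContDiff ℝ ∞ u ∧ ∃ G : Set (Infinity h), IsOpen G ∧ K ⊆ G ∧
      ∀ x ∈ G, 0 < u (embQ fs h x) ∧ cocycleOp y c u (embQ fs h x) < 0 := by
  obtain ⟨O, f', μ, hO, hKO, hf', hdiv⟩ := hyp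
  obtain ⟨u, hu, G, hG, hKG, hx⟩ := hA.exists_local_function hn hh hcrit hf hK hO hKO μ hf'
  refine ⟨u, hu, G, hG, hKG, fun x hxG => ⟨(hx x hxG).1, ?_⟩⟩
  obtain ⟨-, σ, hσ, θ, hθ, a, ha, hw⟩ := hx x hxG
  obtain ⟨w, hw', hP⟩ := hdiv σ hσ
  rw [hw w hw']
  nlinarith [hP θ hθ]

/-! ### Escape functions and growing functions -/

/-- The function u extends k / N, and the escape condition is tested on the extension N (u ∘ emb) of
k. -/
theorem IsAmbientFlow.exists_growth_of_escape [CompactSpace M]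
    (hA : IsAmbientFlow fs h f y c Φ) (hh : IsHamiltonian h) (hf : IsGenerator h univ f)
    {k : Cotangent n M → ℝ} (hk : IsEscapeFunction h k) :
    ∃ u : Ambient n ι → ℝ, ContDiff ℝ ∞ u ∧ ∀ x, 0 < cocycleOp y c u (embQ fs h x) := by
  have hcu : coneOver h univ = shell h := coneOver_univ
  have hsm : LocSmooth (shell h) (fun z => k z / fibNorm fs z) :=
    (LocSmooth.prodMk (l := fibNorm fs) hk.smooth (locSmooth_of_contMDiffAt shell_subset_punctured
      fun w hw => contMDiffAt_fibNorm fs hw)).comp (P := {p : ℝ × ℝ | p.2 ≠ 0})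
      (isOpen_ne_fun (by fun_prop) (by fun_prop)) (Φ := fun p => p.1 / p.2)
      (ContDiffOn.div (by fun_prop) (by fun_prop) fun _ hp => hp)
      fun z hz => (fibNorm_pos fs hz.1).ne'
  obtain ⟨u, hu, -, hku⟩ := exists_compactly_supported_extension fs hh isClosed_univ
    (hcu.symm ▸ hsm) (fun s hs z hz => by
      rw [hk.homogeneous s hs z hz.1, fibNorm_dilate fs hs.le, mul_div_mul_left _ _ hs.ne'])
  rw [hcu] at hku
  refine ⟨u, hu, fun x => ?_⟩
  obtain ⟨z, rfl⟩ := exists_mem_shell_proj x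
  obtain ⟨δ, hδ, hesc⟩ := hk.escape
  have h1 := hesc z z.2 (punctured n M) (lift fs u) isOpen_punctured z.2.1
    (fun w hw => (contMDiffAt_lift hu hw).contMDiffWithinAt) (fun w hw => by
      rw [lift, hku w hw.2, mul_div_cancel₀ _ (fibNorm_pos fs hw.1).ne'])
  have h2 := hA.mul_poisson_lift hh hu z.2
  rw [embQ_proj]
  have h3 : 0 < fibNorm fs (z : Cotangent n M) * cocycleOp y c u (emb fs z) :=
    h2 ▸ mul_pos (hf.pos_shell z.2) (hδ.trans_le h1)
  exact (pos_iff_pos_of_mul_pos h3).1 (fibNorm_pos fs z.2.1)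

/-- The bracket equals (N / f)(y u + c u), a function of degree 0. The second factor is at least q₀
by compactness of Z₀, and f / N is bounded by its values on the compact unit section, which yields a
uniform δ. -/
theorem IsAmbientFlow.isEscapeFunction_lift [CompactSpace M]
    (hA : IsAmbientFlow fs h f y c Φ) (hn : 2 ≤ n) (hh : IsHamiltonian h)
    (hcrit : ZeroNotCritical h) (hf : IsGenerator h univ f) {u : Ambient n ι → ℝ}
    (hu : ContDiff ℝ ∞ u) (hpos : ∀ x, 0 < cocycleOp y c u (embQ fs h x)) :
    IsEscapeFunction h (lift fs u) := by
  obtain ⟨e⟩ := nonempty_shellEquiv hn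
  have := compactSpace_infinity fs hh
  have hcu : coneOver h univ = shell h := coneOver_univ
  refine ⟨locSmooth_of_contMDiffAt shell_subset_punctured fun w hw => contMDiffAt_lift hu hw,
    fun s hs z _ => lift_dilate u hs z, ?_⟩
  obtain ⟨q₀, h0, hq₀⟩ := exists_pos_lower_bound isCompact_univ (hA.continuous_cocycleOp hu)
    (fun x _ => hpos x)
  have hfc : Continuous fun z : shell h => f (z : Cotangent n M) :=
    (hcu ▸ hf.smooth.continuousOn).domRestrict
  obtain ⟨B, hB⟩ := (isCompact_shell_fibNorm_eq_one fs hh).exists_bound_of_continuousOn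
    hfc.continuousOn
  refine ⟨q₀ / (|B| + 1), by positivity, fun z hz U k' hU hzU hk' heq => ?_⟩
  have h1 : poisson h k' z = poisson h (lift fs u) z :=
    poisson_congr e hh hcrit isOpen_univ (k := lift fs u) (fun s hs z _ => lift_dilate u hs z) hU
      isOpen_punctured (hcu.symm ▸ hz) hzU hz.1 hk' (hcu.symm ▸ heq)
      (fun w hw => (contMDiffAt_lift hu hw).contMDiffWithinAt) (fun _ _ => rfl)
  have h2 := hA.mul_poisson_lift hh hu hz
  have hN := fibNorm_pos fs hz.1
  have hfz := hf.pos_shell hz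
  have h3 : f z ≤ fibNorm fs z * (|B| + 1) := by
    have h4 := hf.homogeneous (fibNorm fs z) hN (unit fs z) (by
      rw [hcu]
      exact unit_mem_shell fs hh hz)
    rw [dilate_fibNorm_unit fs hz.1] at h4
    rw [h4]
    have h5 := hB ⟨unit fs z, unit_mem_shell fs hh hz⟩ (fibNorm_unit fs hz.1)
    exact mul_le_mul_of_nonneg_left (((le_abs_self _).trans h5).trans
      ((le_abs_self B).trans (lt_add_one _).le)) hN.le
  have h4 : q₀ ≤ cocycleOp y c u (emb fs z) := hq₀ (proj h ⟨z, hz⟩) (mem_univ _)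
  rw [h1, div_le_iff₀ (by positivity)]
  have h5 : 0 < poisson h (lift fs u) z := by
    have : 0 < f z * poisson h (lift fs u) z := h2 ▸ mul_pos hN (h0.trans_le h4)
    exact (pos_iff_pos_of_mul_pos this).1 hfz
  have h6 : fibNorm fs z * q₀ ≤ fibNorm fs z * (poisson h (lift fs u) z * (|B| + 1)) := by
    nlinarith [mul_le_mul_of_nonneg_left h4 hN.le, mul_le_mul_of_nonneg_right h3 h5.le]
  exact le_of_mul_le_mul_left h6 hN

end Growth

/-! ### The equivalence -/

section Main

variable {ι : Type*} [Fintype ι] [T2Space M] {fs : SmoothBumpCovering ι 𝓘(ℝ, Base n) M}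
  {h f : Cotangent n M → ℝ} {y : Ambient n ι → Ambient n ι} {c : Ambient n ι → ℝ}
  {Φ : ℝ → Ambient n ι × ℝ → Ambient n ι × ℝ} {φ : ℝ → Infinity h → Infinity h}

/-- The divergence of the generator `fibNorm · (u ∘ emb)` for the density attached to it. -/
theorem exists_divergence_lift (hn : 2 ≤ n) (hh : IsHamiltonian h) (hcrit : ZeroNotCritical h)
    {O : Set (Infinity h)} {u : Ambient n ι → ℝ} (hu : ContDiff ℝ ∞ u)
    (hpos : ∀ x ∈ O, 0 < u (embQ fs h x)) :
    IsGenerator h O (lift fs u) ∧ ∃ μ : SmoothDensity h O, ∀ σ : LocalParam h, σ.MapsInto O →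
      ∃ w, IsCoordExpr h (lift fs u) σ w ∧ ∀ θ ∈ σ.dom, coordDiv (μ.coeff σ) w θ =
        -((n - 1) * poisson h (lift fs u) (σ.toFun θ)) := by
  obtain ⟨e⟩ := nonempty_shellEquiv hn
  have hgen : IsGenerator h O (lift fs u) := by
    refine ⟨locSmooth_of_contMDiffAt (fun _ hz => hz.1.1) fun w hw => contMDiffAt_lift hu hw,
      fun z hz => ?_, fun s hs z _ => lift_dilate u hs z⟩
    obtain ⟨hz, hzO⟩ := hz
    exact mul_pos (fibNorm_pos fs hz.1) (hpos _ hzO)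
  refine ⟨hgen, densityOf hh hcrit e hgen, fun σ hσ => ?_⟩
  obtain ⟨w, hw⟩ := σ.exists_coordExpr hh hcrit e (lift fs u)
  refine ⟨w, hw, fun θ hθ => ?_⟩
  have h1 := contMDiffAt_lift (fs := fs) hu (σ.mem_shell θ hθ).1
  have h0 := hgen.pos _ (hσ θ hθ)
  have h2 : ∀ᶠ s : ℝ in 𝓝 1, lift fs u (dilate s (σ.toFun θ)) = s * lift fs u (σ.toFun θ) := by
    filter_upwards [lt_mem_nhds one_pos] with s hs using lift_dilate u hs _
  -- The density is attached to the generator itself, so the formula collapses to {h, k} - n {h, k}.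
  have h3 : coordDiv ((densityOf hh hcrit e hgen).coeff σ) w θ = _ :=
    σ.coordDiv_eq e hh hcrit hθ hw h1 h1 (Eventually.of_forall fun _ => rfl) h0
      (Eventually.of_forall fun _ => rfl) h2 h2
  rw [h3, mul_div_assoc, div_self h0.ne']
  ring

theorem cocycleOp_neg {E : Type*} [NormedAddCommGroup E] [NormedSpace ℝ E] (y : E → E)
    (c u : E → ℝ) (x : E) : cocycleOp y c (fun x => -u x) x = -cocycleOp y c u x := by
  rw [cocycleOp, cocycleOp, fderiv_fun_neg, neg_apply]
  ring

theorem cocycleOp_sub {E : Type*} [NormedAddCommGroup E] [NormedSpace ℝ E] (y : E → E)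
    (c : E → ℝ) {u v : E → ℝ} (hu : ContDiff ℝ ∞ u) (hv : ContDiff ℝ ∞ v) (x : E) :
    cocycleOp y c (fun x => u x - v x) x = cocycleOp y c u x - cocycleOp y c v x := by
  rw [cocycleOp, cocycleOp, cocycleOp, fderiv_fun_sub (hu.differentiable (by simp)).differentiableAt
    (hv.differentiable (by simp)).differentiableAt, sub_apply]
  ring

theorem IsAmbientFlow.poisson_lift_pos (hA : IsAmbientFlow fs h f y c Φ) (hh : IsHamiltonian h)
    (hf : IsGenerator h univ f) {u : Ambient n ι → ℝ} (hu : ContDiff ℝ ∞ u) {z : Cotangent n M}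
    (hz : z ∈ shell h) (hpos : 0 < cocycleOp y c u (emb fs z)) : 0 < poisson h (lift fs u) z := by
  have h1 : 0 < f z * poisson h (lift fs u) z :=
    hA.mul_poisson_lift hh hu hz ▸ mul_pos (fibNorm_pos fs hz.1) hpos
  exact (pos_iff_pos_of_mul_pos h1).1 (hf.pos_shell hz)

theorem IsAmbientFlow.poisson_lift_neg (hA : IsAmbientFlow fs h f y c Φ) (hh : IsHamiltonian h)
    (hf : IsGenerator h univ f) {u : Ambient n ι → ℝ} (hu : ContDiff ℝ ∞ u) {z : Cotangent n M}
    (hz : z ∈ shell h) (hneg : cocycleOp y c u (emb fs z) < 0) :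
    poisson h (lift fs u) z < 0 := by
  have h1 : f z * poisson h (lift fs u) z < 0 :=
    hA.mul_poisson_lift hh hu hz ▸ mul_neg_of_pos_of_neg (fibNorm_pos fs hz.1) hneg
  have h2 := hf.pos_shell hz
  by_contra h3
  exact (mul_nonneg h2.le (not_lt.1 h3)).not_gt h1

/-- A function that grows everywhere gives a weakly hyperbolic simple structure. -/
theorem IsAmbientFlow.exists_simpleStructure [CompactSpace M] (hA : IsAmbientFlow fs h f y c Φ)
    (hn : 2 ≤ n) (hh : IsHamiltonian h) (hcrit : ZeroNotCritical h)
    (hf : IsGenerator h univ f) (hφ : IsFlow h f φ) {u : Ambient n ι → ℝ} (hu : ContDiff ℝ ∞ u)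
    (hpos : ∀ x, 0 < cocycleOp y c u (embQ fs h x)) :
    ∃ Kp Km : Set (Infinity h), IsWeaklyHyperbolicSimpleStructure h Kp Km := by
  have := compactSpace_infinity fs hh
  have hc := hA.isContinuousFlow hh hφ
  have hn1 : (0 : ℝ) < n - 1 := by
    have : (2 : ℝ) ≤ n := by exact_mod_cast hn
    linarith
  set a : Infinity h → ℝ := fun x => u (embQ fs h x)
  have ha : Continuous a := hu.continuous.comp (continuous_embQ fs)
  -- e^τ (u ∘ φ) is strictly increasing along orbits, so a nonnegative value of u is followed by
  -- positive ones.
  have hsign : ∀ x t, 0 < t → 0 ≤ a x → 0 < a (φ t x) := fun x t ht hx => by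
    have hd := hA.hasCocycleDeriv hφ hu x
    have hmono : StrictMono fun s => Real.exp (growth fs h Φ s x) * u (embQ fs h (φ s x)) :=
      strictMono_of_deriv_pos fun s => by
        rw [(hd s).deriv]
        exact mul_pos (Real.exp_pos _) (hpos _)
    have h1 := hmono ht
    simp only [hc.zero] at h1
    have h2 := (mul_nonneg (Real.exp_pos (growth fs h Φ 0 x)).le hx).trans_lt h1
    exact (pos_iff_pos_of_mul_pos h2).1 (Real.exp_pos _)
  have hsign' : ∀ x t, 0 < t → 0 ≤ -a x → 0 < -a (φ (-t) x) := fun x t ht hx => by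
    by_contra h1
    have h2 := hsign (φ (-t) x) t ht (by linarith)
    rw [hc.apply_neg] at h2
    linarith
  obtain ⟨hp1, hp2⟩ := hc.isAttractor_of_sign ha hsign
  obtain ⟨hm1, hm2⟩ := hc.reverse.isAttractor_of_sign ha.neg hsign'
  -- K₊ and K₋ consist of the points whose whole orbits lie in a ≥ 0 and in a ≤ 0. They are
  -- hyperbolic through the generators N u on a > 0 and -N u on a < 0.
  refine ⟨_, _, ⟨f, φ, hf, hφ, ?_, hp1, hm1, fun x hx => ⟨hp2 x fun h1 => hx (Or.inr ?_), ?_⟩⟩,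
    ⟨{x | 0 < a x}, ?_⟩, ⟨{x | 0 < -a x}, ?_⟩⟩
  · refine Set.disjoint_left.2 fun x hx hx' => ?_
    have h1 := hsign x 1 one_pos (by have := hx 0; rwa [hc.zero] at this)
    have h2 := hx' (-1)
    simp only [neg_neg, Pi.neg_apply] at h2
    linarith
  · exact fun t => neg_nonneg.2 (h1 (-t))
  · have h1 := hm2 x fun h1 => hx (Or.inl fun t => by
      have := h1 (-t)
      simp only [neg_neg, Pi.neg_apply] at this
      linarith)
    refine (h1.comp tendsto_neg_atBot_atTop).congr fun t => ?_
    simp only [Function.comp_apply, neg_neg]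
  · obtain ⟨hg, μ, hμ⟩ := exists_divergence_lift (fs := fs) (O := {x | 0 < a x}) hn hh hcrit hu
      fun x hx => hx
    refine ⟨lift fs u, μ, isOpen_lt continuous_const ha, fun x hx => ?_, hg, fun σ hσ => ?_⟩
    · have h1 := hsign _ 1 one_pos (hx (-1))
      rwa [hc.apply_neg] at h1
    · obtain ⟨w, hw, hdiv⟩ := hμ σ hσ
      refine ⟨w, hw, fun θ hθ => ?_⟩
      rw [hdiv θ hθ]
      have h1 := hA.poisson_lift_pos hh hf hu (σ.mem_shell θ hθ)
        (hpos (proj h ⟨_, σ.mem_shell θ hθ⟩))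
      exact neg_neg_of_pos (mul_pos hn1 h1)
  · obtain ⟨hg, μ, hμ⟩ := exists_divergence_lift (fs := fs) (O := {x | 0 < -a x}) hn hh hcrit
      hu.neg fun x hx => hx
    refine ⟨_, μ, isOpen_lt continuous_const ha.neg, fun x hx => ?_, hg, fun σ hσ => ?_⟩
    · have h1 := hsign' _ 1 one_pos (hx (-1))
      rwa [neg_neg, hc.neg_apply] at h1
    · obtain ⟨w, hw, hdiv⟩ := hμ σ hσ
      refine ⟨w, hw, fun θ hθ => ?_⟩
      rw [hdiv θ hθ]
      have h1 := hA.poisson_lift_neg hh hf hu.neg (σ.mem_shell θ hθ) (by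
        have h2 := cocycleOp_neg y c u (emb fs (σ.toFun θ))
        have h3 := hpos (proj h ⟨_, σ.mem_shell θ hθ⟩)
        rw [embQ_proj] at h3
        exact h2.trans_lt (neg_neg_of_pos h3))
      exact neg_pos.2 (mul_neg_of_pos_of_neg hn1 h1)

/-- A weakly hyperbolic simple structure gives a function that grows everywhere. -/
theorem IsAmbientFlow.exists_growth_of_simpleStructure [CompactSpace M]
    (hA : IsAmbientFlow fs h f y c Φ) (hn : 2 ≤ n) (hh : IsHamiltonian h)
    (hcrit : ZeroNotCritical h) (hf : IsGenerator h univ f) (hφ : IsFlow h f φ)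
    {Kp Km : Set (Infinity h)} (hKp : IsAttractor φ Kp) (hKm : IsAttractor (fun t => φ (-t)) Km)
    (hconv : ∀ x, x ∉ Kp ∪ Km → Tendsto (fun t => φ t x) atTop (𝓝ˢ Kp) ∧
      Tendsto (fun t => φ t x) atBot (𝓝ˢ Km))
    (hsink : WeaklyHyperbolicSink h Kp) (hsource : WeaklyHyperbolicSource h Km) :
    ∃ u : Ambient n ι → ℝ, ContDiff ℝ ∞ u ∧ ∀ x, 0 < cocycleOp y c u (embQ fs h x) := by
  have := compactSpace_infinity fs hh
  have := t2Space_infinity (h := h) fs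
  have hc := hA.isContinuousFlow hh hφ
  have hτ := hA.isCocycle hφ
  obtain ⟨K, B, L, hV⟩ := hA.bounded
  obtain ⟨up, hup, Gp, hGp, hKGp, hp⟩ :=
    hA.exists_growth_sink hn hh hcrit hf hKp.compact hsink
  obtain ⟨um, hum, Gm, hGm, hKGm, hm⟩ :=
    hA.exists_growth_source hn hh hcrit hf hKm.compact hsource
  obtain ⟨T, hT⟩ := exists_positive_combination hc hτ hKp hKm hconv
    (hA.hasCocycleDeriv hφ hup) (hA.hasCocycleDeriv hφ hum)
    (hup.continuous.comp (continuous_embQ fs)) (hA.continuous_cocycleOp hup)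
    (hum.continuous.comp (continuous_embQ fs)) (hA.continuous_cocycleOp hum)
    hGp hGm hKGp hKGm hp hm
  have hcont : ∀ {u : Ambient n ι → ℝ}, ContDiff ℝ ∞ u → ∀ t : ℝ, Continuous fun x =>
      Real.exp (growth fs h Φ t x) * cocycleOp y c u (embQ fs h (φ t x)) := fun hu t =>
    (Real.continuous_exp.comp (hτ.continuous.comp (continuous_const.prodMk continuous_id))).mul
      ((hA.continuous_cocycleOp hu).comp (hc.continuous_space t))
  obtain ⟨q, hq0, hq⟩ := exists_pos_lower_bound isCompact_univ ((hcont hup T).sub (hcont hum (-T)))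
    (fun x _ => hT x)
  have hX : IsCompact (range (embQ fs h)) := isCompact_range (continuous_embQ fs)
  -- Each of the two transported terms may err by q/4, which leaves at least q/2 of the lower bound
  -- q.
  have hq4 : 0 < q / 4 := by positivity
  obtain ⟨v, hv, hv'⟩ := exists_smooth_transport hV hA.flow hX hup T hq4
  obtain ⟨w, hw, hw'⟩ := exists_smooth_transport hV hA.flow hX hum (-T) hq4
  refine ⟨fun x => v x - w x, hv.sub hw, fun x => ?_⟩
  rw [cocycleOp_sub y c hv hw]
  have h1 := hv' _ (mem_range_self x)
  have h2 := hw' _ (mem_range_self x)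
  rw [hA.eq_embQ_growth hφ] at h1 h2
  have h3 := hq x (mem_univ x)
  have h4 := abs_le.1 h1
  have h5 := abs_le.1 h2
  simp only [Pi.sub_apply] at h3
  linarith [h4.1, h5.2]

/-- The sink of a weakly hyperbolic simple structure is contained in the sink of any other one,
and similarly for the sources. -/
theorem IsWeaklyHyperbolicSimpleStructure.subset [CompactSpace M] (hn : 2 ≤ n)
    (hh : IsHamiltonian h) (hcrit : ZeroNotCritical h) {Kp Km Kp' Km' : Set (Infinity h)}
    (hK : IsWeaklyHyperbolicSimpleStructure h Kp Km)
    (hK' : IsWeaklyHyperbolicSimpleStructure h Kp' Km') : Kp ⊆ Kp' ∧ Km ⊆ Km' := by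
  obtain ⟨ι, _, ⟨fs⟩⟩ := exists_bumpCovering (n := n) M
  have := compactSpace_infinity fs hh
  have := t2Space_infinity (h := h) fs
  obtain ⟨⟨f, φ, hf, hφ, -, hKp, hKm, -⟩, hsink, hsource⟩ := hK
  obtain ⟨⟨f', φ', hf', hφ', -, hKp', hKm', hconv⟩, hsink', hsource'⟩ := hK'
  obtain ⟨y, c, Φ, hA⟩ := exists_isAmbientFlow fs hh hf'
  have hc := hA.isContinuousFlow hh hφ'
  have hτ := hA.isCocycle hφ'
  -- The two structures may come with different generators. Their flows have the same orbits, so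
  -- invariance passes from one to the other.
  have hinv : ∀ K : Set (Infinity h), (∀ x ∈ K, ∀ t, φ t x ∈ K) → ∀ x ∈ K, ∀ t, φ' t x ∈ K :=
    fun K hK x hx t => by
      obtain ⟨s, hs⟩ := IsFlow.exists_eq_flow hh hf hf' hφ hφ' t x
      exact hs ▸ hK x hx s
  have hattr : ∀ {ψ : ℝ → Infinity h → Infinity h} {K : Set (Infinity h)}, IsAttractor ψ K →
      ∀ x ∈ K, ∀ t, ψ t x ∈ K := fun hK x hx t => by
    rw [← hK.invariant t]
    exact mem_image_of_mem _ hx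
  have hrev : ∀ {ψ : ℝ → Infinity h → Infinity h} {K : Set (Infinity h)},
      IsAttractor (fun t => ψ (-t)) K → ∀ x ∈ K, ∀ t, ψ t x ∈ K := fun hK x hx t => by
    have h1 := hattr hK x hx (-t)
    rwa [neg_neg] at h1
  have hu : ∀ {u : Ambient n ι → ℝ}, ContDiff ℝ ∞ u → Continuous fun x => u (embQ fs h x) :=
    fun hu => hu.continuous.comp (continuous_embQ fs)
  constructor
  · obtain ⟨u, hu1, G, -, hKG, hp⟩ := hA.exists_growth_sink hn hh hcrit hf' hKp.compact hsink
    obtain ⟨v, hv1, G', hG', hKG', hm⟩ :=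
      hA.exists_growth_source hn hh hcrit hf' hKm'.compact hsource'
    exact sink_subset hc hτ hKp.compact (hinv _ (hattr hKp)) hKm'.compact (hrev hKm')
      (fun x hx => (hconv x hx).2) (hA.hasCocycleDeriv hφ' hu1) (hA.hasCocycleDeriv hφ' hv1)
      (hu hu1) (hA.continuous_cocycleOp hu1) (hu hv1) (hA.continuous_cocycleOp hv1) hG' hKG'
      (fun x hx => hp x (hKG hx)) hm
  -- The inclusion of sources is the inclusion of sinks for the reversed flow, under which the signs
  -- of the derivatives change.
  · obtain ⟨u, hu1, G, -, hKG, hp⟩ := hA.exists_growth_source hn hh hcrit hf' hKm.compact hsource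
    obtain ⟨v, hv1, G', hG', hKG', hm⟩ :=
      hA.exists_growth_sink hn hh hcrit hf' hKp'.compact hsink'
    exact sink_subset hc.reverse hτ.reverse hKm.compact
      (fun x hx t => hinv _ (hrev hKm) x hx (-t)) hKp'.compact
      (fun x hx t => hattr hKp' x hx (-t))
      (fun x hx => (hconv x fun h1 => hx h1.symm).1.comp tendsto_neg_atBot_atTop)
      (hA.hasCocycleDeriv hφ' hu1).reverse (hA.hasCocycleDeriv hφ' hv1).reverse
      (hu hu1) (hA.continuous_cocycleOp hu1).neg (hu hv1) (hA.continuous_cocycleOp hv1).neg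
      hG' hKG' (fun x hx => ⟨(hp x (hKG hx)).1, neg_pos.2 (hp x (hKG hx)).2⟩)
      (fun x hx => ⟨(hm x hx).1, neg_neg_of_pos (hm x hx).2⟩)

/-- From an escape function any generator may be used to build the structure, and the norm itself is
taken. Conversely the ambient system is built on the generator that the given structure carries. -/
theorem exists_escapeFunction_iff [CompactSpace M] (hn : 2 ≤ n) (hh : IsHamiltonian h)
    (hcrit : ZeroNotCritical h) : (∃ k, IsEscapeFunction h k) ↔
      ∃ Kp Km : Set (Infinity h), IsWeaklyHyperbolicSimpleStructure h Kp Km := by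
  obtain ⟨ι, _, ⟨fs⟩⟩ := exists_bumpCovering (n := n) M
  constructor
  · rintro ⟨k, hk⟩
    have hf := isGenerator_fibNorm (h := h) fs univ
    obtain ⟨y, c, Φ, hA⟩ := exists_isAmbientFlow fs hh hf
    obtain ⟨φ, hφ⟩ := hA.exists_isFlow hh hf
    obtain ⟨u, hu, hpos⟩ := hA.exists_growth_of_escape hh hf hk
    exact hA.exists_simpleStructure hn hh hcrit hf hφ hu hpos
  · rintro ⟨Kp, Km, ⟨f, φ, hf, hφ, -, hKp, hKm, hconv⟩, hsink, hsource⟩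
    obtain ⟨y, c, Φ, hA⟩ := exists_isAmbientFlow fs hh hf
    obtain ⟨u, hu, hpos⟩ := hA.exists_growth_of_simpleStructure hn hh hcrit hf hφ hKp hKm hconv
      hsink hsource
    exact ⟨_, hA.isEscapeFunction_lift hn hh hcrit hf hu hpos⟩

end Main

end DegreeZero

end

/-! ### The main theorem. -/

theorem mainTheorem2 (n : ℕ) (hn : 2 ≤ n) (M : Type*) [TopologicalSpace M] [T2Space M]
    [CompactSpace M] [ConnectedSpace M] [ChartedSpace (DegreeZero.Base n) M]
    [IsManifold 𝓘(ℝ, DegreeZero.Base n) ∞ M]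
    (h : DegreeZero.Cotangent n M → ℝ) (hh : DegreeZero.IsHamiltonian h)
    (hcrit : DegreeZero.ZeroNotCritical h) :
    ((∃ k : DegreeZero.Cotangent n M → ℝ, DegreeZero.IsEscapeFunction h k) ↔
      ∃ Kp Km : Set (DegreeZero.Infinity h),
        DegreeZero.IsWeaklyHyperbolicSimpleStructure h Kp Km) ∧
    ∀ Kp Km Kp' Km' : Set (DegreeZero.Infinity h),
      DegreeZero.IsWeaklyHyperbolicSimpleStructure h Kp Km →
      DegreeZero.IsWeaklyHyperbolicSimpleStructure h Kp' Km' →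
      Kp = Kp' ∧ Km = Km' := by
  exact ⟨DegreeZero.exists_escapeFunction_iff hn hh hcrit, fun Kp Km Kp' Km' hK hK' =>
    ⟨Subset.antisymm (hK.subset hn hh hcrit hK').1 (hK'.subset hn hh hcrit hK).1,
      Subset.antisymm (hK.subset hn hh hcrit hK').2 (hK'.subset hn hh hcrit hK).2⟩⟩
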